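/- Fix $\tau_0\in\mathbb C$ with $\operatorname{Im}\tau_0>0$, put $q_0^t=e^{-2i\pi\tau_0t}$ for $t\in\mathbb R$, and for $\varepsilon>0$ let $q=q_0^{\varepsilon}$; all limits are for $\varepsilon\to0^+$. Write $\delta=z\,d/dz$ and $\mathbf S=\mathbb P^1(\mathbb C)$. A segment of spiral is a set $z_0q_0^{[a,b]}$ with $z_0\in\mathbb C^*$, $a\le b$. **Data.** Let $\tilde B\in M_n(\mathbb C(z))$ be holomorphic at $0$ and at $\infty$ (the system $\delta\tilde X=\tilde B\tilde X$ is Fuchsian at $0$ and $\infty$), with poles $\tilde z_1,\dots,\tilde z_r\in\mathbb C^*$, and suppose it is non-resonant: two distinct eigenvalues of $\tilde B(0)$, resp. of $\tilde B(\infty)$, never differ by an integer. Let $B_\varepsilon\in M_n(\mathbb C(z))$, $\varepsilon>0$, and $A_\varepsilon=I+(q-1)B_\varepsilon$, such that * (A) at each point of $\mathbf S$ that is not a pole of $\tilde B$, $B_\varepsilon$ has no pole for $\varepsilon$ small enough; * (B) $B_\varepsilon$ has no pole for $\varepsilon$ small enough on, and converges uniformly to $\tilde B$ on, some non-trivial closed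 disc centred at $0$, some non-trivial closed disc centred at $\infty$, both containing no $\tilde z_i$, and every segment of spiral contained in $\mathbb C^*-\{\tilde z_1,\dots,\tilde z_r\}$; * (C) $B_\varepsilon(0)\to\tilde B(0)$ and $B_\varepsilon(\infty)\to\tilde B(\infty)$ with constant Jordan structure: each family is reduced, for small $\varepsilon$, by invertible matrices $Q_\varepsilon$ converging to an invertible $\tilde Q$ that reduces the limit, to Jordan matrices with blocks of fixed sizes $m_i$, whose eigenvalues $\gamma_i(\varepsilon)$ converge to the eigenvalues $\tilde\gamma_i$ of the corresponding blocks of the limit. **Functions.** $\Theta_q(z)=\sum_{m\in\mathbb Z}(-1)^mq^{-m(m-1)/2}z^m$, $e_{q,c}(z)=\Theta_q(z)/\Theta_q(z/c)$, $l_q=z\Theta_q'/\Theta_q$, $l_q^{(k)}=\binom{l_q}{k}$. For $M\in GL_n(\mathbb C)$ with multiplicative Dunford decomposition $M=D(I+N)$, $D=R\,\mathrm{diag}(c_i)R^{-1}$, $N$ nilpotent commuting with $D$, let $e_{q,M}=R\,\mathrm{diag}(e_{q,c_i})R^{-1}\sum_kl_q^{(k)}N^k$. On $\mathbb C^*-q_0^{\mathbb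 R}$, $\log(-z)$ is the determination vanishing at $z=-1$, and $(-z)^M=e^{\log(-z)M}$. **Canonical solutions.** At $0$, the canonical solution of $X(qz)=A(z)X(z)$ is $X=F\,e_{q,A(0)}$, where $F$ is the solution, meromorphic on $\mathbb C$ and holomorphic off the half-spirals $q^kp$ ($k\ge1$, $p$ a pole of $A$), of $F(qz)=A(z)F(z)A(0)^{-1}$, $F(0)=I$. The Frobenius solution at $0$ of $\delta\tilde X=\tilde B\tilde X$ is $\tilde X=\tilde F(z)(-z)^{\tilde B(0)}$, where $\tilde F$ is holomorphic on $\mathbf S-\bigcup_i\tilde z_iq_0^{[0,+\infty]}$, $\delta\tilde F=\tilde B\tilde F-\tilde F\tilde B(0)$, $\tilde F(0)=I$. Let $X_\varepsilon^{(0)}$ and $\tilde X^{(0)}$ be those for $A_\varepsilon$ and $\tilde B$, and let $X_\varepsilon^{(\infty)}$, $\tilde X^{(\infty)}$ be those, in the variable $w=1/z$, for the matrices $C_\varepsilon(w)=A_\varepsilon(1/(qw))^{-1}$ and $\tilde D(w)=-\tilde B(1/w)$ of the same systems written in $w$. Put $P_\varepsilon=(X_\varepsilon^{(\infty)})^{-1}X_\varepsilon^{(0)}$,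 $\tilde P=(\tilde X^{(\infty)})^{-1}\tilde X^{(0)}$, and $$\tilde\Omega'=\mathbf S-\Bigl(q_0^{[-\infty,+\infty]}\cup\bigcup_{i=1}^r\tilde z_iq_0^{[-\infty,+\infty]}\Bigr)\subset\mathbb C^* .$$ **Theorem.** (1) $\tilde X^{(0)}$, $\tilde X^{(\infty)}$ exist and are unique on their domains, and so are $X_\varepsilon^{(0)}$, $X_\varepsilon^{(\infty)}$ for $\varepsilon$ small; then $P_\varepsilon$ is elliptic (meromorphic on $\mathbb C^*$, with $P_\varepsilon(qz)=P_\varepsilon(z)$). On $\tilde\Omega'$ the matrices $\tilde X^{(0)},\tilde X^{(\infty)}$ are holomorphic and invertible and $\tilde P$ is locally constant. For every $z\in\tilde\Omega'$, $X_\varepsilon^{(0)}$ and $X_\varepsilon^{(\infty)}$ are holomorphic and invertible at $z$ for $\varepsilon$ small enough, and $$\lim_{\varepsilon\to0^+}P_\varepsilon(z)=\tilde P(z).$$ (2) Writing $C_\varepsilon=I+(q-1)D_\varepsilon$, the matrices $D_\varepsilon(0)$ converge to $\tilde D(0)$ with constant Jordan structure in the sense of (C). For every choice of families as in (C) reducing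 $B_\varepsilon(0)$ and $D_\varepsilon(0)$, all the statements of (1) also hold for the renormalised canonical solutions built from the Jordan forms: for $A_\varepsilon$ at $0$ this is $X=Q_\varepsilon YN$ with $Y$ the solution, meromorphic on $\mathbb C$, of $Y(qz)=K(z)Y(z)K(0)^{-1}$, $Y(0)=I$, $K=Q_\varepsilon^{-1}A_\varepsilon Q_\varepsilon$, and $N$ block diagonal with upper triangular blocks having entry $e_{q,c_i}\bigl(\tfrac{q-1}{c_i}\bigr)^{b-a}l_q^{(b-a)}$ in place $(a,b)$, $a\le b$, $c_i=1+(q-1)\gamma_i(\varepsilon)$; for $\tilde B$ it is $\tilde Q\tilde Y\tilde N$ with $\delta\tilde Y=\tilde J\tilde Y-\tilde Y\tilde J(0)$, $\tilde Y(0)=I$, $\tilde J=\tilde Q^{-1}\tilde B\tilde Q$, and $\tilde N$ with entries $(-z)^{\tilde\gamma_i}\log(-z)^{b-a}/(b-a)!$; and in the same way at $\infty$ in the variable $w$, with $C_\varepsilon$, $D_\varepsilon(0)$ and $\tilde D$. -/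

import Mathlib

open Filter Topology

noncomputable section

namespace QDiff

/-- Square matrices of size `n` over `ℂ`. -/
abbrev Mat (n : ℕ) := Matrix (Fin n) (Fin n) ℂ

/-- Square matrices of size `n` over the field `ℂ(z)` of rational functions. -/
abbrev RMat (n : ℕ) := Matrix (Fin n) (Fin n) (RatFunc ℂ)

/-! ### Rational matrices on the Riemann sphere -/

/-- The rational matrix `M` has no pole at the point `z` of `ℂ`
(the denominators are those of the reduced fractions). -/
def RegAt {n : ℕ} (M : RMat n) (z : ℂ) : Prop :=
  ∀ i j, (M i j).denom.eval z ≠ 0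

/-- The value `M(z)`; it is meaningful when `RegAt M z`. -/
def evalAt {n : ℕ} (M : RMat n) (z : ℂ) : Mat n :=
  M.map fun f => RatFunc.eval (RingHom.id ℂ) z f

/-- A matrix of constants, as a rational matrix. -/
def const {n : ℕ} (Q : Mat n) : RMat n := Q.map RatFunc.C

/-- The rational matrix `w ↦ M(1/(c w))`, for `c ≠ 0`. -/
def invSubst {n : ℕ} (c : ℂ) (M : RMat n) : RMat n :=
  M.map fun f => RatFunc.eval RatFunc.C (RatFunc.C c * RatFunc.X)⁻¹ f

/-- The rational matrix `w ↦ M(1/w)`. Regularity of `M` at `∞` is regularity of this matrix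
at `w = 0`, and `M(∞)` is its value at `w = 0`. -/
def atInfty {n : ℕ} (M : RMat n) : RMat n := invSubst 1 M

/-! ### The spirals, the cut sphere, the logarithm -/

/-- `q₀ ^ t = exp (-2 i π τ₀ t)` for real `t`; in particular `q = q₀ ^ ε` is `spiral τ₀ ε`. -/
def spiral (τ₀ : ℂ) (t : ℝ) : ℂ :=
  Complex.exp (-(2 * Real.pi * Complex.I * τ₀ * t))

/-- The sphere minus the half-spirals `p q₀ ^ [0, +∞]` starting from the poles `p` of `B`. -/
def halfCut {n : ℕ} (τ₀ : ℂ) (B : RMat n) : Set ℂ :=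
  {z | ∀ p, ¬ RegAt B p → ∀ t : ℝ, 0 ≤ t → z ≠ p * spiral τ₀ t}

/-- The sphere minus the full compact spirals `q₀ ^ [-∞, +∞]` and `p q₀ ^ [-∞, +∞]`,
`p` a pole of `B`; the points `0` and `∞` are removed. -/
def fullCut {n : ℕ} (τ₀ : ℂ) (B : RMat n) : Set ℂ :=
  {z | z ≠ 0 ∧ (∀ t : ℝ, z ≠ spiral τ₀ t) ∧
    ∀ p, ¬ RegAt B p → ∀ t : ℝ, z ≠ p * spiral τ₀ t}

/-- The real number `t` such that `‖exp (2 i π τ₀ t)‖ = ‖z‖`, for `z ≠ 0`. -/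
def spiralParam (τ₀ z : ℂ) : ℝ := -Real.log ‖z‖ / (2 * Real.pi * τ₀.im)

/-- The determination of `log (-z)` on `ℂ* - q₀ ^ ℝ` that vanishes at `z = -1`: writing
`z = exp (2 i π x)` with `x = u + t τ₀`, `0 < u < 1`, `t` real, it is `2 i π (x - 1 / 2)`. -/
def logNeg (τ₀ z : ℂ) : ℂ :=
  2 * Real.pi * Complex.I * τ₀ * spiralParam τ₀ z +
    Complex.log (-(z * spiral τ₀ (spiralParam τ₀ z)))

theorem exp_logNeg (τ₀ : ℂ) {z : ℂ} (hz : z ≠ 0) : Complex.exp (logNeg τ₀ z) = -z := by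
  have h : -(z * spiral τ₀ (spiralParam τ₀ z)) ≠ 0 :=
    neg_ne_zero.mpr (mul_ne_zero hz (Complex.exp_ne_zero _))
  rw [logNeg, Complex.exp_add, Complex.exp_log h, spiral, Complex.exp_neg]
  field_simp

theorem logNeg_neg_one (τ₀ : ℂ) : logNeg τ₀ (-1) = 0 := by
  simp [logNeg, spiralParam, spiral]

/-! ### Theta function, characters, `q`-logarithm -/

/-- `Θ_q(z) = ∑_{m ∈ ℤ} (-1) ^ m q ^ (-(m² - m) / 2) z ^ m`. -/
def theta (q z : ℂ) : ℂ :=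
  ∑' m : ℤ, (-1 : ℂ) ^ m * q ^ (-((m * m - m) / 2)) * z ^ m

/-- The character `e_{q,c}(z) = Θ_q(z) / Θ_q(z / c)`. -/
def qChar (q c z : ℂ) : ℂ := theta q z / theta q (c⁻¹ * z)

/-- `l_q(z) = z Θ_q'(z) / Θ_q(z)`. -/
def qLog (q z : ℂ) : ℂ := z * deriv (theta q) z / theta q z

/-- The Newton polynomial `l (l - 1) ⋯ (l - k + 1) / k!`. -/
def newton (l : ℂ) (k : ℕ) : ℂ :=
  (∏ i ∈ Finset.range k, (l - i)) / (k.factorial : ℂ)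

/-- `E = e_{q,A}` for a constant invertible matrix `A`: if `A = D U` is the multiplicative
Dunford decomposition, with `D = R diag(c₁, …, cₙ) R⁻¹` and `U = 1 + N` unipotent, commuting,
then `e_{q,A} = R diag(e_{q,c₁}, …, e_{q,cₙ}) R⁻¹ · ∑_k l_q^{(k)} N ^ k`. -/
def IsCharMatrix {n : ℕ} (q : ℂ) (A : Mat n) (E : ℂ → Mat n) : Prop :=
  ∃ (R N : Mat n) (c : Fin n → ℂ),
    IsUnit R.det ∧ (∀ i, c i ≠ 0) ∧ IsNilpotent N ∧
    Commute (R * Matrix.diagonal c * R⁻¹) N ∧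
    A = R * Matrix.diagonal c * R⁻¹ * (1 + N) ∧
    ∀ z, E z = R * Matrix.diagonal (fun i => qChar q (c i) z) * R⁻¹ *
      ∑ k ∈ Finset.range n, newton (qLog q z) k • N ^ k

/-! ### Gauge transformations to constant coefficients -/

/-- The complement of the discrete half-spirals `q ^ k p`, `k ≥ 1`, `p` a pole of `A`. -/
def qReg {n : ℕ} (q : ℂ) (A : RMat n) : Set ℂ :=
  {z | ∀ k : ℕ, 1 ≤ k → RegAt A (z / q ^ k)}

/-- `F` is the gauge transformation with `F(q z) = A(z) F(z) A(0)⁻¹` and `F(0) = 1`,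
holomorphic outside the half-spirals generated by the poles of `A`. -/
structure IsQGauge {n : ℕ} (q : ℂ) (A : RMat n) (F : ℂ → Mat n) : Prop where
  analytic : ∀ i j, AnalyticOnNhd ℂ (fun z => F z i j) (qReg q A)
  init : F 0 = 1
  eq : ∀ z, q * z ∈ qReg q A → F (q * z) = evalAt A z * F z * (evalAt A 0)⁻¹

/-- `F` is the gauge transformation with `δ F = B F - F B(0)`, `δ = z d/dz`, and `F(0) = 1`,
holomorphic outside the half-spirals `p q₀ ^ [0, +∞]`, `p` a pole of `B`. -/
structure IsDiffGauge {n : ℕ} (τ₀ : ℂ) (B : RMat n) (F : ℂ → Mat n) : Prop where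
  analytic : ∀ i j, AnalyticOnNhd ℂ (fun z => F z i j) (halfCut τ₀ B)
  init : F 0 = 1
  eq : ∀ z ∈ halfCut τ₀ B, ∀ i j,
    z * deriv (fun y => F y i j) z = (evalAt B z * F z - F z * evalAt B 0) i j

/-! ### Canonical solutions, matrix form -/

/-- `X = F e_{q,A(0)}`, the canonical solution at `0` of `X(q z) = A(z) X(z)`. -/
def IsQCanonical {n : ℕ} (q : ℂ) (A : RMat n) (X : ℂ → Mat n) : Prop :=
  ∃ F E : ℂ → Mat n, IsQGauge q A F ∧ IsCharMatrix q (evalAt A 0) E ∧ ∀ z, X z = F z * E z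

/-- `X = F (-z) ^ B(0)`, the Frobenius solution at `0` of `δ X = B X`, where
`(-z) ^ M = exp (log (-z) M)`. -/
def IsDiffCanonical {n : ℕ} (τ₀ : ℂ) (B : RMat n) (X : ℂ → Mat n) : Prop :=
  ∃ F : ℂ → Mat n, IsDiffGauge τ₀ B F ∧
    ∀ z, X z = F z * NormedSpace.exp (logNeg τ₀ z • evalAt B 0)

/-! ### Canonical solutions attached to a Jordan reduction -/

/-- Block diagonal matrices with blocks of sizes `m i`, the rows and columns being numbered
by means of `e`. -/
def blocks {n k : ℕ} {m : Fin k → ℕ} (e : (Σ i : Fin k, Fin (m i)) ≃ Fin n)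
    (M : ∀ i, Matrix (Fin (m i)) (Fin (m i)) ℂ) : Mat n :=
  Matrix.reindex e e (Matrix.blockDiagonal' M)

/-- The upper triangular Toeplitz matrix with entry `f (b - a)` in place `(a, b)`, `a ≤ b`. -/
def toeplitz (m : ℕ) (f : ℕ → ℂ) : Matrix (Fin m) (Fin m) ℂ :=
  Matrix.of fun a b => if (a : ℕ) ≤ b then f (b - a) else 0

/-- The matrix made of the Jordan blocks with eigenvalue `γ i` and size `m i`. -/
def jordan {n k : ℕ} {m : Fin k → ℕ} (e : (Σ i : Fin k, Fin (m i)) ≃ Fin n)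
    (γ : Fin k → ℂ) : Mat n :=
  blocks e fun i => toeplitz (m i) fun d => if d = 0 then γ i else if d = 1 then 1 else 0

/-- The renormalised log-character part: with `η = q - 1` and `c i = 1 + η γ i`, its `i`-th block
is `e_{q,c i}` times the Toeplitz matrix of the `(η / c i) ^ d l_q^{(d)}`. -/
def qLogCar {n k : ℕ} {m : Fin k → ℕ} (e : (Σ i : Fin k, Fin (m i)) ≃ Fin n)
    (q : ℂ) (γ : Fin k → ℂ) (z : ℂ) : Mat n :=
  blocks e fun i => toeplitz (m i) fun d =>
    qChar q (1 + (q - 1) * γ i) z *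
      (((q - 1) / (1 + (q - 1) * γ i)) ^ d * newton (qLog q z) d)

/-- The matrix whose `i`-th block is `(-z) ^ γ i` times the Toeplitz matrix of the
`log (-z) ^ d / d!`. -/
def diffLogCar {n k : ℕ} {m : Fin k → ℕ} (e : (Σ i : Fin k, Fin (m i)) ≃ Fin n)
    (τ₀ : ℂ) (γ : Fin k → ℂ) (z : ℂ) : Mat n :=
  blocks e fun i => toeplitz (m i) fun d =>
    Complex.exp (γ i * logNeg τ₀ z) * (logNeg τ₀ z ^ d / (d.factorial : ℂ))

/-- The renormalised canonical solution `X = Q Y N` of `X(q z) = A(z) X(z)` attached to a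
matrix `Q` reducing `(A(0) - 1) / (q - 1)` to the Jordan form `jordan e γ`. -/
def IsQJordanCanonical {n k : ℕ} {m : Fin k → ℕ} (e : (Σ i : Fin k, Fin (m i)) ≃ Fin n)
    (q : ℂ) (γ : Fin k → ℂ) (Q : Mat n) (A : RMat n) (X : ℂ → Mat n) : Prop :=
  ∃ Y : ℂ → Mat n, IsQGauge q (const Q⁻¹ * A * const Q) Y ∧
    ∀ z, X z = Q * Y z * qLogCar e q γ z

/-- The Frobenius solution `X = Q Y N` of `δ X = B X` attached to a matrix `Q` reducing `B(0)`
to the Jordan form `jordan e γ`. -/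
def IsDiffJordanCanonical {n k : ℕ} {m : Fin k → ℕ} (e : (Σ i : Fin k, Fin (m i)) ≃ Fin n)
    (τ₀ : ℂ) (γ : Fin k → ℂ) (Q : Mat n) (B : RMat n) (X : ℂ → Mat n) : Prop :=
  ∃ Y : ℂ → Mat n, IsDiffGauge τ₀ (const Q⁻¹ * B * const Q) Y ∧
    ∀ z, X z = Q * Y z * diffLogCar e τ₀ γ z

/-! ### The systems at `0` and at `∞` -/

/-- `A = 1 + (q - 1) B`. -/
def qMatrix {n : ℕ} (q : ℂ) (B : RMat n) : RMat n := 1 + RatFunc.C (q - 1) • B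

/-- `C(w) = A(1 / (q w))⁻¹`: the matrix of the `q`-difference system `X(q z) = A(z) X(z)` in the
variable `w = 1 / z`. -/
def qMatrixInfty {n : ℕ} (q : ℂ) (A : RMat n) : RMat n := (invSubst q A)⁻¹

/-- `D(w) = -B(1 / w)`: the matrix of the system `δ X = B X` in the variable `w = 1 / z`. -/
def diffMatrixInfty {n : ℕ} (B : RMat n) : RMat n := -atInfty B

/-- The value at `0` of `D`, where `C = 1 + (q - 1) D`. -/
def deltaValue {n : ℕ} (q : ℂ) (C : RMat n) : Mat n := (q - 1)⁻¹ • (evalAt C 0 - 1)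

/-! ### Hypotheses -/

/-- Two distinct eigenvalues do not differ by an integer. -/
def NonResonant {n : ℕ} (M : Mat n) : Prop :=
  ∀ a ∈ spectrum ℂ M, ∀ b ∈ spectrum ℂ M, a ≠ b → ∀ k : ℤ, a - b ≠ k

/-- As `ε → 0⁺`, `B ε` has no pole on `K` for small `ε` and converges to `B'` uniformly on `K`. -/
def ConvUnifOn {n : ℕ} (B : ℝ → RMat n) (B' : RMat n) (K : Set ℂ) : Prop :=
  (∀ᶠ ε in 𝓝[>] (0 : ℝ), ∀ z ∈ K, RegAt (B ε) z) ∧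
    TendstoUniformlyOn (fun ε => evalAt (B ε)) (evalAt B') (𝓝[>] (0 : ℝ)) K

/-- Condition (A): at each point of the sphere that is not a pole of `B'`, the matrix `B ε` has
no pole for small `ε`. -/
def PolesConverge {n : ℕ} (B : ℝ → RMat n) (B' : RMat n) : Prop :=
  (∀ z, RegAt B' z → ∀ᶠ ε in 𝓝[>] (0 : ℝ), RegAt (B ε) z) ∧
    (RegAt (atInfty B') 0 → ∀ᶠ ε in 𝓝[>] (0 : ℝ), RegAt (atInfty (B ε)) 0)

/-- Condition (B): uniform convergence on a closed disc centred at `0`, on a closed disc centred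
at `∞`, and on every segment of spiral, all of them free of poles of `B'`. -/
def ConvergesEnough {n : ℕ} (τ₀ : ℂ) (B : ℝ → RMat n) (B' : RMat n) : Prop :=
  (∃ ρ > 0, (∀ z ∈ Metric.closedBall (0 : ℂ) ρ, RegAt B' z) ∧
    ConvUnifOn B B' (Metric.closedBall 0 ρ)) ∧
  (∃ ρ > 0, (∀ w ∈ Metric.closedBall (0 : ℂ) ρ, RegAt (atInfty B') w) ∧
    ConvUnifOn (fun ε => atInfty (B ε)) (atInfty B') (Metric.closedBall 0 ρ)) ∧
  ∀ z₀ : ℂ, z₀ ≠ 0 → ∀ a b : ℝ, a ≤ b → (∀ t ∈ Set.Icc a b, RegAt B' (z₀ * spiral τ₀ t)) →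
    ConvUnifOn B B' ((fun t : ℝ => z₀ * spiral τ₀ t) '' Set.Icc a b)

/-- As `ε → 0⁺`, the matrices `M ε` converge to `M'` with constant Jordan structure: they are
reduced by `Q ε` to Jordan forms with blocks of fixed sizes, and `Q ε` and the eigenvalues `γ ε i`
converge to a reducing matrix `Q'` and to the eigenvalues `γ' i` of `M'`. -/
structure IsJordanFamily {n k : ℕ} {m : Fin k → ℕ} (e : (Σ i : Fin k, Fin (m i)) ≃ Fin n)
    (M : ℝ → Mat n) (M' : Mat n) (Q : ℝ → Mat n) (Q' : Mat n)
    (γ : ℝ → Fin k → ℂ) (γ' : Fin k → ℂ) : Prop where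
  isUnit : ∀ᶠ ε in 𝓝[>] (0 : ℝ), IsUnit (Q ε).det
  isUnit' : IsUnit Q'.det
  reduce : ∀ᶠ ε in 𝓝[>] (0 : ℝ), (Q ε)⁻¹ * M ε * Q ε = jordan e (γ ε)
  reduce' : Q'⁻¹ * M' * Q' = jordan e γ'
  tendsto_Q : Tendsto Q (𝓝[>] 0) (𝓝 Q')
  tendsto_γ : ∀ i, Tendsto (fun ε => γ ε i) (𝓝[>] 0) (𝓝 (γ' i))

/-- Convergence with constant Jordan structure and convergent reducing matrix. -/
def ConvJordan {n : ℕ} (M : ℝ → Mat n) (M' : Mat n) : Prop :=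
  ∃ (k : ℕ) (m : Fin k → ℕ) (e : (Σ i : Fin k, Fin (m i)) ≃ Fin n)
    (Q : ℝ → Mat n) (Q' : Mat n) (γ : ℝ → Fin k → ℂ) (γ' : Fin k → ℂ),
    IsJordanFamily e M M' Q Q' γ γ'

/-! ### The connection matrix and its confluence -/

/-- `S` has a solution, and it is unique on `U`. -/
def ExistsUniqueOn {n : ℕ} (S : (ℂ → Mat n) → Prop) (U : Set ℂ) : Prop :=
  (∃ X, S X) ∧ ∀ X Y, S X → S Y → Set.EqOn X Y U

/-- The connection matrix `X^(∞)(z)⁻¹ X^(0)(z)`; here `Xinf` is written in the variable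
`w = 1 / z`. -/
def conn {n : ℕ} (X0 Xinf : ℂ → Mat n) (z : ℂ) : Mat n := (Xinf z⁻¹)⁻¹ * X0 z

/-- `P` is elliptic: meromorphic on `ℂ*` and equal to `z ↦ P(q z)` as a meromorphic function. -/
def IsElliptic {n : ℕ} (q : ℂ) (P : ℂ → Mat n) : Prop :=
  (∀ i j, MeromorphicOn (fun z => P z i j) {0}ᶜ) ∧
    (fun z => P (q * z)) =ᶠ[codiscreteWithin {0}ᶜ] P

/-- `X` is holomorphic at `z` with an invertible value. -/
def IsFundamentalAt {n : ℕ} (X : ℂ → Mat n) (z : ℂ) : Prop :=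
  (∀ i j, AnalyticAt ℂ (fun y => X y i j) z) ∧ IsUnit (X z).det

/-- Confluence of the connection matrix, for given notions of canonical solutions: `S0 ε` and
`Sinf ε` for the `q`-difference system with matrix `1 + (q - 1) B ε`, `q = q₀ ^ ε`, at `0` and
at `∞`, `T0` and `Tinf` for the system `δ X = B' X`. The canonical solutions exist and are unique,
the connection matrices `P ε` are elliptic, `P'` is locally constant on the cut sphere, and at each
of its points `P ε` is defined for small `ε` and converges to `P'`. -/
def ConnectionConfluence {n : ℕ} (τ₀ : ℂ) (B : ℝ → RMat n) (B' : RMat n)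
    (S0 Sinf : ℝ → (ℂ → Mat n) → Prop) (T0 Tinf : (ℂ → Mat n) → Prop) : Prop :=
  ExistsUniqueOn T0 (halfCut τ₀ B') ∧
  ExistsUniqueOn Tinf (halfCut τ₀ (diffMatrixInfty B')) ∧
  (∀ᶠ ε in 𝓝[>] (0 : ℝ),
    ExistsUniqueOn (S0 ε) (qReg (spiral τ₀ ε) (qMatrix (spiral τ₀ ε) (B ε)))) ∧
  (∀ᶠ ε in 𝓝[>] (0 : ℝ),
    ExistsUniqueOn (Sinf ε) (qReg (spiral τ₀ ε)
      (qMatrixInfty (spiral τ₀ ε) (qMatrix (spiral τ₀ ε) (B ε))))) ∧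
  ∀ X0' Xinf' : ℂ → Mat n, T0 X0' → Tinf Xinf' →
  ∀ X0 Xinf : ℝ → ℂ → Mat n,
    (∀ᶠ ε in 𝓝[>] (0 : ℝ), S0 ε (X0 ε) ∧ Sinf ε (Xinf ε)) →
    (∀ᶠ ε in 𝓝[>] (0 : ℝ), IsElliptic (spiral τ₀ ε) (conn (X0 ε) (Xinf ε))) ∧
    ∀ z ∈ fullCut τ₀ B',
      IsFundamentalAt X0' z ∧ IsFundamentalAt Xinf' z⁻¹ ∧
      (∀ᶠ y in 𝓝 z, conn X0' Xinf' y = conn X0' Xinf' z) ∧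
      (∀ᶠ ε in 𝓝[>] (0 : ℝ), IsFundamentalAt (X0 ε) z ∧ IsFundamentalAt (Xinf ε) z⁻¹) ∧
      Tendsto (fun ε => conn (X0 ε) (Xinf ε) z) (𝓝[>] 0) (𝓝 (conn X0' Xinf' z))

end QDiff

end

open QDiff

/-! For `q` close to `1`, the equation `X(qz) = (1 + (q - 1) B_ε(z)) X(z)` is an Euler scheme of
step `ε` for `δX = B' X`, run along the spirals `z q₀^t`. A canonical solution is a gauge
transformation times a matrix of log-characters, and the two factors converge for different reasons.

The gauge factor. Near `0` it is a power series whose coefficients solve `sylv [k]_q (c_k) = ∑_{j<k}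
b_{k-j} c_j`, where `[k]_q = (q^k - 1)/(q - 1)`. Non-resonance makes the limit operators `X ↦ k X +
X b₀ - b₀ X` injective for `k ≥ 1` (`NonResonant.sylv`), and since `‖[k]_q‖ ≥ c k` with `c`
independent of `ε`, a single constant bounds all the inverses (`exists_sylv_bound`). A majorant
argument then gives a disc and coefficient bounds independent of `ε`, hence uniform convergence near
`0` (`exists_local_solutions`, `exists_qGauge_family`). A point `z` of the cut plane is joined to
this disc by its backward half-spiral, which the scheme covers in about `T/ε` steps. The
differential gauge transformation satisfies the `q`-equation up to `o(ε)` at each step, so a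
discrete Gronwall inequality (`norm_sub_le_of_approx_solution`) gives the convergence at `z`
(`tendsto_qGauge`). The same inequality constructs the differential gauge transformation: for the
constant family `B'` the `q`-solutions are locally bounded, and Vitali's theorem provides a limit on
the whole cut plane (`exists_dGauge`).

The log-characters. In the coordinate `z = -exp(2πi y)`, `Θ_q` is a Jacobi theta function with
modulus `ε τ₀`, which tends to `0`. The modular transformation replaces the modulus by `-1/(ε τ₀)`,
where the series tends to its constant term `1` as long as `y = a + s τ₀` with `|a| < 1/2`, that is,
`z` off the spiral `q₀^ℝ`. What remains is an explicit Gaussian factor, whose quotients and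
logarithmic derivative give `(-z)^γ` and `log(-z)` (`tendsto_qChar`, `tendsto_qLog`,
`tendsto_qLogCar`). The matrix `e_{q,A(0)}` can be computed from any Jordan reduction because the
multiplicative Dunford decomposition is unique (`IsCharMatrix.unique`, `isCharMatrix_jordan`).

At infinity, with `β_ε(w) = B_ε(1/(qw))`, the coefficient is `D_ε = -(1 + (q-1)β_ε)⁻¹ β_ε`, so all
the hypotheses at `0` are transported to `D_ε → -B'(1/w)` (`exists_disc_bInf`, `goodPoint_infty`);
the constancy of the Jordan structure is `IsJordanFamily.neg_inverse`. The study at `0` is then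
applied twice, and the connection matrices converge as products of convergent factors
(`connectionConfluence_canonical`). Finally, a renormalised solution is a canonical one multiplied
on the right by the convergent reducing matrix, so the second statement follows from the first
(`ConnectionConfluence.of_mul_inv`). -/

set_option linter.unusedSectionVars false

noncomputable section

namespace QDiff

/-! ### Taylor coefficients, convergence of power series, Vitali's theorem -/

section Taylor

variable {E : Type*} [NormedAddCommGroup E] [NormedSpace ℂ E] [CompleteSpace E]

/-- The `k`-th Taylor coefficient of `f` at `c`. -/
def taylorCoeff (f : ℂ → E) (c : ℂ) (k : ℕ) : E := (k.factorial : ℂ)⁻¹ • iteratedDeriv k f c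

theorem hasSum_taylorCoeff {f : ℂ → E} {c : ℂ} {r : ℝ} (hf : DifferentiableOn ℂ f (Metric.ball c r))
    {z : ℂ} (hz : z ∈ Metric.ball c r) :
    HasSum (fun k => (z - c) ^ k • taylorCoeff f c k) (f z) := by
  have := Complex.hasSum_taylorSeries_on_ball hf hz
  refine this.congr_fun ?_
  intro k
  rw [taylorCoeff, smul_comm]

/-- Cauchy's estimate on circles of radius `s < r`, followed by `s → r`: nothing is assumed on the
boundary circle. -/
theorem norm_taylorCoeff_le {f : ℂ → E} {c : ℂ} {r C : ℝ} (hr : 0 < r)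
    (hf : DifferentiableOn ℂ f (Metric.ball c r)) (hC : ∀ z ∈ Metric.ball c r, ‖f z‖ ≤ C)
    (k : ℕ) : ‖taylorCoeff f c k‖ ≤ C * (r⁻¹) ^ k := by
  have key : ∀ s ∈ Set.Ioo 0 r, ‖taylorCoeff f c k‖ ≤ C * (s⁻¹) ^ k := by
    intro s hs
    have h1 : DiffContOnCl ℂ f (Metric.ball c s) := by
      apply DifferentiableOn.diffContOnCl
      apply hf.mono
      exact (Metric.closure_ball_subset_closedBall).trans (Metric.closedBall_subset_ball hs.2)
    have h2 := Complex.norm_iteratedDeriv_le_of_forall_mem_sphere_norm_le k hs.1 h1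
      (fun z hz => hC z (Metric.sphere_subset_closedBall.trans
        (Metric.closedBall_subset_ball hs.2) hz))
    rw [taylorCoeff, norm_smul, norm_inv, Complex.norm_natCast, inv_pow]
    rw [inv_mul_le_iff₀ (by positivity)]
    calc _ ≤ _ := h2
      _ = _ := by ring
  have hlim : Tendsto (fun s : ℝ => C * (s⁻¹) ^ k) (𝓝[<] r) (𝓝 (C * (r⁻¹) ^ k)) := by
    have : ContinuousAt (fun s : ℝ => C * (s⁻¹) ^ k) r := by
      have := hr.ne'
      fun_prop (disch := assumption)
    exact this.tendsto.mono_left nhdsWithin_le_nhds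
  refine ge_of_tendsto hlim ?_
  filter_upwards [Ioo_mem_nhdsLT hr] with s hs using key s hs

theorem taylorCoeff_sub {f g : ℂ → E} {c : ℂ} (hf : AnalyticAt ℂ f c) (hg : AnalyticAt ℂ g c)
    (k : ℕ) : taylorCoeff (f - g) c k = taylorCoeff f c k - taylorCoeff g c k := by
  rw [taylorCoeff, iteratedDeriv_sub hf.contDiffAt hg.contDiffAt, smul_sub]; rfl

theorem taylorCoeff_zero {F : Type*} [NormedAddCommGroup F] [NormedSpace ℂ F] (f : ℂ → F) (c : ℂ) : taylorCoeff f c 0 = f c := by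
  simp [taylorCoeff]

/-- Uniform convergence on a disc implies the convergence of the Taylor coefficients. -/
theorem tendsto_taylorCoeff {ι : Type*} {l : Filter ι} {f : ι → ℂ → E} {g : ℂ → E} {c : ℂ} {r : ℝ}
    (hr : 0 < r) (hf : ∀ᶠ i in l, DifferentiableOn ℂ (f i) (Metric.ball c r))
    (hg : DifferentiableOn ℂ g (Metric.ball c r))
    (h : TendstoUniformlyOn f g l (Metric.ball c r)) (k : ℕ) :
    Tendsto (fun i => taylorCoeff (f i) c k) l (𝓝 (taylorCoeff g c k)) := by
  rw [Metric.tendsto_nhds]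
  intro δ hδ
  have hpos : 0 < δ / 2 * r ^ k := by positivity
  filter_upwards [hf, Metric.tendstoUniformlyOn_iff.1 h _ hpos] with i hi hi'
  have hc : Metric.ball c r ∈ 𝓝 c := Metric.ball_mem_nhds c hr
  rw [dist_eq_norm, ← taylorCoeff_sub (hi.analyticAt hc) (hg.analyticAt hc)]
  have := norm_taylorCoeff_le hr (hi.sub hg) (C := δ / 2 * r ^ k)
    (fun z hz => by rw [Pi.sub_apply, ← dist_eq_norm, dist_comm]; exact (hi' z hz).le) k
  rw [inv_pow, mul_assoc, mul_inv_cancel₀ (by positivity)] at this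
  linarith

/-- Convergence of power series with uniformly bounded coefficients. -/
theorem tendsto_powerSeries {ι : Type*} {l : Filter ι} {a : ι → ℕ → E} {a' : ℕ → E} {K r s : ℝ}
    (hs : 0 ≤ s) (hsr : s < r) (hK : ∀ᶠ i in l, ∀ k, ‖a i k‖ ≤ K * (r⁻¹) ^ k)
    (ha : ∀ k, Tendsto (fun i => a i k) l (𝓝 (a' k))) {δ : ℝ} (hδ : 0 < δ) :
    ∀ᶠ i in l, ∀ z : ℂ, ‖z‖ ≤ s → ‖∑' k, z ^ k • a i k - ∑' k, z ^ k • a' k‖ < δ := by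
  rcases l.eq_or_neBot with rfl | hl
  · simp
  have hr : 0 < r := hs.trans_lt hsr
  have hK' : ∀ k, ‖a' k‖ ≤ K * (r⁻¹) ^ k := fun k =>
    le_of_tendsto (ha k).norm (hK.mono fun i hi => hi k)
  have hx : s / r < 1 := (div_lt_one hr).2 hsr
  have hx0 : 0 ≤ s / r := by positivity
  have hgeo : Summable fun k : ℕ => 2 * K * (s / r) ^ k :=
    (summable_geometric_of_lt_one hx0 hx).mul_left _
  have hsum : ∀ u : ℕ → E, (∀ k, ‖u k‖ ≤ K * (r⁻¹) ^ k) → ∀ z : ℂ, ‖z‖ ≤ s →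
      Summable fun k => z ^ k • u k := by
    intro u hu z hz
    refine Summable.of_norm_bounded (g := fun k => K * (s / r) ^ k)
      ((summable_geometric_of_lt_one hx0 hx).mul_left _) fun k => ?_
    rw [norm_smul, norm_pow, div_eq_mul_inv, mul_pow]
    calc ‖z‖ ^ k * ‖u k‖ ≤ s ^ k * (K * (r⁻¹) ^ k) := by
          gcongr
          exact hu k
      _ = _ := by ring
  -- This series does not involve `z` and dominates the difference on the whole disc of radius `s`;
  -- dominated convergence for it therefore gives uniformity in `z`.
  have hlim : Tendsto (fun i => ∑' k, ‖a i k - a' k‖ * s ^ k) l (𝓝 (∑' _ : ℕ, (0 : ℝ))) := by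
    refine tendsto_tsum_of_dominated_convergence (bound := fun k => 2 * K * (s / r) ^ k) hgeo ?_ ?_
    · intro k
      have := ((ha k).sub_const (a' k)).norm.mul_const (s ^ k)
      simpa using this
    · filter_upwards [hK] with i hi k
      rw [Real.norm_of_nonneg (by positivity)]
      calc ‖a i k - a' k‖ * s ^ k ≤ (K * (r⁻¹) ^ k + K * (r⁻¹) ^ k) * s ^ k := by
            gcongr
            exact (norm_sub_le _ _).trans (add_le_add (hi k) (hK' k))
        _ = _ := by rw [div_eq_mul_inv, mul_pow]; ring
  rw [tsum_zero] at hlim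
  filter_upwards [hK, (tendsto_order.1 hlim).2 δ hδ] with i hi hi' z hz
  refine lt_of_le_of_lt ?_ hi'
  rw [← (hsum _ hi z hz).tsum_sub (hsum _ hK' z hz)]
  have hb : ∀ k, ‖z ^ k • a i k - z ^ k • a' k‖ ≤ ‖a i k - a' k‖ * s ^ k := by
    intro k
    rw [← smul_sub, norm_smul, norm_pow, mul_comm]
    gcongr
  have hS : Summable fun k => ‖a i k - a' k‖ * s ^ k := by
    refine Summable.of_nonneg_of_le (fun k => by positivity) (fun k => ?_) hgeo
    calc ‖a i k - a' k‖ * s ^ k ≤ (K * (r⁻¹) ^ k + K * (r⁻¹) ^ k) * s ^ k := by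
            gcongr
            exact (norm_sub_le _ _).trans (add_le_add (hi k) (hK' k))
        _ = _ := by rw [div_eq_mul_inv, mul_pow]; ring
  exact tsum_of_norm_bounded hS.hasSum hb

/-- Vitali's theorem: a locally bounded family of holomorphic functions that converges uniformly
near one point converges, locally uniformly, on a connected open set. -/
theorem exists_limit_of_locally_bounded {ι : Type*} {l : Filter ι} [l.NeBot] {f : ι → ℂ → E}
    {U : Set ℂ} (hU : IsPreconnected U)
    (hb : ∀ z ∈ U, ∃ r > 0, ∃ C : ℝ, ∀ᶠ i in l, DifferentiableOn ℂ (f i) (Metric.ball z r) ∧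
      ∀ y ∈ Metric.ball z r, ‖f i y‖ ≤ C)
    {x₀ : ℂ} (hx₀ : x₀ ∈ U)
    (h₀ : ∃ r > 0, ∃ g, TendstoUniformlyOn f g l (Metric.ball x₀ r)) :
    ∃ g : ℂ → E, AnalyticOnNhd ℂ g U ∧ ∀ z ∈ U, Tendsto (fun i => f i z) l (𝓝 (g z)) := by
  -- The points near which the family converges uniformly. This set is open by definition; by
  -- connectedness it is enough to show that it is closed relatively to `U`.
  set G : Set ℂ := {z | ∃ r > 0, ∃ g, TendstoUniformlyOn f g l (Metric.ball z r)}
  have hGo : IsOpen G := by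
    rw [Metric.isOpen_iff]
    rintro z ⟨r, hr, g, hg⟩
    refine ⟨r, hr, fun y hy => ⟨r - dist y z, sub_pos.2 hy, g, hg.mono ?_⟩⟩
    exact Metric.ball_subset_ball' (by linarith)
  have hsub : U ⊆ G := by
    refine hU.subset_of_closure_inter_subset hGo ⟨x₀, hx₀, h₀⟩ ?_
    rintro z ⟨hzc, hzU⟩
    obtain ⟨R, hR, C, hC⟩ := hb z hzU
    obtain ⟨z₁, ⟨r, hr, g, hg⟩, hz₁⟩ := Metric.mem_closure_iff.1 hzc (R / 4) (by positivity)
    -- The expansion is taken at the nearby good point `z₁`. The bound on radius `3R/4` gives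
    -- uniform convergence on radius `R/2`, and that disc contains the ball of radius `R/4` around
    -- `z`.
    have hsubR : Metric.ball z₁ (3 * R / 4) ⊆ Metric.ball z R :=
      Metric.ball_subset_ball' (by rw [dist_comm]; linarith)
    set δ := min r (R / 4)
    have hδ : 0 < δ := by positivity
    have hgδ : TendstoUniformlyOn f g l (Metric.ball z₁ δ) :=
      hg.mono (Metric.ball_subset_ball (min_le_left _ _))
    have hfδ : ∀ᶠ i in l, DifferentiableOn ℂ (f i) (Metric.ball z₁ δ) := by
      filter_upwards [hC] with i hi
      refine hi.1.mono (subset_trans ?_ hsubR)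
      exact Metric.ball_subset_ball ((min_le_right _ _).trans (by linarith))
    have hgd : DifferentiableOn ℂ g (Metric.ball z₁ δ) :=
      hgδ.tendstoLocallyUniformlyOn.differentiableOn hfδ Metric.isOpen_ball
    have hcoef := fun k => tendsto_taylorCoeff hδ hfδ hgd hgδ k
    have hbd : ∀ᶠ i in l, ∀ k, ‖taylorCoeff (f i) z₁ k‖ ≤ C * ((3 * R / 4)⁻¹) ^ k := by
      filter_upwards [hC] with i hi k
      exact norm_taylorCoeff_le (by positivity) (hi.1.mono hsubR)
        (fun y hy => hi.2 y (hsubR hy)) k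
    refine ⟨R / 4, by positivity, fun y => ∑' k, (y - z₁) ^ k • taylorCoeff g z₁ k, ?_⟩
    rw [Metric.tendstoUniformlyOn_iff]
    intro θ hθ
    filter_upwards [hC, tendsto_powerSeries (s := R / 2) (by positivity) (by linarith) hbd hcoef hθ]
      with i hi hi' y hy
    have hy1 : dist y z₁ < R / 2 := by
      calc dist y z₁ ≤ dist y z + dist z z₁ := dist_triangle _ _ _
        _ < R / 4 + R / 4 := add_lt_add hy hz₁
        _ = R / 2 := by ring
    have := hi' (y - z₁) (by rw [← dist_eq_norm]; exact hy1.le)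
    rw [dist_comm, dist_eq_norm]
    have e := (hasSum_taylorCoeff (hi.1.mono hsubR)
      (Metric.mem_ball.2 (hy1.trans (by linarith)))).tsum_eq
    rwa [e] at this
  choose! g hg using fun z (hz : z ∈ U) => hsub hz
  choose hr G' hG' using hg
  have hpt : ∀ z (hz : z ∈ U), ∀ y ∈ Metric.ball z (g z),
      Tendsto (fun i => f i y) l (𝓝 (G' z hz y)) := fun z hz y hy => (hG' z hz).tendsto_at hy
  classical
  -- As `U` need not be open, analyticity at its points involves values outside `U`; there the
  -- pointwise limit is taken whenever it exists, so that all the local limits agree with this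
  -- function.
  refine ⟨fun z => if hz : z ∈ U then G' z hz z else
    if hz : ∃ w, Tendsto (fun i => f i z) l (𝓝 w) then hz.choose else 0, ?_, ?_⟩
  · intro z hz
    obtain ⟨R, hR, C, hC⟩ := hb z hz
    have hρ : 0 < min (g z) R := lt_min (hr z hz) hR
    have hd : DifferentiableOn ℂ (G' z hz) (Metric.ball z (min (g z) R)) := by
      refine ((hG' z hz).mono (Metric.ball_subset_ball
        (min_le_left _ _))).tendstoLocallyUniformlyOn.differentiableOn ?_ Metric.isOpen_ball
      filter_upwards [hC] with i hi
      exact hi.1.mono (Metric.ball_subset_ball (min_le_right _ _))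
    refine (hd.analyticAt (Metric.ball_mem_nhds z hρ)).congr ?_
    filter_upwards [Metric.ball_mem_nhds z hρ] with y hy
    have hy' := hpt z hz y (Metric.ball_subset_ball (min_le_left _ _) hy)
    split_ifs with h1 h2
    · exact tendsto_nhds_unique hy' (hpt y h1 y (Metric.mem_ball_self (hr y h1)))
    · exact tendsto_nhds_unique hy' h2.choose_spec
    · exact (h2 ⟨_, hy'⟩).elim
  · intro z hz
    simp only [hz, dif_pos]
    exact hpt z hz z (Metric.mem_ball_self (hr z hz))

end Taylor

end QDiff

end

noncomputable section

namespace QDiff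

/-! ### The spiral `q₀^t` and the numbers `(q^k - 1)/(q - 1)` -/

section Spiral

theorem spiral_zero (τ₀ : ℂ) : spiral τ₀ 0 = 1 := by simp [spiral]

theorem spiral_add (τ₀ : ℂ) (s t : ℝ) : spiral τ₀ (s + t) = spiral τ₀ s * spiral τ₀ t := by
  rw [spiral, spiral, spiral, ← Complex.exp_add]; congr 1; push_cast; ring

theorem spiral_ne_zero (τ₀ : ℂ) (t : ℝ) : spiral τ₀ t ≠ 0 := Complex.exp_ne_zero _

theorem spiral_neg (τ₀ : ℂ) (t : ℝ) : spiral τ₀ (-t) = (spiral τ₀ t)⁻¹ := by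
  exact eq_inv_of_mul_eq_one_left (by rw [← spiral_add, neg_add_cancel, spiral_zero])

theorem spiral_nat_mul (τ₀ : ℂ) (k : ℕ) (t : ℝ) : spiral τ₀ (k * t) = spiral τ₀ t ^ k := by
  rw [spiral, spiral, ← Complex.exp_nat_mul]; congr 1; push_cast; ring

theorem norm_spiral (τ₀ : ℂ) (t : ℝ) : ‖spiral τ₀ t‖ = Real.exp (2 * Real.pi * τ₀.im * t) := by
  rw [spiral, Complex.norm_exp]; congr 1
  simp only [Complex.neg_re, Complex.mul_re, Complex.mul_im, Complex.ofReal_re, Complex.ofReal_im,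
    Complex.I_re, Complex.I_im, Complex.re_ofNat, Complex.im_ofNat]
  ring

theorem hasDerivAt_spiral (τ₀ : ℂ) (t : ℝ) :
    HasDerivAt (spiral τ₀) (-(2 * Real.pi * Complex.I * τ₀) * spiral τ₀ t) t := by
  have h : HasDerivAt (fun t : ℝ => -(2 * Real.pi * Complex.I * τ₀ * (t : ℂ)))
      (-(2 * Real.pi * Complex.I * τ₀ * ((1 : ℝ) : ℂ))) t :=
    ((hasDerivAt_id t).ofReal_comp.const_mul _).neg
  refine h.cexp.congr_deriv ?_
  rw [Complex.ofReal_one, mul_one, mul_comm, spiral]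

theorem continuous_spiral (τ₀ : ℂ) : Continuous (spiral τ₀) :=
  continuous_iff_continuousAt.2 fun t => (hasDerivAt_spiral τ₀ t).continuousAt

variable {τ₀ : ℂ}

theorem one_lt_norm_spiral (hτ₀ : 0 < τ₀.im) {t : ℝ} (ht : 0 < t) : 1 < ‖spiral τ₀ t‖ := by
  rw [norm_spiral, Real.one_lt_exp_iff]
  positivity

theorem spiral_sub_one_ne_zero (hτ₀ : 0 < τ₀.im) {t : ℝ} (ht : 0 < t) : spiral τ₀ t - 1 ≠ 0 := by
  intro h
  have := one_lt_norm_spiral hτ₀ ht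
  rw [sub_eq_zero.1 h, norm_one] at this
  exact lt_irrefl _ this

theorem tendsto_spiral_one (τ₀ : ℂ) : Tendsto (spiral τ₀) (𝓝[>] 0) (𝓝 1) := by
  have := (continuous_spiral τ₀).tendsto 0
  rw [spiral_zero] at this
  exact this.mono_left nhdsWithin_le_nhds

theorem tendsto_spiral_sub_one (τ₀ : ℂ) :
    Tendsto (fun ε => spiral τ₀ ε - 1) (𝓝[>] 0) (𝓝 0) := by
  simpa using (tendsto_spiral_one τ₀).sub_const 1

theorem tendsto_spiral_slope (τ₀ : ℂ) :
    Tendsto (fun ε : ℝ => (spiral τ₀ ε - 1) / ε) (𝓝[>] 0)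
      (𝓝 (-(2 * Real.pi * Complex.I * τ₀))) := by
  have := (hasDerivAt_spiral τ₀ 0).tendsto_slope_zero_right
  simp only [zero_add, spiral_zero, mul_one] at this
  refine this.congr fun ε => ?_
  rw [div_eq_inv_mul]
  simp

theorem norm_slope_eventually_le (τ₀ : ℂ) :
    ∃ C > 0, ∀ᶠ ε in 𝓝[>] (0 : ℝ), ‖spiral τ₀ ε - 1‖ ≤ C * ε := by
  refine ⟨‖-(2 * Real.pi * Complex.I * τ₀)‖ + 1, by positivity, ?_⟩
  have h := (tendsto_order.1 (tendsto_spiral_slope τ₀).norm).2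
    (‖-(2 * Real.pi * Complex.I * τ₀)‖ + 1) (by linarith)
  filter_upwards [h, self_mem_nhdsWithin] with ε h1 (h2 : 0 < ε)
  rw [norm_div, Complex.norm_real, Real.norm_of_nonneg h2.le, div_lt_iff₀ h2] at h1
  exact h1.le

/-- By Bernoulli's inequality `|q|^k - 1 ≥ k (|q| - 1)`, and `|q| - 1` is at least `2π Im τ₀ ε`
while `|q - 1|` is at most `C ε`. The constant serves all `k` and all small `ε` at once; positivity
of `Im τ₀` is essential. -/
theorem exists_le_norm_qNumber (hτ₀ : 0 < τ₀.im) :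
    ∃ c > 0, ∀ᶠ ε in 𝓝[>] (0 : ℝ), ∀ k : ℕ,
      c * k ≤ ‖(spiral τ₀ ε ^ k - 1) / (spiral τ₀ ε - 1)‖ := by
  obtain ⟨C, hC, h⟩ := norm_slope_eventually_le τ₀
  refine ⟨2 * Real.pi * τ₀.im / C, by positivity, ?_⟩
  filter_upwards [h, self_mem_nhdsWithin] with ε h1 (h2 : 0 < ε) k
  have hpos : 0 < ‖spiral τ₀ ε - 1‖ := norm_pos_iff.2 (spiral_sub_one_ne_zero hτ₀ h2)
  rw [norm_div, le_div_iff₀ hpos]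
  have h3 : ‖spiral τ₀ ε‖ ^ k - 1 ≤ ‖spiral τ₀ ε ^ k - 1‖ := by
    have := norm_sub_norm_le (spiral τ₀ ε ^ k) 1
    rwa [norm_pow, norm_one] at this
  have h4 : 2 * Real.pi * τ₀.im * ε ≤ ‖spiral τ₀ ε‖ - 1 := by
    rw [norm_spiral]
    linarith [Real.add_one_le_exp (2 * Real.pi * τ₀.im * ε)]
  have h5 : k * (‖spiral τ₀ ε‖ - 1) ≤ ‖spiral τ₀ ε‖ ^ k - 1 := by
    have := one_add_mul_le_pow (a := ‖spiral τ₀ ε‖ - 1) (by linarith [norm_nonneg (spiral τ₀ ε)]) k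
    rw [add_sub_cancel] at this
    linarith
  calc 2 * Real.pi * τ₀.im / C * k * ‖spiral τ₀ ε - 1‖
      ≤ 2 * Real.pi * τ₀.im / C * k * (C * ε) := by gcongr
    _ = k * (2 * Real.pi * τ₀.im * ε) := by field_simp
    _ ≤ k * (‖spiral τ₀ ε‖ - 1) := by gcongr
    _ ≤ _ := h5.trans h3

theorem tendsto_qNumber (hτ₀ : 0 < τ₀.im) (k : ℕ) :
    Tendsto (fun ε => (spiral τ₀ ε ^ k - 1) / (spiral τ₀ ε - 1)) (𝓝[>] 0) (𝓝 (k : ℂ)) := by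
  have h : Tendsto (fun ε => ∑ i ∈ Finset.range k, spiral τ₀ ε ^ i) (𝓝[>] 0)
      (𝓝 (∑ i ∈ Finset.range k, (1 : ℂ) ^ i)) :=
    tendsto_finsetSum _ fun i _ => (tendsto_spiral_one τ₀).pow i
  simp only [one_pow, Finset.sum_const, Finset.card_range, nsmul_eq_mul, mul_one] at h
  refine h.congr' ?_
  filter_upwards [self_mem_nhdsWithin] with ε (hε : 0 < ε)
  rw [geom_sum_eq]
  exact fun h => spiral_sub_one_ne_zero hτ₀ hε (by rw [h, sub_self])

end Spiral

/-! ### Sylvester operators and the recursion for the coefficients -/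

section Recursion

variable {𝔸 : Type*} [NormedRing 𝔸] [NormedAlgebra ℂ 𝔸]

/-- The coefficients solving `c 0 = 1` and `c k = T k (∑ j < k, b (k - j) * c j)`. -/
def gaugeCoeff (T : ℕ → 𝔸 → 𝔸) (b : ℕ → 𝔸) : ℕ → 𝔸
  | 0 => 1
  | k + 1 => T (k + 1) (∑ j : Fin (k + 1), b (k + 1 - j) * gaugeCoeff T b j)

theorem gaugeCoeff_zero (T : ℕ → 𝔸 → 𝔸) (b : ℕ → 𝔸) : gaugeCoeff T b 0 = 1 := by
  rw [gaugeCoeff]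

theorem gaugeCoeff_eq (T : ℕ → 𝔸 → 𝔸) (b : ℕ → 𝔸) {k : ℕ} (hk : 1 ≤ k) :
    gaugeCoeff T b k = T k (∑ j ∈ Finset.range k, b (k - j) * gaugeCoeff T b j) := by
  obtain ⟨k, rfl⟩ := Nat.exists_eq_add_of_le' hk
  rw [gaugeCoeff, Finset.sum_range]

/-- The operator `X ↦ κ X (1 + η b) + X b - b X`. -/
def sylv (κ η : ℂ) (b : 𝔸) : 𝔸 →ₗ[ℂ] 𝔸 where
  toFun X := κ • (X * (1 + η • b)) + X * b - b * X
  map_add' X Y := by simp only [add_mul, mul_add, smul_add]; abel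
  map_smul' a X := by
    simp only [smul_mul_assoc, mul_smul_comm, RingHom.id_apply, smul_add, smul_sub, smul_comm a]

theorem sylv_apply (κ η : ℂ) (b X : 𝔸) :
    sylv κ η b X = κ • (X * (1 + η • b)) + X * b - b * X := rfl

/-- When `η b` is small, `X ↦ κ X (1 + η b)` expands by at least `‖κ‖ / 2`, and the commutator costs
at most `2M`. This settles all large `k`, uniformly in `ε`. -/
theorem norm_sylv_ge {κ η : ℂ} {b : 𝔸} {M : ℝ} (hb : ‖b‖ ≤ M) (hη : ‖η‖ * M ≤ 1 / 2) (X : 𝔸) :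
    (‖κ‖ / 2 - 2 * M) * ‖X‖ ≤ ‖sylv κ η b X‖ := by
  have h1 : ‖X‖ / 2 ≤ ‖X * (1 + η • b)‖ := by
    have e : X = X * (1 + η • b) - η • (X * b) := by
      rw [mul_add, mul_one, mul_smul_comm, add_sub_cancel_right]
    have h2 : ‖η • (X * b)‖ ≤ ‖X‖ / 2 := by
      rw [norm_smul]
      calc ‖η‖ * ‖X * b‖ ≤ ‖η‖ * (‖X‖ * M) := by
            gcongr
            exact (norm_mul_le _ _).trans (by gcongr)
        _ = (‖η‖ * M) * ‖X‖ := by ring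
        _ ≤ 1 / 2 * ‖X‖ := by gcongr
        _ = _ := by ring
    have h3 : ‖X‖ ≤ ‖X * (1 + η • b)‖ + ‖η • (X * b)‖ := by
      conv_lhs => rw [e]
      exact norm_sub_le _ _
    linarith
  have e : κ • (X * (1 + η • b)) = sylv κ η b X + (b * X - X * b) := by
    rw [sylv_apply]; abel
  have h2 : ‖κ‖ * ‖X * (1 + η • b)‖ ≤ ‖sylv κ η b X‖ + ‖b * X - X * b‖ := by
    rw [← norm_smul, e]; exact norm_add_le _ _
  have h3 : ‖b * X - X * b‖ ≤ 2 * M * ‖X‖ := by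
    calc _ ≤ ‖b * X‖ + ‖X * b‖ := norm_sub_le _ _
      _ ≤ ‖b‖ * ‖X‖ + ‖X‖ * ‖b‖ := add_le_add (norm_mul_le _ _) (norm_mul_le _ _)
      _ = 2 * ‖b‖ * ‖X‖ := by ring
      _ ≤ _ := by gcongr
  have h4 : ‖κ‖ * (‖X‖ / 2) ≤ ‖κ‖ * ‖X * (1 + η • b)‖ := by gcongr
  linarith

/-- The perturbation estimate that transfers a lower bound from the limit operator to the operators
with small `ε`; it serves for one fixed `k` at a time. -/
theorem norm_sylv_sub_le (κ κ' η : ℂ) (b b' X : 𝔸) :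
    ‖sylv κ η b X - sylv κ' 0 b' X‖ ≤
      (‖κ - κ'‖ + ‖κ * η‖ * ‖b‖ + 2 * ‖b - b'‖) * ‖X‖ := by
  have e : sylv κ η b X - sylv κ' 0 b' X =
      (κ - κ') • X + (κ * η) • (X * b) + (X * (b - b') - (b - b') * X) := by
    simp only [sylv_apply, zero_smul, add_zero, mul_one, mul_add, mul_sub, sub_mul, smul_add,
      mul_smul_comm, sub_smul, mul_smul]
    abel
  rw [e]
  calc _ ≤ ‖(κ - κ') • X‖ + ‖(κ * η) • (X * b)‖ + (‖X * (b - b')‖ + ‖(b - b') * X‖) := by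
        refine (norm_add_le _ _).trans (add_le_add (norm_add_le _ _) (norm_sub_le _ _))
    _ ≤ ‖κ - κ'‖ * ‖X‖ + ‖κ * η‖ * (‖X‖ * ‖b‖) + (‖X‖ * ‖b - b'‖ + ‖b - b'‖ * ‖X‖) := by
        rw [norm_smul, norm_smul]
        gcongr <;> exact norm_mul_le _ _
    _ = _ := by ring

/-- For large `k` the term in `κ` dominates. Only finitely many `k` remain, and for each of them
injectivity in finite dimension gives a lower bound for the limit operator, stable under
perturbation at the price of doubling the constant. -/
theorem exists_sylv_bound [FiniteDimensional ℂ 𝔸] {τ₀ : ℂ} (hτ₀ : 0 < τ₀.im) {b : ℝ → 𝔸} {b' : 𝔸}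
    (hb : Tendsto b (𝓝[>] 0) (𝓝 b'))
    (hres : ∀ k : ℕ, 1 ≤ k → ∀ X : 𝔸, sylv k 0 b' X = 0 → X = 0) :
    ∃ C > 0, (∀ k : ℕ, 1 ≤ k → ∀ X : 𝔸, ‖X‖ ≤ C * ‖sylv k 0 b' X‖) ∧
      ∀ᶠ ε in 𝓝[>] (0 : ℝ), ∀ k : ℕ, 1 ≤ k → ∀ X : 𝔸, ‖X‖ ≤
        C * ‖sylv ((spiral τ₀ ε ^ k - 1) / (spiral τ₀ ε - 1)) (spiral τ₀ ε - 1) (b ε) X‖ := by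
  obtain ⟨c, hc, hck⟩ := exists_le_norm_qNumber hτ₀
  set M := ‖b'‖ + 1
  have hM : ∀ᶠ ε in 𝓝[>] (0 : ℝ), ‖b ε‖ ≤ M :=
    ((tendsto_order.1 hb.norm).2 M (by simp [M])).mono fun _ h => h.le
  have hη := tendsto_spiral_sub_one τ₀
  have hηM : ∀ᶠ ε in 𝓝[>] (0 : ℝ), ‖spiral τ₀ ε - 1‖ * M ≤ 1 / 2 := by
    have h := hη.norm.mul_const M
    rw [norm_zero, zero_mul] at h
    exact ((tendsto_order.1 h).2 (1 / 2) (by norm_num)).mono fun _ h => h.le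
  have hsmall : ∀ k : ℕ, ∃ C > 0, 1 ≤ k → (∀ X : 𝔸, ‖X‖ ≤ C * ‖sylv k 0 b' X‖) ∧
      ∀ᶠ ε in 𝓝[>] (0 : ℝ), ∀ X : 𝔸, ‖X‖ ≤
        C * ‖sylv ((spiral τ₀ ε ^ k - 1) / (spiral τ₀ ε - 1)) (spiral τ₀ ε - 1) (b ε) X‖ := by
    intro k
    by_cases hk : 1 ≤ k
    swap
    · exact ⟨1, one_pos, fun h => absurd h hk⟩
    obtain ⟨K, hK, hanti⟩ := LinearMap.exists_antilipschitzWith (sylv (k : ℂ) 0 b')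
      (LinearMap.ker_eq_bot'.2 (hres k hk))
    have hK' : ∀ X : 𝔸, ‖X‖ ≤ K * ‖sylv k 0 b' X‖ := fun X =>
      ZeroHomClass.bound_of_antilipschitz _ hanti X
    have hKpos : (0 : ℝ) < K := hK
    refine ⟨2 * K, by positivity, fun _ => ⟨fun X => (hK' X).trans ?_, ?_⟩⟩
    · gcongr; linarith
    have hlim : Tendsto (fun ε => ‖(spiral τ₀ ε ^ k - 1) / (spiral τ₀ ε - 1) - k‖ +
        ‖(spiral τ₀ ε ^ k - 1) / (spiral τ₀ ε - 1) * (spiral τ₀ ε - 1)‖ * ‖b ε‖ +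
        2 * ‖b ε - b'‖) (𝓝[>] 0) (𝓝 (‖(k : ℂ) - k‖ + ‖(k : ℂ) * 0‖ * ‖b'‖ + 2 * ‖b' - b'‖)) :=
      ((((tendsto_qNumber hτ₀ k).sub_const _).norm).add
        (((tendsto_qNumber hτ₀ k).mul hη).norm.mul hb.norm)).add
        ((hb.sub_const b').norm.const_mul 2)
    simp only [sub_self, mul_zero, norm_zero, zero_mul, add_zero] at hlim
    filter_upwards [(tendsto_order.1 hlim).2 (1 / (2 * K)) (by positivity)] with ε hε X
    have h1 := norm_sylv_sub_le ((spiral τ₀ ε ^ k - 1) / (spiral τ₀ ε - 1)) k (spiral τ₀ ε - 1)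
      (b ε) b' X
    set S := sylv ((spiral τ₀ ε ^ k - 1) / (spiral τ₀ ε - 1)) (spiral τ₀ ε - 1) (b ε) X
    have h2 : ‖sylv k 0 b' X‖ ≤ ‖S‖ + 1 / (2 * K) * ‖X‖ := by
      have h3 : sylv (k : ℂ) 0 b' X = S - (S - sylv (k : ℂ) 0 b' X) := by abel
      rw [h3]
      refine (norm_sub_le _ _).trans ?_
      gcongr
      refine h1.trans ?_
      gcongr
    have h3 : (K : ℝ) * ‖sylv k 0 b' X‖ ≤ K * ‖S‖ + ‖X‖ / 2 := by
      calc (K : ℝ) * ‖sylv k 0 b' X‖ ≤ K * (‖S‖ + 1 / (2 * K) * ‖X‖) := by gcongr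
        _ = _ := by field_simp
    linarith [hK' X]
  choose D hD hDk using hsmall
  -- For `k ≥ N` both `k` and `c k` are at least `4M + 2`, so that `‖κ‖ / 2 - 2M ≥ 1` for the limit
  -- operator as well as for the `q`-operators.
  obtain ⟨N, hN⟩ := exists_nat_ge ((4 * M + 2) / min c 1)
  have hmin : 0 < min c 1 := lt_min hc one_pos
  refine ⟨1 + ∑ k ∈ Finset.range N, D k,
    add_pos_of_pos_of_nonneg one_pos (Finset.sum_nonneg fun k _ => (hD k).le), ?_, ?_⟩
  · intro k hk X
    rcases lt_or_ge k N with h | h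
    · refine ((hDk k hk).1 X).trans ?_
      gcongr
      have := Finset.single_le_sum (f := D) (fun i _ => (hD i).le) (Finset.mem_range.2 h)
      linarith
    · have h1 := norm_sylv_ge (κ := k) (η := 0) (b := b') (M := M) (by simp [M]) (by simp) X
      have h2 : 4 * M + 2 ≤ (k : ℝ) := by
        have h3 : (4 * M + 2) / min c 1 ≤ k := hN.trans (by exact_mod_cast h)
        rw [div_le_iff₀ hmin] at h3
        refine h3.trans ?_
        calc (k : ℝ) * min c 1 ≤ k * 1 := by gcongr; exact min_le_right _ _
          _ = k := mul_one _
      rw [Complex.norm_natCast] at h1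
      have h3 : 1 * ‖X‖ ≤ ((k : ℝ) / 2 - 2 * M) * ‖X‖ := by gcongr; linarith
      have h4 : 0 ≤ ∑ k ∈ Finset.range N, D k := Finset.sum_nonneg fun k _ => (hD k).le
      have h5 := mul_nonneg h4 (norm_nonneg (sylv (k : ℂ) 0 b' X))
      linarith
  · have hall : ∀ᶠ ε in 𝓝[>] (0 : ℝ), ∀ k ∈ Finset.range N, 1 ≤ k → ∀ X : 𝔸, ‖X‖ ≤
        D k * ‖sylv ((spiral τ₀ ε ^ k - 1) / (spiral τ₀ ε - 1)) (spiral τ₀ ε - 1) (b ε) X‖ := by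
      rw [Filter.eventually_all_finset]
      intro k _
      by_cases hk : 1 ≤ k
      · exact (hDk k hk).2.mono fun ε h _ => h
      · exact Eventually.of_forall fun ε h => absurd h hk
    filter_upwards [hall, hM, hηM, hck] with ε h0 hM hηM hck k hk X
    rcases lt_or_ge k N with h | h
    · refine (h0 k (Finset.mem_range.2 h) hk X).trans ?_
      gcongr
      have := Finset.single_le_sum (f := D) (fun i _ => (hD i).le) (Finset.mem_range.2 h)
      linarith
    · have h1 := norm_sylv_ge (κ := (spiral τ₀ ε ^ k - 1) / (spiral τ₀ ε - 1)) hM hηM X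
      have h2 : 4 * M + 2 ≤ ‖(spiral τ₀ ε ^ k - 1) / (spiral τ₀ ε - 1)‖ := by
        refine le_trans ?_ (hck k)
        have h3 : (4 * M + 2) / min c 1 ≤ k := hN.trans (by exact_mod_cast h)
        rw [div_le_iff₀ hmin] at h3
        refine h3.trans ?_
        rw [mul_comm]
        gcongr
        exact min_le_left _ _
      have h3 : 1 * ‖X‖ ≤ (‖(spiral τ₀ ε ^ k - 1) / (spiral τ₀ ε - 1)‖ / 2 - 2 * M) * ‖X‖ := by
        gcongr; linarith
      have h4 : 0 ≤ ∑ k ∈ Finset.range N, D k := Finset.sum_nonneg fun k _ => (hD k).le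
      have h5 := mul_nonneg h4 (norm_nonneg
        (sylv ((spiral τ₀ ε ^ k - 1) / (spiral τ₀ ε - 1)) (spiral τ₀ ε - 1) (b ε) X))
      linarith

/-- The majorant estimate for the coefficients of a gauge transformation. -/
theorem norm_coeff_le_of_recursion {L : ℕ → 𝔸 → 𝔸} {b c : ℕ → 𝔸} {C M ρ : ℝ} (hC : 0 ≤ C)
    (hM : 0 ≤ M) (hρ : 0 < ρ) (hL : ∀ k, 1 ≤ k → ∀ X, ‖X‖ ≤ C * ‖L k X‖)
    (hb : ∀ k, ‖b k‖ ≤ M * (ρ⁻¹) ^ k)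
    (hc : ∀ k, 1 ≤ k → L k (c k) = ∑ j ∈ Finset.range k, b (k - j) * c j) (k : ℕ) :
    ‖c k‖ ≤ ‖c 0‖ * ((ρ / (1 + C * M))⁻¹) ^ k := by
  induction k using Nat.strong_induction_on with
  | _ k ih =>
    rcases Nat.eq_zero_or_pos k with rfl | hk
    · simp
    have hx : (ρ / (1 + C * M))⁻¹ = ρ⁻¹ * (1 + C * M) := by rw [inv_div, div_eq_inv_mul]
    rw [hx] at ih ⊢
    set x := 1 + C * M
    have hx0 : 0 ≤ x := by positivity
    have h1 : ‖∑ j ∈ Finset.range k, b (k - j) * c j‖ ≤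
        ∑ j ∈ Finset.range k, M * ‖c 0‖ * (ρ⁻¹) ^ k * x ^ j := by
      refine norm_sum_le_of_le _ fun j hj => ?_
      have hj' := Finset.mem_range.1 hj
      calc ‖b (k - j) * c j‖ ≤ ‖b (k - j)‖ * ‖c j‖ := norm_mul_le _ _
        _ ≤ M * (ρ⁻¹) ^ (k - j) * (‖c 0‖ * (ρ⁻¹ * x) ^ j) := by
            gcongr
            · exact hb _
            · exact ih j hj'
        _ = M * ‖c 0‖ * ((ρ⁻¹) ^ (k - j) * (ρ⁻¹) ^ j) * x ^ j := by rw [mul_pow]; ring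
        _ = _ := by rw [← pow_add, Nat.sub_add_cancel hj'.le]
    rw [← Finset.mul_sum] at h1
    -- With `x = 1 + C M` one has `C M = x - 1`, so the geometric sum of the previous bounds closes
    -- up; this dictates the radius `ρ / (1 + C M)`.
    have h2 : C * M * ∑ j ∈ Finset.range k, x ^ j = x ^ k - 1 := by
      rw [← geom_sum_mul x k]
      simp only [x]; ring
    calc ‖c k‖ ≤ C * ‖L k (c k)‖ := hL k hk _
      _ = C * ‖∑ j ∈ Finset.range k, b (k - j) * c j‖ := by rw [hc k hk]
      _ ≤ C * (M * ‖c 0‖ * (ρ⁻¹) ^ k * ∑ j ∈ Finset.range k, x ^ j) := by gcongr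
      _ = ‖c 0‖ * (ρ⁻¹) ^ k * (C * M * ∑ j ∈ Finset.range k, x ^ j) := by ring
      _ = ‖c 0‖ * (ρ⁻¹) ^ k * (x ^ k - 1) := by rw [h2]
      _ ≤ ‖c 0‖ * (ρ⁻¹) ^ k * x ^ k := by gcongr; linarith
      _ = _ := by rw [mul_pow]; ring

/-- Apply the lower bound to `c i k - c' k`: its image under `L i k` is the right-hand side of the
recursion minus `L i k (c' k)`, which tends to `0` by the induction hypothesis. No convergence of
the inverse operators has to be discussed. -/
theorem tendsto_coeff_of_recursion {ι : Type*} {l : Filter ι} {L : ι → ℕ → 𝔸 →ₗ[ℂ] 𝔸}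
    {L' : ℕ → 𝔸 →ₗ[ℂ] 𝔸} {b c : ι → ℕ → 𝔸} {b' c' : ℕ → 𝔸} {C : ℝ}
    (hL : ∀ᶠ i in l, ∀ k, 1 ≤ k → ∀ X, ‖X‖ ≤ C * ‖L i k X‖)
    (hLL : ∀ k, 1 ≤ k → ∀ X, Tendsto (fun i => L i k X) l (𝓝 (L' k X)))
    (hb : ∀ k, Tendsto (fun i => b i k) l (𝓝 (b' k)))
    (hc : ∀ᶠ i in l, ∀ k, 1 ≤ k → L i k (c i k) = ∑ j ∈ Finset.range k, b i (k - j) * c i j)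
    (hc' : ∀ k, 1 ≤ k → L' k (c' k) = ∑ j ∈ Finset.range k, b' (k - j) * c' j)
    (h0 : ∀ᶠ i in l, c i 0 = c' 0) (k : ℕ) :
    Tendsto (fun i => c i k) l (𝓝 (c' k)) := by
  induction k using Nat.strong_induction_on with
  | _ k ih =>
    rcases Nat.eq_zero_or_pos k with rfl | hk
    · exact tendsto_const_nhds.congr' (h0.mono fun i hi => hi.symm)
    rw [tendsto_iff_norm_sub_tendsto_zero]
    have h1 : Tendsto (fun i => C * ‖∑ j ∈ Finset.range k, b i (k - j) * c i j - L i k (c' k)‖) l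
        (𝓝 (C * ‖∑ j ∈ Finset.range k, b' (k - j) * c' j - L' k (c' k)‖)) := by
      refine ((Tendsto.sub ?_ (hLL k hk _)).norm).const_mul C
      exact tendsto_finsetSum _ fun j hj => (hb _).mul (ih j (Finset.mem_range.1 hj))
    rw [hc' k hk, sub_self, norm_zero, mul_zero] at h1
    refine tendsto_of_tendsto_of_tendsto_of_le_of_le' tendsto_const_nhds h1
      (Eventually.of_forall fun i => norm_nonneg _) ?_
    filter_upwards [hL, hc] with i hi hi'
    rw [← hi' k hk, ← map_sub]
    exact hi k hk _

end Recursion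

end QDiff

end

noncomputable section

namespace QDiff

variable {𝔸 : Type*} [NormedRing 𝔸] [NormedAlgebra ℂ 𝔸] [CompleteSpace 𝔸]

/-! ### Power series solutions of both equations -/

section Series

/-- The sum of the power series with coefficients `c`. -/
def gaugeSeries (c : ℕ → 𝔸) (z : ℂ) : 𝔸 := ∑' k, z ^ k • c k

variable {c : ℕ → 𝔸} {K s : ℝ}

theorem norm_pow_smul_le (hc : ∀ k, ‖c k‖ ≤ K * (s⁻¹) ^ k) (z : ℂ) (k : ℕ) :
    ‖z ^ k • c k‖ ≤ K * (‖z‖ / s) ^ k := by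
  rw [norm_smul, norm_pow, div_eq_mul_inv, mul_pow]
  calc ‖z‖ ^ k * ‖c k‖ ≤ ‖z‖ ^ k * (K * (s⁻¹) ^ k) := by
        gcongr
        exact hc k
    _ = _ := by ring

theorem summable_norm_gaugeSeries (hs : 0 < s) (hc : ∀ k, ‖c k‖ ≤ K * (s⁻¹) ^ k) {z : ℂ}
    (hz : z ∈ Metric.ball (0 : ℂ) s) : Summable fun k => ‖z ^ k • c k‖ := by
  rw [mem_ball_zero_iff] at hz
  exact Summable.of_nonneg_of_le (fun k => norm_nonneg _) (norm_pow_smul_le hc z)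
    ((summable_geometric_of_lt_one (by positivity) ((div_lt_one hs).2 hz)).mul_left K)

theorem hasSum_gaugeSeries (hs : 0 < s) (hc : ∀ k, ‖c k‖ ≤ K * (s⁻¹) ^ k) {z : ℂ}
    (hz : z ∈ Metric.ball (0 : ℂ) s) : HasSum (fun k => z ^ k • c k) (gaugeSeries c z) :=
  (summable_norm_gaugeSeries hs hc hz).of_norm.hasSum

theorem gaugeSeries_apply_zero (c : ℕ → 𝔸) : gaugeSeries c 0 = c 0 := by
  rw [gaugeSeries, tsum_eq_single 0 fun k hk => by rw [zero_pow hk, zero_smul], pow_zero, one_smul]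

theorem norm_gaugeSeries_le (hs : 0 < s) (hc : ∀ k, ‖c k‖ ≤ K * (s⁻¹) ^ k) {z : ℂ}
    (hz : ‖z‖ ≤ s / 2) : ‖gaugeSeries c z‖ ≤ 2 * K := by
  have hK : 0 ≤ K := by simpa using (norm_nonneg _).trans (hc 0)
  have h : HasSum (fun k : ℕ => K * (1 / 2 : ℝ) ^ k) (2 * K) := by
    have := hasSum_geometric_two.mul_left K
    rwa [mul_comm] at this
  refine tsum_of_norm_bounded h fun k => (norm_pow_smul_le hc z k).trans ?_
  have hz' : ‖z‖ / s ≤ 1 / 2 := by rw [div_le_iff₀ hs]; linarith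
  gcongr

theorem hasSum_deriv_gaugeSeries (hs : 0 < s) (hc : ∀ k, ‖c k‖ ≤ K * (s⁻¹) ^ k) :
    DifferentiableOn ℂ (gaugeSeries c) (Metric.ball (0 : ℂ) s) ∧
    ∀ z ∈ Metric.ball (0 : ℂ) s,
      HasSum (fun k : ℕ => z ^ k • ((k : ℂ) • c k)) (z • deriv (gaugeSeries c) z) := by
  have key : ∀ r, 0 < r → r < s → DifferentiableOn ℂ (gaugeSeries c) (Metric.ball (0 : ℂ) r) ∧
      ∀ z ∈ Metric.ball (0 : ℂ) r,
        HasSum (fun k : ℕ => z ^ k • ((k : ℂ) • c k)) (z • deriv (gaugeSeries c) z) := by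
    intro r hr hrs
    have hu : Summable fun k : ℕ => K * (r / s) ^ k :=
      (summable_geometric_of_lt_one (by positivity) ((div_lt_one hs).2 hrs)).mul_left K
    have hK : 0 ≤ K := by simpa using (norm_nonneg _).trans (hc 0)
    have hd : ∀ k : ℕ, DifferentiableOn ℂ (fun z : ℂ => z ^ k • c k) (Metric.ball (0 : ℂ) r) :=
      fun k => ((differentiable_id.pow k).smul_const (c k)).differentiableOn
    have hb : ∀ (k : ℕ) (z : ℂ), z ∈ Metric.ball (0 : ℂ) r → ‖z ^ k • c k‖ ≤ K * (r / s) ^ k := by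
      intro k z hz
      refine (norm_pow_smul_le hc z k).trans ?_
      have := (mem_ball_zero_iff.1 hz).le
      gcongr
    refine ⟨Complex.differentiableOn_tsum_of_summable_norm hu hd Metric.isOpen_ball hb, ?_⟩
    intro z hz
    have h := (Complex.hasSum_deriv_of_summable_norm hu hd Metric.isOpen_ball hb hz).const_smul z
    refine h.congr_fun fun k => ?_
    have hder : deriv (fun w : ℂ => w ^ k • c k) z = ((k : ℂ) * z ^ (k - 1)) • c k := by
      simpa using ((hasDerivAt_pow k z).smul_const (c k)).deriv
    rw [hder, smul_smul, smul_smul]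
    congr 1
    rcases Nat.eq_zero_or_pos k with rfl | hk
    · simp
    · obtain ⟨m, rfl⟩ := Nat.exists_eq_add_of_le' hk
      rw [Nat.add_sub_cancel, pow_succ]; ring
  have hex : ∀ z ∈ Metric.ball (0 : ℂ) s, ∃ r, 0 < r ∧ r < s ∧ z ∈ Metric.ball (0 : ℂ) r := by
    intro z hz
    rw [mem_ball_zero_iff] at hz
    obtain ⟨r, h1, h2⟩ := exists_between hz
    exact ⟨r, (norm_nonneg z).trans_lt h1, h2, mem_ball_zero_iff.2 h1⟩
  constructor
  · intro z hz
    obtain ⟨r, hr, hrs, hzr⟩ := hex z hz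
    exact ((key r hr hrs).1.differentiableAt
      (Metric.isOpen_ball.mem_nhds hzr)).differentiableWithinAt
  · intro z hz
    obtain ⟨r, hr, hrs, hzr⟩ := hex z hz
    exact (key r hr hrs).2 z hzr

/-- The Cauchy product, with the term in `b 0 * c k` set apart because in the recursion it belongs
to the operator acting on `c k` and not to the known part. -/
theorem hasSum_mul_gaugeSeries {b : ℂ → 𝔸} {ρ : ℝ} (hs : 0 < s) (hsρ : s ≤ ρ)
    (hb : DifferentiableOn ℂ b (Metric.ball 0 ρ)) {M : ℝ} (hM : ∀ z ∈ Metric.ball 0 ρ, ‖b z‖ ≤ M)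
    (hc : ∀ k, ‖c k‖ ≤ K * (s⁻¹) ^ k) {z : ℂ} (hz : z ∈ Metric.ball (0 : ℂ) s) :
    HasSum (fun k => z ^ k • (∑ j ∈ Finset.range k, taylorCoeff b 0 (k - j) * c j + b 0 * c k))
      (b z * gaugeSeries c z) := by
  have hρ : 0 < ρ := hs.trans_le hsρ
  have hzρ : z ∈ Metric.ball (0 : ℂ) ρ := Metric.ball_subset_ball hsρ hz
  have h1 := summable_norm_gaugeSeries hρ (norm_taylorCoeff_le hρ hb hM) hzρ
  have h2 := summable_norm_gaugeSeries hs hc hz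
  have h3 := hasSum_taylorCoeff hb hzρ
  simp only [sub_zero] at h3
  have h4 : Summable fun k => ∑ p ∈ Finset.HasAntidiagonal.antidiagonal k,
      (z ^ p.1 • taylorCoeff b 0 p.1) * (z ^ p.2 • c p.2) :=
    (summable_norm_sum_mul_antidiagonal_of_summable_norm h1 h2).of_norm
  have h5 := h4.hasSum
  rw [← tsum_mul_tsum_eq_tsum_sum_antidiagonal_of_summable_norm h1 h2, h3.tsum_eq] at h5
  refine h5.congr_fun fun k => ?_
  rw [← Finset.Nat.sum_antidiagonal_swap, Finset.Nat.sum_antidiagonal_eq_sum_range_succ_mk,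
    Finset.sum_range_succ, smul_add, Finset.smul_sum]
  have e : ∀ i j (h : i + j = k), (z ^ i • taylorCoeff b 0 i) * (z ^ j • c j) =
      z ^ k • (taylorCoeff b 0 i * c j) := by
    intro i j h
    rw [smul_mul_smul_comm, ← pow_add, h]
  congr 1
  · exact Finset.sum_congr rfl fun j hj => (e _ _ (Nat.sub_add_cancel (Finset.mem_range.1 hj).le)).symm
  · simp only [Prod.swap, Nat.sub_self]
    rw [e 0 k (zero_add k), taylorCoeff_zero]

/-- With `η = q - 1`, the coefficient of `z^k` reads `q^k c_k (1 + η b₀) = c_k + η (b₀ c_k + ∑_{j<k}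
b_{k-j} c_j)`. Subtracting `c_k (1 + η b₀)` and dividing by `η` gives exactly the operator `sylv`.
-/
theorem gaugeSeries_q_equation {b : ℂ → 𝔸} {ρ : ℝ} (hs : 0 < s) (hsρ : s ≤ ρ)
    (hb : DifferentiableOn ℂ b (Metric.ball 0 ρ)) {M : ℝ} (hM : ∀ z ∈ Metric.ball 0 ρ, ‖b z‖ ≤ M)
    (hc : ∀ k, ‖c k‖ ≤ K * (s⁻¹) ^ k) {q : ℂ} (hq : q - 1 ≠ 0)
    (hrec : ∀ k : ℕ, sylv ((q ^ k - 1) / (q - 1)) (q - 1) (b 0) (c k) =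
      ∑ j ∈ Finset.range k, taylorCoeff b 0 (k - j) * c j)
    {z : ℂ} (hz : z ∈ Metric.ball (0 : ℂ) s) (hqz : q * z ∈ Metric.ball (0 : ℂ) s) :
    gaugeSeries c (q * z) * (1 + (q - 1) • b 0) = (1 + (q - 1) • b z) * gaugeSeries c z := by
  have h1 := (hasSum_gaugeSeries hs hc hqz).mul_right (1 + (q - 1) • b 0)
  have h2 := (hasSum_gaugeSeries hs hc hz).add
    ((hasSum_mul_gaugeSeries hs hsρ hb hM hc hz).const_smul (q - 1))
  rw [add_mul, one_mul, smul_mul_assoc]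
  refine h1.unique (h2.congr_fun fun k => ?_)
  rw [← hrec k, sylv_apply]
  simp only [mul_pow, mul_add, mul_one, smul_add, smul_sub, smul_smul, mul_smul_comm,
    smul_mul_assoc]
  have e : (q - 1) * (z ^ k * ((q ^ k - 1) / (q - 1))) = z ^ k * (q ^ k - 1) := by field_simp
  have e' : (q - 1) * (z ^ k * ((q ^ k - 1) / (q - 1) * (q - 1))) = z ^ k * (q ^ k - 1) * (q - 1) := by
    field_simp
  rw [e, e']
  module

/-- The same comparison of coefficients at `η = 0`, `κ = k`: the differential recursion is the
member `q = 1` of the family. -/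
theorem gaugeSeries_diff_equation {b : ℂ → 𝔸} {ρ : ℝ} (hs : 0 < s) (hsρ : s ≤ ρ)
    (hb : DifferentiableOn ℂ b (Metric.ball 0 ρ)) {M : ℝ} (hM : ∀ z ∈ Metric.ball 0 ρ, ‖b z‖ ≤ M)
    (hc : ∀ k, ‖c k‖ ≤ K * (s⁻¹) ^ k)
    (hrec : ∀ k : ℕ, sylv (k : ℂ) 0 (b 0) (c k) =
      ∑ j ∈ Finset.range k, taylorCoeff b 0 (k - j) * c j)
    {z : ℂ} (hz : z ∈ Metric.ball (0 : ℂ) s) :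
    z • deriv (gaugeSeries c) z = b z * gaugeSeries c z - gaugeSeries c z * b 0 := by
  have h1 := (hasSum_deriv_gaugeSeries hs hc).2 z hz
  have h2 := (hasSum_mul_gaugeSeries hs hsρ hb hM hc hz).sub
    ((hasSum_gaugeSeries hs hc hz).mul_right (b 0))
  refine h1.unique (h2.congr_fun fun k => ?_)
  rw [← hrec k, sylv_apply]
  simp only [zero_smul, add_zero, mul_one, smul_add, smul_sub, smul_mul_assoc]
  abel

end Series

/-! ### Convergence of the local solutions as `ε → 0⁺` -/

section LocalSolutions

/-- Uniform convergence near `0` of the holomorphic functions `b ε` to `b'`. -/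
structure LocalConv (b : ℝ → ℂ → 𝔸) (b' : ℂ → 𝔸) (ρ : ℝ) : Prop where
  pos : 0 < ρ
  diff : ∀ᶠ ε in 𝓝[>] (0 : ℝ), DifferentiableOn ℂ (b ε) (Metric.ball 0 ρ)
  diff' : DifferentiableOn ℂ b' (Metric.ball 0 ρ)
  bdd : ∃ M, ∀ z ∈ Metric.ball (0 : ℂ) ρ, ‖b' z‖ ≤ M
  unif : TendstoUniformlyOn b b' (𝓝[>] 0) (Metric.ball 0 ρ)

theorem LocalConv.eventually_bdd {b : ℝ → ℂ → 𝔸} {b' : ℂ → 𝔸} {ρ : ℝ} (h : LocalConv b b' ρ) :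
    ∃ M, 0 ≤ M ∧ (∀ z ∈ Metric.ball (0 : ℂ) ρ, ‖b' z‖ ≤ M) ∧
      ∀ᶠ ε in 𝓝[>] (0 : ℝ), ∀ z ∈ Metric.ball (0 : ℂ) ρ, ‖b ε z‖ ≤ M := by
  obtain ⟨M, hM⟩ := h.bdd
  have hM0 : 0 ≤ M := (norm_nonneg _).trans (hM 0 (Metric.mem_ball_self h.pos))
  refine ⟨M + 1, by positivity, fun z hz => (hM z hz).trans (by linarith), ?_⟩
  filter_upwards [Metric.tendstoUniformlyOn_iff.1 h.unif 1 one_pos] with ε hε z hz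
  have h1 := hε z hz
  rw [dist_comm, dist_eq_norm] at h1
  have h2 := norm_le_norm_add_norm_sub' (b ε z) (b' z)
  linarith [hM z hz]

/-- `0` is not an eigenvalue of `X ↦ k X + X b - b X` for `k ≥ 1`. -/
def SylvNonResonant (b : 𝔸) : Prop := ∀ k : ℕ, 1 ≤ k → ∀ X : 𝔸, sylv k 0 b X = 0 → X = 0

/-- In finite dimension injective operators are surjective, so each step of the recursion can be
solved. At order `0` the sum is empty, and the equation holds because `1` is killed by `L 0`. -/
theorem exists_solve [FiniteDimensional ℂ 𝔸] {L : ℕ → 𝔸 →ₗ[ℂ] 𝔸} (β : ℕ → 𝔸)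
    (hL0 : L 0 1 = 0) (hL : ∀ k, 1 ≤ k → ∀ X, L k X = 0 → X = 0) :
    ∃ c : ℕ → 𝔸, c 0 = 1 ∧ ∀ k, L k (c k) = ∑ j ∈ Finset.range k, β (k - j) * c j := by
  refine ⟨gaugeCoeff (fun k => Function.invFun (L k)) β, gaugeCoeff_zero _ _, fun k => ?_⟩
  rcases Nat.eq_zero_or_pos k with rfl | hk
  · rw [gaugeCoeff_zero, hL0, Finset.range_zero, Finset.sum_empty]
  · have hinj : Function.Injective (L k) :=
      LinearMap.ker_eq_bot.1 (LinearMap.ker_eq_bot'.2 (hL k hk))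
    have hsurj := LinearMap.surjective_of_injective hinj
    conv_lhs => rw [gaugeCoeff_eq _ _ hk]
    exact Function.rightInverse_invFun hsurj _

/-- The point is that the radius `s = ρ / (1 + C M)` and the constant `K = ‖1‖` do not depend on
`ε`; with the convergence of each coefficient this amounts to uniform convergence on smaller discs.
-/
theorem exists_local_solutions [FiniteDimensional ℂ 𝔸] {τ₀ : ℂ} (hτ₀ : 0 < τ₀.im)
    {b : ℝ → ℂ → 𝔸} {b' : ℂ → 𝔸} {ρ : ℝ} (h : LocalConv b b' ρ) (hres : SylvNonResonant (b' 0)) :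
    ∃ s > 0, s ≤ ρ ∧ ∃ (K : ℝ) (c : ℝ → ℕ → 𝔸) (c' : ℕ → 𝔸),
      ((∀ k, ‖c' k‖ ≤ K * (s⁻¹) ^ k) ∧ c' 0 = 1 ∧
        ∀ k : ℕ, sylv (k : ℂ) 0 (b' 0) (c' k) =
          ∑ j ∈ Finset.range k, taylorCoeff b' 0 (k - j) * c' j) ∧
      (∀ᶠ ε in 𝓝[>] (0 : ℝ), (∀ k, ‖c ε k‖ ≤ K * (s⁻¹) ^ k) ∧ c ε 0 = 1 ∧
        (∀ k : ℕ, sylv ((spiral τ₀ ε ^ k - 1) / (spiral τ₀ ε - 1)) (spiral τ₀ ε - 1) (b ε 0)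
          (c ε k) = ∑ j ∈ Finset.range k, taylorCoeff (b ε) 0 (k - j) * c ε j) ∧
        ∀ k : ℕ, 1 ≤ k → ∀ X : 𝔸, sylv ((spiral τ₀ ε ^ k - 1) / (spiral τ₀ ε - 1))
          (spiral τ₀ ε - 1) (b ε 0) X = 0 → X = 0) ∧
      ∀ k, Tendsto (fun ε => c ε k) (𝓝[>] 0) (𝓝 (c' k)) := by
  have h0 : Tendsto (fun ε => b ε 0) (𝓝[>] 0) (𝓝 (b' 0)) :=
    h.unif.tendsto_at (Metric.mem_ball_self h.pos)
  obtain ⟨C, hC, hC', hCε⟩ := exists_sylv_bound hτ₀ h0 hres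
  obtain ⟨M, hM0, hM', hM⟩ := h.eventually_bdd
  have hinj : ∀ᶠ ε in 𝓝[>] (0 : ℝ), ∀ k : ℕ, 1 ≤ k → ∀ X : 𝔸,
      sylv ((spiral τ₀ ε ^ k - 1) / (spiral τ₀ ε - 1)) (spiral τ₀ ε - 1) (b ε 0) X = 0 → X = 0 := by
    filter_upwards [hCε] with ε hε k hk X hX
    have := hε k hk X
    rw [hX, norm_zero, mul_zero] at this
    exact norm_le_zero_iff.1 this
  have hL0 : ∀ (κ η : ℂ) (X : 𝔸), κ = 0 → sylv κ η X 1 = 0 := by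
    intro κ η X hκ; rw [hκ, sylv_apply]; simp
  obtain ⟨c', hc'0, hc'⟩ := exists_solve (L := fun k => sylv (k : ℂ) 0 (b' 0))
    (taylorCoeff b' 0) (hL0 _ _ _ Nat.cast_zero) hres
  have hex : ∀ ε : ℝ, ∃ c : ℕ → 𝔸, (∀ k : ℕ, 1 ≤ k → ∀ X : 𝔸,
      sylv ((spiral τ₀ ε ^ k - 1) / (spiral τ₀ ε - 1)) (spiral τ₀ ε - 1) (b ε 0) X = 0 → X = 0) →
      c 0 = 1 ∧ ∀ k : ℕ, sylv ((spiral τ₀ ε ^ k - 1) / (spiral τ₀ ε - 1)) (spiral τ₀ ε - 1) (b ε 0)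
          (c k) = ∑ j ∈ Finset.range k, taylorCoeff (b ε) 0 (k - j) * c j := by
    intro ε
    by_cases hε : ∀ k : ℕ, 1 ≤ k → ∀ X : 𝔸,
      sylv ((spiral τ₀ ε ^ k - 1) / (spiral τ₀ ε - 1)) (spiral τ₀ ε - 1) (b ε 0) X = 0 → X = 0
    · obtain ⟨c, hc⟩ := exists_solve (L := fun k => sylv ((spiral τ₀ ε ^ k - 1) / (spiral τ₀ ε - 1))
        (spiral τ₀ ε - 1) (b ε 0)) (taylorCoeff (b ε) 0) (hL0 _ _ _ (by simp)) hε
      exact ⟨c, fun _ => hc⟩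
    · exact ⟨0, fun h => absurd h hε⟩
  choose c hc using hex
  have hcM : 0 ≤ C * M := by positivity
  refine ⟨ρ / (1 + C * M), div_pos h.pos (by positivity), div_le_self h.pos.le (by linarith),
    ‖(1 : 𝔸)‖, c, c', ⟨fun k => ?_, hc'0, hc'⟩, ?_, ?_⟩
  · have := norm_coeff_le_of_recursion (L := fun k => sylv (k : ℂ) 0 (b' 0)) hC.le hM0 h.pos hC'
      (norm_taylorCoeff_le h.pos h.diff' hM') (fun k _ => hc' k) k
    rwa [hc'0] at this
  · filter_upwards [hinj, hCε, hM, h.diff] with ε hi hCε hM hd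
    obtain ⟨h1, h2⟩ := hc ε hi
    refine ⟨fun k => ?_, h1, h2, hi⟩
    have := norm_coeff_le_of_recursion (L := fun k => sylv ((spiral τ₀ ε ^ k - 1) / (spiral τ₀ ε - 1))
      (spiral τ₀ ε - 1) (b ε 0)) hC.le hM0 h.pos hCε
      (norm_taylorCoeff_le h.pos hd hM) (fun k _ => h2 k) k
    rwa [h1] at this
  · refine tendsto_coeff_of_recursion (L := fun (ε : ℝ) k =>
      sylv ((spiral τ₀ ε ^ k - 1) / (spiral τ₀ ε - 1)) (spiral τ₀ ε - 1) (b ε 0))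
      (b := fun ε => taylorCoeff (b ε) 0) hCε ?_
      (tendsto_taylorCoeff h.pos h.diff h.diff' h.unif) ?_ (fun k _ => hc' k) ?_
    · intro k _ X
      simp only [sylv_apply]
      have hη := tendsto_spiral_sub_one τ₀
      exact (((tendsto_qNumber hτ₀ k).smul ((tendsto_const_nhds (x := X)).mul
        ((tendsto_const_nhds (x := (1 : 𝔸))).add (hη.smul h0)))).add
        (tendsto_const_nhds.mul h0)).sub (h0.mul tendsto_const_nhds)
    · filter_upwards [hinj] with ε hi k _ using (hc ε hi).2 k
    · filter_upwards [hinj] with ε hi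
      rw [(hc ε hi).1, hc'0]

end LocalSolutions

end QDiff

end

/-! ### Global `q`-gauge transformations: existence and uniqueness -/

noncomputable section

namespace QDiff

variable {𝔸 : Type*} [NormedRing 𝔸] [NormedAlgebra ℂ 𝔸] [CompleteSpace 𝔸]

/-- The points `z` such that `z / q ^ k ∈ R` for all `k ≥ 1`. -/
def qStar (q : ℂ) (R : Set ℂ) : Set ℂ := {z | ∀ k : ℕ, 1 ≤ k → z / q ^ k ∈ R}

/-- Gauge transformations of `q`-difference systems with coefficient `1 + (q - 1) b`, the function
`b` being holomorphic on `R`. -/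
structure QGauge (q : ℂ) (R : Set ℂ) (b F : ℂ → 𝔸) : Prop where
  analytic : AnalyticOnNhd ℂ F (qStar q R)
  init : F 0 = 1
  eq : ∀ z, q * z ∈ qStar q R →
    F (q * z) * (1 + (q - 1) • b 0) = (1 + (q - 1) • b z) * F z

theorem div_mem_qStar {q : ℂ} {R : Set ℂ} {z : ℂ} (hz : z ∈ qStar q R) : z / q ∈ qStar q R := by
  intro k hk
  have := hz (k + 1) (by omega)
  rwa [div_div, ← pow_succ']

theorem div_mem_of_mem_qStar {q : ℂ} {R : Set ℂ} {z : ℂ} (hz : z ∈ qStar q R) : z / q ∈ R := by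
  simpa using hz 1 le_rfl

theorem zero_mem_qStar {q : ℂ} {R : Set ℂ} (h : (0 : ℂ) ∈ R) : (0 : ℂ) ∈ qStar q R := by
  intro k _; rwa [zero_div]

theorem exists_norm_div_pow_lt {q : ℂ} (hq : 1 < ‖q‖) (z : ℂ) {s : ℝ} (hs : 0 < s) :
    ∃ N : ℕ, ‖z / q ^ N‖ < s := by
  obtain ⟨N, hN⟩ := pow_unbounded_of_one_lt (‖z‖ / s) hq
  refine ⟨N, ?_⟩
  rw [norm_div, norm_pow, div_lt_iff₀ (by positivity)]
  rwa [div_lt_iff₀ hs, mul_comm] at hN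

theorem norm_div_pow_anti {q : ℂ} (hq : 1 < ‖q‖) (z : ℂ) {M N : ℕ} (h : M ≤ N) :
    ‖z / q ^ N‖ ≤ ‖z / q ^ M‖ := by
  rw [norm_div, norm_div, norm_pow, norm_pow]
  gcongr
  exact hq.le

theorem tendsto_div_pow {q : ℂ} (hq : 1 < ‖q‖) (z : ℂ) :
    Tendsto (fun N : ℕ => z / q ^ N) atTop (𝓝 0) := by
  have : Tendsto (fun N : ℕ => z * (q⁻¹) ^ N) atTop (𝓝 (z * 0)) := by
    refine (tendsto_pow_atTop_nhds_zero_of_norm_lt_one ?_).const_mul z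
    rw [norm_inv]; exact inv_lt_one_of_one_lt₀ hq
  rw [mul_zero] at this
  refine this.congr fun N => ?_
  rw [inv_pow, div_eq_mul_inv]

theorem ball_subset_qStar {q : ℂ} (hq : 1 < ‖q‖) {R : Set ℂ} {s : ℝ}
    (hs : Metric.ball 0 s ⊆ R) : Metric.ball 0 s ⊆ qStar q R := by
  intro z hz k _
  apply hs
  rw [mem_ball_zero_iff] at hz ⊢
  have := norm_div_pow_anti hq z (Nat.zero_le k)
  rw [pow_zero, div_one] at this
  exact this.trans_lt hz

/-- Extension of a local solution by means of the functional equation. -/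
def qExtend (q : ℂ) (a : ℂ → 𝔸) (u : 𝔸) (f : ℂ → 𝔸) : ℕ → ℂ → 𝔸
  | 0, z => f z
  | N + 1, z => a (z / q) * qExtend q a u f N (z / q) * u

/-- The equation expresses `F z` through `F (z / q)`, and `z / q ^ N` ends up in the disc where `f`
is defined. The local equation shows that the number of iterations is irrelevant once the disc is
reached. -/
theorem exists_qGauge {q : ℂ} (hq : 1 < ‖q‖) {R : Set ℂ} {b : ℂ → 𝔸}
    (hb : AnalyticOnNhd ℂ b R) {s : ℝ} (hs : 0 < s)
    (hu : IsUnit (1 + (q - 1) • b 0)) {f : ℂ → 𝔸} (hf : DifferentiableOn ℂ f (Metric.ball 0 s))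
    (hf0 : f 0 = 1) (hfq : ∀ z, z ∈ Metric.ball (0 : ℂ) s → q * z ∈ Metric.ball (0 : ℂ) s →
      f (q * z) * (1 + (q - 1) • b 0) = (1 + (q - 1) • b z) * f z) :
    ∃ F, QGauge q R b F ∧ Set.EqOn F f (Metric.ball 0 s) := by
  have hq0 : q ≠ 0 := by rintro rfl; simp at hq; linarith
  obtain ⟨u, hu⟩ := hu
  set a : ℂ → 𝔸 := fun z => 1 + (q - 1) • b z
  set G := qExtend q a (↑u⁻¹ : 𝔸) f
  have hG : ∀ N z, G (N + 1) z = a (z / q) * G N (z / q) * ↑u⁻¹ := fun N z => rfl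
  have hGs : ∀ N z, ‖z / q ^ N‖ < s → G (N + 1) z = G N z := by
    intro N
    induction N with
    | zero =>
      intro z hz
      rw [pow_zero, div_one] at hz
      have h1 : z ∈ Metric.ball (0 : ℂ) s := mem_ball_zero_iff.2 hz
      have h2 : z / q ∈ Metric.ball (0 : ℂ) s := by
        rw [mem_ball_zero_iff, norm_div]
        exact (div_le_self (norm_nonneg z) hq.le).trans_lt hz
      have h3 := hfq (z / q) h2 (by rwa [mul_div_cancel₀ z hq0])
      rw [mul_div_cancel₀ z hq0, ← hu] at h3
      change a (z / q) * f (z / q) * ↑u⁻¹ = f z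
      rw [← h3, mul_assoc, Units.mul_inv, mul_one]
    | succ N ih =>
      intro z hz
      rw [hG (N + 1) z, hG N z, ih (z / q)]
      rwa [div_div, ← pow_succ']
  have hGm : ∀ M N z, M ≤ N → ‖z / q ^ M‖ < s → G N z = G M z := by
    intro M N z hMN hz
    induction N, hMN using Nat.le_induction with
    | base => rfl
    | succ N hMN ih => rw [hGs N z ((norm_div_pow_anti hq z hMN).trans_lt hz), ih]
  have hGa : ∀ N z, z ∈ qStar q R → ‖z / q ^ N‖ < s → AnalyticAt ℂ (G N) z := by
    intro N
    induction N with
    | zero =>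
      intro z _ hz
      rw [pow_zero, div_one] at hz
      exact hf.analyticAt (Metric.isOpen_ball.mem_nhds (mem_ball_zero_iff.2 hz))
    | succ N ih =>
      intro z hzR hz
      have hd : AnalyticAt ℂ (fun z : ℂ => z / q) z := analyticAt_id.div analyticAt_const hq0
      have h1 : AnalyticAt ℂ (fun z => G N (z / q)) z :=
        AnalyticAt.fun_comp (f := fun z : ℂ => z / q) (ih (z / q) (div_mem_qStar hzR)
          (by rwa [div_div, ← pow_succ'])) hd
      have h2 : AnalyticAt ℂ (fun z => b (z / q)) z :=
        AnalyticAt.fun_comp (f := fun z : ℂ => z / q) (hb _ (div_mem_of_mem_qStar hzR)) hd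
      change AnalyticAt ℂ (fun z => (1 + (q - 1) • b (z / q)) * G N (z / q) * (↑u⁻¹ : 𝔸)) z
      exact ((analyticAt_const.fun_add (analyticAt_const.fun_smul h2)).fun_mul h1).fun_mul
        analyticAt_const
  -- The number of steps may be any admissible one: near `z` the function agrees with `G (N z)` for
  -- the fixed number `N z`, which is how analyticity is obtained.
  choose N hN using fun z => exists_norm_div_pow_lt hq z hs
  have hFG : ∀ M z, ‖z / q ^ M‖ < s → G (N z) z = G M z := by
    intro M z hM
    rw [← hGm (N z) (max M (N z)) z (le_max_right _ _) (hN z),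
      ← hGm M (max M (N z)) z (le_max_left _ _) hM]
  have hFf : Set.EqOn (fun z => G (N z) z) f (Metric.ball 0 s) := by
    intro z hz
    exact hFG 0 z (by rw [pow_zero, div_one]; exact mem_ball_zero_iff.1 hz)
  refine ⟨fun z => G (N z) z, ⟨?_, ?_, ?_⟩, hFf⟩
  · intro z hz
    refine (hGa (N z) z hz (hN z)).congr ?_
    have ho : ∀ᶠ y in 𝓝 z, ‖y / q ^ N z‖ < s := by
      have hcont : ContinuousAt (fun y : ℂ => ‖y / q ^ N z‖) z := by fun_prop
      exact hcont.eventually_lt_const (hN z)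
    filter_upwards [ho] with y hy
    exact (hFG (N z) y hy).symm
  · exact (hFf (Metric.mem_ball_self hs)).trans hf0
  · intro z _
    change G (N (q * z)) (q * z) * (1 + (q - 1) • b 0) = a z * G (N z) z
    have h1 : ‖q * z / q ^ (N z + 1)‖ < s := by
      rw [pow_succ', mul_div_mul_left _ _ hq0]; exact hN z
    rw [hFG (N z + 1) _ h1, hG, mul_div_cancel_left₀ z hq0, ← hu, mul_assoc, Units.inv_mul, mul_one]

/-- If the difference of two solutions does not vanish near `0`, its leading coefficient has order
`k ≥ 1` and lies in the kernel of the `k`-th Sylvester operator. Once it vanishes near `0`, the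
equation propagates the vanishing outwards because `1 + (q - 1) b 0` is invertible. -/
theorem QGauge.eqOn {q : ℂ} (hq : 1 < ‖q‖) {R : Set ℂ} {b : ℂ → 𝔸}
    (hb : AnalyticAt ℂ b 0) {s : ℝ} (hs : 0 < s) (hsR : Metric.ball 0 s ⊆ R)
    (hu : IsUnit (1 + (q - 1) • b 0))
    (hres : ∀ k : ℕ, 1 ≤ k → ∀ X : 𝔸, sylv ((q ^ k - 1) / (q - 1)) (q - 1) (b 0) X = 0 → X = 0)
    {F₁ F₂ : ℂ → 𝔸} (h₁ : QGauge q R b F₁) (h₂ : QGauge q R b F₂) :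
    Set.EqOn F₁ F₂ (qStar q R) := by
  have hq0 : q ≠ 0 := by rintro rfl; simp at hq; linarith
  have hq1 : q - 1 ≠ 0 := by
    intro h; rw [sub_eq_zero.1 h, norm_one] at hq; exact lt_irrefl _ hq
  have h0R : (0 : ℂ) ∈ R := hsR (Metric.mem_ball_self hs)
  set H : ℂ → 𝔸 := fun z => F₁ z - F₂ z with hH
  have hHa : AnalyticAt ℂ H 0 :=
    (h₁.analytic 0 (zero_mem_qStar h0R)).sub (h₂.analytic 0 (zero_mem_qStar h0R))
  have hH0 : H 0 = 0 := by simp only [hH, h₁.init, h₂.init, sub_self]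
  have hHq : ∀ z, q * z ∈ qStar q R →
      H (q * z) * (1 + (q - 1) • b 0) = (1 + (q - 1) • b z) * H z := by
    intro z hz
    simp only [hH]
    rw [sub_mul, mul_sub, h₁.eq z hz, h₂.eq z hz]
  have hzero : ∀ᶠ z in 𝓝 (0 : ℂ), H z = 0 := by
    by_contra hne
    obtain ⟨k, g, hg, hg0, hHg⟩ := hHa.exists_eventuallyEq_pow_smul_nonzero_iff.2 hne
    simp only [sub_zero] at hHg
    have hk : 1 ≤ k := by
      rw [Nat.one_le_iff_ne_zero]
      rintro rfl
      have := hHg.self_of_nhds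
      rw [hH0, pow_zero, one_smul] at this
      exact hg0 this.symm
    have hmul : Tendsto (fun z : ℂ => q * z) (𝓝 0) (𝓝 0) := by
      have : ContinuousAt (fun z : ℂ => q * z) 0 := by fun_prop
      simpa [ContinuousAt] using this
    have hball : ∀ᶠ z in 𝓝 (0 : ℂ), q * z ∈ qStar q R :=
      hmul.eventually (Filter.mem_of_superset (Metric.ball_mem_nhds 0 hs)
        (ball_subset_qStar hq hsR))
    -- After cancellation of `z ^ k`, which requires `z ≠ 0`, letting `z → 0` gives the equation for
    -- the leading coefficient `g 0`.
    have hev : ∀ᶠ z in 𝓝[≠] (0 : ℂ), (q ^ k • g (q * z)) * (1 + (q - 1) • b 0) =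
        (1 + (q - 1) • b z) * g z := by
      have h3 : ∀ᶠ z in 𝓝 (0 : ℂ), z ≠ 0 → (q ^ k • g (q * z)) * (1 + (q - 1) • b 0) =
          (1 + (q - 1) • b z) * g z := by
        filter_upwards [hHg, hmul.eventually hHg, hball] with z e1 e2 e3 hz
        have e4 := hHq z e3
        rw [e1, e2, mul_pow, mul_comm, mul_smul, smul_mul_assoc, mul_smul_comm] at e4
        exact smul_right_injective 𝔸 (pow_ne_zero k hz) e4
      exact eventually_nhdsWithin_iff.2 (h3.mono fun z hz hz' => hz hz')
    have hl : Tendsto (fun z => (q ^ k • g (q * z)) * (1 + (q - 1) • b 0)) (𝓝[≠] 0)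
        (𝓝 ((q ^ k • g 0) * (1 + (q - 1) • b 0))) :=
      (((hg.continuousAt.tendsto.comp hmul).const_smul _).mul_const _).mono_left nhdsWithin_le_nhds
    have hr : Tendsto (fun z => (1 + (q - 1) • b z) * g z) (𝓝[≠] 0)
        (𝓝 ((1 + (q - 1) • b 0) * g 0)) :=
      (((hb.continuousAt.tendsto.const_smul _).const_add _).mul
        hg.continuousAt.tendsto).mono_left nhdsWithin_le_nhds
    have hE := tendsto_nhds_unique (hl.congr' hev) hr
    refine hg0 (hres k hk _ ?_)
    have : (q - 1) • sylv ((q ^ k - 1) / (q - 1)) (q - 1) (b 0) (g 0) =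
        (q ^ k • g 0) * (1 + (q - 1) • b 0) - (1 + (q - 1) • b 0) * g 0 := by
      rw [sylv_apply, smul_sub, smul_add, smul_smul, mul_div_cancel₀ _ hq1]
      simp only [mul_add, add_mul, one_mul, mul_one, smul_mul_assoc, mul_smul_comm, smul_add]
      module
    rw [hE, sub_self] at this
    exact (smul_eq_zero.1 this).resolve_left hq1
  intro z hz
  have hind : ∀ N : ℕ, ∀ z, z ∈ qStar q R → H (z / q ^ N) = 0 → H z = 0 := by
    intro N
    induction N with
    | zero => intro z _ h; simpa using h
    | succ N ih =>
      intro z hz h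
      have h1 := ih (z / q) (div_mem_qStar hz) (by rwa [div_div, ← pow_succ'])
      have h2 := hHq (z / q) (by rwa [mul_div_cancel₀ z hq0])
      rw [mul_div_cancel₀ z hq0, h1, mul_zero] at h2
      exact hu.mul_left_eq_zero.1 h2
  obtain ⟨N, hN⟩ := ((tendsto_div_pow hq z).eventually hzero).exists
  exact sub_eq_zero.1 (hind N z hz hN)

/-! ### Growth of solutions along spirals -/

theorem norm_le_two_mul_norm_mul {η : ℂ} {b : 𝔸} {M : ℝ} (hb : ‖b‖ ≤ M) (hη : ‖η‖ * M ≤ 1 / 2)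
    (X : 𝔸) : ‖X‖ ≤ 2 * ‖X * (1 + η • b)‖ := by
  have e : X = X * (1 + η • b) - η • (X * b) := by
    rw [mul_add, mul_one, mul_smul_comm, add_sub_cancel_right]
  have h2 : ‖η • (X * b)‖ ≤ ‖X‖ / 2 := by
    rw [norm_smul]
    calc ‖η‖ * ‖X * b‖ ≤ ‖η‖ * (‖X‖ * M) := by
          gcongr
          exact (norm_mul_le _ _).trans (by gcongr)
      _ = (‖η‖ * M) * ‖X‖ := by ring
      _ ≤ 1 / 2 * ‖X‖ := by gcongr
      _ = _ := by ring
  have h3 : ‖X‖ ≤ ‖X * (1 + η • b)‖ + ‖η • (X * b)‖ := by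
    conv_lhs => rw [e]
    exact norm_sub_le _ _
  linarith

/-- Comparison of a solution `Y` of `Y (k + 1) (1 + η b₀) = (1 + η b k) Y k` with an approximate
solution `G`. -/
theorem norm_sub_le_of_approx_solution {η : ℂ} {b₀ : 𝔸} {b Y G : ℕ → 𝔸} {M δ : ℝ} {N : ℕ}
    (hη : ‖η‖ * M ≤ 1 / 2) (hb₀ : ‖b₀‖ ≤ M) (hδ : 0 ≤ δ) (hb : ∀ k < N, ‖b k‖ ≤ M)
    (hY : ∀ k < N, Y (k + 1) * (1 + η • b₀) = (1 + η • b k) * Y k)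
    (hG : ∀ k < N, ‖η • (b k * G k - G k * b₀) - (G (k + 1) - G k) * (1 + η • b₀)‖ ≤ δ) :
    ‖Y N - G N‖ ≤ (‖Y 0 - G 0‖ + N * (2 * δ)) * Real.exp (N * (4 * M * ‖η‖)) := by
  have hM : 0 ≤ M := (norm_nonneg _).trans hb₀
  have hstep : ∀ k < N, ‖Y (k + 1) - G (k + 1)‖ ≤ (1 + 4 * M * ‖η‖) * ‖Y k - G k‖ + 2 * δ := by
    intro k hk
    -- The increment of the error. The equation writes `D (1 + η b₀)` as `η` times a commutator-like
    -- expression in the error, plus the defect of `G`; this is the step of a discrete Gronwall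
    -- inequality.
    set D := (Y (k + 1) - G (k + 1)) - (Y k - G k)
    have e : D * (1 + η • b₀) = η • (b k * (Y k - G k) - (Y k - G k) * b₀) +
        (η • (b k * G k - G k * b₀) - (G (k + 1) - G k) * (1 + η • b₀)) := by
      have : D * (1 + η • b₀) = Y (k + 1) * (1 + η • b₀) - Y k * (1 + η • b₀) -
          (G (k + 1) - G k) * (1 + η • b₀) := by
        simp only [D, sub_mul]; abel
      rw [this, hY k hk]
      simp only [mul_sub, sub_mul, mul_add, add_mul, smul_sub, one_mul, mul_one, smul_mul_assoc,
        mul_smul_comm]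
      abel
    have h1 := norm_le_two_mul_norm_mul hb₀ hη D
    have h2 : ‖D * (1 + η • b₀)‖ ≤ ‖η‖ * (2 * M * ‖Y k - G k‖) + δ := by
      rw [e]
      refine (norm_add_le _ _).trans (add_le_add ?_ (hG k hk))
      rw [norm_smul]
      gcongr
      calc _ ≤ ‖b k * (Y k - G k)‖ + ‖(Y k - G k) * b₀‖ := norm_sub_le _ _
        _ ≤ ‖b k‖ * ‖Y k - G k‖ + ‖Y k - G k‖ * ‖b₀‖ :=
          add_le_add (norm_mul_le _ _) (norm_mul_le _ _)
        _ ≤ M * ‖Y k - G k‖ + ‖Y k - G k‖ * M := by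
          gcongr
          exact hb k hk
        _ = _ := by ring
    have h3 : ‖Y (k + 1) - G (k + 1)‖ ≤ ‖D‖ + ‖Y k - G k‖ := by
      have : Y (k + 1) - G (k + 1) = D + (Y k - G k) := by simp only [D]; abel
      rw [this]; exact norm_add_le _ _
    linarith
  have hind : ∀ k ≤ N, ‖Y k - G k‖ ≤
      (‖Y 0 - G 0‖ + k * (2 * δ)) * (1 + 4 * M * ‖η‖) ^ k := by
    intro k
    induction k with
    | zero => intro _; simp
    | succ k ih =>
      intro hk
      have h1 : (1 : ℝ) ≤ (1 + 4 * M * ‖η‖) ^ (k + 1) :=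
        one_le_pow₀ (by have : 0 ≤ 4 * M * ‖η‖ := by positivity
                        linarith)
      calc ‖Y (k + 1) - G (k + 1)‖ ≤ (1 + 4 * M * ‖η‖) * ‖Y k - G k‖ + 2 * δ := hstep k hk
        _ ≤ (1 + 4 * M * ‖η‖) * ((‖Y 0 - G 0‖ + k * (2 * δ)) * (1 + 4 * M * ‖η‖) ^ k) +
            2 * δ * (1 + 4 * M * ‖η‖) ^ (k + 1) := by
          refine add_le_add (mul_le_mul_of_nonneg_left (ih (by omega)) (by positivity)) ?_
          exact le_mul_of_one_le_right (by positivity) h1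
        _ = _ := by push_cast; ring
  refine (hind N le_rfl).trans ?_
  gcongr
  calc (1 + 4 * M * ‖η‖) ^ N ≤ (Real.exp (4 * M * ‖η‖)) ^ N := by
        gcongr
        linarith [Real.add_one_le_exp (4 * M * ‖η‖)]
    _ = _ := by rw [← Real.exp_nat_mul]

end QDiff

end

noncomputable section

namespace QDiff

/-! ### Domains star-shaped along spirals -/

section Star

/-- The points `z` such that the half-spiral `z q₀ ^ [-∞, 0]` is contained in `R`. -/
def sStar (τ₀ : ℂ) (R : Set ℂ) : Set ℂ := {z | ∀ t : ℝ, 0 ≤ t → z * spiral τ₀ (-t) ∈ R}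

variable {τ₀ : ℂ} {R : Set ℂ}

theorem sStar_subset : sStar τ₀ R ⊆ R := fun z hz => by
  simpa [spiral_zero] using hz 0 le_rfl

theorem mul_spiral_mem_sStar {z : ℂ} (hz : z ∈ sStar τ₀ R) {t : ℝ} (ht : t ≤ 0) :
    z * spiral τ₀ t ∈ sStar τ₀ R := by
  intro s hs
  rw [mul_assoc, ← spiral_add]
  have := hz (s - t) (by linarith)
  rwa [neg_sub, sub_eq_add_neg] at this

theorem div_spiral_pow (z : ℂ) (ε : ℝ) (k : ℕ) :
    z / spiral τ₀ ε ^ k = z * spiral τ₀ (-(k * ε)) := by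
  rw [spiral_neg, spiral_nat_mul, div_eq_mul_inv]

theorem sStar_subset_qStar {ε : ℝ} (hε : 0 < ε) : sStar τ₀ R ⊆ qStar (spiral τ₀ ε) R := by
  intro z hz k _
  rw [div_spiral_pow]
  exact hz _ (by positivity)

theorem norm_mul_spiral_neg_le (hτ₀ : 0 < τ₀.im) (z : ℂ) {t : ℝ} (ht : 0 ≤ t) :
    ‖z * spiral τ₀ (-t)‖ ≤ ‖z‖ := by
  rw [norm_mul, norm_spiral]
  refine mul_le_of_le_one_right (norm_nonneg _) (Real.exp_le_one_iff.2 ?_)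
  have : 0 ≤ 2 * Real.pi * τ₀.im * t := by positivity
  linarith

theorem ball_subset_sStar (hτ₀ : 0 < τ₀.im) {s : ℝ} (hs : Metric.ball 0 s ⊆ R) :
    Metric.ball 0 s ⊆ sStar τ₀ R := by
  intro z hz t ht
  apply hs
  rw [mem_ball_zero_iff] at hz ⊢
  exact (norm_mul_spiral_neg_le hτ₀ z ht).trans_lt hz

theorem exists_norm_mul_spiral_lt (hτ₀ : 0 < τ₀.im) (C : ℝ) {s : ℝ} (hs : 0 < s) :
    ∃ T : ℝ, 0 ≤ T ∧ ∀ t, T ≤ t → ∀ z : ℂ, ‖z‖ ≤ C → ‖z * spiral τ₀ (-t)‖ < s := by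
  have h1 : Tendsto (fun t : ℝ => C * Real.exp (-(2 * Real.pi * τ₀.im * t))) atTop (𝓝 (C * 0)) := by
    refine (Real.tendsto_exp_neg_atTop_nhds_zero.comp ?_).const_mul C
    exact tendsto_id.const_mul_atTop (by positivity)
  rw [mul_zero] at h1
  obtain ⟨T, hT⟩ := eventually_atTop.1 ((tendsto_order.1 h1).2 s hs)
  refine ⟨max T 0, le_max_right _ _, fun t ht z hz => lt_of_le_of_lt ?_
    (hT t ((le_max_left _ _).trans ht))⟩
  rw [norm_mul, norm_spiral, mul_neg]
  gcongr

theorem continuous_mul_spiral_neg : Continuous fun p : ℂ × ℝ => p.1 * spiral τ₀ (-p.2) :=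
  continuous_fst.mul ((continuous_spiral τ₀).comp continuous_snd.neg)

/-- The tube lemma around the compact arc issued from `z₀`: one neighbourhood of `z₀` works for all
times in `[0, T]`. -/
theorem exists_bound_near_spiral {E : Type*} [SeminormedAddCommGroup E] (hR : IsOpen R)
    {b : ℂ → E} (hb : ContinuousOn b R) {z₀ : ℂ} (hz₀ : z₀ ∈ sStar τ₀ R) (T : ℝ) :
    ∃ M : ℝ, ∀ᶠ z in 𝓝 z₀, ∀ t ∈ Set.Icc 0 T, z * spiral τ₀ (-t) ∈ R ∧
      ‖b (z * spiral τ₀ (-t))‖ ≤ M := by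
  have hc : ContinuousOn (fun t : ℝ => ‖b (z₀ * spiral τ₀ (-t))‖) (Set.Icc 0 T) := by
    refine ContinuousOn.norm (hb.comp ?_ fun t ht => hz₀ t ht.1)
    exact (continuous_const.mul ((continuous_spiral τ₀).comp continuous_neg)).continuousOn
  obtain ⟨M, hM⟩ := isCompact_Icc.bddAbove_image hc
  refine ⟨M + 1, isCompact_Icc.eventually_forall_of_forall_eventually fun t ht => ?_⟩
  have hmem : z₀ * spiral τ₀ (-t) ∈ R := hz₀ t ht.1
  have hcont : Tendsto (fun p : ℂ × ℝ => p.1 * spiral τ₀ (-p.2)) (𝓝 (z₀, t))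
    (𝓝 (z₀ * spiral τ₀ (-t))) := continuous_mul_spiral_neg.tendsto (z₀, t)
  have h1 := hcont.eventually (hR.mem_nhds hmem)
  have h2 : ∀ᶠ y in 𝓝 (z₀ * spiral τ₀ (-t)), ‖b y‖ < M + 1 := by
    have := (hb.continuousAt (hR.mem_nhds hmem)).norm
    refine this.eventually_lt_const ?_
    have := hM (Set.mem_image_of_mem _ ht)
    linarith
  filter_upwards [h1, hcont.eventually h2] with p hp1 hp2 using ⟨hp1, hp2.le⟩

/-- A backward half-spiral is not compact, but its tail lies in a disc around `0` inside `R`, from a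
time `T` valid for all nearby points; the compact remainder is handled by
`exists_bound_near_spiral`. -/
theorem isOpen_sStar (hτ₀ : 0 < τ₀.im) (hR : IsOpen R) (h0 : (0 : ℂ) ∈ R) :
    IsOpen (sStar τ₀ R) := by
  rw [isOpen_iff_mem_nhds]
  intro z₀ hz₀
  obtain ⟨s, hs, hsR⟩ := Metric.isOpen_iff.1 hR 0 h0
  obtain ⟨T, hT0, hT⟩ := exists_norm_mul_spiral_lt hτ₀ (‖z₀‖ + 1) hs
  obtain ⟨M, hM⟩ := exists_bound_near_spiral hR (continuousOn_const (c := (0 : ℂ))) hz₀ T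
  have hn : ∀ᶠ z in 𝓝 z₀, ‖z‖ < ‖z₀‖ + 1 :=
    continuous_norm.continuousAt.eventually_lt_const (by linarith)
  filter_upwards [hM, hn] with z hz hzn t ht
  rcases le_total t T with h | h
  · exact (hz t ⟨ht, h⟩).1
  · exact hsR (mem_ball_zero_iff.2 (hT t h z hzn.le))

/-- Each point is joined to `0` inside the set by its own backward half-spiral, completed by its
limit point `0`. -/
theorem isPreconnected_sStar (hτ₀ : 0 < τ₀.im) (h0 : (0 : ℂ) ∈ R) :
    IsPreconnected (sStar τ₀ R) := by
  refine isPreconnected_of_forall 0 fun z hz => ?_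
  set A : Set ℂ := (fun t : ℝ => z * spiral τ₀ (-t)) '' Set.Ici 0
  have hA : IsPreconnected A := isPreconnected_Ici.image _
    (continuous_const.mul ((continuous_spiral τ₀).comp continuous_neg)).continuousOn
  have hcl : (0 : ℂ) ∈ closure A := by
    rw [Metric.mem_closure_iff]
    intro s hs
    obtain ⟨T, hT0, hT⟩ := exists_norm_mul_spiral_lt hτ₀ ‖z‖ hs
    refine ⟨z * spiral τ₀ (-T), ⟨T, hT0, rfl⟩, ?_⟩
    rw [dist_comm, dist_zero_right]
    exact hT T le_rfl z le_rfl
  refine ⟨insert 0 A, ?_, Set.mem_insert _ _, Set.mem_insert_of_mem _ ⟨0, ?_, ?_⟩, ?_⟩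
  · rintro y (rfl | ⟨t, ht, rfl⟩)
    · intro t _; rwa [zero_mul]
    · exact mul_spiral_mem_sStar hz (neg_nonpos.2 ht)
  · exact Set.mem_Ici.2 le_rfl
  · simp [spiral_zero]
  · refine hA.subset_closure (Set.subset_insert _ _) ?_
    rintro y (rfl | hy)
    · exact hcl
    · exact subset_closure hy

end Star

/-! ### Comparison along spirals and construction of the differential gauge transformation -/

variable {𝔸 : Type*} [NormedRing 𝔸] [NormedAlgebra ℂ 𝔸] [CompleteSpace 𝔸]

/-- Gauge transformations of differential systems with coefficient `b`, the function `b` being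
holomorphic on `R`. -/
structure DGauge (τ₀ : ℂ) (R : Set ℂ) (b F : ℂ → 𝔸) : Prop where
  analytic : AnalyticOnNhd ℂ F (sStar τ₀ R)
  init : F 0 = 1
  eq : ∀ z ∈ sStar τ₀ R, z • deriv F z = b z * F z - F z * b 0

/-- Gronwall along the points `z / q ^ (N - k)`, numbered from the disc near `0` towards `z`. The
function `G` is free: `G = 0` gives a priori bounds, and the differential gauge transformation as
`G` gives convergence. -/
theorem QGauge.norm_sub_le {q : ℂ} (hq0 : q ≠ 0) {R : Set ℂ} {b F : ℂ → 𝔸} (hF : QGauge q R b F)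
    {z : ℂ} (hz : z ∈ qStar q R) {N : ℕ} {M δ : ℝ} (hη : ‖q - 1‖ * M ≤ 1 / 2) (hb₀ : ‖b 0‖ ≤ M)
    (hδ : 0 ≤ δ) (hb : ∀ k : ℕ, 1 ≤ k → k ≤ N → ‖b (z / q ^ k)‖ ≤ M) (G : ℂ → 𝔸)
    (hG : ∀ k : ℕ, 1 ≤ k → k ≤ N → ‖(q - 1) • (b (z / q ^ k) * G (z / q ^ k) -
      G (z / q ^ k) * b 0) - (G (q * (z / q ^ k)) - G (z / q ^ k)) * (1 + (q - 1) • b 0)‖ ≤ δ) :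
    ‖F z - G z‖ ≤ (‖F (z / q ^ N) - G (z / q ^ N)‖ + N * (2 * δ)) *
      Real.exp (N * (4 * M * ‖q - 1‖)) := by
  have hmem : ∀ k : ℕ, z / q ^ k ∈ qStar q R := by
    intro k j hj
    rw [div_div, ← pow_add]
    exact hz _ (by omega)
  have hsucc : ∀ k < N, z / q ^ (N - (k + 1)) = q * (z / q ^ (N - k)) := by
    intro k hk
    have : N - k = (N - (k + 1)) + 1 := by omega
    rw [this, pow_succ]
    field_simp
  have := norm_sub_le_of_approx_solution (Y := fun k => F (z / q ^ (N - k)))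
    (G := fun k => G (z / q ^ (N - k))) (b := fun k => b (z / q ^ (N - k))) (N := N) hη hb₀ hδ
    (fun k hk => hb _ (by omega) (by omega))
    (fun k hk => by
      have h1 := hF.eq (z / q ^ (N - k)) (by rw [← hsucc k hk]; exact hmem _)
      rw [← hsucc k hk] at h1
      exact h1)
    (fun k hk => by
      have := hG (N - k) (by omega) (by omega)
      rw [← hsucc k hk] at this
      exact this)
  simpa using this

theorem eventually_isUnit_one_add_smul {b : ℝ → ℂ → 𝔸} {b' : ℂ → 𝔸} (τ₀ : ℂ)
    (h0 : Tendsto (fun ε => b ε 0) (𝓝[>] 0) (𝓝 (b' 0))) :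
    ∀ᶠ ε in 𝓝[>] (0 : ℝ), IsUnit (1 + (spiral τ₀ ε - 1) • b ε 0) := by
  have h : Tendsto (fun ε => 1 + (spiral τ₀ ε - 1) • b ε 0) (𝓝[>] 0)
      (𝓝 (1 + (0 : ℂ) • b' 0)) := ((tendsto_spiral_sub_one τ₀).smul h0).const_add 1
  rw [zero_smul, add_zero] at h
  exact h.eventually (Units.nhds (1 : 𝔸ˣ))

/-- Existence and uniqueness of the gauge transformations of a convergent family of
`q`-difference systems, and their convergence near `0`. -/
theorem exists_qGauge_family [FiniteDimensional ℂ 𝔸] {τ₀ : ℂ} (hτ₀ : 0 < τ₀.im)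
    {R : ℝ → Set ℂ} {b : ℝ → ℂ → 𝔸} {b' : ℂ → 𝔸} {ρ : ℝ} (h : LocalConv b b' ρ)
    (hR : ∀ᶠ ε in 𝓝[>] (0 : ℝ), Metric.ball 0 ρ ⊆ R ε)
    (hb : ∀ᶠ ε in 𝓝[>] (0 : ℝ), AnalyticOnNhd ℂ (b ε) (R ε)) (hres : SylvNonResonant (b' 0)) :
    ∃ s > 0, s ≤ ρ ∧ ∃ (K : ℝ) (f' : ℂ → 𝔸), DifferentiableOn ℂ f' (Metric.ball 0 s) ∧ f' 0 = 1 ∧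
      (∀ z ∈ Metric.ball (0 : ℂ) s, z • deriv f' z = b' z * f' z - f' z * b' 0) ∧
      (∀ᶠ ε in 𝓝[>] (0 : ℝ), (∃ F, QGauge (spiral τ₀ ε) (R ε) (b ε) F) ∧
        (∀ F₁ F₂, QGauge (spiral τ₀ ε) (R ε) (b ε) F₁ → QGauge (spiral τ₀ ε) (R ε) (b ε) F₂ →
          Set.EqOn F₁ F₂ (qStar (spiral τ₀ ε) (R ε))) ∧
        ∀ F, QGauge (spiral τ₀ ε) (R ε) (b ε) F → ∀ z : ℂ, ‖z‖ ≤ s / 2 → ‖F z‖ ≤ 2 * K) ∧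
      ∀ δ > 0, ∀ᶠ ε in 𝓝[>] (0 : ℝ), ∀ F, QGauge (spiral τ₀ ε) (R ε) (b ε) F →
        ∀ z : ℂ, ‖z‖ ≤ s / 2 → ‖F z - f' z‖ < δ := by
  obtain ⟨s, hs, hsρ, K, c, c', ⟨hc'K, hc'0, hc'⟩, hε, hlim⟩ := exists_local_solutions hτ₀ h hres
  obtain ⟨M, hM0, hM', hM⟩ := h.eventually_bdd
  have h0 : Tendsto (fun ε => b ε 0) (𝓝[>] 0) (𝓝 (b' 0)) :=
    h.unif.tendsto_at (Metric.mem_ball_self h.pos)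
  have hmain : ∀ᶠ ε in 𝓝[>] (0 : ℝ), (∃ F, QGauge (spiral τ₀ ε) (R ε) (b ε) F) ∧
      (∀ F₁ F₂, QGauge (spiral τ₀ ε) (R ε) (b ε) F₁ → QGauge (spiral τ₀ ε) (R ε) (b ε) F₂ →
        Set.EqOn F₁ F₂ (qStar (spiral τ₀ ε) (R ε))) ∧
      ∀ F, QGauge (spiral τ₀ ε) (R ε) (b ε) F →
        Set.EqOn F (gaugeSeries (c ε)) (Metric.ball 0 s) := by
    filter_upwards [hε, hR, hb, h.diff, hM, eventually_isUnit_one_add_smul τ₀ h0,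
      self_mem_nhdsWithin] with ε ⟨h1, h2, h3, h4⟩ hR hb hd hM hu (hε : 0 < ε)
    have hq := one_lt_norm_spiral hτ₀ hε
    have hsR : Metric.ball 0 s ⊆ R ε := (Metric.ball_subset_ball hsρ).trans hR
    have hex := exists_qGauge hq hb hs hu (hasSum_deriv_gaugeSeries hs h1).1
      (by rw [gaugeSeries_apply_zero, h2]) (fun z hz hqz => gaugeSeries_q_equation hs hsρ hd hM h1
        (spiral_sub_one_ne_zero hτ₀ hε) h3 hz hqz)
    have huniq : ∀ F₁ F₂, QGauge (spiral τ₀ ε) (R ε) (b ε) F₁ →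
        QGauge (spiral τ₀ ε) (R ε) (b ε) F₂ → Set.EqOn F₁ F₂ (qStar (spiral τ₀ ε) (R ε)) :=
      fun F₁ F₂ hF₁ hF₂ => hF₁.eqOn hq (hb 0 (hsR (Metric.mem_ball_self hs))) hs hsR hu h4 hF₂
    obtain ⟨F, hF, hFs⟩ := hex
    exact ⟨⟨F, hF⟩, huniq, fun F₁ hF₁ z hz =>
      (huniq F₁ F hF₁ hF (ball_subset_qStar hq hsR hz)).trans (hFs hz)⟩
  refine ⟨s, hs, hsρ, K, gaugeSeries c', (hasSum_deriv_gaugeSeries hs hc'K).1,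
    by rw [gaugeSeries_apply_zero, hc'0],
    fun z hz => gaugeSeries_diff_equation hs hsρ h.diff' hM' hc'K hc' hz, ?_, ?_⟩
  · filter_upwards [hmain, hε] with ε h1 h2
    refine ⟨h1.1, h1.2.1, fun F hF z hz => ?_⟩
    rw [h1.2.2 F hF (mem_ball_zero_iff.2 (by linarith))]
    exact norm_gaugeSeries_le hs h2.1 hz
  · intro δ hδ
    filter_upwards [hmain, tendsto_powerSeries (half_pos hs).le (half_lt_self hs)
      (hε.mono fun ε h => h.1) hlim hδ] with ε h1 h2 F hF z hz
    rw [h1.2.2 F hF (mem_ball_zero_iff.2 (by linarith))]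
    exact h2 z hz

/-- The number of steps of size `ε` that cover a segment of length `T`. -/
theorem exists_steps (T : ℝ) (hT : 0 ≤ T) {ε : ℝ} (hε : 0 < ε) (hε1 : ε < 1) :
    ∃ N : ℕ, T ≤ N * ε ∧ N * ε ≤ T + 1 := by
  refine ⟨⌈T / ε⌉₊, ?_, ?_⟩
  · have := Nat.le_ceil (T / ε)
    rwa [div_le_iff₀ hε] at this
  · have := (Nat.ceil_lt_add_one (div_nonneg hT hε.le)).le
    calc (⌈T / ε⌉₊ : ℝ) * ε ≤ (T / ε + 1) * ε := by gcongr
      _ = T + ε := by field_simp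
      _ ≤ T + 1 := by linarith

theorem eventually_norm_mul_le (τ₀ : ℂ) (M : ℝ) :
    ∀ᶠ ε in 𝓝[>] (0 : ℝ), ‖spiral τ₀ ε - 1‖ * M ≤ 1 / 2 := by
  have h := (tendsto_spiral_sub_one τ₀).norm.mul_const M
  rw [norm_zero, zero_mul] at h
  exact ((tendsto_order.1 h).2 (1 / 2) (by norm_num)).mono fun _ h => h.le

/-- A fixed coefficient is viewed as a constant family, so that the results on families produce
solutions of the differential equation. -/
theorem exists_localConv_const {R : Set ℂ} (hR : IsOpen R) (h0 : (0 : ℂ) ∈ R) {b : ℂ → 𝔸}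
    (hb : AnalyticOnNhd ℂ b R) : ∃ ρ, LocalConv (fun _ => b) b ρ ∧ Metric.ball 0 ρ ⊆ R := by
  obtain ⟨ρ, hρ, hρR⟩ := Metric.nhds_basis_closedBall.mem_iff.1 (hR.mem_nhds h0)
  have hd : DifferentiableOn ℂ b (Metric.ball 0 ρ) :=
    hb.differentiableOn.mono (Metric.ball_subset_closedBall.trans hρR)
  refine ⟨ρ, ⟨hρ, Eventually.of_forall fun _ => hd, hd, ?_, ?_⟩,
    Metric.ball_subset_closedBall.trans hρR⟩
  · obtain ⟨M, hM⟩ := (isCompact_closedBall (0 : ℂ) ρ).exists_bound_of_continuousOn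
      (hb.continuousOn.mono hρR)
    exact ⟨M, fun z hz => hM z (Metric.ball_subset_closedBall hz)⟩
  · rw [Metric.tendstoUniformlyOn_iff]
    intro δ hδ
    exact Eventually.of_forall fun ε z _ => by rwa [dist_self]

/-- The solution is the limit of the `q`-gauge transformations with the same coefficient `b`. They
converge near `0` and are locally bounded on the star-shaped domain, so Vitali's theorem applies;
the differential equation, known near `0`, extends by the identity theorem. -/
theorem exists_dGauge [FiniteDimensional ℂ 𝔸] {τ₀ : ℂ} (hτ₀ : 0 < τ₀.im) {R : Set ℂ}
    (hR : IsOpen R) (h0 : (0 : ℂ) ∈ R) {b : ℂ → 𝔸} (hb : AnalyticOnNhd ℂ b R)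
    (hres : SylvNonResonant (b 0)) : ∃ F, DGauge τ₀ R b F := by
  obtain ⟨ρ, hρ, hρR⟩ := exists_localConv_const hR h0 hb
  obtain ⟨s, hs, hsρ, K, f', hf', hf'0, hf'eq, hε, hlim⟩ := exists_qGauge_family hτ₀
    (R := fun _ => R) hρ (Eventually.of_forall fun _ => hρR)
    (Eventually.of_forall fun _ => hb) hres
  have hsR : Metric.ball 0 s ⊆ R := (Metric.ball_subset_ball hsρ).trans hρR
  have hch : ∀ ε : ℝ, ∃ F, (∃ F, QGauge (spiral τ₀ ε) R b F) → QGauge (spiral τ₀ ε) R b F := by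
    intro ε
    by_cases h : ∃ F, QGauge (spiral τ₀ ε) R b F
    · exact ⟨h.choose, fun _ => h.choose_spec⟩
    · exact ⟨0, fun h' => absurd h' h⟩
  choose F hF using hch
  obtain ⟨C, hC, hCε⟩ := norm_slope_eventually_le τ₀
  have hone : ∀ᶠ ε in 𝓝[>] (0 : ℝ), ε < 1 :=
    (eventually_lt_nhds one_pos).filter_mono nhdsWithin_le_nhds
  have hopen := isOpen_sStar hτ₀ hR h0
  have h0s : (0 : ℂ) ∈ sStar τ₀ R := ball_subset_sStar hτ₀ hsR (Metric.mem_ball_self hs)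
  have hbound : ∀ z ∈ sStar τ₀ R, ∃ r > 0, ∃ C : ℝ, ∀ᶠ ε in 𝓝[>] (0 : ℝ),
      DifferentiableOn ℂ (F ε) (Metric.ball z r) ∧ ∀ y ∈ Metric.ball z r, ‖F ε y‖ ≤ C := by
    intro z hz
    obtain ⟨T, hT0, hT⟩ := exists_norm_mul_spiral_lt hτ₀ (‖z‖ + 1) (half_pos hs)
    obtain ⟨M₀, hM₀⟩ := exists_bound_near_spiral hR hb.continuousOn hz (T + 1)
    obtain ⟨r₀, hr₀, hr₀'⟩ := Metric.eventually_nhds_iff_ball.1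
      (hM₀.and (hopen.mem_nhds hz))
    set M := max M₀ ‖b 0‖
    have hM0 : 0 ≤ M := (norm_nonneg _).trans (le_max_right _ _)
    -- The radius is at most `1`, so that `‖y‖ ≤ ‖z‖ + 1` and the same `T` brings every `y` into the
    -- disc; the bound of Gronwall survives because the number of steps times `ε` stays below `T +
    -- 1`.
    refine ⟨min r₀ 1, by positivity, 2 * K * Real.exp ((T + 1) * (4 * M * C)), ?_⟩
    filter_upwards [hε, hCε, hone, eventually_norm_mul_le τ₀ M, self_mem_nhdsWithin]
      with ε h1 h2 h3 h4 (h5 : 0 < ε)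
    have hFε := hF ε h1.1
    have hin : ∀ y ∈ Metric.ball z (min r₀ 1), y ∈ qStar (spiral τ₀ ε) R := fun y hy =>
      sStar_subset_qStar h5 (hr₀' y (Metric.ball_subset_ball (min_le_left _ _) hy)).2
    refine ⟨fun y hy => (hFε.analytic y (hin y hy)).differentiableAt.differentiableWithinAt, ?_⟩
    intro y hy
    obtain ⟨N, hN1, hN2⟩ := exists_steps T hT0 h5 h3
    have hy1 : ‖y‖ ≤ ‖z‖ + 1 := by
      have h6 : dist y z < 1 := lt_of_lt_of_le hy (min_le_right _ _)
      rw [dist_eq_norm] at h6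
      linarith [norm_le_norm_add_norm_sub' y z]
    have hb' : ∀ k : ℕ, 1 ≤ k → k ≤ N → ‖b (y / spiral τ₀ ε ^ k)‖ ≤ M := by
      intro k _ hk
      rw [div_spiral_pow]
      refine ((hr₀' y (Metric.ball_subset_ball (min_le_left _ _) hy)).1 _ ⟨by positivity, ?_⟩).2.trans
        (le_max_left _ _)
      refine le_trans ?_ hN2
      gcongr
    have h6 := hFε.norm_sub_le (spiral_ne_zero _ _) (hin y hy) h4 (le_max_right _ _) le_rfl hb' 0
      (fun k _ _ => by simp)
    simp only [Pi.zero_apply, sub_zero, mul_zero, add_zero] at h6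
    refine h6.trans ?_
    have h7 : ‖F ε (y / spiral τ₀ ε ^ N)‖ ≤ 2 * K := by
      refine h1.2.2 _ hFε _ ?_
      rw [div_spiral_pow]
      exact (hT _ hN1 y hy1).le
    have h8 : (N : ℝ) * (4 * M * ‖spiral τ₀ ε - 1‖) ≤ (T + 1) * (4 * M * C) := by
      calc (N : ℝ) * (4 * M * ‖spiral τ₀ ε - 1‖) ≤ N * (4 * M * (C * ε)) := by gcongr
        _ = (N * ε) * (4 * M * C) := by ring
        _ ≤ _ := by gcongr
    gcongr
    exact (norm_nonneg _).trans h7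
  have hconv : TendstoUniformlyOn F f' (𝓝[>] 0) (Metric.ball 0 (s / 2)) := by
    rw [Metric.tendstoUniformlyOn_iff]
    intro δ hδ
    filter_upwards [hlim δ hδ, hε] with ε h1 h2 z hz
    rw [dist_comm, dist_eq_norm]
    exact h1 _ (hF ε h2.1) z (mem_ball_zero_iff.1 hz).le
  obtain ⟨g, hg, hgl⟩ := exists_limit_of_locally_bounded (isPreconnected_sStar hτ₀ h0) hbound h0s
    ⟨s / 2, half_pos hs, f', hconv⟩
  have hgf : ∀ z ∈ Metric.ball (0 : ℂ) (s / 2), g z = f' z := by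
    intro z hz
    have hz' : z ∈ Metric.ball (0 : ℂ) s := Metric.ball_subset_ball (by linarith) hz
    exact tendsto_nhds_unique (hgl z (ball_subset_sStar hτ₀ hsR hz')) (hconv.tendsto_at hz)
  have hev : g =ᶠ[𝓝 0] f' := by
    filter_upwards [Metric.ball_mem_nhds (0 : ℂ) (half_pos hs)] with z hz using hgf z hz
  refine ⟨g, hg, ?_, ?_⟩
  · rw [hgf 0 (Metric.mem_ball_self (half_pos hs)), hf'0]
  · have hbs : AnalyticOnNhd ℂ b (sStar τ₀ R) := hb.mono sStar_subset
    have h1 : AnalyticOnNhd ℂ (fun z => z • deriv g z) (sStar τ₀ R) :=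
      fun z hz => analyticAt_id.smul (hg.deriv z hz)
    have h2 : AnalyticOnNhd ℂ (fun z => b z * g z - g z * b 0) (sStar τ₀ R) :=
      fun z hz => ((hbs z hz).mul (hg z hz)).sub ((hg z hz).mul analyticAt_const)
    refine h1.eqOn_of_preconnected_of_eventuallyEq h2 (isPreconnected_sStar hτ₀ h0) h0s ?_
    filter_upwards [hev.eventuallyEq_nhds, Metric.ball_mem_nhds (0 : ℂ) hs] with z hz hzs
    rw [hz.deriv_eq, hz.eq_of_nhds]
    exact hf'eq z hzs

end QDiff

end

/-! ### Uniqueness and invertibility of the differential gauge transformation -/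

noncomputable section

namespace QDiff

variable {𝔸 : Type*} [NormedRing 𝔸] [NormedAlgebra ℂ 𝔸] [CompleteSpace 𝔸]

/-- The leading coefficient `g 0` of order `k ≥ 1` satisfies `k g₀ + g₀ b₀ - b₀ g₀ = 0`. Two
coefficients `b` and `d` with the same value at `0` are allowed so that the statement covers the
difference of two gauges as well as `G F - 1` and `F G - 1` for a candidate inverse `G`. -/
theorem eventually_eq_zero_of_diff_equation {b d H : ℂ → 𝔸} (hb : ContinuousAt b 0)
    (hd : ContinuousAt d 0) (hbd : d 0 = b 0) (hres : SylvNonResonant (b 0))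
    (hH : AnalyticAt ℂ H 0) (hH0 : H 0 = 0)
    (heq : ∀ᶠ z in 𝓝 (0 : ℂ), z • deriv H z = b z * H z - H z * d z) :
    ∀ᶠ z in 𝓝 (0 : ℂ), H z = 0 := by
  by_contra hne
  obtain ⟨k, g, hg, hg0, hHg⟩ := hH.exists_eventuallyEq_pow_smul_nonzero_iff.2 hne
  simp only [sub_zero] at hHg
  have hk : 1 ≤ k := by
    rw [Nat.one_le_iff_ne_zero]
    rintro rfl
    have := hHg.self_of_nhds
    rw [hH0, pow_zero, one_smul] at this
    exact hg0 this.symm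
  have hga : ∀ᶠ z in 𝓝 (0 : ℂ), AnalyticAt ℂ g z := hg.eventually_analyticAt
  have hev : ∀ᶠ z in 𝓝[≠] (0 : ℂ), (k : ℂ) • g z + z • deriv g z = b z * g z - g z * d z := by
    have h3 : ∀ᶠ z in 𝓝 (0 : ℂ), z ≠ 0 →
        (k : ℂ) • g z + z • deriv g z = b z * g z - g z * d z := by
      filter_upwards [hHg.eventually_nhds, hga, heq] with z e1 e2 e3 hz
      have e4 : deriv H z = ((k : ℂ) * z ^ (k - 1)) • g z + z ^ k • deriv g z := by
        have h5 : H =ᶠ[𝓝 z] fun y => y ^ k • g y := e1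
        rw [h5.deriv_eq]
        have := (hasDerivAt_pow k z).smul e2.differentiableAt.hasDerivAt
        rw [add_comm]
        exact this.deriv
      rw [e4, e1.self_of_nhds, mul_smul_comm, smul_mul_assoc, ← smul_sub] at e3
      refine smul_right_injective 𝔸 (pow_ne_zero k hz) ?_
      change z ^ k • _ = z ^ k • _
      rw [← e3, smul_add, smul_add, smul_smul, smul_smul, smul_smul, smul_smul]
      congr 2
      · obtain ⟨m, rfl⟩ := Nat.exists_eq_add_of_le' hk
        rw [Nat.add_sub_cancel, pow_succ]; ring
      · ring
    exact eventually_nhdsWithin_iff.2 (h3.mono fun z hz hz' => hz hz')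
  have hl : Tendsto (fun z => (k : ℂ) • g z + z • deriv g z) (𝓝[≠] 0)
      (𝓝 ((k : ℂ) • g 0 + (0 : ℂ) • deriv g 0)) :=
    ((hg.continuousAt.tendsto.const_smul _).add
      (continuousAt_id.tendsto.smul hg.deriv.continuousAt.tendsto)).mono_left nhdsWithin_le_nhds
  have hr : Tendsto (fun z => b z * g z - g z * d z) (𝓝[≠] 0) (𝓝 (b 0 * g 0 - g 0 * d 0)) :=
    ((hb.tendsto.mul hg.continuousAt.tendsto).sub
      (hg.continuousAt.tendsto.mul hd.tendsto)).mono_left nhdsWithin_le_nhds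
  have hE := tendsto_nhds_unique (hl.congr' hev) hr
  refine hg0 (hres k hk _ ?_)
  rw [zero_smul, add_zero, hbd] at hE
  rw [sylv_apply, zero_smul, add_zero, mul_one, hE]
  abel

theorem DGauge.eqOn {τ₀ : ℂ} (hτ₀ : 0 < τ₀.im) {R : Set ℂ}
    (hR : IsOpen R) (h0 : (0 : ℂ) ∈ R) {b : ℂ → 𝔸} (hb : AnalyticOnNhd ℂ b R)
    (hres : SylvNonResonant (b 0)) {F₁ F₂ : ℂ → 𝔸} (h₁ : DGauge τ₀ R b F₁)
    (h₂ : DGauge τ₀ R b F₂) : Set.EqOn F₁ F₂ (sStar τ₀ R) := by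
  have h0s : (0 : ℂ) ∈ sStar τ₀ R := by intro t _; rwa [zero_mul]
  refine h₁.analytic.eqOn_of_preconnected_of_eventuallyEq h₂.analytic
    (isPreconnected_sStar hτ₀ h0) h0s ?_
  have := eventually_eq_zero_of_diff_equation (b := b) (d := fun _ => b 0)
    (H := fun z => F₁ z - F₂ z) (hb 0 h0).continuousAt continuousAt_const rfl hres
    ((h₁.analytic 0 h0s).sub (h₂.analytic 0 h0s)) (by simp [h₁.init, h₂.init]) ?_
  · filter_upwards [this] with z hz using sub_eq_zero.1 hz
  · filter_upwards [(isOpen_sStar hτ₀ hR h0).mem_nhds h0s] with z hz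
    rw [deriv_fun_sub (h₁.analytic z hz).differentiableAt (h₂.analytic z hz).differentiableAt,
      smul_sub, h₁.eq z hz, h₂.eq z hz, mul_sub, sub_mul]
    abel

/-- The inverse should satisfy `δG = b₀ G - G b`, which is a gauge equation in the opposite algebra
for the coefficient `-b`. Solving it by `exists_dGauge` yields `G`, and both products with `F` equal
`1` by uniqueness near `0` and the identity theorem. -/
theorem DGauge.isUnit [FiniteDimensional ℂ 𝔸] {τ₀ : ℂ} (hτ₀ : 0 < τ₀.im) {R : Set ℂ}
    (hR : IsOpen R) (h0 : (0 : ℂ) ∈ R) {b : ℂ → 𝔸} (hb : AnalyticOnNhd ℂ b R)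
    (hres : SylvNonResonant (b 0)) {F : ℂ → 𝔸} (hF : DGauge τ₀ R b F) {z : ℂ}
    (hz : z ∈ sStar τ₀ R) : IsUnit (F z) := by
  have h0s : (0 : ℂ) ∈ sStar τ₀ R := by intro t _; rwa [zero_mul]
  have hopen := isOpen_sStar hτ₀ hR h0
  have hpre := isPreconnected_sStar (τ₀ := τ₀) hτ₀ h0
  have hconn : ∀ W : ℂ → 𝔸, AnalyticOnNhd ℂ W (sStar τ₀ R) → (∀ᶠ z in 𝓝 0, W z - 1 = 0) →
      W z = 1 := by
    intro W hW hW0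
    exact hW.eqOn_of_preconnected_of_eventuallyEq (g := fun _ => 1)
      (fun _ _ => analyticAt_const) hpre h0s (hW0.mono fun z hz => sub_eq_zero.1 hz) hz
  set L : 𝔸 ≃L[ℂ] 𝔸ᵐᵒᵖ := MulOpposite.opContinuousLinearEquiv ℂ
  have hL : ∀ x, L x = MulOpposite.op x := fun x => rfl
  have hL' : ∀ x, L.symm x = MulOpposite.unop x := fun x => rfl
  have : FiniteDimensional ℂ 𝔸ᵐᵒᵖ := L.toLinearEquiv.finiteDimensional
  have hbop : AnalyticOnNhd ℂ (fun z => L (-b z)) R := fun z hz =>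
    (L.toContinuousLinearMap.analyticAt _).fun_comp (hb z hz).neg
  -- Passing to the opposite algebra reverses the products and the sign restores them: the operator
  -- for `-b 0` there is the original one.
  have hresop : SylvNonResonant (L (-b 0)) := by
    intro k hk X hX
    have h1 := congrArg MulOpposite.unop hX
    rw [sylv_apply, zero_smul, add_zero, mul_one] at h1
    have h2 : sylv (k : ℂ) 0 (b 0) X.unop = 0 := by
      rw [sylv_apply, zero_smul, add_zero, mul_one]
      simp only [MulOpposite.unop_sub, MulOpposite.unop_add, MulOpposite.unop_smul,
        MulOpposite.unop_mul, hL, MulOpposite.unop_op, MulOpposite.unop_zero] at h1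
      rw [← h1]; simp only [neg_mul, mul_neg]; abel
    exact MulOpposite.unop_injective (hres k hk _ h2)
  obtain ⟨F₁, hF₁⟩ := exists_dGauge hτ₀ hR h0 hbop hresop
  set G : ℂ → 𝔸 := fun z => L.symm (F₁ z)
  have hGa : AnalyticOnNhd ℂ G (sStar τ₀ R) := fun z hz =>
    (L.symm.toContinuousLinearMap.analyticAt _).fun_comp (hF₁.analytic z hz)
  have hG0 : G 0 = 1 := by simp only [G, hF₁.init, hL', MulOpposite.unop_one]
  have hGd : ∀ z ∈ sStar τ₀ R, z • deriv G z = b 0 * G z - G z * b z := by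
    intro z hz
    have h1 : HasDerivAt G (L.symm (deriv F₁ z)) z :=
      L.symm.toContinuousLinearMap.hasFDerivAt.comp_hasDerivAt z
        (hF₁.analytic z hz).differentiableAt.hasDerivAt
    rw [h1.deriv, ← map_smul, hF₁.eq z hz]
    simp only [G, hL, hL', MulOpposite.unop_sub, MulOpposite.unop_mul, MulOpposite.unop_op]
    simp only [neg_mul, mul_neg]; abel
  have hsmul : ∀ (y : ℂ) (x : 𝔸) (w : 𝔸), y • (x * w) = (y • x) * w := fun y x w =>
    (smul_mul_assoc _ _ _).symm
  have hleft : G z * F z = 1 := by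
    refine hconn (fun z => G z * F z) (fun z hz => (hGa z hz).mul (hF.analytic z hz)) ?_
    refine eventually_eq_zero_of_diff_equation (b := fun _ => b 0) (d := fun _ => b 0)
      (H := fun z => G z * F z - 1) continuousAt_const continuousAt_const rfl hres
      (((hGa 0 h0s).mul (hF.analytic 0 h0s)).sub analyticAt_const)
      (by simp [hG0, hF.init]) ?_
    filter_upwards [hopen.mem_nhds h0s] with z hz
    have h1 := ((hGa z hz).differentiableAt.hasDerivAt.mul
      (hF.analytic z hz).differentiableAt.hasDerivAt).sub_const (1 : 𝔸)
    have h2 : deriv (fun z => G z * F z - 1) z = deriv G z * F z + G z * deriv F z := h1.deriv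
    rw [h2, smul_add, ← smul_mul_assoc, ← mul_smul_comm, hGd z hz, hF.eq z hz]
    simp only [sub_mul, mul_sub, mul_assoc, mul_one, one_mul]
    abel
  have hright : F z * G z = 1 := by
    refine hconn (fun z => F z * G z) (fun z hz => (hF.analytic z hz).mul (hGa z hz)) ?_
    refine eventually_eq_zero_of_diff_equation (b := b) (d := b)
      (H := fun z => F z * G z - 1) (hb 0 h0).continuousAt (hb 0 h0).continuousAt rfl hres
      (((hF.analytic 0 h0s).mul (hGa 0 h0s)).sub analyticAt_const)
      (by simp [hG0, hF.init]) ?_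
    filter_upwards [hopen.mem_nhds h0s] with z hz
    have h1 := ((hF.analytic z hz).differentiableAt.hasDerivAt.mul
      (hGa z hz).differentiableAt.hasDerivAt).sub_const (1 : 𝔸)
    have h2 : deriv (fun z => F z * G z - 1) z = deriv F z * G z + F z * deriv G z := h1.deriv
    rw [h2, smul_add, ← smul_mul_assoc, ← mul_smul_comm, hGd z hz, hF.eq z hz]
    simp only [sub_mul, mul_sub, mul_assoc, mul_one, one_mul]
    abel
  exact ⟨⟨F z, G z, hright, hleft⟩, rfl⟩

/-! ### Confluence of the gauge transformations -/

/-- Uniform first-order Taylor estimate on a compact interval. -/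
theorem exists_taylor_one_uniform {E : Type*} [NormedAddCommGroup E] [NormedSpace ℝ E]
    {g g' : ℝ → E} {a c : ℝ} (hg : ∀ t ∈ Set.Icc a c, HasDerivAt g (g' t) t)
    (hg' : ContinuousOn g' (Set.Icc a c)) {δ : ℝ} (hδ : 0 < δ) :
    ∃ h₀ > 0, ∀ h ∈ Set.Ioo 0 h₀, ∀ t ∈ Set.Icc a c, t + h ∈ Set.Icc a c →
      ‖g (t + h) - g t - h • g' t‖ ≤ δ * h := by
  obtain ⟨h₀, hh₀, hu⟩ := Metric.uniformContinuousOn_iff.1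
    (isCompact_Icc.uniformContinuousOn_of_continuous hg') δ hδ
  refine ⟨h₀, hh₀, fun h hh t ht hth => ?_⟩
  have hsub : Set.Icc t (t + h) ⊆ Set.Icc a c := Set.Icc_subset_Icc ht.1 hth.2
  have key := Convex.norm_image_sub_le_of_norm_hasDerivWithin_le
    (f := fun u => g u - u • g' t) (f' := fun u => g' u - g' t) (C := δ)
    (s := Set.Icc t (t + h)) (x := t) (y := t + h) ?_ ?_ (convex_Icc _ _)
    (Set.left_mem_Icc.2 (by linarith [hh.1])) (Set.right_mem_Icc.2 (by linarith [hh.1]))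
  · rw [add_sub_cancel_left, Real.norm_of_nonneg hh.1.le] at key
    convert key using 2
    rw [add_smul]; abel
  · intro u hu'
    have h1 : HasDerivAt (fun u : ℝ => u • g' t) ((1 : ℝ) • g' t) u :=
      (hasDerivAt_id u).smul_const (g' t)
    rw [one_smul] at h1
    exact ((hg u (hsub hu')).sub h1).hasDerivWithinAt
  · intro u hu'
    have := hu u (hsub hu') t ht (by
      rw [Real.dist_eq, abs_lt]
      constructor <;> linarith [hu'.1, hu'.2, hh.1, hh.2])
    rw [dist_eq_norm] at this
    exact this.le

/-- Convergence of Euler's method along the arc from the disc near `0` to `z`. The restriction of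
`F'` to the arc is an approximate solution of the `q`-equation with defect `o(ε)` per step,
uniformly, for `O(1/ε)` steps. -/
theorem tendsto_qGauge [FiniteDimensional ℂ 𝔸] {τ₀ : ℂ} (hτ₀ : 0 < τ₀.im)
    {R : ℝ → Set ℂ} {R' : Set ℂ} {b : ℝ → ℂ → 𝔸} {b' : ℂ → 𝔸} {ρ : ℝ} (h : LocalConv b b' ρ)
    (hR : ∀ᶠ ε in 𝓝[>] (0 : ℝ), Metric.ball 0 ρ ⊆ R ε)
    (hb : ∀ᶠ ε in 𝓝[>] (0 : ℝ), AnalyticOnNhd ℂ (b ε) (R ε)) (hres : SylvNonResonant (b' 0))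
    (hR' : IsOpen R') (hb' : AnalyticOnNhd ℂ b' R')
    {F : ℝ → ℂ → 𝔸} (hF : ∀ᶠ ε in 𝓝[>] (0 : ℝ), QGauge (spiral τ₀ ε) (R ε) (b ε) (F ε))
    {F' : ℂ → 𝔸} (hF' : DGauge τ₀ R' b' F') {z : ℂ} (hz : z ∈ sStar τ₀ R')
    (hreg : ∀ T : ℝ, 0 ≤ T → ∀ᶠ ε in 𝓝[>] (0 : ℝ), ∀ t ∈ Set.Icc 0 T, z * spiral τ₀ (-t) ∈ R ε)
    (hconv : ∀ T : ℝ, 0 ≤ T → TendstoUniformlyOn (fun ε (t : ℝ) => b ε (z * spiral τ₀ (-t)))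
      (fun t : ℝ => b' (z * spiral τ₀ (-t))) (𝓝[>] 0) (Set.Icc 0 T))
    (h0R' : (0 : ℂ) ∈ R') :
    (∀ᶠ ε in 𝓝[>] (0 : ℝ), z ∈ qStar (spiral τ₀ ε) (R ε)) ∧
      Tendsto (fun ε => F ε z) (𝓝[>] 0) (𝓝 (F' z)) := by
  obtain ⟨s, hs, hsρ, K, f', hf', hf'0, hf'eq, -, hlim⟩ := exists_qGauge_family hτ₀ h hR hb hres
  have h0s : (0 : ℂ) ∈ sStar τ₀ R' := by intro t _; rwa [zero_mul]
  have hopen := isOpen_sStar hτ₀ hR' h0R'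
  -- the local solution is the restriction of `F'`
  obtain ⟨s₁, hs₁, hs₁s, hs₁F⟩ : ∃ s₁ > 0, s₁ ≤ s / 2 ∧ ∀ y : ℂ, ‖y‖ < s₁ → F' y = f' y := by
    have hball := Metric.ball_mem_nhds (0 : ℂ) hs
    have := eventually_eq_zero_of_diff_equation (b := b') (d := fun _ => b' 0)
      (H := fun z => F' z - f' z) (hb' 0 h0R').continuousAt continuousAt_const rfl hres
      ((hF'.analytic 0 h0s).sub (hf'.analyticAt hball)) (by simp [hF'.init, hf'0]) (by
        filter_upwards [hopen.mem_nhds h0s, hball] with y hy hys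
        rw [deriv_fun_sub (hF'.analytic y hy).differentiableAt
          ((hf'.analyticAt (Metric.isOpen_ball.mem_nhds hys)).differentiableAt),
          smul_sub, hF'.eq y hy, hf'eq y hys, mul_sub, sub_mul]
        abel)
    obtain ⟨r, hr, hr'⟩ := Metric.eventually_nhds_iff_ball.1 this
    exact ⟨min r (s / 2), by positivity, min_le_right _ _, fun y hy => sub_eq_zero.1
      (hr' y (mem_ball_zero_iff.2 (hy.trans_le (min_le_left _ _))))⟩
  obtain ⟨T, hT0, hT⟩ := exists_norm_mul_spiral_lt hτ₀ ‖z‖ hs₁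
  have hT1 : 0 ≤ T + 1 := by linarith
  have hone : ∀ᶠ ε in 𝓝[>] (0 : ℝ), ε < 1 :=
    (eventually_lt_nhds one_pos).filter_mono nhdsWithin_le_nhds
  have hmem : ∀ᶠ ε in 𝓝[>] (0 : ℝ), z ∈ qStar (spiral τ₀ ε) (R ε) := by
    filter_upwards [hreg T hT0, hR, self_mem_nhdsWithin] with ε h1 h2 (h3 : 0 < ε) k _
    rw [div_spiral_pow]
    rcases le_total ((k : ℝ) * ε) T with h4 | h4
    · exact h1 _ ⟨by positivity, h4⟩
    · exact h2 (mem_ball_zero_iff.2 ((hT _ h4 z le_rfl).trans_le (by linarith)))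
  refine ⟨hmem, ?_⟩
  set γ : ℂ := -(2 * Real.pi * Complex.I * τ₀)
  set y : ℝ → ℂ := fun t => z * spiral τ₀ t
  have hyc : Continuous y := continuous_const.mul (continuous_spiral τ₀)
  have hyR : ∀ t : ℝ, t ≤ 0 → y t ∈ sStar τ₀ R' := fun t ht => mul_spiral_mem_sStar hz ht
  set V : ℝ → 𝔸 := fun t => b' (y t) * F' (y t) - F' (y t) * b' 0
  have hgd : ∀ t ∈ Set.Icc (-(T + 1)) 0, HasDerivAt (fun t => F' (y t)) (γ • V t) t := by
    intro t ht
    have h1 := (hF'.analytic _ (hyR t ht.2)).differentiableAt.hasDerivAt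
    have h2 : HasDerivAt y (z * (γ * spiral τ₀ t)) t := (hasDerivAt_spiral τ₀ t).const_mul z
    have h3 := h1.scomp t h2
    refine h3.congr_deriv ?_
    change _ = γ • (b' (y t) * F' (y t) - F' (y t) * b' 0)
    rw [← hF'.eq _ (hyR t ht.2), smul_smul]
    congr 1
    simp only [y]; ring
  have hFc : ContinuousOn (fun t => F' (y t)) (Set.Icc (-(T + 1)) 0) := fun t ht =>
    ((hF'.analytic _ (hyR t ht.2)).continuousAt.comp hyc.continuousAt).continuousWithinAt
  have hbc : ContinuousOn (fun t => b' (y t)) (Set.Icc (-(T + 1)) 0) := fun t ht =>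
    ((hb' _ (sStar_subset (hyR t ht.2))).continuousAt.comp hyc.continuousAt).continuousWithinAt
  have hVc : ContinuousOn V (Set.Icc (-(T + 1)) 0) :=
    (hbc.mul hFc).sub (hFc.mul continuousOn_const)
  obtain ⟨B₁, hB₁⟩ := isCompact_Icc.exists_bound_of_continuousOn hFc
  obtain ⟨B₂, hB₂⟩ := isCompact_Icc.exists_bound_of_continuousOn hVc
  obtain ⟨B₃, hB₃⟩ := isCompact_Icc.exists_bound_of_continuousOn hbc
  have h0mem : (0 : ℝ) ∈ Set.Icc (-(T + 1)) 0 := ⟨by linarith, le_rfl⟩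
  have hB₁0 : 0 ≤ B₁ := (norm_nonneg _).trans (hB₁ 0 h0mem)
  have hB₂0 : 0 ≤ B₂ := (norm_nonneg _).trans (hB₂ 0 h0mem)
  set M := max (B₃ + 1) (‖b' 0‖ + 1)
  have hM0 : 0 ≤ M := le_trans (by positivity) (le_max_right _ _)
  obtain ⟨C, hC, hCε⟩ := norm_slope_eventually_le τ₀
  have hb0 : Tendsto (fun ε => b ε 0) (𝓝[>] 0) (𝓝 (b' 0)) :=
    h.unif.tendsto_at (Metric.mem_ball_self h.pos)
  have key : ∀ δ > 0, ∀ᶠ ε in 𝓝[>] (0 : ℝ), ‖F ε z - F' z‖ ≤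
      (δ + (T + 1) * (2 * δ)) * Real.exp ((T + 1) * (4 * M * C)) := by
    intro δ hδ
    -- The tolerance for `b ε - b'` on the arc and at `0`: at most `1`, so that `b ε` stays below
    -- `M`, and small enough for its contribution to one step to be at most `δ / 4 * ε`.
    set θ := min 1 (δ / 4 / (C * (2 * B₁) + 1))
    have hθ : 0 < θ := by positivity
    have hθ1 : θ ≤ 1 := min_le_left _ _
    have hθδ : C * (2 * (θ * B₁)) ≤ δ / 4 := by
      have h1 : θ * (C * (2 * B₁) + 1) ≤ δ / 4 := by
        rw [← le_div_iff₀ (by positivity)]; exact min_le_right _ _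
      linarith
    obtain ⟨h₀, hh₀, htay⟩ := exists_taylor_one_uniform hgd
      (hVc.const_smul γ) (show 0 < δ / 4 by positivity)
    have hsl : ∀ᶠ ε in 𝓝[>] (0 : ℝ), ‖(spiral τ₀ ε - 1) / ε - γ‖ * B₂ ≤ δ / 4 := by
      have h1 := ((tendsto_spiral_slope τ₀).sub_const γ).norm.mul_const B₂
      rw [sub_self, norm_zero, zero_mul] at h1
      exact ((tendsto_order.1 h1).2 _ (by positivity)).mono fun _ h => h.le
    have hlast : ∀ᶠ ε in 𝓝[>] (0 : ℝ), ‖spiral τ₀ ε - 1‖ * ((‖γ‖ * B₂ + δ / 4) * M) ≤ δ / 4 := by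
      have h1 := (tendsto_spiral_sub_one τ₀).norm.mul_const ((‖γ‖ * B₂ + δ / 4) * M)
      rw [norm_zero, zero_mul] at h1
      exact ((tendsto_order.1 h1).2 _ (by positivity)).mono fun _ h => h.le
    have hεh : ∀ᶠ ε in 𝓝[>] (0 : ℝ), ε < h₀ :=
      (eventually_lt_nhds hh₀).filter_mono nhdsWithin_le_nhds
    filter_upwards [hF, hmem, hlim δ hδ, hCε, hone, eventually_norm_mul_le τ₀ M, hsl, hlast, hεh,
      Metric.tendstoUniformlyOn_iff.1 (hconv (T + 1) hT1) θ hθ,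
      Metric.tendsto_nhds.1 hb0 θ hθ, self_mem_nhdsWithin]
      with ε hFε hzq hlimε hCε hε1 hηM hsl hlast hεh hbt hb0θ (hε : 0 < ε)
    obtain ⟨N, hN1, hN2⟩ := exists_steps T hT0 hε hε1
    have hyk : ∀ k : ℕ, z / spiral τ₀ ε ^ k = y (-(k * ε)) := fun k => div_spiral_pow z ε k
    have hkI : ∀ k : ℕ, k ≤ N → (k : ℝ) * ε ∈ Set.Icc 0 (T + 1) := fun k hk =>
      ⟨by positivity, le_trans (by gcongr) hN2⟩
    have hkI' : ∀ k : ℕ, k ≤ N → -((k : ℝ) * ε) ∈ Set.Icc (-(T + 1)) 0 := fun k hk => by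
      have := hkI k hk
      exact ⟨by linarith [this.2], by linarith [this.1]⟩
    have hbθ : ∀ k : ℕ, k ≤ N → ‖b ε (y (-(k * ε))) - b' (y (-(k * ε)))‖ ≤ θ := fun k hk => by
      have := hbt _ (hkI k hk)
      rw [dist_comm, dist_eq_norm] at this
      exact this.le
    rw [dist_eq_norm] at hb0θ
    have hb0M : ‖b ε 0‖ ≤ M := by
      have := norm_le_norm_add_norm_sub' (b ε 0) (b' 0)
      linarith [le_max_right (B₃ + 1) (‖b' 0‖ + 1)]
    have hbM : ∀ k : ℕ, 1 ≤ k → k ≤ N → ‖b ε (z / spiral τ₀ ε ^ k)‖ ≤ M := by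
      intro k _ hk
      rw [hyk]
      have h1 := norm_le_norm_add_norm_sub' (b ε (y (-(k * ε)))) (b' (y (-(k * ε))))
      have h2 := hbθ k hk
      have h3 := hB₃ _ (hkI' k hk)
      linarith [le_max_left (B₃ + 1) (‖b' 0‖ + 1)]
    have hfin := hFε.norm_sub_le (spiral_ne_zero _ _) hzq (N := N) hηM hb0M
      (show 0 ≤ δ * ε by positivity) hbM F' ?_
    · refine hfin.trans ?_
      have h1 : ‖F ε (z / spiral τ₀ ε ^ N) - F' (z / spiral τ₀ ε ^ N)‖ ≤ δ := by
        have h2 : ‖z / spiral τ₀ ε ^ N‖ < s₁ := by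
          rw [div_spiral_pow]; exact hT _ hN1 z le_rfl
        rw [hs₁F _ h2]
        exact (hlimε _ hFε _ (by linarith)).le
      have h2 : (N : ℝ) * (2 * (δ * ε)) ≤ (T + 1) * (2 * δ) := by
        calc (N : ℝ) * (2 * (δ * ε)) = (N * ε) * (2 * δ) := by ring
          _ ≤ _ := by gcongr
      have h3 : (N : ℝ) * (4 * M * ‖spiral τ₀ ε - 1‖) ≤ (T + 1) * (4 * M * C) := by
        calc (N : ℝ) * (4 * M * ‖spiral τ₀ ε - 1‖) ≤ N * (4 * M * (C * ε)) := by gcongr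
          _ = (N * ε) * (4 * M * C) := by ring
          _ ≤ _ := by gcongr
      gcongr
    · intro k hk1 hkN
      obtain ⟨j, rfl⟩ := Nat.exists_eq_add_of_le' hk1
      have hy2 : spiral τ₀ ε * (z / spiral τ₀ ε ^ (j + 1)) = y (-((j + 1 : ℕ) * ε) + ε) := by
        rw [hyk]
        simp only [y]
        rw [spiral_add]; ring
      rw [hy2, hyk]
      set t : ℝ := -((j + 1 : ℕ) * ε)
      have ht : t ∈ Set.Icc (-(T + 1)) 0 := hkI' _ hkN
      have htε : t + ε ∈ Set.Icc (-(T + 1)) 0 := by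
        have : t + ε = -((j : ℕ) * ε) := by simp only [t]; push_cast; ring
        rw [this]; exact hkI' _ (by omega)
      set η := spiral τ₀ ε - 1
      set ΔG := F' (y (t + ε)) - F' (y t)
      have e1 : ‖ΔG - ε • (γ • V t)‖ ≤ δ / 4 * ε := htay ε ⟨hε, hεh⟩ t ht htε
      have hV := hB₂ t ht
      have hG := hB₁ t ht
      have hΔ : ‖ΔG‖ ≤ ε * (‖γ‖ * B₂ + δ / 4) := by
        have e2 : ΔG = (ΔG - ε • (γ • V t)) + ε • (γ • V t) := by abel
        rw [e2]
        refine (norm_add_le _ _).trans ?_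
        have e3 : ‖ε • (γ • V t)‖ ≤ ε * (‖γ‖ * B₂) := by
          rw [norm_smul, norm_smul, Real.norm_of_nonneg hε.le]
          gcongr
        linarith
      -- The defect splits into four terms, each made at most `δ / 4 * ε`: the error on the
      -- coefficients, the error `η - ε γ` on the step, the Taylor remainder of `F'` along the arc,
      -- and a second-order term.
      have hdec : η • (b ε (y t) * F' (y t) - F' (y t) * b ε 0) - ΔG * (1 + η • b ε 0) =
          η • ((b ε (y t) - b' (y t)) * F' (y t) - F' (y t) * (b ε 0 - b' 0)) +
          (η - ε * γ) • V t - (ΔG - ε • (γ • V t)) - η • (ΔG * b ε 0) := by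
        have e5 : (ε : ℝ) • (γ • V t) = ((ε : ℂ) * γ) • V t := by
          rw [mul_smul]; rfl
        rw [e5]
        simp only [V, sub_mul, mul_sub, mul_add, mul_one, smul_sub, sub_smul, mul_smul_comm]
        abel
      rw [hdec]
      have n1 : ‖η • ((b ε (y t) - b' (y t)) * F' (y t) - F' (y t) * (b ε 0 - b' 0))‖ ≤
          δ / 4 * ε := by
        rw [norm_smul]
        have e6 : ‖(b ε (y t) - b' (y t)) * F' (y t) - F' (y t) * (b ε 0 - b' 0)‖ ≤
            2 * (θ * B₁) := by
          calc _ ≤ ‖b ε (y t) - b' (y t)‖ * ‖F' (y t)‖ + ‖F' (y t)‖ * ‖b ε 0 - b' 0‖ :=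
                (norm_sub_le _ _).trans (add_le_add (norm_mul_le _ _) (norm_mul_le _ _))
            _ ≤ θ * B₁ + B₁ * θ := by
                gcongr
                exact hbθ _ hkN
            _ = _ := by ring
        calc _ ≤ (C * ε) * (2 * (θ * B₁)) := by gcongr
          _ = C * (2 * (θ * B₁)) * ε := by ring
          _ ≤ _ := by gcongr
      have n2 : ‖(η - ε * γ) • V t‖ ≤ δ / 4 * ε := by
        have e7 : η - ε * γ = ε * (η / ε - γ) := by
          have : (ε : ℂ) ≠ 0 := by exact_mod_cast hε.ne'
          field_simp
        rw [norm_smul, e7, norm_mul, Complex.norm_real, Real.norm_of_nonneg hε.le]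
        calc ε * ‖η / ε - γ‖ * ‖V t‖ ≤ ε * ‖η / ε - γ‖ * B₂ := by gcongr
          _ = ‖η / ε - γ‖ * B₂ * ε := by ring
          _ ≤ _ := by gcongr
      have n3 : ‖η • (ΔG * b ε 0)‖ ≤ δ / 4 * ε := by
        rw [norm_smul]
        calc ‖η‖ * ‖ΔG * b ε 0‖ ≤ ‖η‖ * ((ε * (‖γ‖ * B₂ + δ / 4)) * M) := by
              gcongr
              refine (norm_mul_le _ _).trans ?_
              gcongr
          _ = ‖η‖ * ((‖γ‖ * B₂ + δ / 4) * M) * ε := by ring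
          _ ≤ _ := by gcongr
      refine (norm_sub_le _ _).trans ((add_le_add ((norm_sub_le _ _).trans (add_le_add
        ((norm_add_le _ _).trans (add_le_add n1 n2)) e1)) n3).trans (le_of_eq ?_))
      ring
  rw [Metric.tendsto_nhds]
  intro κ hκ
  set A := (1 + (T + 1) * 2) * Real.exp ((T + 1) * (4 * M * C))
  have hA : 0 < A := by positivity
  filter_upwards [key (κ / (2 * A)) (by positivity)] with ε hε
  rw [dist_eq_norm]
  refine hε.trans_lt ?_
  have e : (κ / (2 * A) + (T + 1) * (2 * (κ / (2 * A)))) * Real.exp ((T + 1) * (4 * M * C)) =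
      κ / (2 * A) * A := by simp only [A]; ring
  rw [e]
  have : κ / (2 * A) * A = κ / 2 := by field_simp
  rw [this]; linarith

end QDiff

end

noncomputable section

namespace QDiff

open Complex (I)
open scoped Real

theorem two_pi_I_ne_zero : 2 * (π : ℂ) * I ≠ 0 := Complex.two_pi_I_ne_zero

/-! ### The logarithm on the complement of a spiral -/

section LogNeg

variable {τ₀ : ℂ}

theorem norm_mul_spiral_spiralParam (hτ₀ : 0 < τ₀.im) {z : ℂ} (hz : z ≠ 0) :
    ‖z * spiral τ₀ (spiralParam τ₀ z)‖ = 1 := by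
  have h : 0 < ‖z‖ := norm_pos_iff.2 hz
  rw [norm_mul, norm_spiral, spiralParam, mul_div_cancel₀ _ (by positivity), Real.exp_neg,
    Real.exp_log h, mul_inv_cancel₀ h.ne']

/-- The point lies on the unit circle, where the only point outside the slit plane is `-1`; reaching
it means that `z` is on the spiral. -/
theorem neg_mul_spiral_mem_slitPlane (hτ₀ : 0 < τ₀.im) {z : ℂ} (hz : z ≠ 0)
    (hs : ∀ t : ℝ, z ≠ spiral τ₀ t) :
    -(z * spiral τ₀ (spiralParam τ₀ z)) ∈ Complex.slitPlane := by
  have hn : ‖-(z * spiral τ₀ (spiralParam τ₀ z))‖ = 1 := by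
    rw [norm_neg, norm_mul_spiral_spiralParam hτ₀ hz]
  rw [Complex.mem_slitPlane_iff_arg]
  refine ⟨fun h => ?_, by rw [← norm_ne_zero_iff, hn]; exact one_ne_zero⟩
  have h1 := Complex.norm_mul_exp_arg_mul_I (-(z * spiral τ₀ (spiralParam τ₀ z)))
  rw [hn, h, Complex.exp_pi_mul_I, Complex.ofReal_one, one_mul, neg_inj] at h1
  refine hs (-(spiralParam τ₀ z)) ?_
  rw [spiral_neg]
  exact eq_inv_of_mul_eq_one_left h1.symm

/-- The strict bound on `a` is the bound `|arg| < π` on the slit plane. It is precisely what the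
limit of the theta functions requires. -/
theorem exists_logNeg_eq (hτ₀ : 0 < τ₀.im) {z : ℂ} (hz : z ≠ 0)
    (hs : ∀ t : ℝ, z ≠ spiral τ₀ t) :
    ∃ a s : ℝ, |a| < 1 / 2 ∧ logNeg τ₀ z = 2 * π * I * (a + s * τ₀) := by
  set u := -(z * spiral τ₀ (spiralParam τ₀ z))
  have hu := neg_mul_spiral_mem_slitPlane hτ₀ hz hs
  have hn : ‖u‖ = 1 := by
    rw [norm_neg, norm_mul_spiral_spiralParam hτ₀ hz]
  have hlog : Complex.log u = u.arg * I := by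
    rw [Complex.log, hn, Real.log_one, Complex.ofReal_zero, zero_add]
  have harg := (Complex.mem_slitPlane_iff_arg.1 hu).1
  refine ⟨u.arg / (2 * π), spiralParam τ₀ z, ?_, ?_⟩
  · rw [abs_div, abs_of_pos (show 0 < 2 * π by positivity), div_lt_iff₀ (by positivity)]
    have h1 := Complex.abs_arg_le_pi u
    have h2 : |u.arg| ≠ π := by
      intro h
      rcases (abs_eq Real.pi_pos.le).1 h with h | h
      · exact harg h
      · linarith [Complex.neg_pi_lt_arg u]
    linarith [lt_of_le_of_ne h1 h2]
  · rw [logNeg, hlog]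
    have : (π : ℂ) ≠ 0 := by exact_mod_cast Real.pi_ne_zero
    push_cast
    field_simp
    ring

/-- A continuous local inverse of `x ↦ -exp x` is differentiable, although the definition goes
through the non-holomorphic function `spiralParam`. -/
theorem hasDerivAt_logNeg (hτ₀ : 0 < τ₀.im) {z : ℂ} (hz : z ≠ 0)
    (hs : ∀ t : ℝ, z ≠ spiral τ₀ t) : HasDerivAt (logNeg τ₀) z⁻¹ z := by
  have hpar : ContinuousAt (spiralParam τ₀) z := by
    have : ContinuousAt (fun z : ℂ => -Real.log ‖z‖ / (2 * π * τ₀.im)) z := by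
      have h1 : ContinuousAt (fun z : ℂ => Real.log ‖z‖) z :=
        continuous_norm.continuousAt.log (norm_ne_zero_iff.2 hz)
      exact h1.neg.div_const _
    exact this
  have hcont : ContinuousAt (logNeg τ₀) z := by
    have h1 : ContinuousAt (fun z : ℂ => ((spiralParam τ₀ z : ℝ) : ℂ)) z :=
      Complex.continuous_ofReal.continuousAt.comp hpar
    have h2 : ContinuousAt (fun z => -(z * spiral τ₀ (spiralParam τ₀ z))) z :=
      (continuousAt_id.mul ((continuous_spiral τ₀).continuousAt.comp hpar)).neg
    exact (continuousAt_const.mul h1).add (h2.clog (neg_mul_spiral_mem_slitPlane hτ₀ hz hs))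
  have h1 : HasDerivAt (fun x => -Complex.exp x) (-Complex.exp (logNeg τ₀ z)) (logNeg τ₀ z) :=
    (Complex.hasDerivAt_exp _).neg
  rw [exp_logNeg τ₀ hz, neg_neg] at h1
  refine h1.of_local_left_inverse hcont hz ?_
  filter_upwards [isOpen_ne.mem_nhds hz] with y hy
  rw [exp_logNeg τ₀ hy, neg_neg]

end LogNeg

/-! ### The theta function -/

section Theta

variable {τ₀ : ℂ}

/-- The sign in `-exp` absorbs `(-1) ^ m`. The quadratic part of the exponent of `q` gives the
modulus `ε τ₀`, and its linear part the shift by `ε τ₀ / 2`. -/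
theorem theta_neg_exp (τ₀ : ℂ) (ε : ℝ) (y : ℂ) :
    theta (spiral τ₀ ε) (-Complex.exp (2 * π * I * y)) =
      jacobiTheta₂ (y - ε * τ₀ / 2) (ε * τ₀) := by
  rw [theta, jacobiTheta₂]
  refine tsum_congr fun m => ?_
  have h1 : (-1 : ℂ) ^ m * (-Complex.exp (2 * π * I * y)) ^ m = Complex.exp (2 * π * I * y) ^ m := by
    rw [← mul_zpow, neg_one_mul, neg_neg]
  rw [mul_right_comm, h1, spiral, jacobiTheta₂_term, ← Complex.exp_int_mul, ← Complex.exp_int_mul,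
    ← Complex.exp_add]
  congr 1
  obtain ⟨k, hk⟩ : (2 : ℤ) ∣ m * m - m := by
    have := (Int.even_mul_pred_self m).two_dvd
    rwa [mul_sub, mul_one] at this
  rw [hk, Int.mul_ediv_cancel_left k two_ne_zero]
  have hk' : (m : ℂ) * m - m = 2 * k := by exact_mod_cast hk
  push_cast
  linear_combination (-(π * I * τ₀ * ε)) * hk'

theorem exists_neg_exp_eq {z : ℂ} (hz : z ≠ 0) : ∃ y : ℂ, -Complex.exp (2 * π * I * y) = z := by
  refine ⟨Complex.log (-z) / (2 * π * I), ?_⟩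
  rw [mul_div_cancel₀ _ two_pi_I_ne_zero, Complex.exp_log (neg_ne_zero.2 hz), neg_neg]

variable {ε : ℝ}

theorem im_ofReal_mul_pos (hτ₀ : 0 < τ₀.im) (hε : 0 < ε) : 0 < (ε * τ₀ : ℂ).im := by
  rw [Complex.im_ofReal_mul]; positivity

/-- The lift `z ↦ y` is taken with the logarithm of `z / z₀`, which is evaluated near `1`; no point
of `ℂ*` meets a branch cut. -/
theorem hasDerivAt_theta (hτ₀ : 0 < τ₀.im) (hε : 0 < ε) (y : ℂ) :
    HasDerivAt (theta (spiral τ₀ ε)) (jacobiTheta₂' (y - ε * τ₀ / 2) (ε * τ₀) *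
      (2 * π * I * -Complex.exp (2 * π * I * y))⁻¹) (-Complex.exp (2 * π * I * y)) := by
  set z₀ := -Complex.exp (2 * π * I * y)
  have hz₀ : z₀ ≠ 0 := neg_ne_zero.2 (Complex.exp_ne_zero _)
  set w : ℂ → ℂ := fun z => y + Complex.log (z / z₀) / (2 * π * I) with hw
  have hw0 : w z₀ = y := by simp [hw, div_self hz₀]
  have hwd : HasDerivAt w ((2 * π * I * z₀)⁻¹) z₀ := by
    have h1 : HasDerivAt (fun z : ℂ => z / z₀) (1 / z₀) z₀ := (hasDerivAt_id z₀).div_const z₀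
    have h2 := (h1.clog (by rw [div_self hz₀]; exact Complex.one_mem_slitPlane)).div_const (2 * π * I)
    have h3 := h2.const_add y
    refine h3.congr_deriv ?_
    rw [div_self hz₀]
    field_simp
  have hJ := hasDerivAt_jacobiTheta₂_fst (y - ε * τ₀ / 2) (im_ofReal_mul_pos hτ₀ hε)
  have hcomp : HasDerivAt (fun z => jacobiTheta₂ (w z - ε * τ₀ / 2) (ε * τ₀))
      (jacobiTheta₂' (y - ε * τ₀ / 2) (ε * τ₀) * (2 * π * I * z₀)⁻¹) z₀ := by
    have h4 : HasDerivAt (fun z => w z - ε * τ₀ / 2) ((2 * π * I * z₀)⁻¹) z₀ := hwd.sub_const _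
    exact HasDerivAt.comp z₀ (h₂ := fun v => jacobiTheta₂ v (ε * τ₀)) (by rw [hw0]; exact hJ) h4
  refine hcomp.congr_of_eventuallyEq ?_
  filter_upwards [isOpen_ne.mem_nhds hz₀] with z hz
  rw [← theta_neg_exp]
  congr 1
  have hzz : z / z₀ ≠ 0 := div_ne_zero hz hz₀
  rw [hw]
  simp only
  rw [mul_add, Complex.exp_add, mul_div_cancel₀ _ two_pi_I_ne_zero, Complex.exp_log hzz]
  change z = -(Complex.exp (2 * π * I * y) * (z / z₀))
  rw [← neg_mul]
  exact (mul_div_cancel₀ z hz₀).symm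

theorem analyticOnNhd_theta (hτ₀ : 0 < τ₀.im) (hε : 0 < ε) :
    AnalyticOnNhd ℂ (theta (spiral τ₀ ε)) {0}ᶜ := by
  refine DifferentiableOn.analyticOnNhd (fun z hz => ?_) isOpen_compl_singleton
  obtain ⟨y, rfl⟩ := exists_neg_exp_eq hz
  exact (hasDerivAt_theta hτ₀ hε y).differentiableAt.differentiableWithinAt

/-- Quasi-periodicity of the Jacobi theta function: multiplying `z` by `q` translates `y` by `-ε
τ₀`. -/
theorem theta_mul (τ₀ : ℂ) (ε : ℝ) {z : ℂ} (hz : z ≠ 0) :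
    theta (spiral τ₀ ε) (spiral τ₀ ε * z) = -(spiral τ₀ ε * z) * theta (spiral τ₀ ε) z := by
  obtain ⟨y, rfl⟩ := exists_neg_exp_eq hz
  have h1 : spiral τ₀ ε * -Complex.exp (2 * π * I * y) =
      -Complex.exp (2 * π * I * (y - ε * τ₀)) := by
    rw [spiral, mul_neg, ← Complex.exp_add]; congr 2; ring
  rw [h1, theta_neg_exp, theta_neg_exp]
  have h2 := jacobiTheta₂_add_left' (y - ε * τ₀ - ε * τ₀ / 2) (ε * τ₀)
  have h3 : y - ε * τ₀ - ε * τ₀ / 2 + ε * τ₀ = y - ε * τ₀ / 2 := by ring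
  rw [h3] at h2
  rw [h2, neg_neg, ← mul_assoc, ← Complex.exp_add]
  have h4 : 2 * π * I * (y - ε * τ₀) + -π * I * (ε * τ₀ + 2 * (y - ε * τ₀ - ε * τ₀ / 2)) = 0 := by
    ring
  rw [h4, Complex.exp_zero, one_mul]

theorem qChar_mul (τ₀ : ℂ) (ε : ℝ) {c z : ℂ} (hc : c ≠ 0) (hz : z ≠ 0) :
    qChar (spiral τ₀ ε) c (spiral τ₀ ε * z) = c * qChar (spiral τ₀ ε) c z := by
  rw [qChar, qChar, mul_left_comm, theta_mul _ _ hz, theta_mul _ _ (mul_ne_zero (inv_ne_zero hc) hz)]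
  have := spiral_ne_zero τ₀ ε
  field_simp

theorem qLog_mul (hτ₀ : 0 < τ₀.im) (hε : 0 < ε) {z : ℂ} (hz : z ≠ 0)
    (hθ : theta (spiral τ₀ ε) z ≠ 0) :
    qLog (spiral τ₀ ε) (spiral τ₀ ε * z) = qLog (spiral τ₀ ε) z + 1 := by
  set q := spiral τ₀ ε
  have hq : q ≠ 0 := spiral_ne_zero _ _
  have hd := fun y (hy : y ≠ 0) => (analyticOnNhd_theta hτ₀ hε y hy).differentiableAt.hasDerivAt
  have h1 : HasDerivAt (fun z => theta q (q * z)) (deriv (theta q) (q * z) * (q * 1)) z :=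
    HasDerivAt.comp z (hd (q * z) (mul_ne_zero hq hz)) ((hasDerivAt_id z).const_mul q)
  have h2 : HasDerivAt (fun z => -(q * z) * theta q z)
      (-(q * 1) * theta q z + -(q * z) * deriv (theta q) z) z :=
    (((hasDerivAt_id z).const_mul q).neg).mul (hd z hz)
  have h3 : (fun z => theta q (q * z)) =ᶠ[𝓝 z] fun z => -(q * z) * theta q z := by
    filter_upwards [isOpen_ne.mem_nhds hz] with y hy using theta_mul τ₀ ε hy
  have h4 := h1.unique (h2.congr_of_eventuallyEq h3)
  have h5 : q * z * deriv (theta q) (q * z) = z * (deriv (theta q) (q * z) * (q * 1)) := by ring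
  rw [qLog, qLog, theta_mul _ _ hz, h5, h4]
  change z * (-(q * 1) * theta q z + -(q * z) * deriv (theta q) z) / (-(q * z) * theta q z) = _
  field_simp
  ring

/-! ### Asymptotics as `q → 1` -/

theorem neg_inv_im_pos (hτ₀ : 0 < τ₀.im) : 0 < (-1 / τ₀).im := by
  have h0 : τ₀ ≠ 0 := by rintro rfl; simp at hτ₀
  rw [neg_div, Complex.neg_im, one_div, Complex.inv_im, neg_div, neg_neg]
  exact div_pos hτ₀ (Complex.normSq_pos.2 h0)

theorem summable_int_pow_mul_exp {δ : ℝ} (hδ : 0 < δ) (k : ℕ) :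
    Summable fun n : ℤ => ((|n| : ℤ) : ℝ) ^ k * Real.exp (-δ * ((|n| : ℤ) : ℝ)) := by
  have h := Real.summable_pow_mul_exp_neg_nat_mul k hδ
  refine Summable.of_nat_of_neg ?_ ?_ <;> simpa using h

/-- After the modular transformation the Gaussian decay is `π n² σ / ε`, with `σ = Im(-1/τ₀)`,
against a linear growth at most `2π |n| μ / ε`; `n² ≥ |n|` combines the two. -/
theorem norm_jacobiTheta₂_term_le_exp (hτ₀ : 0 < τ₀.im) (hε : 0 < ε) {v : ℂ} {μ : ℝ}
    (hμ : |ε * v.im| ≤ μ) (n : ℤ) :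
    ‖jacobiTheta₂_term n v (-1 / (ε * τ₀))‖ ≤
      Real.exp (-(π * ((-1 / τ₀).im - 2 * μ)) / ε * ((|n| : ℤ) : ℝ)) := by
  set σ := (-1 / τ₀).im
  have hσ : 0 < σ := neg_inv_im_pos hτ₀
  have hσε : (-1 / (ε * τ₀) : ℂ).im = σ / ε := by
    have : (-1 / (ε * τ₀) : ℂ) = ((ε⁻¹ : ℝ) : ℂ) * (-1 / τ₀) := by
      push_cast
      rw [div_mul_eq_div_div_swap, div_eq_inv_mul (-1 / τ₀)]
    rw [this, Complex.im_ofReal_mul]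
    exact (div_eq_inv_mul _ _).symm
  rw [norm_jacobiTheta₂_term, hσε, Real.exp_le_exp]
  have hn : ((|n| : ℤ) : ℝ) ≤ (n : ℝ) ^ 2 := by
    rw [← Int.cast_pow, ← sq_abs]
    norm_cast
    rcases (abs_nonneg n).eq_or_lt with h | h
    · rw [← h]; norm_num
    · nlinarith
  have hv : -(2 * π * n * v.im) ≤ 2 * π * ((|n| : ℤ) : ℝ) * (μ / ε) := by
    have h1 : |v.im| ≤ μ / ε := by
      rw [abs_mul, abs_of_pos hε] at hμ
      rw [le_div_iff₀ hε, mul_comm]; exact hμ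
    calc -(2 * π * n * v.im) ≤ |2 * π * n * v.im| := neg_le_abs _
      _ = 2 * π * ((|n| : ℤ) : ℝ) * |v.im| := by
        rw [abs_mul, abs_mul, abs_of_pos (show 0 < 2 * π by positivity), Int.cast_abs]
      _ ≤ _ := by gcongr
  have h2 : -π * n ^ 2 * (σ / ε) ≤ -(π * (((|n| : ℤ) : ℝ)) * (σ / ε)) := by
    have : π * ((|n| : ℤ) : ℝ) * (σ / ε) ≤ π * (n : ℝ) ^ 2 * (σ / ε) := by gcongr
    linarith
  calc -π * n ^ 2 * (σ / ε) - 2 * π * n * v.im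
      ≤ -(π * (((|n| : ℤ) : ℝ)) * (σ / ε)) + 2 * π * ((|n| : ℤ) : ℝ) * (μ / ε) := by linarith
    _ = _ := by ring

/-- When `2 |μ| < Im(-1/τ₀)` all terms with `n ≠ 0` decay like `exp(-δ |n| / ε)`, so only the
constant term survives, and it disappears in the derivative. -/
theorem tendsto_jacobiTheta₂ (hτ₀ : 0 < τ₀.im) {v : ℝ → ℂ} {μ : ℝ}
    (hv : Tendsto (fun ε => ε * (v ε).im) (𝓝[>] 0) (𝓝 μ)) (hμ : 2 * |μ| < (-1 / τ₀).im) :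
    Tendsto (fun ε : ℝ => jacobiTheta₂ (v ε) (-1 / (ε * τ₀))) (𝓝[>] 0) (𝓝 1) ∧
    Tendsto (fun ε : ℝ => jacobiTheta₂' (v ε) (-1 / (ε * τ₀))) (𝓝[>] 0) (𝓝 0) := by
  set σ := (-1 / τ₀).im
  obtain ⟨μ', hμ1, hμ2⟩ := exists_between (show |μ| < σ / 2 by linarith)
  set δ := π * (σ - 2 * μ')
  have hδ : 0 < δ := mul_pos Real.pi_pos (by linarith)
  have hb : ∀ᶠ ε in 𝓝[>] (0 : ℝ), 0 < ε ∧ ε < 1 ∧ ∀ n : ℤ,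
      ‖jacobiTheta₂_term n (v ε) (-1 / (ε * τ₀))‖ ≤ Real.exp (-δ / ε * ((|n| : ℤ) : ℝ)) := by
    filter_upwards [self_mem_nhdsWithin, (tendsto_order.1 hv.abs).2 μ' hμ1,
      (eventually_lt_nhds one_pos).filter_mono nhdsWithin_le_nhds] with ε h1 h2 h3
    exact ⟨h1, h3, fun n => norm_jacobiTheta₂_term_le_exp hτ₀ h1 h2.le n⟩
  have hb' : ∀ᶠ ε in 𝓝[>] (0 : ℝ), ∀ n : ℤ,
      ‖jacobiTheta₂_term n (v ε) (-1 / (ε * τ₀))‖ ≤ Real.exp (-δ * ((|n| : ℤ) : ℝ)) := by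
    filter_upwards [hb] with ε ⟨h1, h2, h3⟩ n
    refine (h3 n).trans (Real.exp_le_exp.2 ?_)
    have : δ ≤ δ / ε := by rw [le_div_iff₀ h1]; nlinarith
    have hn : (0 : ℝ) ≤ ((|n| : ℤ) : ℝ) := by positivity
    rw [neg_div]
    nlinarith
  have hterm : ∀ n : ℤ, n ≠ 0 → Tendsto (fun ε : ℝ => jacobiTheta₂_term n (v ε) (-1 / (ε * τ₀)))
      (𝓝[>] 0) (𝓝 0) := by
    intro n hn
    have h1 : Tendsto (fun ε : ℝ => Real.exp (-δ / ε * ((|n| : ℤ) : ℝ))) (𝓝[>] 0) (𝓝 0) := by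
      refine Real.tendsto_exp_atBot.comp ?_
      have h2 : Tendsto (fun ε : ℝ => (δ * ((|n| : ℤ) : ℝ)) * ε⁻¹) (𝓝[>] 0) atTop := by
        refine Tendsto.const_mul_atTop ?_ tendsto_inv_nhdsGT_zero
        have : 0 < |n| := abs_pos.2 hn
        positivity
      refine (tendsto_neg_atTop_atBot.comp h2).congr fun ε => ?_
      simp only [Function.comp]; ring
    exact squeeze_zero_norm' (hb.mono fun ε h => h.2.2 n) h1
  constructor
  · have h : Tendsto (fun ε : ℝ => ∑' n : ℤ, jacobiTheta₂_term n (v ε) (-1 / (ε * τ₀))) (𝓝[>] 0)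
        (𝓝 (∑' n : ℤ, if n = 0 then (1 : ℂ) else 0)) := by
      refine tendsto_tsum_of_dominated_convergence (by simpa using summable_int_pow_mul_exp hδ 0)
        ?_ hb'
      intro n
      split_ifs with hn
      · subst hn; simp [jacobiTheta₂_term]
      · exact hterm n hn
    rw [tsum_ite_eq] at h
    exact h
  · have h : Tendsto (fun ε : ℝ => ∑' n : ℤ, jacobiTheta₂'_term n (v ε) (-1 / (ε * τ₀))) (𝓝[>] 0)
        (𝓝 (∑' _ : ℤ, (0 : ℂ))) := by
      refine tendsto_tsum_of_dominated_convergence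
        (bound := fun n : ℤ => 2 * π * (((|n| : ℤ) : ℝ) ^ 1 * Real.exp (-δ * ((|n| : ℤ) : ℝ))))
        ((summable_int_pow_mul_exp hδ 1).mul_left _) ?_ ?_
      · intro n
        rcases eq_or_ne n 0 with hn | hn
        · subst hn; simp [jacobiTheta₂'_term]
        · simpa [jacobiTheta₂'_term] using! (hterm n hn).const_mul (2 * π * I * n)
      · filter_upwards [hb'] with ε h n
        rw [jacobiTheta₂'_term, norm_mul]
        have h1 : ‖(2 * π * I * n : ℂ)‖ = 2 * π * ((|n| : ℤ) : ℝ) := by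
          simp [abs_of_pos Real.pi_pos]
        rw [h1, pow_one, mul_assoc]
        rw [← mul_assoc (2 * π)]
        rw [← mul_assoc (2 * π)]
        gcongr
        exact h n
    rw [tsum_zero] at h
    exact h

end Theta

end QDiff

end

noncomputable section

namespace QDiff

open Complex (I)
open scoped Real

/-! ### Limits of the log-characters -/

section ThetaLimit

variable {τ₀ : ℂ}

/-- For `y = a + s τ₀` the rescaled imaginary part tends to `Im(y / τ₀) = -a Im(-1/τ₀)`, so the
smallness condition of `tendsto_jacobiTheta₂` becomes `|a| < 1/2`. -/
theorem tendsto_jacobiTheta₂_of_tendsto (hτ₀ : 0 < τ₀.im) {y : ℝ → ℂ} {a s : ℝ}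
    (ha : |a| < 1 / 2) (hy : Tendsto y (𝓝[>] 0) (𝓝 (a + s * τ₀))) :
    Tendsto (fun ε : ℝ => jacobiTheta₂ ((y ε - ε * τ₀ / 2) / (ε * τ₀)) (-1 / (ε * τ₀)))
      (𝓝[>] 0) (𝓝 1) ∧
    Tendsto (fun ε : ℝ => jacobiTheta₂' ((y ε - ε * τ₀ / 2) / (ε * τ₀)) (-1 / (ε * τ₀)))
      (𝓝[>] 0) (𝓝 0) := by
  have h0 : τ₀ ≠ 0 := by rintro rfl; simp at hτ₀
  have hσ := neg_inv_im_pos hτ₀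
  refine tendsto_jacobiTheta₂ hτ₀ (μ := -(a * (-1 / τ₀).im)) ?_ ?_
  · have hid : Tendsto (fun ε : ℝ => (ε : ℂ)) (𝓝[>] 0) (𝓝 0) := by
      have : Tendsto (fun ε : ℝ => (ε : ℂ)) (𝓝 0) (𝓝 ((0 : ℝ) : ℂ)) :=
        Complex.continuous_ofReal.tendsto 0
      exact (this.mono_left nhdsWithin_le_nhds).trans (by simp)
    have h1 : Tendsto (fun ε : ℝ => (y ε - ε * τ₀ / 2) / τ₀) (𝓝[>] 0)
        (𝓝 ((a + s * τ₀ - 0 * τ₀ / 2) / τ₀)) :=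
      (hy.sub ((hid.mul_const _).div_const _)).div_const _
    have h2 := (Complex.continuous_im.tendsto _).comp h1
    have h3 : ((a + s * τ₀ - 0 * τ₀ / 2) / τ₀).im = -(a * (-1 / τ₀).im) := by
      have : (a + s * τ₀ - 0 * τ₀ / 2) / τ₀ = s - (a : ℂ) * (-1 / τ₀) := by
        field_simp; ring
      rw [this, Complex.sub_im, Complex.im_ofReal_mul, Complex.ofReal_im, zero_sub]
    rw [h3] at h2
    refine h2.congr' ?_
    filter_upwards [self_mem_nhdsWithin] with ε hε
    have hε' : (ε : ℂ) ≠ 0 := by exact_mod_cast (ne_of_gt hε)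
    simp only [Function.comp]
    rw [← Complex.im_ofReal_mul]
    congr 1
    field_simp
  · rw [abs_neg, abs_mul, abs_of_pos hσ]
    nlinarith

/-- The exponential factor in the modular transformation of `theta`. -/
def modularFactor (τ₀ : ℂ) (ε : ℝ) (y : ℂ) : ℂ :=
  1 / (-I * (ε * τ₀)) ^ (1 / 2 : ℂ) * Complex.exp (-π * I * (y - ε * τ₀ / 2) ^ 2 / (ε * τ₀))

theorem modularFactor_ne_zero (hτ₀ : 0 < τ₀.im) {ε : ℝ} (hε : 0 < ε) (y : ℂ) :
    modularFactor τ₀ ε y ≠ 0 := by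
  have h0 : τ₀ ≠ 0 := by rintro rfl; simp at hτ₀
  have hε' : (ε : ℂ) ≠ 0 := by exact_mod_cast hε.ne'
  refine mul_ne_zero (one_div_ne_zero ?_) (Complex.exp_ne_zero _)
  rw [Complex.cpow_ne_zero_iff_of_exponent_ne_zero (by norm_num)]
  exact mul_ne_zero (neg_ne_zero.2 Complex.I_ne_zero) (mul_ne_zero hε' h0)

theorem theta_eq_modularFactor_mul (τ₀ : ℂ) (ε : ℝ) (y : ℂ) :
    theta (spiral τ₀ ε) (-Complex.exp (2 * π * I * y)) = modularFactor τ₀ ε y *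
      jacobiTheta₂ ((y - ε * τ₀ / 2) / (ε * τ₀)) (-1 / (ε * τ₀)) := by
  rw [theta_neg_exp, jacobiTheta₂_functional_equation, modularFactor]

theorem eventually_theta_ne_zero (hτ₀ : 0 < τ₀.im) {y : ℝ → ℂ} {a s : ℝ}
    (ha : |a| < 1 / 2) (hy : Tendsto y (𝓝[>] 0) (𝓝 (a + s * τ₀))) :
    ∀ᶠ ε in 𝓝[>] (0 : ℝ), theta (spiral τ₀ ε) (-Complex.exp (2 * π * I * y ε)) ≠ 0 := by
  filter_upwards [(tendsto_jacobiTheta₂_of_tendsto hτ₀ ha hy).1.eventually_ne one_ne_zero,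
    self_mem_nhdsWithin] with ε h1 h2
  rw [theta_eq_modularFactor_mul]
  exact mul_ne_zero (modularFactor_ne_zero hτ₀ h2 _) h1

theorem eventually_theta_self_ne_zero (hτ₀ : 0 < τ₀.im) {z : ℂ} (hz : z ≠ 0)
    (hs : ∀ t : ℝ, z ≠ spiral τ₀ t) :
    ∀ᶠ ε in 𝓝[>] (0 : ℝ), theta (spiral τ₀ ε) z ≠ 0 := by
  obtain ⟨a, s, ha, hL⟩ := exists_logNeg_eq hτ₀ hz hs
  have hzy : -Complex.exp (2 * π * I * (a + s * τ₀)) = z := by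
    rw [← hL, exp_logNeg τ₀ hz, neg_neg]
  have := eventually_theta_ne_zero hτ₀ ha (y := fun _ => a + s * τ₀) tendsto_const_nhds
  rwa [hzy] at this

/-- `(q - 1) l_q(z)` tends to `log (-z)`. -/
theorem tendsto_qLog (hτ₀ : 0 < τ₀.im) {z : ℂ} (hz : z ≠ 0) (hs : ∀ t : ℝ, z ≠ spiral τ₀ t) :
    Tendsto (fun ε : ℝ => (spiral τ₀ ε - 1) * qLog (spiral τ₀ ε) z) (𝓝[>] 0)
      (𝓝 (logNeg τ₀ z)) := by
  obtain ⟨a, s, ha, hL⟩ := exists_logNeg_eq hτ₀ hz hs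
  set y : ℂ := a + s * τ₀ with hy
  have hzy : -Complex.exp (2 * π * I * y) = z := by
    rw [← hL, exp_logNeg τ₀ hz, neg_neg]
  have h0 : τ₀ ≠ 0 := by rintro rfl; simp at hτ₀
  obtain ⟨hJ, hJ'⟩ := tendsto_jacobiTheta₂_of_tendsto hτ₀ ha (y := fun _ => y) tendsto_const_nhds
  have hid : Tendsto (fun ε : ℝ => (ε : ℂ)) (𝓝[>] 0) (𝓝 0) := by
    have : Tendsto (fun ε : ℝ => (ε : ℂ)) (𝓝 0) (𝓝 ((0 : ℝ) : ℂ)) :=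
      Complex.continuous_ofReal.tendsto 0
    exact (this.mono_left nhdsWithin_le_nhds).trans (by simp)
  -- By the functional equation, `2πi ε τ₀ l_q` equals the logarithmic derivative of the transformed
  -- theta function, which tends to `0`, minus `2πi (y - ε τ₀ / 2)`, which comes from the Gaussian
  -- factor.
  have hlim := (((tendsto_spiral_slope τ₀).div_const (2 * π * I * τ₀)).mul
    ((hJ'.div hJ one_ne_zero).sub
      ((((hid.mul_const τ₀).div_const 2).const_sub y).const_mul (2 * π * I))))
  have hv : -(2 * π * I * τ₀) / (2 * π * I * τ₀) * (0 / 1 - 2 * π * I * (y - 0 * τ₀ / 2)) =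
      logNeg τ₀ z := by
    rw [neg_div, div_self (mul_ne_zero two_pi_I_ne_zero h0), hL]; ring
  rw [hv] at hlim
  refine hlim.congr' ?_
  filter_upwards [self_mem_nhdsWithin, hJ.eventually_ne one_ne_zero] with ε hε hJε
  have hε' : (ε : ℂ) ≠ 0 := by exact_mod_cast (ne_of_gt hε)
  have hm := modularFactor_ne_zero hτ₀ hε y
  have hθ := theta_eq_modularFactor_mul τ₀ ε y
  have hd := (hasDerivAt_theta hτ₀ hε y).deriv
  rw [jacobiTheta₂'_functional_equation, ← modularFactor] at hd
  rw [hzy] at hd hθ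
  have hpi := two_pi_I_ne_zero
  rw [qLog, hd, hθ]
  simp only [Pi.div_apply]
  set J := jacobiTheta₂ ((y - ε * τ₀ / 2) / (ε * τ₀)) (-1 / (ε * τ₀))
  set J' := jacobiTheta₂' ((y - ε * τ₀ / 2) / (ε * τ₀)) (-1 / (ε * τ₀))
  set P := 2 * (π : ℂ) * I
  field_simp

/-- The slope function `dslope` is continuous at the base point, so values of `ε` with `γ ε = 0`
need no separate treatment. -/
theorem tendsto_log_one_add_div (τ₀ : ℂ) {γ : ℝ → ℂ} {γ' : ℂ}
    (hγ : Tendsto γ (𝓝[>] 0) (𝓝 γ')) :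
    Tendsto (fun ε : ℝ => Complex.log (1 + (spiral τ₀ ε - 1) * γ ε) / ε) (𝓝[>] 0)
      (𝓝 (-(2 * π * I * τ₀) * γ')) := by
  have hc : Tendsto (fun ε => 1 + (spiral τ₀ ε - 1) * γ ε) (𝓝[>] 0) (𝓝 1) := by
    simpa using ((tendsto_spiral_sub_one τ₀).mul hγ).const_add 1
  have hdiff : DifferentiableAt ℂ Complex.log 1 := Complex.differentiableAt_log (by simp)
  have h1 : Tendsto (fun ε => dslope Complex.log 1 (1 + (spiral τ₀ ε - 1) * γ ε)) (𝓝[>] 0)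
      (𝓝 1) := by
    have := (continuousAt_dslope_same.2 hdiff).tendsto.comp hc
    rwa [dslope_same, (Complex.hasDerivAt_log (by simp)).deriv, inv_one] at this
  have h2 := (h1.mul (tendsto_spiral_slope τ₀)).mul hγ
  rw [one_mul] at h2
  refine h2.congr fun ε => ?_
  have := sub_smul_dslope Complex.log 1 (1 + (spiral τ₀ ε - 1) * γ ε)
  rw [Complex.log_one, sub_zero, add_sub_cancel_left, smul_eq_mul] at this
  rw [← this]
  ring

theorem tendsto_one_add_mul (τ₀ : ℂ) {γ : ℝ → ℂ} {γ' : ℂ} (hγ : Tendsto γ (𝓝[>] 0) (𝓝 γ')) :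
    Tendsto (fun ε => 1 + (spiral τ₀ ε - 1) * γ ε) (𝓝[>] 0) (𝓝 1) := by
  simpa using ((tendsto_spiral_sub_one τ₀).mul hγ).const_add 1

/-- `e_{q,c}(z)` tends to `(-z) ^ γ` when `(c - 1) / (q - 1)` tends to `γ`. -/
theorem tendsto_qChar (hτ₀ : 0 < τ₀.im) {z : ℂ} (hz : z ≠ 0) (hs : ∀ t : ℝ, z ≠ spiral τ₀ t)
    {γ : ℝ → ℂ} {γ' : ℂ} (hγ : Tendsto γ (𝓝[>] 0) (𝓝 γ')) :
    (∀ᶠ ε in 𝓝[>] (0 : ℝ),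
      theta (spiral τ₀ ε) ((1 + (spiral τ₀ ε - 1) * γ ε)⁻¹ * z) ≠ 0) ∧
    Tendsto (fun ε : ℝ => qChar (spiral τ₀ ε) (1 + (spiral τ₀ ε - 1) * γ ε) z) (𝓝[>] 0)
      (𝓝 (Complex.exp (γ' * logNeg τ₀ z))) := by
  obtain ⟨a, s, ha, hL⟩ := exists_logNeg_eq hτ₀ hz hs
  set y : ℂ := a + s * τ₀ with hy
  have hzy : -Complex.exp (2 * π * I * y) = z := by
    rw [← hL, exp_logNeg τ₀ hz, neg_neg]
  have h0 : τ₀ ≠ 0 := by rintro rfl; simp at hτ₀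
  have hpi := two_pi_I_ne_zero
  set c : ℝ → ℂ := fun ε => 1 + (spiral τ₀ ε - 1) * γ ε with hc
  -- Dividing `z` by `c` translates `y` by `-κ`. Since `κ / (ε τ₀)` tends to `-γ'`, the quotient of
  -- the two Gaussian factors tends to `exp(2πi γ' y)`.
  set κ : ℝ → ℂ := fun ε => Complex.log (c ε) / (2 * π * I)
  have hc1 : Tendsto c (𝓝[>] 0) (𝓝 1) := tendsto_one_add_mul τ₀ hγ
  have hc0 := hc1.eventually_ne one_ne_zero
  have hκτ : Tendsto (fun ε : ℝ => κ ε / (ε * τ₀)) (𝓝[>] 0) (𝓝 (-γ')) := by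
    have h := (tendsto_log_one_add_div τ₀ hγ).div_const (2 * π * I * τ₀)
    have hv : -(2 * π * I * τ₀) * γ' / (2 * π * I * τ₀) = -γ' := by
      field_simp
    rw [hv] at h
    refine h.congr fun ε => ?_
    change Complex.log (c ε) / ε / (2 * π * I * τ₀) = Complex.log (c ε) / (2 * π * I) / (ε * τ₀)
    rw [div_div, div_div]; ring
  have hid : Tendsto (fun ε : ℝ => (ε : ℂ)) (𝓝[>] 0) (𝓝 0) := by
    have : Tendsto (fun ε : ℝ => (ε : ℂ)) (𝓝 0) (𝓝 ((0 : ℝ) : ℂ)) :=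
      Complex.continuous_ofReal.tendsto 0
    exact (this.mono_left nhdsWithin_le_nhds).trans (by simp)
  have hκ : Tendsto κ (𝓝[>] 0) (𝓝 0) := by
    have := (hc1.clog (by simp)).div_const (2 * π * I)
    simpa using this
  have hyκ : Tendsto (fun ε => y - κ ε) (𝓝[>] 0) (𝓝 (a + s * τ₀)) := by
    simpa using hκ.const_sub y
  have hzκ : ∀ᶠ ε in 𝓝[>] (0 : ℝ), -Complex.exp (2 * π * I * (y - κ ε)) = (c ε)⁻¹ * z := by
    filter_upwards [hc0] with ε h
    rw [mul_sub, mul_div_cancel₀ _ hpi, Complex.exp_sub, Complex.exp_log h, ← hzy]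
    ring
  have hJ1 := (tendsto_jacobiTheta₂_of_tendsto hτ₀ ha (y := fun _ => y) tendsto_const_nhds).1
  have hJ2 := (tendsto_jacobiTheta₂_of_tendsto hτ₀ ha hyκ).1
  constructor
  · filter_upwards [eventually_theta_ne_zero hτ₀ ha hyκ, hzκ] with ε h1 h2
    rwa [h2] at h1
  · have hexp := (Complex.continuous_exp.tendsto _).comp
      (((hκτ.const_mul (-π * I)).mul
        (((hid.mul_const τ₀).const_sub (2 * y)).sub hκ)))
    have h := hexp.mul (hJ1.div hJ2 one_ne_zero)
    have hv : Complex.exp (-π * I * -γ' * (2 * y - 0 * τ₀ - 0)) * (1 / 1) =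
        Complex.exp (γ' * logNeg τ₀ z) := by
      rw [hL, div_one, mul_one]; congr 1; ring
    rw [hv] at h
    refine h.congr' ?_
    filter_upwards [self_mem_nhdsWithin, hzκ, hJ2.eventually_ne one_ne_zero] with ε hε h2 hJ
    have hε' : (ε : ℂ) ≠ 0 := by exact_mod_cast (ne_of_gt hε)
    have e1 := theta_eq_modularFactor_mul τ₀ ε y
    have e2 := theta_eq_modularFactor_mul τ₀ ε (y - κ ε)
    rw [hzy] at e1
    rw [h2] at e2
    have hm := modularFactor_ne_zero hτ₀ hε (y - κ ε)
    have hmf : modularFactor τ₀ ε y = Complex.exp (-π * I * (κ ε / (ε * τ₀)) *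
        (2 * y - ε * τ₀ - κ ε)) * modularFactor τ₀ ε (y - κ ε) := by
      rw [modularFactor, modularFactor, mul_left_comm (Complex.exp _), ← Complex.exp_add]
      congr 2
      field_simp
      ring
    change _ = theta _ z / theta _ ((c ε)⁻¹ * z)
    rw [e1, e2, hmf]
    simp only [Function.comp, Pi.div_apply]
    field_simp

/-- One factor `(q - 1) / c` goes to each of the `d` factors `l_q - i`, and every product tends to
`log(-z)`; this is the reason for the renormalising power. -/
theorem tendsto_newton (hτ₀ : 0 < τ₀.im) {z : ℂ} (hz : z ≠ 0) (hs : ∀ t : ℝ, z ≠ spiral τ₀ t)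
    {γ : ℝ → ℂ} {γ' : ℂ} (hγ : Tendsto γ (𝓝[>] 0) (𝓝 γ')) (d : ℕ) :
    Tendsto (fun ε : ℝ => ((spiral τ₀ ε - 1) / (1 + (spiral τ₀ ε - 1) * γ ε)) ^ d *
      newton (qLog (spiral τ₀ ε) z) d) (𝓝[>] 0) (𝓝 (logNeg τ₀ z ^ d / (d.factorial : ℂ))) := by
  have h1 : ∀ i : ℕ, Tendsto (fun ε : ℝ => (spiral τ₀ ε - 1) / (1 + (spiral τ₀ ε - 1) * γ ε) *
      (qLog (spiral τ₀ ε) z - i)) (𝓝[>] 0) (𝓝 (logNeg τ₀ z)) := by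
    intro i
    have h := ((tendsto_qLog hτ₀ hz hs).sub ((tendsto_spiral_sub_one τ₀).mul_const (i : ℂ))).div
      (tendsto_one_add_mul τ₀ hγ) one_ne_zero
    rw [zero_mul, sub_zero, div_one] at h
    refine h.congr fun ε => ?_
    simp only [Pi.div_apply]
    ring
  have h2 := (tendsto_finsetProd (Finset.range d) fun i _ => h1 i).div_const (d.factorial : ℂ)
  rw [Finset.prod_const, Finset.card_range] at h2
  refine h2.congr fun ε => ?_
  rw [Finset.prod_mul_distrib, Finset.prod_const, Finset.card_range, newton, mul_div_assoc]

theorem tendsto_qLogCar (hτ₀ : 0 < τ₀.im) {n k : ℕ} {m : Fin k → ℕ}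
    (e : (Σ i : Fin k, Fin (m i)) ≃ Fin n) {z : ℂ} (hz : z ≠ 0) (hs : ∀ t : ℝ, z ≠ spiral τ₀ t)
    {γ : ℝ → Fin k → ℂ} {γ' : Fin k → ℂ}
    (hγ : ∀ i, Tendsto (fun ε => γ ε i) (𝓝[>] 0) (𝓝 (γ' i))) :
    Tendsto (fun ε : ℝ => qLogCar e (spiral τ₀ ε) (γ ε) z) (𝓝[>] 0)
      (𝓝 (diffLogCar e τ₀ γ' z)) := by
  refine tendsto_pi_nhds.2 fun i => tendsto_pi_nhds.2 fun j => ?_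
  simp only [qLogCar, diffLogCar, blocks, Matrix.reindex_apply, Matrix.submatrix_apply]
  rcases e.symm i with ⟨i₁, a⟩
  rcases e.symm j with ⟨j₁, b⟩
  rcases eq_or_ne i₁ j₁ with rfl | h
  · simp only [Matrix.blockDiagonal'_apply_eq, toeplitz, Matrix.of_apply]
    split_ifs
    · exact (tendsto_qChar hτ₀ hz hs (hγ i₁)).2.mul (tendsto_newton hτ₀ hz hs (hγ i₁) _)
    · exact tendsto_const_nhds
  · simp only [Matrix.blockDiagonal'_apply_ne _ _ _ h]
    exact tendsto_const_nhds

/-! ### Nonvanishing and meromorphy -/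

/-- The point `-1` is off the spiral, so the limit formula gives a non-zero value. This excludes an
identically zero theta function, and its zeros are then isolated. -/
theorem eventually_exists_theta_ne_zero (hτ₀ : 0 < τ₀.im) :
    ∀ᶠ ε in 𝓝[>] (0 : ℝ), ∃ z : ℂ, z ≠ 0 ∧ theta (spiral τ₀ ε) z ≠ 0 := by
  have h : ∀ t : ℝ, (-1 : ℂ) ≠ spiral τ₀ t := by
    intro t ht
    have h1 := norm_spiral τ₀ t
    rw [← ht, norm_neg, norm_one, eq_comm, Real.exp_eq_one_iff] at h1
    have h2 : t = 0 := by
      have : 2 * π * τ₀.im ≠ 0 := by positivity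
      simpa [this] using h1
    rw [h2, spiral_zero] at ht
    norm_num at ht
  exact (eventually_theta_self_ne_zero hτ₀ (by norm_num) h).mono fun ε h =>
    ⟨-1, by norm_num, h⟩

theorem eventually_theta_ne_zero_nhdsNE (hτ₀ : 0 < τ₀.im) {ε : ℝ} (hε : 0 < ε)
    (hθ : ∃ z : ℂ, z ≠ 0 ∧ theta (spiral τ₀ ε) z ≠ 0) {z : ℂ}
    (hz : z ≠ 0) : ∀ᶠ y in 𝓝[≠] z, theta (spiral τ₀ ε) y ≠ 0 := by
  have ha := analyticOnNhd_theta hτ₀ hε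
  rcases (ha z hz).eventually_eq_zero_or_eventually_ne_zero with h | h
  · obtain ⟨w, hw, hw'⟩ := hθ
    have hpre : IsPreconnected ({0}ᶜ : Set ℂ) :=
      (isConnected_compl_singleton_of_one_lt_rank (by simp) 0).isPreconnected
    exact absurd (ha.eqOn_zero_of_preconnected_of_eventuallyEq_zero hpre hz h hw) hw'
  · exact h

theorem analyticAt_theta_mul (hτ₀ : 0 < τ₀.im) {ε : ℝ} (hε : 0 < ε) {c z : ℂ} (hc : c ≠ 0)
    (hz : z ≠ 0) : AnalyticAt ℂ (fun z => theta (spiral τ₀ ε) (c * z)) z :=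
  (analyticOnNhd_theta hτ₀ hε (c * z) (mul_ne_zero hc hz)).fun_comp
    (analyticAt_const.mul analyticAt_id)

theorem meromorphicAt_qChar (hτ₀ : 0 < τ₀.im) {ε : ℝ} (hε : 0 < ε) {c z : ℂ} (hc : c ≠ 0)
    (hz : z ≠ 0) : MeromorphicAt (qChar (spiral τ₀ ε) c) z :=
  (analyticOnNhd_theta hτ₀ hε z hz).meromorphicAt.div
    (analyticAt_theta_mul hτ₀ hε (inv_ne_zero hc) hz).meromorphicAt

theorem analyticAt_qChar (hτ₀ : 0 < τ₀.im) {ε : ℝ} (hε : 0 < ε) {c z : ℂ} (hc : c ≠ 0)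
    (hz : z ≠ 0) (hθ : theta (spiral τ₀ ε) (c⁻¹ * z) ≠ 0) :
    AnalyticAt ℂ (qChar (spiral τ₀ ε) c) z :=
  (analyticOnNhd_theta hτ₀ hε z hz).div (analyticAt_theta_mul hτ₀ hε (inv_ne_zero hc) hz) hθ

theorem meromorphicAt_qLog (hτ₀ : 0 < τ₀.im) {ε : ℝ} (hε : 0 < ε) {z : ℂ}
    (hz : z ≠ 0) : MeromorphicAt (qLog (spiral τ₀ ε)) z :=
  (analyticAt_id.mul (analyticOnNhd_theta hτ₀ hε z hz).deriv).meromorphicAt.div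
    (analyticOnNhd_theta hτ₀ hε z hz).meromorphicAt

theorem analyticAt_qLog (hτ₀ : 0 < τ₀.im) {ε : ℝ} (hε : 0 < ε) {z : ℂ}
    (hz : z ≠ 0) (hθ : theta (spiral τ₀ ε) z ≠ 0) : AnalyticAt ℂ (qLog (spiral τ₀ ε)) z :=
  (analyticAt_id.mul (analyticOnNhd_theta hτ₀ hε z hz).deriv).div
    (analyticOnNhd_theta hτ₀ hε z hz) hθ

theorem meromorphicAt_newton {f : ℂ → ℂ} {z : ℂ} (hf : MeromorphicAt f z) (d : ℕ) :
    MeromorphicAt (fun z => newton (f z) d) z := by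
  unfold newton
  exact (MeromorphicAt.fun_prod (s := Finset.range d) (F := fun i z => f z - (i : ℂ)) fun i _ =>
    hf.fun_sub (MeromorphicAt.const (i : ℂ) z)).div (MeromorphicAt.const _ z)

theorem analyticAt_newton {f : ℂ → ℂ} {z : ℂ} (hf : AnalyticAt ℂ f z) (d : ℕ) :
    AnalyticAt ℂ (fun z => newton (f z) d) z := by
  unfold newton
  simp only [div_eq_mul_inv]
  exact (Finset.analyticAt_fun_prod (Finset.range d) fun i _ =>
    hf.sub analyticAt_const).mul analyticAt_const

/-- Entries of the `q`-log-character matrix are meromorphic on `ℂ*`. -/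
theorem meromorphicAt_qLogCar (hτ₀ : 0 < τ₀.im) {ε : ℝ} (hε : 0 < ε) {n k : ℕ} {m : Fin k → ℕ}
    (e : (Σ i : Fin k, Fin (m i)) ≃ Fin n) {γ : Fin k → ℂ}
    (hγ : ∀ i, 1 + (spiral τ₀ ε - 1) * γ i ≠ 0) {z : ℂ} (hz : z ≠ 0) (i j : Fin n) :
    MeromorphicAt (fun z => qLogCar e (spiral τ₀ ε) γ z i j) z := by
  simp only [qLogCar, blocks, Matrix.reindex_apply, Matrix.submatrix_apply]
  rcases e.symm i with ⟨i₁, a⟩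
  rcases e.symm j with ⟨j₁, b⟩
  rcases eq_or_ne i₁ j₁ with rfl | h
  · simp only [Matrix.blockDiagonal'_apply_eq, toeplitz, Matrix.of_apply]
    split_ifs
    · exact (meromorphicAt_qChar hτ₀ hε (hγ i₁) hz).mul ((MeromorphicAt.const _ z).mul
        (meromorphicAt_newton (meromorphicAt_qLog hτ₀ hε hz) _))
    · exact MeromorphicAt.const _ z
  · simp only [Matrix.blockDiagonal'_apply_ne _ _ _ h]
    exact MeromorphicAt.const _ z

theorem analyticAt_qLogCar (hτ₀ : 0 < τ₀.im) {ε : ℝ} (hε : 0 < ε) {n k : ℕ} {m : Fin k → ℕ}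
    (e : (Σ i : Fin k, Fin (m i)) ≃ Fin n) {γ : Fin k → ℂ}
    (hγ : ∀ i, 1 + (spiral τ₀ ε - 1) * γ i ≠ 0) {z : ℂ} (hz : z ≠ 0)
    (hθ : theta (spiral τ₀ ε) z ≠ 0)
    (hθ' : ∀ i, theta (spiral τ₀ ε) ((1 + (spiral τ₀ ε - 1) * γ i)⁻¹ * z) ≠ 0) (i j : Fin n) :
    AnalyticAt ℂ (fun z => qLogCar e (spiral τ₀ ε) γ z i j) z := by
  simp only [qLogCar, blocks, Matrix.reindex_apply, Matrix.submatrix_apply]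
  rcases e.symm i with ⟨i₁, a⟩
  rcases e.symm j with ⟨j₁, b⟩
  rcases eq_or_ne i₁ j₁ with rfl | h
  · simp only [Matrix.blockDiagonal'_apply_eq, toeplitz, Matrix.of_apply]
    split_ifs
    · exact (analyticAt_qChar hτ₀ hε (hγ i₁) hz (hθ' i₁)).mul (analyticAt_const.mul
        (analyticAt_newton (analyticAt_qLog hτ₀ hε hz hθ) _))
    · exact analyticAt_const
  · simp only [Matrix.blockDiagonal'_apply_ne _ _ _ h]
    exact analyticAt_const

end ThetaLimit

end QDiff

end

noncomputable section

namespace QDiff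

attribute [local instance] Matrix.linftyOpNormedRing Matrix.linftyOpNormedAlgebra

/-! ### Functions of a diagonalizable matrix -/

section Dunford

variable {n : ℕ}

theorem aeval_diagonal (c : Fin n → ℂ) (p : Polynomial ℂ) :
    Polynomial.aeval (Matrix.diagonal c) p = Matrix.diagonal fun i => p.eval (c i) := by
  induction p using Polynomial.induction_on' with
  | add p r hp hr => simp only [map_add, hp, hr, Matrix.diagonal_add, Polynomial.eval_add]
  | monomial d a =>
    rw [Polynomial.aeval_monomial, Matrix.diagonal_pow, Matrix.algebraMap_eq_diagonal,
      Matrix.diagonal_mul_diagonal]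
    simp [Polynomial.eval_monomial]

theorem conj_mul_conj {R : Mat n} (hR : IsUnit R.det) (M N : Mat n) :
    R * M * R⁻¹ * (R * N * R⁻¹) = R * (M * N) * R⁻¹ := by
  simp only [Matrix.mul_assoc, Matrix.nonsing_inv_mul_cancel_left _ _ hR]

/-- Conjugation by an invertible matrix. -/
def conjHom (R : Mat n) (hR : IsUnit R.det) : Mat n →ₐ[ℂ] Mat n where
  toFun M := R * M * R⁻¹
  map_one' := by rw [mul_one, Matrix.mul_nonsing_inv _ hR]
  map_mul' M N := (conj_mul_conj hR M N).symm
  map_zero' := by rw [mul_zero, zero_mul]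
  map_add' M N := by rw [mul_add, add_mul]
  commutes' a := by
    rw [← Algebra.commutes, Matrix.mul_assoc, Matrix.mul_nonsing_inv _ hR, mul_one]

theorem conjHom_apply (R : Mat n) (hR : IsUnit R.det) (M : Mat n) :
    conjHom R hR M = R * M * R⁻¹ := rfl

/-- It is annihilated by the product of the `X - a` over the distinct diagonal entries, which is
squarefree. -/
theorem isSemisimple_conj_diagonal {R : Mat n} (hR : IsUnit R.det) (c : Fin n → ℂ) :
    Module.End.IsSemisimple (Matrix.toLinAlgEquiv' (R * Matrix.diagonal c * R⁻¹)) := by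
  classical
  let p : Polynomial ℂ := ∏ a ∈ Finset.univ.image c, (Polynomial.X - Polynomial.C a)
  have hp : p.Separable :=
    Polynomial.separable_prod_X_sub_C_iff'.2 fun x _ y _ h => h
  refine Module.End.isSemisimple_of_squarefree_aeval_eq_zero (p := p) hp.squarefree ?_
  have haux := Polynomial.aeval_algHom_apply (Matrix.toLinAlgEquiv' (R := ℂ) (n := Fin n)).toAlgHom
    (R * Matrix.diagonal c * R⁻¹) p
  refine haux.trans ?_
  rw [← conjHom_apply R hR, Polynomial.aeval_algHom_apply, aeval_diagonal]
  have : (fun i => p.eval (c i)) = 0 := by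
    funext i
    rw [Polynomial.eval_prod]
    exact Finset.prod_eq_zero (Finset.mem_image_of_mem c (Finset.mem_univ i)) (by simp)
  rw [this]
  simp

/-- The multiplicative decomposition `D (1 + N)` is the additive one `D + D N`, to which the
uniqueness of the Jordan–Chevalley decomposition applies; `N` is recovered because `D` is
invertible. -/
theorem dunford_unique {R₁ R₂ N₁ N₂ : Mat n} {c₁ c₂ : Fin n → ℂ} (hR₁ : IsUnit R₁.det)
    (hR₂ : IsUnit R₂.det) (hc₁ : ∀ i, c₁ i ≠ 0) (hN₁ : IsNilpotent N₁) (hN₂ : IsNilpotent N₂)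
    (h₁ : Commute (R₁ * Matrix.diagonal c₁ * R₁⁻¹) N₁)
    (h₂ : Commute (R₂ * Matrix.diagonal c₂ * R₂⁻¹) N₂)
    (h : R₁ * Matrix.diagonal c₁ * R₁⁻¹ * (1 + N₁) = R₂ * Matrix.diagonal c₂ * R₂⁻¹ * (1 + N₂)) :
    R₁ * Matrix.diagonal c₁ * R₁⁻¹ = R₂ * Matrix.diagonal c₂ * R₂⁻¹ ∧ N₁ = N₂ := by
  set D₁ := R₁ * Matrix.diagonal c₁ * R₁⁻¹ with hD₁
  set D₂ := R₂ * Matrix.diagonal c₂ * R₂⁻¹ with hD₂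
  let φ := Matrix.toLinAlgEquiv' (R := ℂ) (n := Fin n)
  have key := Module.End.isNilpotent_isSemisimple_unique
    (n₁ := φ (D₁ * N₁)) (s₁ := φ D₁) (n₂ := φ (D₂ * N₂)) (s₂ := φ D₂)
    ((h₁.isNilpotent_mul_left hN₁).map φ) (isSemisimple_conj_diagonal hR₁ c₁)
    ((h₂.isNilpotent_mul_left hN₂).map φ) (isSemisimple_conj_diagonal hR₂ c₂)
    (((Commute.refl D₁).mul_left h₁.symm).map φ) (((Commute.refl D₂).mul_left h₂.symm).map φ)
    (by
      rw [← map_add, ← map_add]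
      congr 1
      rw [mul_add, mul_add, mul_one, mul_one] at h
      rw [add_comm, h, add_comm])
  have hD : D₁ = D₂ := φ.injective key.2
  refine ⟨hD, ?_⟩
  have hN : D₁ * N₁ = D₁ * N₂ := by
    rw [φ.injective key.1, hD]
  have hu : IsUnit D₁.det := by
    rw [hD₁, Matrix.det_mul, Matrix.det_mul, Matrix.det_diagonal]
    refine (hR₁.mul (IsUnit.mk0 _ (Finset.prod_ne_zero_iff.2 fun i _ => hc₁ i))).mul ?_
    exact Matrix.isUnit_nonsing_inv_det _ hR₁
  rw [← Matrix.nonsing_inv_mul_cancel_left (A := D₁) N₁ hu, hN,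
    Matrix.nonsing_inv_mul_cancel_left (A := D₁) N₂ hu]

/-- Functions of a diagonalisable matrix are well defined, for an arbitrary `f`: the transition
matrix intertwines the two diagonals, so a non-zero `(i, j)` entry forces `c₁ j = c₂ i`, hence the
equality of the values of `f`. -/
theorem conj_diagonal_congr {R₁ R₂ : Mat n} {c₁ c₂ : Fin n → ℂ} (hR₁ : IsUnit R₁.det)
    (hR₂ : IsUnit R₂.det)
    (h : R₁ * Matrix.diagonal c₁ * R₁⁻¹ = R₂ * Matrix.diagonal c₂ * R₂⁻¹) (f : ℂ → ℂ) :
    R₁ * Matrix.diagonal (fun i => f (c₁ i)) * R₁⁻¹ =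
      R₂ * Matrix.diagonal (fun i => f (c₂ i)) * R₂⁻¹ := by
  have hswap : ∀ d₁ d₂ : Fin n → ℂ, R₁ * Matrix.diagonal d₁ * R₁⁻¹ =
      R₂ * Matrix.diagonal d₂ * R₂⁻¹ ↔
      R₂⁻¹ * R₁ * Matrix.diagonal d₁ = Matrix.diagonal d₂ * (R₂⁻¹ * R₁) := by
    intro d₁ d₂
    constructor
    · intro h
      calc R₂⁻¹ * R₁ * Matrix.diagonal d₁
          = R₂⁻¹ * (R₁ * Matrix.diagonal d₁ * R₁⁻¹) * R₁ := by
            simp only [Matrix.mul_assoc, Matrix.nonsing_inv_mul _ hR₁, mul_one]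
        _ = _ := by
            rw [h]
            simp only [← Matrix.mul_assoc, Matrix.nonsing_inv_mul _ hR₂, one_mul]
    · intro h
      calc R₁ * Matrix.diagonal d₁ * R₁⁻¹
          = R₂ * (R₂⁻¹ * R₁ * Matrix.diagonal d₁) * R₁⁻¹ := by
            simp only [← Matrix.mul_assoc, Matrix.mul_nonsing_inv _ hR₂, one_mul]
        _ = _ := by
            rw [h]
            simp only [Matrix.mul_assoc, Matrix.mul_nonsing_inv _ hR₁, mul_one]
  rw [hswap] at h ⊢
  ext i j
  have hij := congrFun (congrFun h i) j
  rw [Matrix.mul_diagonal, Matrix.diagonal_mul] at hij ⊢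
  rcases eq_or_ne ((R₂⁻¹ * R₁) i j) 0 with h0 | h0
  · rw [h0, zero_mul, mul_zero]
  · rw [mul_comm] at hij
    rw [mul_right_cancel₀ h0 hij, mul_comm]

/-- The log-character matrix does not depend on the chosen diagonalisation, so it may be computed
from any convergent Jordan reduction. -/
theorem IsCharMatrix.unique {q : ℂ} {A : Mat n} {E₁ E₂ : ℂ → Mat n} (h₁ : IsCharMatrix q A E₁)
    (h₂ : IsCharMatrix q A E₂) : E₁ = E₂ := by
  obtain ⟨R₁, N₁, c₁, hR₁, hc₁, hN₁, hcom₁, hA₁, hE₁⟩ := h₁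
  obtain ⟨R₂, N₂, c₂, hR₂, hc₂, hN₂, hcom₂, hA₂, hE₂⟩ := h₂
  obtain ⟨hD, hN⟩ := dunford_unique hR₁ hR₂ hc₁ hN₁ hN₂ hcom₁ hcom₂ (hA₁ ▸ hA₂)
  funext z
  rw [hE₁, hE₂, hN, conj_diagonal_congr hR₁ hR₂ hD fun c => qChar q c z]

end Dunford

/-! ### Block matrices of Jordan type -/

section Blocks

theorem toeplitz_smul (m : ℕ) (a : ℂ) (f : ℕ → ℂ) :
    toeplitz m (fun d => a * f d) = a • toeplitz m f := by
  ext i j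
  simp only [toeplitz, Matrix.of_apply, Matrix.smul_apply, smul_eq_mul, mul_ite, mul_zero]

/-- The nilpotent Jordan block. -/
def shift (m : ℕ) : Matrix (Fin m) (Fin m) ℂ := toeplitz m fun d => if d = 1 then 1 else 0

theorem shift_apply (m : ℕ) (a b : Fin m) :
    shift m a b = if (a : ℕ) + 1 = b then 1 else 0 := by
  simp only [shift, toeplitz, Matrix.of_apply]
  split_ifs <;> first | rfl | omega

theorem shift_pow_apply (m d : ℕ) (a b : Fin m) :
    (shift m ^ d) a b = if (a : ℕ) + d = b then 1 else 0 := by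
  induction d generalizing a with
  | zero => simp [Matrix.one_apply, Fin.ext_iff]
  | succ d ih =>
    rw [pow_succ', Matrix.mul_apply]
    simp only [shift_apply, ih, ite_mul, one_mul, zero_mul]
    by_cases h : (a : ℕ) + 1 < m
    · rw [Finset.sum_eq_single (⟨a + 1, h⟩ : Fin m)]
      · simp only [if_true]
        congr 1
        rw [add_assoc, add_comm 1]
      · intro x _ hx
        rw [if_neg]
        intro hx'
        exact hx (Fin.ext hx'.symm)
      · simp
    · rw [if_neg (by have := b.2; omega)]
      refine Finset.sum_eq_zero fun x _ => if_neg ?_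
      have := x.2
      omega

theorem shift_pow_eq_zero {m d : ℕ} (h : m ≤ d) : shift m ^ d = 0 := by
  ext a b
  rw [shift_pow_apply, if_neg (by have := b.2; omega), Matrix.zero_apply]

theorem toeplitz_eq_sum {m K : ℕ} (h : m ≤ K) (f : ℕ → ℂ) :
    toeplitz m f = ∑ d ∈ Finset.range K, f d • shift m ^ d := by
  ext a b
  simp only [toeplitz, Matrix.of_apply, Matrix.sum_apply, Matrix.smul_apply, shift_pow_apply,
    smul_eq_mul, mul_ite, mul_one, mul_zero]
  split_ifs with hab
  · rw [Finset.sum_eq_single ((b : ℕ) - a)]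
    · rw [if_pos (by omega)]
    · intro d _ hd
      rw [if_neg (by omega)]
    · intro hd
      rw [Finset.mem_range] at hd
      have := b.2
      omega
  · symm
    exact Finset.sum_eq_zero fun d _ => if_neg (by omega)

variable {n k : ℕ} {m : Fin k → ℕ} (e : (Σ i : Fin k, Fin (m i)) ≃ Fin n)

/-- `blocks` as a homomorphism of algebras. -/
def blocksHom : (∀ i, Matrix (Fin (m i)) (Fin (m i)) ℂ) →ₐ[ℂ] Mat n :=
  AlgHom.ofLinearMap
    { toFun := blocks e
      map_add' := fun M N => by
        rw [blocks, Matrix.blockDiagonal'_add]; rfl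
      map_smul' := fun a M => by
        rw [blocks, Matrix.blockDiagonal'_smul]; rfl }
    (by
      change blocks e 1 = 1
      rw [blocks, Matrix.blockDiagonal'_one, ← Matrix.coe_reindexAlgEquiv ℂ ℂ, map_one])
    (fun M N => by
      change blocks e (M * N) = blocks e M * blocks e N
      simp only [blocks]
      rw [← Matrix.coe_reindexAlgEquiv ℂ ℂ, ← map_mul, ← Matrix.blockDiagonal'_mul]
      rfl)

theorem blocks_eq (M : ∀ i, Matrix (Fin (m i)) (Fin (m i)) ℂ) : blocks e M = blocksHom e M := rfl

theorem le_of_equiv (e : (Σ i : Fin k, Fin (m i)) ≃ Fin n) (i : Fin k) : m i ≤ n := by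
  have := Fintype.card_le_of_injective (fun a : Fin (m i) => e ⟨i, a⟩)
    (fun a b h => by simpa using h)
  simpa using this

theorem blocksHom_scalar (c : Fin k → ℂ) :
    blocksHom e (fun i => c i • 1) = Matrix.diagonal fun j => c (e.symm j).1 := by
  rw [← blocks_eq, blocks]
  have : (fun i => c i • (1 : Matrix (Fin (m i)) (Fin (m i)) ℂ)) =
      fun i => Matrix.diagonal fun _ => c i := by
    funext i
    rw [Matrix.smul_one_eq_diagonal]
  rw [this, Matrix.blockDiagonal'_diagonal, Matrix.reindex_apply, Matrix.submatrix_diagonal_equiv]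
  rfl

theorem isNilpotent_blocksHom_smul_shift (c : Fin k → ℂ) :
    IsNilpotent (blocksHom e fun i => c i • shift (m i)) := by
  refine ⟨n, ?_⟩
  rw [← map_pow]
  have : (fun i => c i • shift (m i)) ^ n = 0 := by
    funext i
    rw [Pi.pow_apply, smul_pow, shift_pow_eq_zero (le_of_equiv e i), smul_zero]; rfl
  rw [this, map_zero]

theorem blocksHom_pow_smul_shift_eq_zero (c : Fin k → ℂ) :
    (blocksHom e fun i => c i • shift (m i)) ^ n = 0 := by
  rw [← map_pow]
  have : (fun i => c i • shift (m i)) ^ n = 0 := by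
    funext i
    rw [Pi.pow_apply, smul_pow, shift_pow_eq_zero (le_of_equiv e i), smul_zero]; rfl
  rw [this, map_zero]

theorem jordan_eq (γ : Fin k → ℂ) :
    jordan e γ = blocksHom e ((fun i => γ i • 1) + fun i => shift (m i)) := by
  rw [jordan, blocks_eq]
  congr 1
  funext i
  ext a b
  simp only [toeplitz, Matrix.of_apply, Pi.add_apply, Matrix.add_apply, Matrix.smul_apply,
    Matrix.one_apply, shift_apply, Fin.ext_iff, smul_eq_mul]
  split_ifs <;> first | omega | simp

theorem commute_scalar_blocks (c : Fin k → ℂ) (M : ∀ i, Matrix (Fin (m i)) (Fin (m i)) ℂ) :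
    Commute (blocksHom e fun i => c i • 1) (blocksHom e M) := by
  refine Commute.map ?_ (blocksHom e)
  funext i
  simp

/-- Block Toeplitz matrices as polynomials in the nilpotent part. -/
theorem blocks_toeplitz_eq (a c : Fin k → ℂ) (f : ℕ → ℂ) :
    blocks e (fun i => toeplitz (m i) fun d => a i * (c i ^ d * f d)) =
      blocksHom e (fun i => a i • 1) *
        ∑ d ∈ Finset.range n, f d • (blocksHom e fun i => c i • shift (m i)) ^ d := by
  rw [blocks_eq]
  simp only [← map_pow, ← map_smul, ← map_sum, ← map_mul]
  congr 1
  funext i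
  rw [toeplitz_smul, toeplitz_eq_sum (le_of_equiv e i)]
  simp only [Pi.mul_apply, Finset.sum_apply, Pi.smul_apply, Pi.pow_apply, smul_pow, smul_mul_assoc,
    one_mul, smul_smul]
  congr 1
  exact Finset.sum_congr rfl fun d _ => by rw [mul_comm]

/-- The multiplicative Dunford decomposition of `1 + η J`; its unipotent part carries the factor `η
/ c i` found in `qLogCar`. -/
theorem one_add_smul_jordan (η : ℂ) {γ : Fin k → ℂ} (hγ : ∀ i, 1 + η * γ i ≠ 0) :
    1 + η • jordan e γ = blocksHom e (fun i => (1 + η * γ i) • 1) *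
      (1 + blocksHom e fun i => (η / (1 + η * γ i)) • shift (m i)) := by
  rw [jordan_eq, ← map_one (blocksHom e), ← map_smul, ← map_add, ← map_add, ← map_mul]
  congr 1
  funext i
  have := hγ i
  simp only [Pi.add_apply, Pi.one_apply, Pi.smul_apply, Pi.mul_apply, smul_mul_assoc, one_mul,
    smul_add, smul_smul, mul_div_cancel₀ _ (hγ i)]
  rw [← add_assoc, add_smul, one_smul]

theorem isCharMatrix_jordan {q : ℂ} {Q A : Mat n} {γ : Fin k → ℂ} (hQ : IsUnit Q.det)
    (hγ : ∀ i, 1 + (q - 1) * γ i ≠ 0) (hA : A = Q * (1 + (q - 1) • jordan e γ) * Q⁻¹) :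
    IsCharMatrix q A fun z => Q * qLogCar e q γ z * Q⁻¹ := by
  refine ⟨Q, conjHom Q hQ (blocksHom e fun i => ((q - 1) / (1 + (q - 1) * γ i)) • shift (m i)),
    fun j => 1 + (q - 1) * γ (e.symm j).1, hQ, fun j => hγ _,
    (isNilpotent_blocksHom_smul_shift e _).map _, ?_, ?_, fun z => ?_⟩
  · rw [← conjHom_apply Q hQ, ← blocksHom_scalar e fun i => 1 + (q - 1) * γ i]
    exact (commute_scalar_blocks e _ _).map (conjHom Q hQ)
  · rw [← conjHom_apply Q hQ, ← blocksHom_scalar e fun i => 1 + (q - 1) * γ i, hA,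
      ← conjHom_apply Q hQ, one_add_smul_jordan e _ hγ, map_mul, map_add, map_one]
  · simp only [← conjHom_apply Q hQ, ← map_pow, ← map_smul, ← map_sum]
    rw [← map_mul, ← blocksHom_scalar e fun i => qChar q (1 + (q - 1) * γ i) z, qLogCar,
      blocks_toeplitz_eq e (fun i => qChar q (1 + (q - 1) * γ i) z)]
    simp only [map_pow, map_smul, map_sum]

theorem newton_succ_add_one (l : ℂ) (d : ℕ) :
    newton (l + 1) (d + 1) = newton l (d + 1) + newton l d := by
  have h : ((d + 1).factorial : ℂ) = (d + 1) * d.factorial := by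
    rw [Nat.factorial_succ]; push_cast; ring
  have h0 : (d.factorial : ℂ) ≠ 0 := by exact_mod_cast d.factorial_ne_zero
  have h1 : (d + 1 : ℂ) ≠ 0 := by exact_mod_cast d.succ_ne_zero
  rw [newton, newton, newton, Finset.prod_range_succ', Finset.prod_range_succ, h]
  have h2 : ∀ i : ℕ, l + 1 - ((i + 1 : ℕ) : ℂ) = l - i := fun i => by push_cast; ring
  simp only [h2]
  field_simp
  push_cast
  ring

/-- The sum is the binomial series of `(1 + N) ^ l`; Pascal's rule raises the exponent by one, and
the boundary term disappears because `N ^ n = 0`. -/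
theorem sum_newton_add_one {N : Mat n} (hN : N ^ n = 0) (l : ℂ) :
    ∑ d ∈ Finset.range n, newton (l + 1) d • N ^ d =
      (1 + N) * ∑ d ∈ Finset.range n, newton l d • N ^ d := by
  have h0 : ∀ l, newton l 0 = 1 := fun l => by simp [newton]
  have hext : ∀ l, ∑ d ∈ Finset.range n, newton l d • N ^ d =
      ∑ d ∈ Finset.range (n + 1), newton l d • N ^ d := fun l => by
    rw [Finset.sum_range_succ, hN, smul_zero, add_zero]
  rw [add_mul, one_mul, hext, hext l, Finset.sum_range_succ', Finset.sum_range_succ' (fun d =>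
    newton l d • N ^ d)]
  simp only [newton_succ_add_one, add_smul, Finset.sum_add_distrib, h0]
  rw [← h0 l, ← Finset.sum_range_succ' (fun d => newton l d • N ^ d), ← hext, Finset.mul_sum,
    add_right_comm, h0, ← h0 l, ← Finset.sum_range_succ' (fun d => newton l d • N ^ d), ← hext]
  have : ∑ d ∈ Finset.range n, newton l d • N ^ (d + 1) =
      ∑ d ∈ Finset.range n, N * newton l d • N ^ d :=
    Finset.sum_congr rfl fun d _ => by rw [mul_smul_comm, pow_succ']
  rw [this]

theorem qLogCar_mul {τ₀ : ℂ} (hτ₀ : 0 < τ₀.im) {ε : ℝ} (hε : 0 < ε) {γ : Fin k → ℂ}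
    (hγ : ∀ i, 1 + (spiral τ₀ ε - 1) * γ i ≠ 0) {z : ℂ} (hz : z ≠ 0)
    (hθ : theta (spiral τ₀ ε) z ≠ 0) :
    qLogCar e (spiral τ₀ ε) γ (spiral τ₀ ε * z) =
      (1 + (spiral τ₀ ε - 1) • jordan e γ) * qLogCar e (spiral τ₀ ε) γ z := by
  set q := spiral τ₀ ε with hq
  rw [qLogCar, qLogCar, blocks_toeplitz_eq e (fun i => qChar q (1 + (q - 1) * γ i) (q * z)),
    blocks_toeplitz_eq e (fun i => qChar q (1 + (q - 1) * γ i) z), hq, qLog_mul hτ₀ hε hz hθ, ← hq,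
    sum_newton_add_one (blocksHom_pow_smul_shift_eq_zero e _), one_add_smul_jordan e _ hγ]
  have : (blocksHom e fun i => qChar q (1 + (q - 1) * γ i) (q * z) • 1) =
      (blocksHom e fun i => (1 + (q - 1) * γ i) • 1) *
      (blocksHom e fun i => qChar q (1 + (q - 1) * γ i) z • 1) := by
    rw [← map_mul]
    congr 1
    funext i
    rw [hq, qChar_mul τ₀ ε (hγ i) hz, ← hq]
    simp [smul_smul, mul_comm]
  rw [this]
  set N := blocksHom e fun i => ((q - 1) / (1 + (q - 1) * γ i)) • shift (m i)
  set P := blocksHom e fun i => (1 + (q - 1) * γ i) • 1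
  set P' := blocksHom e fun i => qChar q (1 + (q - 1) * γ i) z • 1 with hP'
  have hcom : P' * (1 + N) = (1 + N) * P' := by
    have : Commute P' N := commute_scalar_blocks e _ _
    exact (Commute.one_right P').add_right this
  rw [mul_assoc P, ← mul_assoc P', hcom]
  simp only [mul_assoc]

open scoped Nat in
theorem exp_smul_jordan (τ₀ : ℂ) (γ : Fin k → ℂ) (z : ℂ) :
    NormedSpace.exp (logNeg τ₀ z • jordan e γ) = diffLogCar e τ₀ γ z := by
  set L := logNeg τ₀ z
  have hN : (L • blocksHom e fun i => shift (m i)) ^ n = 0 := by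
    have := blocksHom_pow_smul_shift_eq_zero e (fun _ => L)
    rw [← map_smul]
    exact this
  have hexp : NormedSpace.exp (L • blocksHom e fun i => shift (m i)) =
      ∑ d ∈ Finset.range n, ((d ! : ℂ)⁻¹) • (L • blocksHom e fun i => shift (m i)) ^ d := by
    rw [NormedSpace.exp_eq_tsum ℂ]
    refine tsum_eq_sum fun d hd => ?_
    rw [Finset.mem_range, not_lt] at hd
    rw [pow_eq_zero_of_le hd hN, smul_zero]
  rw [jordan_eq, map_add, smul_add, Matrix.exp_add_of_commute, hexp, diffLogCar]
  · have h1 := blocks_toeplitz_eq e (fun i => Complex.exp (γ i * L)) (fun _ => L)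
      (fun d => ((d ! : ℂ)⁻¹))
    have h2 : NormedSpace.exp (L • blocksHom e fun i => γ i • 1) =
        blocksHom e fun i => Complex.exp (γ i * L) • 1 := by
      rw [blocksHom_scalar e, blocksHom_scalar e, ← Matrix.diagonal_smul, Matrix.exp_diagonal]
      congr 1
      funext j
      rw [Pi.coe_exp, Pi.smul_apply, smul_eq_mul, mul_comm, Complex.exp_eq_exp_ℂ]
    rw [h2, ← map_smul]
    exact h1.symm
  · exact ((commute_scalar_blocks e _ _).smul_right L).smul_left L

end Blocks

/-! ### Non-resonance -/

theorem intertwine_aeval {n : ℕ} {X b b₁ : Mat n} (h : X * b₁ = b * X) (p : Polynomial ℂ) :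
    X * Polynomial.aeval b₁ p = Polynomial.aeval b p * X := by
  have hpow : ∀ d : ℕ, X * b₁ ^ d = b ^ d * X := by
    intro d
    induction d with
    | zero => simp
    | succ d ih => rw [pow_succ, ← mul_assoc, ih, mul_assoc, h, ← mul_assoc, ← pow_succ]
  induction p using Polynomial.induction_on' with
  | add p r hp hr => rw [map_add, map_add, mul_add, add_mul, hp, hr]
  | monomial d a =>
    rw [Polynomial.aeval_monomial, Polynomial.aeval_monomial, ← mul_assoc, ← Algebra.commutes,
      mul_assoc, hpow, mul_assoc]

/-- An element `X` of the kernel satisfies `X (M + k) = M X`, hence `X χ(M + k) = χ(M) X = 0` for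
the characteristic polynomial `χ` of `M`. A common eigenvalue of `M` and `M + k` would be a
resonance, so `χ(M + k)` is invertible and `X = 0`. -/
theorem NonResonant.sylv {n : ℕ} {M : Mat n} (h : NonResonant M) : SylvNonResonant M := by
  intro k hk X hX
  rw [sylv_apply, zero_smul, add_zero, mul_one] at hX
  have hint : X * (M + algebraMap ℂ (Mat n) k) = M * X := by
    rw [mul_add, ← Algebra.commutes, ← Algebra.smul_def, add_comm]
    exact sub_eq_zero.1 hX
  rcases subsingleton_or_nontrivial (Mat n) with hs | hs
  · exact Subsingleton.elim _ _
  have h1 := intertwine_aeval hint M.charpoly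
  rw [Matrix.aeval_self_charpoly, zero_mul] at h1
  have hu : IsUnit (Polynomial.aeval (M + algebraMap ℂ (Mat n) k) M.charpoly) := by
    rw [← spectrum.zero_notMem_iff ℂ, spectrum.map_polynomial_aeval_of_nonempty]
    · rintro ⟨ν, hν, hν0⟩
      have hn : Nonempty (Fin n) := by
        by_contra hne
        rw [not_nonempty_iff] at hne
        exact not_subsingleton (Mat n) inferInstance
      have ha : ν ∈ spectrum ℂ M := by
        rw [Matrix.mem_spectrum_iff_isRoot_charpoly]; exact hν0
      have hb : ν - k ∈ spectrum ℂ M := by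
        rw [← spectrum.add_mem_add_iff (s := (k : ℂ)), sub_add_cancel]
        rwa [add_comm]
      refine h ν ha _ hb ?_ (k : ℤ) (by push_cast; ring)
      intro heq
      have : (k : ℂ) = 0 := by linear_combination heq
      have : k = 0 := by exact_mod_cast this
      omega
    · exact spectrum.nonempty_of_isAlgClosed_of_finiteDimensional ℂ _
  exact (hu.mul_left_eq_zero).1 h1

end QDiff

end

noncomputable section

namespace QDiff

attribute [local instance] Matrix.linftyOpNormedRing Matrix.linftyOpNormedAlgebra

open Polynomial (eval₂)

/-! ### Rational functions regular at a point -/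

section Scalar

theorem eval₂_id (z : ℂ) (p : Polynomial ℂ) : eval₂ (RingHom.id ℂ) z p = p.eval z := rfl

/-- The ring of rational functions regular at `z`. -/
def regRing (z : ℂ) : Subring (RatFunc ℂ) where
  carrier := {f | f.denom.eval z ≠ 0}
  mul_mem' {f g} hf hg h := by
    have := Polynomial.eval_eq_zero_of_dvd_of_eval_eq_zero (RatFunc.denom_mul_dvd f g) h
    rw [Polynomial.eval_mul] at this
    exact (mul_ne_zero hf hg) this
  add_mem' {f g} hf hg h := by
    have := Polynomial.eval_eq_zero_of_dvd_of_eval_eq_zero (RatFunc.denom_add_dvd f g) h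
    rw [Polynomial.eval_mul] at this
    exact (mul_ne_zero hf hg) this
  one_mem' := by simp
  zero_mem' := by simp
  neg_mem' {f} hf h := by
    have h1 : -f = algebraMap _ _ (-f.num) / algebraMap _ _ f.denom := by
      conv_lhs => rw [← RatFunc.num_div_denom f]
      rw [map_neg]; ring
    rw [h1] at h
    exact hf (Polynomial.eval_eq_zero_of_dvd_of_eval_eq_zero (RatFunc.denom_div_dvd _ _) h)

theorem mem_regRing {z : ℂ} {f : RatFunc ℂ} : f ∈ regRing z ↔ f.denom.eval z ≠ 0 := Iff.rfl

/-- Evaluation at `z`. -/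
def evalHom (z : ℂ) : regRing z →+* ℂ where
  toFun f := RatFunc.eval (RingHom.id ℂ) z f
  map_one' := RatFunc.eval_one ..
  map_zero' := RatFunc.eval_zero ..
  map_mul' f g := RatFunc.eval_mul _ _ f.2 g.2
  map_add' f g := RatFunc.eval_add _ _ f.2 g.2

theorem evalHom_apply (z : ℂ) (f : regRing z) :
    evalHom z f = RatFunc.eval (RingHom.id ℂ) z f := rfl

theorem algebraMap_mem_regRing (p : Polynomial ℂ) (z : ℂ) :
    algebraMap (Polynomial ℂ) (RatFunc ℂ) p ∈ regRing z := by
  rw [mem_regRing, RatFunc.denom_algebraMap]; simp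

theorem C_mem_regRing (a z : ℂ) : RatFunc.C a ∈ regRing z := by
  rw [mem_regRing, RatFunc.denom_C]; simp

theorem inv_mem_regRing {z : ℂ} {f : RatFunc ℂ}
    (h : RatFunc.eval (RingHom.id ℂ) z f ≠ 0) : f⁻¹ ∈ regRing z := by
  have hn : f.num.eval z ≠ 0 := by
    intro h0
    rw [RatFunc.eval, eval₂_id, h0, zero_div] at h
    exact h rfl
  rw [mem_regRing]
  intro h0
  have h1 : f⁻¹ = algebraMap _ _ f.denom / algebraMap _ _ f.num := by
    conv_lhs => rw [← RatFunc.num_div_denom f]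
    rw [inv_div]
  rw [h1] at h0
  exact hn (Polynomial.eval_eq_zero_of_dvd_of_eval_eq_zero (RatFunc.denom_div_dvd _ _) h0)

theorem eval_inv_of_mem {z : ℂ} {f : RatFunc ℂ} (hf : f ∈ regRing z)
    (h : RatFunc.eval (RingHom.id ℂ) z f ≠ 0) :
    RatFunc.eval (RingHom.id ℂ) z f⁻¹ = (RatFunc.eval (RingHom.id ℂ) z f)⁻¹ := by
  have hf0 : f ≠ 0 := by
    rintro rfl
    exact h (RatFunc.eval_zero ..)
  have h1 := RatFunc.eval_mul (RingHom.id ℂ) z (inv_mem_regRing h) hf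
  rw [inv_mul_cancel₀ hf0, RatFunc.eval_one] at h1
  exact eq_inv_of_mul_eq_one_left h1.symm

theorem eval₂_C_mem {z : ℂ} {a : RatFunc ℂ} (ha : a ∈ regRing z) (p : Polynomial ℂ) :
    ∃ h : p.eval₂ RatFunc.C a ∈ regRing z, evalHom z ⟨_, h⟩ = p.eval (evalHom z ⟨a, ha⟩) := by
  let φ : ℂ →+* regRing z := (RatFunc.C).codRestrict (regRing z) fun c => C_mem_regRing c z
  have h1 : p.eval₂ RatFunc.C a = ((p.eval₂ φ ⟨a, ha⟩ : regRing z) : RatFunc ℂ) := by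
    have := Polynomial.hom_eval₂ p φ (regRing z).subtype ⟨a, ha⟩
    exact this.symm
  have h2 : p.eval₂ RatFunc.C a ∈ regRing z := h1 ▸ (p.eval₂ φ ⟨a, ha⟩).2
  refine ⟨h2, ?_⟩
  have h3 : (⟨_, h2⟩ : regRing z) = p.eval₂ φ ⟨a, ha⟩ := Subtype.ext h1
  rw [h3, Polynomial.hom_eval₂]
  have : (evalHom z).comp φ = RingHom.id ℂ := by
    ext c
    exact RatFunc.eval_C ..
  rw [this, eval₂_id]

theorem inv_C_mul_X_mem {c w : ℂ} (hc : c ≠ 0) (hw : w ≠ 0) :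
    ∃ h : (RatFunc.C c * RatFunc.X)⁻¹ ∈ regRing w, evalHom w ⟨_, h⟩ = 1 / (c * w) := by
  have hX : (RatFunc.X : RatFunc ℂ) ∈ regRing w := by rw [mem_regRing, RatFunc.denom_X]; simp
  have h1 : RatFunc.C c * RatFunc.X ∈ regRing w := mul_mem (C_mem_regRing c w) hX
  have h2 : RatFunc.eval (RingHom.id ℂ) w (RatFunc.C c * RatFunc.X) = c * w := by
    rw [RatFunc.eval_mul _ _ (C_mem_regRing c w) hX, RatFunc.eval_C, RatFunc.eval_X]; rfl
  have h3 : RatFunc.eval (RingHom.id ℂ) w (RatFunc.C c * RatFunc.X) ≠ 0 := by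
    rw [h2]; exact mul_ne_zero hc hw
  refine ⟨inv_mem_regRing h3, ?_⟩
  rw [evalHom_apply, eval_inv_of_mem h1 h3, h2, one_div]

/-- Evaluating at all `w ≠ 0` would give a polynomial with infinitely many roots. Denominators
therefore survive the substitution, which makes it a homomorphism of fields. -/
theorem eval₂_inv_C_mul_X_ne_zero {c : ℂ} (hc : c ≠ 0) {p : Polynomial ℂ} (hp : p ≠ 0) :
    p.eval₂ RatFunc.C (RatFunc.C c * RatFunc.X)⁻¹ ≠ 0 := by
  intro h0
  refine hp (Polynomial.eq_zero_of_infinite_isRoot p ?_)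
  refine Set.Infinite.mono (s := {0}ᶜ) (fun z (hz : z ≠ 0) => ?_)
    (Set.finite_singleton (0 : ℂ)).infinite_compl
  have hw : (c * z)⁻¹ ≠ 0 := inv_ne_zero (mul_ne_zero hc hz)
  obtain ⟨ha, hav⟩ := inv_C_mul_X_mem hc hw
  obtain ⟨h, hv⟩ := eval₂_C_mem ha p
  rw [hav, evalHom_apply] at hv
  simp only [h0] at hv
  rw [RatFunc.eval_zero] at hv
  have : 1 / (c * (c * z)⁻¹) = z := by field_simp
  rw [this] at hv
  exact hv.symm

/-- The substitution `z = 1 / (c w)` as a homomorphism of fields. -/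
def invHom (c : ℂ) (hc : c ≠ 0) : RatFunc ℂ →+* RatFunc ℂ where
  toFun f := RatFunc.eval RatFunc.C (RatFunc.C c * RatFunc.X)⁻¹ f
  map_one' := RatFunc.eval_one ..
  map_zero' := RatFunc.eval_zero ..
  map_mul' f g := RatFunc.eval_mul _ _ (eval₂_inv_C_mul_X_ne_zero hc f.denom_ne_zero)
    (eval₂_inv_C_mul_X_ne_zero hc g.denom_ne_zero)
  map_add' f g := RatFunc.eval_add _ _ (eval₂_inv_C_mul_X_ne_zero hc f.denom_ne_zero)
    (eval₂_inv_C_mul_X_ne_zero hc g.denom_ne_zero)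

theorem invHom_apply {c : ℂ} (hc : c ≠ 0) (f : RatFunc ℂ) :
    invHom c hc f = RatFunc.eval RatFunc.C (RatFunc.C c * RatFunc.X)⁻¹ f := rfl

theorem invHom_C {c : ℂ} (hc : c ≠ 0) (a : ℂ) : invHom c hc (RatFunc.C a) = RatFunc.C a :=
  RatFunc.eval_C ..

theorem invHom_mem {c w : ℂ} (hc : c ≠ 0) (hw : w ≠ 0) {f : RatFunc ℂ}
    (hf : f ∈ regRing (1 / (c * w))) : invHom c hc f ∈ regRing w ∧
      RatFunc.eval (RingHom.id ℂ) w (invHom c hc f) =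
        RatFunc.eval (RingHom.id ℂ) (1 / (c * w)) f := by
  obtain ⟨ha, hav⟩ := inv_C_mul_X_mem hc hw
  obtain ⟨hn, hnv⟩ := eval₂_C_mem ha f.num
  obtain ⟨hd, hdv⟩ := eval₂_C_mem ha f.denom
  rw [hav, evalHom_apply] at hnv hdv
  have hd0 : RatFunc.eval (RingHom.id ℂ) w (f.denom.eval₂ RatFunc.C (RatFunc.C c * RatFunc.X)⁻¹)
      ≠ 0 := by rw [hdv]; exact hf
  have hdi := inv_mem_regRing hd0
  rw [invHom_apply, RatFunc.eval, div_eq_mul_inv]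
  refine ⟨mul_mem hn hdi, ?_⟩
  rw [RatFunc.eval_mul _ _ hn hdi, eval_inv_of_mem hd hd0, hnv, hdv, ← div_eq_mul_inv]
  rfl

/-- The substitution `X ↦ c X` of polynomials. -/
def scalePoly (c : ℂ) : Polynomial ℂ →+* Polynomial ℂ :=
  Polynomial.compRingHom (Polynomial.C c * Polynomial.X)

theorem scalePoly_eval (c w : ℂ) (p : Polynomial ℂ) :
    (scalePoly c p).eval w = p.eval (c * w) := by
  simp [scalePoly, Polynomial.eval_comp]

theorem scalePoly_ne_zero {c : ℂ} (hc : c ≠ 0) {p : Polynomial ℂ} (hp : p ≠ 0) :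
    scalePoly c p ≠ 0 := by
  intro h
  refine hp (Polynomial.funext fun z => ?_)
  have := scalePoly_eval c (z / c) p
  rw [h, Polynomial.eval_zero, mul_div_cancel₀ _ hc] at this
  rw [← this, Polynomial.eval_zero]

theorem le_comap_scalePoly {c : ℂ} (hc : c ≠ 0) :
    nonZeroDivisors (Polynomial ℂ) ≤ (nonZeroDivisors (Polynomial ℂ)).comap (scalePoly c) := by
  intro p hp
  rw [mem_nonZeroDivisors_iff_ne_zero] at hp
  rw [Submonoid.mem_comap, mem_nonZeroDivisors_iff_ne_zero]
  exact scalePoly_ne_zero hc hp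

theorem eval_div {z : ℂ} {p s : Polynomial ℂ} (hs : s.eval z ≠ 0) :
    (algebraMap _ (RatFunc ℂ) p / algebraMap _ (RatFunc ℂ) s) ∈ regRing z ∧
    RatFunc.eval (RingHom.id ℂ) z (algebraMap _ (RatFunc ℂ) p / algebraMap _ (RatFunc ℂ) s) =
      p.eval z / s.eval z := by
  have hp' := algebraMap_mem_regRing p z
  have hs' := algebraMap_mem_regRing s z
  have e : ∀ p : Polynomial ℂ, RatFunc.eval (RingHom.id ℂ) z (algebraMap _ (RatFunc ℂ) p) =
      p.eval z := fun p => by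
    rw [RatFunc.eval_algebraMap]; rfl
  have hs0 : RatFunc.eval (RingHom.id ℂ) z (algebraMap _ (RatFunc ℂ) s) ≠ 0 := by rwa [e]
  have hi := inv_mem_regRing hs0
  rw [div_eq_mul_inv]
  refine ⟨mul_mem hp' hi, ?_⟩
  rw [RatFunc.eval_mul _ _ hp' hi, eval_inv_of_mem hs' hs0, e, e, div_eq_mul_inv]

/-- The counterpart of `invHom_mem` that also covers `w = 0`, where `1 / (c w)` is not a point of
`ℂ`: `w ↦ 1 / (c w)` is `w ↦ 1 / w` followed by the scaling `X ↦ c X`, which is harmless at `0`. -/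
theorem invHom_mem_of_one {c w : ℂ} (hc : c ≠ 0) {f : RatFunc ℂ}
    (hf : invHom 1 one_ne_zero f ∈ regRing (c * w)) : invHom c hc f ∈ regRing w ∧
      RatFunc.eval (RingHom.id ℂ) w (invHom c hc f) =
        RatFunc.eval (RingHom.id ℂ) (c * w) (invHom 1 one_ne_zero f) := by
  let ψ : RatFunc ℂ →+* RatFunc ℂ := RatFunc.mapRingHom (scalePoly c) (le_comap_scalePoly hc)
  have hψ : ∀ p s : Polynomial ℂ, ψ (algebraMap _ _ p / algebraMap _ _ s) =
      algebraMap _ _ (scalePoly c p) / algebraMap _ _ (scalePoly c s) := fun p s =>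
    RatFunc.map_apply_div (scalePoly c) (le_comap_scalePoly hc) p s
  have hψp : ∀ p : Polynomial ℂ, ψ (algebraMap _ _ p) = algebraMap _ _ (scalePoly c p) :=
    fun p => by simpa using hψ p 1
  have hψC : ψ.comp RatFunc.C = RatFunc.C := by
    ext a
    rw [RingHom.comp_apply, ← RatFunc.algebraMap_C, hψp]
    simp [scalePoly]
  have hψX : ψ (RatFunc.C 1 * RatFunc.X)⁻¹ = (RatFunc.C c * RatFunc.X)⁻¹ := by
    rw [map_inv₀, map_one, one_mul, ← RatFunc.algebraMap_X, hψp]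
    simp [scalePoly]
  have hkey : invHom c hc f = ψ (invHom 1 one_ne_zero f) := by
    rw [invHom_apply, invHom_apply, RatFunc.eval, RatFunc.eval, map_div₀, Polynomial.hom_eval₂,
      Polynomial.hom_eval₂, hψC, hψX]
  set g := invHom 1 one_ne_zero f
  have hg : ψ g = algebraMap _ _ (scalePoly c g.num) / algebraMap _ _ (scalePoly c g.denom) := by
    rw [← hψ, RatFunc.num_div_denom]
  have hd : (scalePoly c g.denom).eval w ≠ 0 := by rw [scalePoly_eval]; exact hf
  rw [hkey, hg]
  refine ⟨(eval_div hd).1, ?_⟩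
  rw [(eval_div hd).2, scalePoly_eval, scalePoly_eval]
  rfl

theorem analyticAt_eval {z : ℂ} {f : RatFunc ℂ} (hf : f ∈ regRing z) :
    AnalyticAt ℂ (fun z => RatFunc.eval (RingHom.id ℂ) z f) z := by
  have h : ∀ p : Polynomial ℂ, AnalyticAt ℂ (fun z => p.eval z) z := fun p =>
    p.differentiable.analyticAt z
  exact (h f.num).div (h f.denom) hf

theorem meromorphicAt_eval (z : ℂ) (f : RatFunc ℂ) :
    MeromorphicAt (fun z => RatFunc.eval (RingHom.id ℂ) z f) z := by
  have h : ∀ p : Polynomial ℂ, AnalyticAt ℂ (fun z => p.eval z) z := fun p =>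
    p.differentiable.analyticAt z
  exact (h f.num).meromorphicAt.div (h f.denom).meromorphicAt

end Scalar

/-! ### Rational matrices -/

section MatrixReg

variable {n : ℕ} {M N : RMat n} {z : ℂ}

/-- A rational matrix regular at `z`, over the local ring. -/
def toReg (h : RegAt M z) : Matrix (Fin n) (Fin n) (regRing z) := fun i j => ⟨M i j, h i j⟩

theorem map_toReg (h : RegAt M z) : (regRing z).subtype.mapMatrix (toReg h) = M := rfl

theorem regAt_map (M' : Matrix (Fin n) (Fin n) (regRing z)) :
    RegAt ((regRing z).subtype.mapMatrix M') z := fun i j => (M' i j).2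

theorem evalAt_map (M' : Matrix (Fin n) (Fin n) (regRing z)) :
    evalAt ((regRing z).subtype.mapMatrix M') z = (evalHom z).mapMatrix M' := rfl

theorem RegAt.mul (hM : RegAt M z) (hN : RegAt N z) :
    RegAt (M * N) z ∧ evalAt (M * N) z = evalAt M z * evalAt N z := by
  rw [← map_toReg hM, ← map_toReg hN, ← map_mul, evalAt_map, evalAt_map, evalAt_map]
  exact ⟨regAt_map _, map_mul (evalHom z).mapMatrix (toReg hM) (toReg hN)⟩

theorem RegAt.add (hM : RegAt M z) (hN : RegAt N z) :
    RegAt (M + N) z ∧ evalAt (M + N) z = evalAt M z + evalAt N z := by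
  rw [← map_toReg hM, ← map_toReg hN, ← map_add, evalAt_map, evalAt_map, evalAt_map]
  exact ⟨regAt_map _, map_add (evalHom z).mapMatrix (toReg hM) (toReg hN)⟩

theorem RegAt.neg (hM : RegAt M z) : RegAt (-M) z ∧ evalAt (-M) z = -evalAt M z := by
  rw [← map_toReg hM, ← map_neg, evalAt_map, evalAt_map]
  exact ⟨regAt_map _, map_neg (evalHom z).mapMatrix (toReg hM)⟩

theorem regAt_one : RegAt (1 : RMat n) z ∧ evalAt (1 : RMat n) z = 1 := by
  rw [← map_one (regRing z).subtype.mapMatrix, evalAt_map]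
  exact ⟨regAt_map _, map_one (evalHom z).mapMatrix⟩

theorem regAt_const (Q : Mat n) : RegAt (const Q) z ∧ evalAt (const Q) z = Q :=
  ⟨fun i j => C_mem_regRing (Q i j) z, by
    ext i j
    exact RatFunc.eval_C ..⟩

theorem RegAt.smul (hM : RegAt M z) (a : ℂ) :
    RegAt (RatFunc.C a • M) z ∧ evalAt (RatFunc.C a • M) z = a • evalAt M z := by
  refine ⟨fun i j => mul_mem (C_mem_regRing a z) (hM i j), ?_⟩
  ext i j
  refine (RatFunc.eval_mul _ _ (C_mem_regRing a z) (hM i j)).trans ?_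
  rw [RatFunc.eval_C]; rfl

/-- Over the ring of functions regular at `z`, determinant and adjugate commute with evaluation, and
the determinant is invertible there as soon as its value at `z` is non-zero. -/
theorem RegAt.inv (hM : RegAt M z) (hu : IsUnit (evalAt M z).det) :
    RegAt M⁻¹ z ∧ evalAt M⁻¹ z = (evalAt M z)⁻¹ ∧ IsUnit M.det := by
  have hdet : M.det = ((toReg hM).det : RatFunc ℂ) := by
    conv_lhs => rw [← map_toReg hM]
    exact ((regRing z).subtype.map_det (toReg hM)).symm
  have hdetv : RatFunc.eval (RingHom.id ℂ) z M.det = (evalAt M z).det := by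
    rw [hdet, ← evalHom_apply, RingHom.map_det]
    rfl
  have hmem : M.det ∈ regRing z := hdet ▸ (toReg hM).det.2
  have hne : RatFunc.eval (RingHom.id ℂ) z M.det ≠ 0 := by rw [hdetv]; exact hu.ne_zero
  have hM0 : IsUnit M.det := by
    refine IsUnit.mk0 _ ?_
    intro h
    rw [h, RatFunc.eval_zero] at hne
    exact hne rfl
  have hadj : ∀ i j, M.adjugate i j ∈ regRing z := by
    intro i j
    have h1 : M.adjugate = (regRing z).subtype.mapMatrix (toReg hM).adjugate := by
      conv_lhs => rw [← map_toReg hM]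
      exact ((regRing z).subtype.map_adjugate (toReg hM)).symm
    rw [h1]
    exact ((toReg hM).adjugate i j).2
  have hreg : RegAt M⁻¹ z := by
    intro i j
    rw [Matrix.inv_def, Ring.inverse_eq_inv']
    exact mul_mem (inv_mem_regRing hne) (hadj i j)
  refine ⟨hreg, ?_, hM0⟩
  have h1 := (hreg.mul hM).2
  rw [Matrix.nonsing_inv_mul _ hM0, regAt_one.2] at h1
  exact (Matrix.inv_eq_left_inv h1.symm).symm

theorem regAt_conj_iff {Q : Mat n} (hQ : IsUnit Q.det) (M : RMat n) (z : ℂ) :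
    RegAt (const Q⁻¹ * M * const Q) z ↔ RegAt M z := by
  constructor
  · intro h
    have h1 := (((regAt_const Q).1.mul h).1.mul (regAt_const Q⁻¹).1).1
    have hc : const Q * const Q⁻¹ = (1 : RMat n) := by
      have : const Q * const Q⁻¹ = RatFunc.C.mapMatrix (Q * Q⁻¹) := by
        rw [map_mul]; rfl
      rw [this, Matrix.mul_nonsing_inv _ hQ, map_one]
    have hM : const Q * (const Q⁻¹ * M * const Q) * const Q⁻¹ = M := by
      calc _ = (const Q * const Q⁻¹) * M * (const Q * const Q⁻¹) := by simp only [mul_assoc]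
        _ = M := by rw [hc, one_mul, mul_one]
    rwa [hM] at h1
  · intro h
    exact (((regAt_const Q⁻¹).1.mul h).1.mul (regAt_const Q).1).1

theorem evalAt_conj {Q : Mat n} (h : RegAt M z) :
    evalAt (const Q⁻¹ * M * const Q) z = Q⁻¹ * evalAt M z * Q := by
  have h1 := (regAt_const (z := z) Q⁻¹).1.mul h
  rw [(h1.1.mul (regAt_const Q).1).2, h1.2, (regAt_const _).2, (regAt_const _).2]

theorem qMatrix_reg (q : ℂ) (h : RegAt M z) :
    RegAt (qMatrix q M) z ∧ evalAt (qMatrix q M) z = 1 + (q - 1) • evalAt M z := by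
  have h1 := regAt_one.1.add (h.smul (q - 1)).1
  exact ⟨h1.1, by rw [qMatrix, h1.2, regAt_one.2, (h.smul (q - 1)).2]⟩

/-- The matrix `D` with `C = 1 + (q - 1) D`. -/
def qDelta (q : ℂ) (C : RMat n) : RMat n := RatFunc.C (q - 1)⁻¹ • (C - 1)

theorem qMatrix_qDelta {q : ℂ} (hq : q - 1 ≠ 0) (C : RMat n) : qMatrix q (qDelta q C) = C := by
  rw [qMatrix, qDelta, smul_smul, ← map_mul, mul_inv_cancel₀ hq, map_one, one_smul]
  abel

theorem qDelta_qMatrix {q : ℂ} (hq : q - 1 ≠ 0) (M : RMat n) : qDelta q (qMatrix q M) = M := by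
  rw [qMatrix, qDelta, add_sub_cancel_left, smul_smul, ← map_mul, inv_mul_cancel₀ hq, map_one,
    one_smul]

theorem qDelta_reg (q : ℂ) (h : RegAt M z) :
    RegAt (qDelta q M) z ∧ evalAt (qDelta q M) z = (q - 1)⁻¹ • (evalAt M z - 1) := by
  have h1 := h.add regAt_one.1.neg.1
  rw [← sub_eq_add_neg, regAt_one.1.neg.2, regAt_one.2, ← sub_eq_add_neg] at h1
  have h2 := h1.1.smul (q - 1)⁻¹
  exact ⟨h2.1, by rw [qDelta, h2.2, h1.2]⟩

theorem qMatrix_reg_iff {q : ℂ} (hq : q - 1 ≠ 0) : RegAt (qMatrix q M) z ↔ RegAt M z := by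
  refine ⟨fun h => ?_, fun h => (qMatrix_reg q h).1⟩
  have := (qDelta_reg q h).1
  rwa [qDelta_qMatrix hq] at this

theorem invSubst_eq {c : ℂ} (hc : c ≠ 0) (M : RMat n) :
    invSubst c M = (invHom c hc).mapMatrix M := rfl

theorem invSubst_qMatrix {c : ℂ} (hc : c ≠ 0) (q : ℂ) (M : RMat n) :
    invSubst c (qMatrix q M) = qMatrix q (invSubst c M) := by
  rw [invSubst_eq hc, qMatrix, map_add, map_one, qMatrix, invSubst_eq hc]
  congr 1
  ext i j
  change invHom c hc (RatFunc.C (q - 1) * M i j) = RatFunc.C (q - 1) * invHom c hc (M i j)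
  rw [map_mul, invHom_C]

theorem invSubst_reg {c w : ℂ} (hc : c ≠ 0) (hw : w ≠ 0) (h : RegAt M (1 / (c * w))) :
    RegAt (invSubst c M) w ∧ evalAt (invSubst c M) w = evalAt M (1 / (c * w)) :=
  ⟨fun i j => (invHom_mem hc hw (h i j)).1, by
    ext i j; exact (invHom_mem hc hw (h i j)).2⟩

theorem invSubst_reg_of_atInfty {c w : ℂ} (hc : c ≠ 0) (h : RegAt (atInfty M) (c * w)) :
    RegAt (invSubst c M) w ∧ evalAt (invSubst c M) w = evalAt (atInfty M) (c * w) :=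
  ⟨fun i j => (invHom_mem_of_one hc (h i j)).1, by
    ext i j; exact (invHom_mem_of_one hc (h i j)).2⟩

theorem atInfty_reg {w : ℂ} (hw : w ≠ 0) (h : RegAt M w⁻¹) :
    RegAt (atInfty M) w ∧ evalAt (atInfty M) w = evalAt M w⁻¹ := by
  have := invSubst_reg (M := M) (c := 1) one_ne_zero hw
  rw [one_mul, one_div] at this
  exact this h

theorem finite_poles (M : RMat n) : {z | ¬ RegAt M z}.Finite := by
  have : {z | ¬ RegAt M z} ⊆ ⋃ i, ⋃ j, {z | (M i j).denom.IsRoot z} := by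
    intro z hz
    simp only [RegAt, Set.mem_ofPred_eq, not_forall, not_not] at hz
    obtain ⟨i, j, h⟩ := hz
    exact Set.mem_iUnion.2 ⟨i, Set.mem_iUnion.2 ⟨j, h⟩⟩
  refine Set.Finite.subset (Set.finite_iUnion fun i => Set.finite_iUnion fun j => ?_) this
  exact Polynomial.finite_setOfPred_isRoot (RatFunc.denom_ne_zero _)

theorem isOpen_regAt (M : RMat n) : IsOpen {z | RegAt M z} := by
  have := (finite_poles M).isClosed.isOpen_compl
  convert this using 1
  ext z; simp

theorem matrix_analyticAt_iff {X : ℂ → Mat n} {z : ℂ} :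
    AnalyticAt ℂ X z ↔ ∀ i j, AnalyticAt ℂ (fun z => X z i j) z := by
  constructor
  · intro h i j
    let φ : Mat n →L[ℂ] ℂ := LinearMap.toContinuousLinearMap (Matrix.entryLinearMap ℂ ℂ i j)
    exact (φ.analyticAt _).comp h
  · intro h
    have hX : X = fun z => ∑ i, ∑ j, X z i j • Matrix.single i j (1 : ℂ) := by
      funext z
      conv_lhs => rw [Matrix.matrix_eq_sum_single (X z)]
      simp only [Matrix.smul_single, smul_eq_mul, mul_one]
    rw [hX]
    exact Finset.analyticAt_fun_sum _ fun i _ => Finset.analyticAt_fun_sum _ fun j _ =>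
      (h i j).fun_smul analyticAt_const

theorem analyticAt_evalAt (h : RegAt M z) : AnalyticAt ℂ (evalAt M) z :=
  matrix_analyticAt_iff.2 fun i j => analyticAt_eval (h i j)

/-- A point avoids the forward half-spirals of the poles exactly when its backward half-spiral meets
no pole. -/
theorem halfCut_eq (τ₀ : ℂ) (B : RMat n) : halfCut τ₀ B = sStar τ₀ {z | RegAt B z} := by
  ext z
  simp only [halfCut, sStar, Set.mem_ofPred_eq]
  constructor
  · intro h t ht
    by_contra hne
    refine h _ hne t ht ?_
    rw [mul_assoc, ← spiral_add, neg_add_cancel, spiral_zero, mul_one]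
  · rintro h p hp t ht rfl
    have := h t ht
    rw [mul_assoc, ← spiral_add, add_neg_cancel, spiral_zero, mul_one] at this
    exact hp this

theorem qReg_eq {q : ℂ} (hq : q - 1 ≠ 0) (B : RMat n) :
    qReg q (qMatrix q B) = qStar q {z | RegAt B z} := by
  ext z
  simp only [qReg, qStar, Set.mem_ofPred_eq, qMatrix_reg_iff hq]

/-- The passage to the abstract form of the equation, in which `A(0)⁻¹` has been moved to the other
side. -/
theorem isQGauge_iff {q : ℂ} (hq : q - 1 ≠ 0) {B : RMat n} (h0 : RegAt B 0)
    (hu : IsUnit (1 + (q - 1) • evalAt B 0)) (hq0 : q ≠ 0) (F : ℂ → Mat n) :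
    IsQGauge q (qMatrix q B) F ↔ QGauge q {z | RegAt B z} (evalAt B) F := by
  have hu' : IsUnit (1 + (q - 1) • evalAt B 0).det := (Matrix.isUnit_iff_isUnit_det _).1 hu
  have hz : ∀ z, q * z ∈ qStar q {z | RegAt B z} → RegAt B z := by
    intro z hz
    have := hz 1 le_rfl
    rwa [pow_one, mul_div_cancel_left₀ _ hq0] at this
  have heq : ∀ z, q * z ∈ qStar q {z | RegAt B z} →
      (F (q * z) = evalAt (qMatrix q B) z * F z * (evalAt (qMatrix q B) 0)⁻¹ ↔
      F (q * z) * (1 + (q - 1) • evalAt B 0) = (1 + (q - 1) • evalAt B z) * F z) := by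
    intro z h
    rw [(qMatrix_reg q (hz z h)).2, (qMatrix_reg q h0).2]
    constructor
    · intro h
      rw [h, Matrix.nonsing_inv_mul_cancel_right _ _ hu']
    · intro h
      rw [← h, Matrix.mul_nonsing_inv_cancel_right _ _ hu']
  constructor
  · rintro ⟨h1, h2, h3⟩
    rw [qReg_eq hq] at h1 h3
    exact ⟨fun z hz => matrix_analyticAt_iff.2 fun i j => h1 i j z hz, h2,
      fun z hz => (heq z hz).1 (h3 z hz)⟩
  · rintro ⟨h1, h2, h3⟩
    refine ⟨fun i j z hz => ?_, h2, fun z hz => ?_⟩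
    · rw [qReg_eq hq] at hz
      exact matrix_analyticAt_iff.1 (h1 z hz) i j
    · rw [qReg_eq hq] at hz
      exact (heq z hz).2 (h3 z hz)

theorem matrix_deriv_apply {X : ℂ → Mat n} {z : ℂ} (h : DifferentiableAt ℂ X z) (i j : Fin n) :
    deriv X z i j = deriv (fun y => X y i j) z := by
  let φ : Mat n →L[ℂ] ℂ := LinearMap.toContinuousLinearMap (Matrix.entryLinearMap ℂ ℂ i j)
  exact ((φ.hasFDerivAt.comp_hasDerivAt z h.hasDerivAt).deriv).symm

theorem isDiffGauge_iff {τ₀ : ℂ} {B : RMat n} (F : ℂ → Mat n) :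
    IsDiffGauge τ₀ B F ↔ DGauge τ₀ {z | RegAt B z} (evalAt B) F := by
  have heq : ∀ z, AnalyticAt ℂ F z → ((∀ i j, z * deriv (fun y => F y i j) z =
      (evalAt B z * F z - F z * evalAt B 0) i j) ↔
      z • deriv F z = evalAt B z * F z - F z * evalAt B 0) := by
    intro z hz
    constructor
    · intro h
      ext i j
      rw [← h i j, Matrix.smul_apply, matrix_deriv_apply hz.differentiableAt, smul_eq_mul]
    · intro h i j
      rw [← h, Matrix.smul_apply, matrix_deriv_apply hz.differentiableAt, smul_eq_mul]
  constructor
  · rintro ⟨h1, h2, h3⟩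
    rw [halfCut_eq] at h1 h3
    have ha : AnalyticOnNhd ℂ F (sStar τ₀ {z | RegAt B z}) := fun z hz =>
      matrix_analyticAt_iff.2 fun i j => h1 i j z hz
    exact ⟨ha, h2, fun z hz => (heq z (ha z hz)).1 (h3 z hz)⟩
  · rintro ⟨h1, h2, h3⟩
    refine ⟨fun i j z hz => ?_, h2, fun z hz => ?_⟩
    · rw [halfCut_eq] at hz
      exact matrix_analyticAt_iff.1 (h1 z hz) i j
    · rw [halfCut_eq] at hz
      exact (heq z (h1 z hz)).2 (h3 z hz)

end MatrixReg

end QDiff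

end

/-! ### Canonical solutions at `0`: existence, meromorphy, confluence -/

noncomputable section

namespace QDiff

attribute [local instance] Matrix.linftyOpNormedRing Matrix.linftyOpNormedAlgebra

/-- The local hypotheses at `0` under which the canonical solutions are studied. -/
structure SideData {n : ℕ} (B : ℝ → RMat n) (B' : RMat n) : Prop where
  nonres : NonResonant (evalAt B' 0)
  disc : ∃ ρ > 0, (∀ z ∈ Metric.closedBall (0 : ℂ) ρ, RegAt B' z) ∧
    ConvUnifOn B B' (Metric.closedBall 0 ρ)
  jordan : ConvJordan (fun ε => evalAt (B ε) 0) (evalAt B' 0)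

/-- The points of the cut sphere to which `B ε → B'` converges along the spiral. -/
structure GoodPoint {n : ℕ} (τ₀ : ℂ) (B : ℝ → RMat n) (B' : RMat n) (z : ℂ) : Prop where
  ne_zero : z ≠ 0
  off_spiral : ∀ t : ℝ, z ≠ spiral τ₀ t
  mem_halfCut : z ∈ halfCut τ₀ B'
  conv : ∀ T : ℝ, 0 ≤ T → ConvUnifOn B B' ((fun t : ℝ => z * spiral τ₀ (-t)) '' Set.Icc 0 T)

section Side

variable {n : ℕ} {τ₀ : ℂ} {B : ℝ → RMat n} {B' : RMat n}

theorem SideData.reg0 (h : SideData B B') : RegAt B' 0 := by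
  obtain ⟨ρ, hρ, h1, -⟩ := h.disc
  exact h1 0 (Metric.mem_closedBall_self hρ.le)

theorem SideData.exists_localConv (h : SideData B B') :
    ∃ ρ, LocalConv (fun ε => evalAt (B ε)) (evalAt B') ρ ∧
      ∀ᶠ ε in 𝓝[>] (0 : ℝ), Metric.ball 0 ρ ⊆ {z | RegAt (B ε) z} := by
  obtain ⟨ρ, hρ, h1, h2, h3⟩ := h.disc
  have hsub : Metric.ball (0 : ℂ) ρ ⊆ Metric.closedBall 0 ρ := Metric.ball_subset_closedBall
  refine ⟨ρ, ⟨hρ, ?_, ?_, ?_, h3.mono hsub⟩, h2.mono fun ε h z hz => h z (hsub hz)⟩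
  · exact h2.mono fun ε h z hz =>
      (analyticAt_evalAt (h z (hsub hz))).differentiableAt.differentiableWithinAt
  · exact fun z hz => (analyticAt_evalAt (h1 z (hsub hz))).differentiableAt.differentiableWithinAt
  · obtain ⟨M, hM⟩ := (isCompact_closedBall (0 : ℂ) ρ).exists_bound_of_continuousOn
      (f := evalAt B') fun z hz => (analyticAt_evalAt (h1 z hz)).continuousAt.continuousWithinAt
    exact ⟨M, fun z hz => hM z (hsub hz)⟩

theorem analyticOnNhd_evalAt (M : RMat n) : AnalyticOnNhd ℂ (evalAt M) {z | RegAt M z} :=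
  fun _ hz => analyticAt_evalAt hz

theorem existsUniqueOn_diffCanonical (hτ₀ : 0 < τ₀.im) (h0 : RegAt B' 0)
    (hres : NonResonant (evalAt B' 0)) :
    ExistsUniqueOn (IsDiffCanonical τ₀ B') (halfCut τ₀ B') := by
  constructor
  · obtain ⟨F, hF⟩ := exists_dGauge hτ₀ (isOpen_regAt B') h0 (analyticOnNhd_evalAt B') hres.sylv
    exact ⟨_, F, (isDiffGauge_iff F).2 hF, fun z => rfl⟩
  · rintro X Y ⟨F, hF, hX⟩ ⟨G, hG, hY⟩ z hz
    rw [halfCut_eq] at hz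
    have := DGauge.eqOn hτ₀ (isOpen_regAt B') h0 (analyticOnNhd_evalAt B') hres.sylv
      ((isDiffGauge_iff F).1 hF) ((isDiffGauge_iff G).1 hG) hz
    rw [hX, hY, this]

theorem eq_conj_of_reduce {Q M J : Mat n} (hQ : IsUnit Q.det) (h : Q⁻¹ * M * Q = J) :
    M = Q * J * Q⁻¹ := by
  rw [← h]
  simp only [Matrix.mul_assoc, Matrix.mul_nonsing_inv _ hQ, mul_one]
  rw [Matrix.mul_nonsing_inv_cancel_left _ _ hQ]

/-- The equivalent description of the canonical solutions by means of a Jordan family. -/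
theorem eventually_isQCanonical_iff (hτ₀ : 0 < τ₀.im) (h : SideData B B') {k : ℕ}
    {m : Fin k → ℕ} (e : (Σ i : Fin k, Fin (m i)) ≃ Fin n) {Q : ℝ → Mat n} {Q' : Mat n}
    {γ : ℝ → Fin k → ℂ} {γ' : Fin k → ℂ}
    (hJ : IsJordanFamily e (fun ε => evalAt (B ε) 0) (evalAt B' 0) Q Q' γ γ') :
    ∀ᶠ ε in 𝓝[>] (0 : ℝ), RegAt (B ε) 0 ∧ IsUnit (Q ε).det ∧
      (∀ i, 1 + (spiral τ₀ ε - 1) * γ ε i ≠ 0) ∧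
      (Q ε)⁻¹ * evalAt (B ε) 0 * Q ε = QDiff.jordan e (γ ε) ∧
      IsUnit (1 + (spiral τ₀ ε - 1) • evalAt (B ε) 0) ∧
      ∀ X, IsQCanonical (spiral τ₀ ε) (qMatrix (spiral τ₀ ε) (B ε)) X ↔
        ∃ F, QGauge (spiral τ₀ ε) {z | RegAt (B ε) z} (evalAt (B ε)) F ∧
          ∀ z, X z = F z * (Q ε * qLogCar e (spiral τ₀ ε) (γ ε) z * (Q ε)⁻¹) := by
  obtain ⟨ρ, hloc, hball⟩ := h.exists_localConv
  have hlim0 : Tendsto (fun ε => evalAt (B ε) 0) (𝓝[>] 0) (𝓝 (evalAt B' 0)) :=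
    hloc.unif.tendsto_at (Metric.mem_ball_self hloc.pos)
  have hc : ∀ᶠ ε in 𝓝[>] (0 : ℝ), ∀ i, 1 + (spiral τ₀ ε - 1) * γ ε i ≠ 0 :=
    eventually_all.2 fun i => (tendsto_one_add_mul τ₀ (hJ.tendsto_γ i)).eventually_ne one_ne_zero
  filter_upwards [hball, hc, hJ.isUnit, hJ.reduce, eventually_isUnit_one_add_smul τ₀ hlim0,
    self_mem_nhdsWithin] with ε h1 hc hQ hred hu hε
  have h0 : RegAt (B ε) 0 := h1 (Metric.mem_ball_self hloc.pos)
  have hq := spiral_sub_one_ne_zero hτ₀ hε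
  refine ⟨h0, hQ, hc, hred, hu, fun X => ?_⟩
  have hchar := isCharMatrix_jordan e (q := spiral τ₀ ε) (A := evalAt (qMatrix (spiral τ₀ ε) (B ε)) 0)
    hQ hc (by
      rw [(qMatrix_reg _ h0).2, mul_add, add_mul, mul_one, Matrix.mul_nonsing_inv _ hQ,
        mul_smul_comm, smul_mul_assoc, ← eq_conj_of_reduce hQ hred])
  constructor
  · rintro ⟨F, E, hF, hE, hX⟩
    refine ⟨F, (isQGauge_iff hq h0 hu (spiral_ne_zero _ _) F).1 hF, fun z => ?_⟩
    rw [hX, hE.unique hchar]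
  · rintro ⟨F, hF, hX⟩
    exact ⟨F, _, (isQGauge_iff hq h0 hu (spiral_ne_zero _ _) F).2 hF, hchar, hX⟩

theorem eventually_existsUniqueOn_qCanonical (hτ₀ : 0 < τ₀.im) (h : SideData B B') :
    ∀ᶠ ε in 𝓝[>] (0 : ℝ),
      ExistsUniqueOn (IsQCanonical (spiral τ₀ ε) (qMatrix (spiral τ₀ ε) (B ε)))
        (qReg (spiral τ₀ ε) (qMatrix (spiral τ₀ ε) (B ε))) := by
  obtain ⟨ρ, hloc, hball⟩ := h.exists_localConv
  obtain ⟨k, m, e, Q, Q', γ, γ', hJ⟩ := h.jordan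
  obtain ⟨s, -, -, K, f', -, -, -, hex, -⟩ := exists_qGauge_family hτ₀ hloc hball
    (Eventually.of_forall fun ε => analyticOnNhd_evalAt (B ε)) h.nonres.sylv
  filter_upwards [hex, eventually_isQCanonical_iff hτ₀ h e hJ, self_mem_nhdsWithin]
    with ε ⟨⟨F, hF⟩, huniq, _⟩ ⟨_, _, _, _, _, hiff⟩ hε
  refine ⟨⟨_, (hiff _).2 ⟨F, hF, fun z => rfl⟩⟩, fun X Y hX hY z hz => ?_⟩
  obtain ⟨F₁, hF₁, hX⟩ := (hiff X).1 hX
  obtain ⟨F₂, hF₂, hY⟩ := (hiff Y).1 hY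
  rw [qReg_eq (spiral_sub_one_ne_zero hτ₀ hε)] at hz
  rw [hX, hY, huniq F₁ F₂ hF₁ hF₂ hz]

/-! ### Meromorphic continuation -/

theorem exists_forall_norm_div_pow_lt {q : ℂ} (hq : 1 < ‖q‖) (r : ℝ) {s : ℝ} (hs : 0 < s) :
    ∃ N : ℕ, ∀ y : ℂ, ‖y‖ ≤ r → ∀ k, N ≤ k → ‖y / q ^ k‖ < s := by
  obtain ⟨N, hN⟩ := pow_unbounded_of_one_lt (r / s) hq
  refine ⟨N, fun y hy k hk => ?_⟩
  have h0 : 0 < ‖q‖ ^ k := by positivity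
  rw [norm_div, norm_pow, div_lt_iff₀ h0]
  rw [div_lt_iff₀ hs, mul_comm] at hN
  exact hy.trans_lt (hN.trans_le (mul_le_mul_of_nonneg_left
    (pow_le_pow_right₀ hq.le hk) hs.le))

/-- On a bounded neighbourhood of `z`, all but finitely many `z / q ^ k` fall into a disc free of
poles, and each remaining `k` excludes finitely many points. -/
theorem eventually_mem_qStar {q : ℂ} (hq : 1 < ‖q‖) {M : RMat n} (h0 : RegAt M 0) (z : ℂ) :
    ∀ᶠ y in 𝓝[≠] z, y ∈ qStar q {z | RegAt M z} := by
  have hq0 : q ≠ 0 := by rintro rfl; simp at hq; linarith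
  obtain ⟨ρ, hρ, hρR⟩ := Metric.isOpen_iff.1 (isOpen_regAt M) 0 h0
  obtain ⟨N, hN⟩ := exists_forall_norm_div_pow_lt hq (‖z‖ + 1) hρ
  have h1 : ∀ᶠ y in 𝓝[≠] z, ‖y‖ ≤ ‖z‖ + 1 := by
    refine ((continuous_norm.tendsto z).eventually_le_const ?_).filter_mono nhdsWithin_le_nhds
    linarith
  have h2 : ∀ᶠ y in 𝓝[≠] z, ∀ k ∈ Finset.range N, RegAt M (y / q ^ k) := by
    refine (eventually_all_finset _).2 fun k _ => ?_
    have hfin : {y | ¬ RegAt M (y / q ^ k)}.Finite := by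
      refine (finite_poles M).preimage (f := fun y => y / q ^ k) ?_
      intro a _ b _ hab
      exact (div_left_inj' (pow_ne_zero k hq0)).1 hab
    have := hfin.isClosed
    have h3 : ({y | ¬ RegAt M (y / q ^ k)} \ {z})ᶜ ∈ 𝓝 z :=
      ((hfin.subset Set.sdiff_subset).isClosed.isOpen_compl).mem_nhds (by simp)
    filter_upwards [nhdsWithin_le_nhds h3, self_mem_nhdsWithin] with y hy hyz
    by_contra hne
    exact hy ⟨hne, hyz⟩
  filter_upwards [h1, h2] with y h1 h2 k hk
  rcases lt_or_ge k N with h | h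
  · exact h2 k (Finset.mem_range.2 h)
  · refine hρR ?_
    rw [mem_ball_zero_iff]
    exact hN y h1 k h

theorem tendsto_mul_nhdsNE {q : ℂ} (hq : q ≠ 0) (z : ℂ) :
    Tendsto (fun y => q * y) (𝓝[≠] z) (𝓝[≠] (q * z)) := by
  refine tendsto_nhdsWithin_iff.2 ⟨(continuous_const_mul q).continuousAt.mono_left
    nhdsWithin_le_nhds, ?_⟩
  filter_upwards [self_mem_nhdsWithin] with y hy h
  exact hy (mul_left_cancel₀ hq h)

theorem matrix_mul_meromorphicAt {X Y : ℂ → Mat n} {z : ℂ}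
    (hX : ∀ i j, MeromorphicAt (fun z => X z i j) z)
    (hY : ∀ i j, MeromorphicAt (fun z => Y z i j) z) (i j : Fin n) :
    MeromorphicAt (fun z => (X z * Y z) i j) z := by
  simp only [Matrix.mul_apply]
  exact MeromorphicAt.fun_sum fun l _ => (hX i l).fun_mul (hY l j)

/-- Induction on the number of divisions by `q` needed to reach the disc of holomorphy. The equation
is only used on a punctured neighbourhood, where the values of `F` are controlled. -/
theorem QGauge.meromorphicAt {q : ℂ} (hq : 1 < ‖q‖) {M : RMat n} (h0 : RegAt M 0)
    (hu : IsUnit (1 + (q - 1) • evalAt M 0)) {F : ℂ → Mat n}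
    (hF : QGauge q {z | RegAt M z} (evalAt M) F) (z : ℂ) (i j : Fin n) :
    MeromorphicAt (fun z => F z i j) z := by
  have hq0 : q ≠ 0 := by rintro rfl; simp at hq; linarith
  have hu' : IsUnit (1 + (q - 1) • evalAt M 0).det := (Matrix.isUnit_iff_isUnit_det _).1 hu
  obtain ⟨ρ, hρ, hρR⟩ := Metric.isOpen_iff.1 (isOpen_regAt M) 0 h0
  have hsmall : ∀ z : ℂ, ‖z‖ < ρ → ∀ i j, MeromorphicAt (fun z => F z i j) z := by
    intro z hz i j
    refine (matrix_analyticAt_iff.1 (hF.analytic z ?_) i j).meromorphicAt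
    exact ball_subset_qStar hq hρR (by rwa [mem_ball_zero_iff])
  have hind : ∀ N : ℕ, ∀ z : ℂ, ‖z / q ^ N‖ < ρ → ∀ i j, MeromorphicAt (fun z => F z i j) z := by
    intro N
    induction N with
    | zero => intro z hz; rw [pow_zero, div_one] at hz; exact hsmall z hz
    | succ N ih =>
      intro z hz i j
      have hz' : ‖z / q / q ^ N‖ < ρ := by rwa [div_div, ← pow_succ']
      have hdiv : AnalyticAt ℂ (fun y : ℂ => y / q) z := analyticAt_id.div_const
      have hFq : ∀ i j, MeromorphicAt (fun y => F (y / q) i j) z := fun i j =>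
        MeromorphicAt.comp_analyticAt (g := fun y : ℂ => y / q) (ih (z / q) hz' i j) hdiv
      have hAq : ∀ i j, MeromorphicAt (fun y => (1 + (q - 1) • evalAt M (y / q)) i j) z := by
        intro i j
        simp only [Matrix.add_apply, Matrix.smul_apply, smul_eq_mul]
        exact (MeromorphicAt.const _ z).fun_add ((MeromorphicAt.const _ z).fun_mul
          (MeromorphicAt.comp_analyticAt (g := fun y : ℂ => y / q) (meromorphicAt_eval (z / q) (M i j))
            hdiv))
      have hprod := matrix_mul_meromorphicAt (matrix_mul_meromorphicAt hAq hFq)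
        (fun i j => MeromorphicAt.const ((1 + (q - 1) • evalAt M 0)⁻¹ i j) z) i j
      refine hprod.congr ?_
      filter_upwards [eventually_mem_qStar hq h0 z] with y hy
      have h1 := hF.eq (y / q) (by rwa [mul_div_cancel₀ _ hq0])
      rw [mul_div_cancel₀ _ hq0] at h1
      rw [← h1]
      exact congrFun (congrFun (Matrix.mul_nonsing_inv_cancel_right _ _ hu') i) j
  obtain ⟨N, hN⟩ := exists_norm_div_pow_lt hq z hρ
  exact hind N z hN i j

/-- Canonical solutions are meromorphic on `ℂ*` and solve the `q`-difference equation. -/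
theorem eventually_qCanonical_meromorphic (hτ₀ : 0 < τ₀.im) (h : SideData B B') :
    ∀ᶠ ε in 𝓝[>] (0 : ℝ), ∀ X,
      IsQCanonical (spiral τ₀ ε) (qMatrix (spiral τ₀ ε) (B ε)) X → ∀ z ≠ 0,
      (∀ i j, MeromorphicAt (fun z => X z i j) z) ∧
      ∀ᶠ y in 𝓝[≠] z, X (spiral τ₀ ε * y) = (1 + (spiral τ₀ ε - 1) • evalAt (B ε) y) * X y := by
  obtain ⟨k, m, e, Q, Q', γ, γ', hJ⟩ := h.jordan
  filter_upwards [eventually_isQCanonical_iff hτ₀ h e hJ, self_mem_nhdsWithin,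
    eventually_exists_theta_ne_zero hτ₀] with ε ⟨h0, hQ, hc, hred, hu, hiff⟩ hε hθ X hX z hz
  obtain ⟨F, hF, hX⟩ := (hiff X).1 hX
  have hq := one_lt_norm_spiral hτ₀ hε
  have hq0 := spiral_ne_zero τ₀ ε
  constructor
  · intro i j
    simp only [hX]
    exact matrix_mul_meromorphicAt (fun i j => hF.meromorphicAt hq h0 hu z i j)
      (matrix_mul_meromorphicAt (matrix_mul_meromorphicAt
        (fun i j => MeromorphicAt.const (Q ε i j) z)
        (fun i j => meromorphicAt_qLogCar hτ₀ hε e hc hz i j))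
        (fun i j => MeromorphicAt.const ((Q ε)⁻¹ i j) z)) i j
  · filter_upwards [(tendsto_mul_nhdsNE hq0 z).eventually (eventually_mem_qStar hq h0 _),
      eventually_theta_ne_zero_nhdsNE hτ₀ hε hθ hz,
      (eventually_ne_nhds hz).filter_mono nhdsWithin_le_nhds] with y h1 h2 hy
    have h3 := hF.eq y h1
    rw [hX, hX, qLogCar_mul e hτ₀ hε hc hy h2, ← mul_assoc (1 + _), ← h3]
    have hA : 1 + (spiral τ₀ ε - 1) • evalAt (B ε) 0 =
        Q ε * (1 + (spiral τ₀ ε - 1) • QDiff.jordan e (γ ε)) * (Q ε)⁻¹ := by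
      rw [mul_add, add_mul, mul_one, Matrix.mul_nonsing_inv _ hQ,
        mul_smul_comm, smul_mul_assoc, ← eq_conj_of_reduce hQ hred]
    rw [mul_assoc (F _), hA]
    congr 1
    simp only [Matrix.mul_assoc, Matrix.nonsing_inv_mul_cancel_left _ _ hQ]

/-! ### The differential side -/

/-- It is the preimage of the slit plane under the continuous map that brings `z` to the unit circle
along its spiral. -/
theorem isOpen_off_spiral (hτ₀ : 0 < τ₀.im) :
    IsOpen {z : ℂ | z ≠ 0 ∧ ∀ t : ℝ, z ≠ spiral τ₀ t} := by
  have hcont : ContinuousOn (fun z => -(z * spiral τ₀ (spiralParam τ₀ z))) {0}ᶜ := by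
    intro z hz
    have h1 : ContinuousAt (spiralParam τ₀) z := by
      have h1 : ContinuousAt (fun z : ℂ => Real.log ‖z‖) z :=
        continuous_norm.continuousAt.log (norm_ne_zero_iff.2 hz)
      exact h1.neg.div_const _
    exact (continuousAt_id.mul
      ((continuous_spiral τ₀).continuousAt.comp h1)).neg.continuousWithinAt
  have h2 := hcont.isOpen_inter_preimage isOpen_compl_singleton Complex.isOpen_slitPlane
  convert h2 using 1
  ext z
  constructor
  · rintro ⟨h1, h2⟩
    exact ⟨h1, neg_mul_spiral_mem_slitPlane hτ₀ h1 h2⟩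
  · rintro ⟨h1, h2⟩
    refine ⟨h1, ?_⟩
    rintro t rfl
    have hp : spiralParam τ₀ (spiral τ₀ t) = -t := by
      have hpi := Real.pi_pos
      rw [spiralParam, norm_spiral, Real.log_exp]
      field_simp
    rw [Set.mem_preimage, hp, ← spiral_add, add_neg_cancel, spiral_zero] at h2
    simp [Complex.mem_slitPlane_iff] at h2
    linarith

theorem analyticAt_logNeg (hτ₀ : 0 < τ₀.im) {z : ℂ} (hz : z ≠ 0)
    (hs : ∀ t : ℝ, z ≠ spiral τ₀ t) : AnalyticAt ℂ (logNeg τ₀) z := by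
  have hd : DifferentiableOn ℂ (logNeg τ₀) {z : ℂ | z ≠ 0 ∧ ∀ t : ℝ, z ≠ spiral τ₀ t} :=
    fun y hy => (hasDerivAt_logNeg hτ₀ hy.1 hy.2).differentiableAt.differentiableWithinAt
  exact hd.analyticAt ((isOpen_off_spiral hτ₀).mem_nhds ⟨hz, hs⟩)

/-- Frobenius solutions are holomorphic, invertible, and solve the differential system. -/
theorem IsDiffCanonical.isFundamentalAt (hτ₀ : 0 < τ₀.im) (h0 : RegAt B' 0)
    (hres : NonResonant (evalAt B' 0)) {X : ℂ → Mat n} (hX : IsDiffCanonical τ₀ B' X) {z : ℂ}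
    (hz : z ≠ 0) (hs : ∀ t : ℝ, z ≠ spiral τ₀ t) (hz' : z ∈ halfCut τ₀ B') :
    IsFundamentalAt X z ∧ HasDerivAt X (z⁻¹ • (evalAt B' z * X z)) z := by
  obtain ⟨F, hF, hX⟩ := hX
  rw [isDiffGauge_iff] at hF
  rw [halfCut_eq] at hz'
  have hXe : X = fun z => F z * NormedSpace.exp (logNeg τ₀ z • evalAt B' 0) := funext hX
  have hFa := hF.analytic z hz'
  have hexp : AnalyticAt ℂ (fun z => NormedSpace.exp (logNeg τ₀ z • evalAt B' 0)) z :=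
    AnalyticAt.fun_comp (f := fun z => logNeg τ₀ z • evalAt B' 0)
      (NormedSpace.exp_analytic (𝕂 := ℂ) (logNeg τ₀ z • evalAt B' 0))
      ((analyticAt_logNeg hτ₀ hz hs).fun_smul analyticAt_const)
  have hXa : AnalyticAt ℂ X z := by rw [hXe]; exact hFa.fun_mul hexp
  refine ⟨⟨matrix_analyticAt_iff.1 hXa, ?_⟩, ?_⟩
  · rw [hX, ← Matrix.isUnit_iff_isUnit_det]
    exact (hF.isUnit hτ₀ (isOpen_regAt B') h0 (analyticOnNhd_evalAt B') hres.sylv hz').mul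
      (Matrix.isUnit_exp _)
  · have h1 : HasDerivAt (fun z => NormedSpace.exp (logNeg τ₀ z • evalAt B' 0))
        (z⁻¹ • (evalAt B' 0 * NormedSpace.exp (logNeg τ₀ z • evalAt B' 0))) z :=
      (hasDerivAt_exp_smul_const' (evalAt B' 0) (logNeg τ₀ z)).scomp z
        (hasDerivAt_logNeg hτ₀ hz hs)
    have h2 : HasDerivAt (fun z => F z * NormedSpace.exp (logNeg τ₀ z • evalAt B' 0))
        (deriv F z * NormedSpace.exp (logNeg τ₀ z • evalAt B' 0) +
          F z * (z⁻¹ • (evalAt B' 0 * NormedSpace.exp (logNeg τ₀ z • evalAt B' 0)))) z :=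
      hFa.differentiableAt.hasDerivAt.mul h1
    rw [hX, hXe]
    refine h2.congr_deriv ?_
    have h3 : deriv F z = z⁻¹ • (evalAt B' z * F z - F z * evalAt B' 0) := by
      rw [← hF.eq z hz', smul_smul, inv_mul_cancel₀ hz, one_smul]
      rfl
    rw [h3, smul_mul_assoc, mul_smul_comm, ← smul_add, sub_mul]
    congr 1
    simp only [mul_assoc]
    abel

/-- Confluence of the canonical solutions. -/
theorem tendsto_qCanonical (hτ₀ : 0 < τ₀.im) (h : SideData B B') {z : ℂ}
    (hz : GoodPoint τ₀ B B' z) {X' : ℂ → Mat n} (hX' : IsDiffCanonical τ₀ B' X')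
    {X : ℝ → ℂ → Mat n}
    (hX : ∀ᶠ ε in 𝓝[>] (0 : ℝ),
      IsQCanonical (spiral τ₀ ε) (qMatrix (spiral τ₀ ε) (B ε)) (X ε)) :
    Tendsto (fun ε => X ε z) (𝓝[>] 0) (𝓝 (X' z)) ∧
      ∀ᶠ ε in 𝓝[>] (0 : ℝ), IsFundamentalAt (X ε) z := by
  obtain ⟨ρ, hloc, hball⟩ := h.exists_localConv
  obtain ⟨k, m, e, Q, Q', γ, γ', hJ⟩ := h.jordan
  have hiff := eventually_isQCanonical_iff hτ₀ h e hJ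
  have hch : ∀ ε, ∃ F : ℂ → Mat n, (∃ F, QGauge (spiral τ₀ ε) {z | RegAt (B ε) z} (evalAt (B ε)) F ∧
      ∀ z, X ε z = F z * (Q ε * qLogCar e (spiral τ₀ ε) (γ ε) z * (Q ε)⁻¹)) →
      QGauge (spiral τ₀ ε) {z | RegAt (B ε) z} (evalAt (B ε)) F ∧
      ∀ z, X ε z = F z * (Q ε * qLogCar e (spiral τ₀ ε) (γ ε) z * (Q ε)⁻¹) := by
    intro ε
    by_cases hex : ∃ F, QGauge (spiral τ₀ ε) {z | RegAt (B ε) z} (evalAt (B ε)) F ∧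
      ∀ z, X ε z = F z * (Q ε * qLogCar e (spiral τ₀ ε) (γ ε) z * (Q ε)⁻¹)
    · exact ⟨hex.choose, fun _ => hex.choose_spec⟩
    · exact ⟨0, fun h => absurd h hex⟩
  choose F hF using hch
  have hF : ∀ᶠ ε in 𝓝[>] (0 : ℝ), QGauge (spiral τ₀ ε) {z | RegAt (B ε) z} (evalAt (B ε)) (F ε) ∧
      ∀ z, X ε z = F ε z * (Q ε * qLogCar e (spiral τ₀ ε) (γ ε) z * (Q ε)⁻¹) := by
    filter_upwards [hiff, hX] with ε h1 h2
    exact hF ε ((h1.2.2.2.2.2 (X ε)).1 h2)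
  have hfund := hX'.isFundamentalAt hτ₀ h.reg0 h.nonres hz.ne_zero hz.off_spiral hz.mem_halfCut
  obtain ⟨F', hF', hX'⟩ := hX'
  rw [isDiffGauge_iff] at hF'
  have hzs := hz.mem_halfCut
  rw [halfCut_eq] at hzs
  obtain ⟨hmem, hlim⟩ := tendsto_qGauge hτ₀ hloc hball
    (Eventually.of_forall fun ε => analyticOnNhd_evalAt (B ε)) h.nonres.sylv (isOpen_regAt B')
    (analyticOnNhd_evalAt B') (hF.mono fun ε h => h.1) hF' hzs
    (fun T hT => (hz.conv T hT).1.mono fun ε h t ht => h _ ⟨t, ht, rfl⟩)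
    (fun T hT => (hz.conv T hT).2.comp _ |>.mono fun t ht => ⟨t, ht, rfl⟩) h.reg0
  have hQinv : Tendsto (fun ε => (Q ε)⁻¹) (𝓝[>] 0) (𝓝 Q'⁻¹) := by
    have := NormedRing.inverse_continuousAt
      ((Matrix.isUnit_iff_isUnit_det Q').2 hJ.isUnit').unit
    simp only [Matrix.nonsing_inv_eq_ringInverse]
    exact this.tendsto.comp hJ.tendsto_Q
  have hE := (hJ.tendsto_Q.mul (tendsto_qLogCar hτ₀ e hz.ne_zero hz.off_spiral
    hJ.tendsto_γ)).mul hQinv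
  have hE' : NormedSpace.exp (logNeg τ₀ z • evalAt B' 0) = Q' * diffLogCar e τ₀ γ' z * Q'⁻¹ := by
    rw [eq_conj_of_reduce hJ.isUnit' hJ.reduce', ← exp_smul_jordan,
      ← Matrix.exp_conj _ _ ((Matrix.isUnit_iff_isUnit_det Q').2 hJ.isUnit'), mul_smul_comm,
      smul_mul_assoc]
  have hXlim : Tendsto (fun ε => X ε z) (𝓝[>] 0) (𝓝 (X' z)) := by
    rw [hX', hE']
    refine (hlim.mul hE).congr' ?_
    filter_upwards [hF] with ε h
    rw [h.2]
  refine ⟨hXlim, ?_⟩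
  -- Invertibility for small `ε` is deduced from the invertibility of the limit.
  have hdet : ∀ᶠ ε in 𝓝[>] (0 : ℝ), (X ε z).det ≠ 0 :=
    ((Continuous.matrix_det continuous_id).continuousAt.tendsto.comp hXlim).eventually_ne
      hfund.1.2.ne_zero
  have hθ : ∀ᶠ ε in 𝓝[>] (0 : ℝ), ∀ i,
      theta (spiral τ₀ ε) ((1 + (spiral τ₀ ε - 1) * γ ε i)⁻¹ * z) ≠ 0 :=
    eventually_all.2 fun i => (tendsto_qChar hτ₀ hz.ne_zero hz.off_spiral (hJ.tendsto_γ i)).1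
  filter_upwards [hF, hmem, hdet, hθ, hiff, self_mem_nhdsWithin,
    eventually_theta_self_ne_zero hτ₀ hz.ne_zero hz.off_spiral] with ε hF hm hd hθ' hiff hε hθ
  refine ⟨matrix_analyticAt_iff.1 ?_, IsUnit.mk0 _ hd⟩
  have hXe : X ε = fun z => F ε z * (Q ε * qLogCar e (spiral τ₀ ε) (γ ε) z * (Q ε)⁻¹) :=
    funext hF.2
  rw [hXe]
  have hL : AnalyticAt ℂ (qLogCar e (spiral τ₀ ε) (γ ε)) z := matrix_analyticAt_iff.2
    (analyticAt_qLogCar hτ₀ hε e hiff.2.2.1 hz.ne_zero hθ hθ')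
  exact (hF.1.analytic z hm).fun_mul ((analyticAt_const.fun_mul hL).fun_mul analyticAt_const)

end Side

end QDiff

end

noncomputable section

namespace QDiff

attribute [local instance] Matrix.linftyOpNormedRing Matrix.linftyOpNormedAlgebra

/-! ### Uniform convergence under perturbation -/

/-- Needed because the coefficient at infinity is evaluated at `1 / (q w)`, a point that moves with
`ε`. -/
theorem tendstoUniformlyOn_comp_of_isCompact {ι α β E : Type*} [PseudoMetricSpace α]
    [PseudoMetricSpace E] {l : Filter ι} {f : ι → α → E} {f' : α → E} {K : Set α}
    (hK : IsCompact K) (hf : TendstoUniformlyOn f f' l K) (hf' : ContinuousOn f' K)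
    {φ : ι → β → α} {φ' : β → α} {K₀ : Set β} (hφ : TendstoUniformlyOn φ φ' l K₀)
    (hφK : ∀ᶠ i in l, ∀ x ∈ K₀, φ i x ∈ K) (hφK' : ∀ x ∈ K₀, φ' x ∈ K) :
    TendstoUniformlyOn (fun i x => f i (φ i x)) (fun x => f' (φ' x)) l K₀ := by
  rw [Metric.tendstoUniformlyOn_iff] at hf hφ ⊢
  intro δ hδ
  obtain ⟨r, hr, hu⟩ := Metric.uniformContinuousOn_iff.1
    (hK.uniformContinuousOn_of_continuous hf') (δ / 2) (by positivity)
  filter_upwards [hf (δ / 2) (by positivity), hφ r hr, hφK] with i h1 h2 h3 x hx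
  calc dist (f' (φ' x)) (f i (φ i x))
      ≤ dist (f' (φ' x)) (f' (φ i x)) + dist (f' (φ i x)) (f i (φ i x)) := dist_triangle _ _ _
    _ < δ / 2 + δ / 2 := add_lt_add (hu _ (hφK' x hx) _ (h3 x hx) (h2 x hx)) (h1 _ (h3 x hx))
    _ = δ := add_halves δ

/-- As `η → 0` with `β` bounded, the inverse tends to `1`; quantitatively, `G = 1 - G η β` bounds
`‖G‖` by `2 ‖1‖`, and then the correction `G η β β` is uniformly small. -/
theorem tendstoUniformlyOn_neg_inverse_mul {𝔸 α : Type*} [NormedRing 𝔸] [NormedAlgebra ℂ 𝔸]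
    [CompleteSpace 𝔸] {η : ℝ → ℂ} (hη : Tendsto η (𝓝[>] 0) (𝓝 0)) {β : ℝ → α → 𝔸} {β' : α → 𝔸}
    {K : Set α} (h : TendstoUniformlyOn β β' (𝓝[>] 0) K) {M : ℝ} (hM : ∀ x ∈ K, ‖β' x‖ ≤ M) :
    (∀ᶠ ε in 𝓝[>] (0 : ℝ), ∀ x ∈ K, IsUnit (1 + η ε • β ε x)) ∧
    TendstoUniformlyOn (fun ε x => -(Ring.inverse (1 + η ε • β ε x) * β ε x)) (fun x => -β' x)
      (𝓝[>] 0) K := by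
  rw [Metric.tendstoUniformlyOn_iff] at h
  have hbd : ∀ᶠ ε in 𝓝[>] (0 : ℝ), ∀ x ∈ K, ‖β ε x‖ ≤ M + 1 := by
    filter_upwards [h 1 one_pos] with ε h x hx
    have h1 := h x hx
    rw [dist_comm, dist_eq_norm] at h1
    have h2 := norm_le_norm_add_norm_sub' (β ε x) (β' x)
    linarith [hM x hx]
  have hηn : Tendsto (fun ε => ‖η ε‖ * (|M| + 1)) (𝓝[>] 0) (𝓝 0) := by
    simpa using hη.norm.mul_const (|M| + 1)
  have hsmall : ∀ c > 0, ∀ᶠ ε in 𝓝[>] (0 : ℝ), ∀ x ∈ K, ‖η ε • β ε x‖ < c := by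
    intro c hc
    filter_upwards [hbd, (tendsto_order.1 hηn).2 c hc] with ε h1 h2 x hx
    rw [norm_smul]
    refine lt_of_le_of_lt (mul_le_mul_of_nonneg_left ((h1 x hx).trans ?_) (norm_nonneg _)) h2
    linarith [le_abs_self M]
  have hunit : ∀ᶠ ε in 𝓝[>] (0 : ℝ), ∀ x ∈ K, IsUnit (1 + η ε • β ε x) := by
    filter_upwards [hsmall 1 one_pos] with ε h x hx
    have := isUnit_one_sub_of_norm_lt_one (x := -(η ε • β ε x)) (by rw [norm_neg]; exact h x hx)
    rwa [sub_neg_eq_add] at this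
  refine ⟨hunit, ?_⟩
  rw [Metric.tendstoUniformlyOn_iff]
  intro δ hδ
  set C : ℝ := 2 * ‖(1 : 𝔸)‖ * (|M| + 1) with hC
  have hC0 : 0 ≤ C := by positivity
  filter_upwards [hunit, hbd, h (δ / 2) (by positivity), hsmall (1 / 2) (by norm_num),
    hsmall (δ / (2 * (C + 1))) (by positivity)] with ε hu hb hd hs hs' x hx
  set b := β ε x
  set G := Ring.inverse (1 + η ε • b)
  have hG : G * (1 + η ε • b) = 1 := Ring.inverse_mul_cancel _ (hu x hx)
  have hG' : G = 1 - G * (η ε • b) := by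
    rw [mul_add, mul_one] at hG
    rw [← hG, add_sub_cancel_right]
  have hGn : ‖G‖ ≤ 2 * ‖(1 : 𝔸)‖ := by
    have h1 : ‖G‖ ≤ ‖(1 : 𝔸)‖ + ‖G‖ * (1 / 2) := by
      calc ‖G‖ = ‖1 - G * (η ε • b)‖ := congrArg _ hG'
        _ ≤ ‖(1 : 𝔸)‖ + ‖G * (η ε • b)‖ := norm_sub_le _ _
        _ ≤ ‖(1 : 𝔸)‖ + ‖G‖ * (1 / 2) := by
          gcongr
          exact (norm_mul_le _ _).trans (mul_le_mul_of_nonneg_left (hs x hx).le (norm_nonneg _))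
    linarith
  have heq : -β' x - -(G * b) = -(β' x - b) - G * (η ε • b) * b := by
    have : G * b = b - G * (η ε • b) * b := by
      conv_lhs => rw [hG', sub_mul, one_mul]
    rw [this]; abel
  rw [dist_eq_norm, heq]
  have hdx := hd x hx
  rw [dist_eq_norm] at hdx
  have hbM : ‖b‖ ≤ |M| + 1 := (hb x hx).trans (by linarith [le_abs_self M])
  have h3 : ‖G * (η ε • b) * b‖ ≤ C * (δ / (2 * (C + 1))) := by
    calc ‖G * (η ε • b) * b‖ ≤ ‖G‖ * ‖η ε • b‖ * ‖b‖ :=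
          (norm_mul_le _ _).trans (mul_le_mul_of_nonneg_right (norm_mul_le _ _) (norm_nonneg _))
      _ ≤ 2 * ‖(1 : 𝔸)‖ * (δ / (2 * (C + 1))) * (|M| + 1) := by
          gcongr
          exact (hs' x hx).le
      _ = C * (δ / (2 * (C + 1))) := by rw [hC]; ring
  have h4 : C * (δ / (2 * (C + 1))) < δ / 2 := by
    rw [mul_div_assoc', div_lt_div_iff₀ (by positivity) (by positivity)]
    nlinarith
  calc ‖-(β' x - b) - G * (η ε • b) * b‖ ≤ ‖-(β' x - b)‖ + ‖G * (η ε • b) * b‖ := norm_sub_le _ _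
    _ < δ / 2 + δ / 2 := by rw [norm_neg]; linarith
    _ = δ := add_halves δ

/-! ### The system at infinity -/

section Infinity

variable {n : ℕ} {τ₀ : ℂ} {B : ℝ → RMat n} {B' : RMat n}

/-- The matrix `D_ε` of the system at infinity. -/
def bInf (τ₀ : ℂ) (B : ℝ → RMat n) (ε : ℝ) : RMat n :=
  qDelta (spiral τ₀ ε) (qMatrixInfty (spiral τ₀ ε) (qMatrix (spiral τ₀ ε) (B ε)))

theorem qMatrix_bInf (hτ₀ : 0 < τ₀.im) (B : ℝ → RMat n) {ε : ℝ} (hε : 0 < ε) :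
    qMatrix (spiral τ₀ ε) (bInf τ₀ B ε) =
      qMatrixInfty (spiral τ₀ ε) (qMatrix (spiral τ₀ ε) (B ε)) :=
  qMatrix_qDelta (spiral_sub_one_ne_zero hτ₀ hε) _

/-- This rewriting removes the singular factor `η⁻¹` from the coefficient at infinity and makes its
limit `-b` visible. -/
theorem smul_inverse_sub_one {η : ℂ} (hη : η ≠ 0) {b : Mat n} (hu : IsUnit (1 + η • b).det) :
    η⁻¹ • ((1 + η • b)⁻¹ - 1) = -((1 + η • b)⁻¹ * b) := by
  have h : (1 + η • b)⁻¹ - 1 = -(η • ((1 + η • b)⁻¹ * b)) := by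
    have h1 := Matrix.nonsing_inv_mul _ hu
    rw [mul_add, mul_one, mul_smul_comm] at h1
    calc (1 + η • b)⁻¹ - 1
        = (1 + η • b)⁻¹ - ((1 + η • b)⁻¹ + η • ((1 + η • b)⁻¹ * b)) := by rw [h1]
      _ = _ := by abel
  rw [h, smul_neg, smul_smul, inv_mul_cancel₀ hη, one_smul]

theorem bInf_reg (hτ₀ : 0 < τ₀.im) {ε : ℝ} (hε : 0 < ε) {w : ℂ}
    (h : RegAt (invSubst (spiral τ₀ ε) (B ε)) w)
    (hu : IsUnit (1 + (spiral τ₀ ε - 1) • evalAt (invSubst (spiral τ₀ ε) (B ε)) w)) :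
    RegAt (qMatrixInfty (spiral τ₀ ε) (qMatrix (spiral τ₀ ε) (B ε))) w ∧ RegAt (bInf τ₀ B ε) w ∧
      evalAt (bInf τ₀ B ε) w =
      -((1 + (spiral τ₀ ε - 1) • evalAt (invSubst (spiral τ₀ ε) (B ε)) w)⁻¹ *
        evalAt (invSubst (spiral τ₀ ε) (B ε)) w) := by
  have hu' := (Matrix.isUnit_iff_isUnit_det _).1 hu
  have h1 := qMatrix_reg (spiral τ₀ ε) h
  rw [← h1.2] at hu'
  have h2 := h1.1.inv hu'
  rw [← invSubst_qMatrix (spiral_ne_zero τ₀ ε)] at h2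
  have h3 := qDelta_reg (spiral τ₀ ε) h2.1
  refine ⟨h2.1, h3.1, ?_⟩
  rw [bInf, qMatrixInfty, h3.2, h2.2.1, invSubst_qMatrix (spiral_ne_zero τ₀ ε), h1.2]
  rw [h1.2] at hu'
  exact smul_inverse_sub_one (spiral_sub_one_ne_zero hτ₀ hε) hu'

theorem convUnifOn_bInf (hτ₀ : 0 < τ₀.im) {K : Set ℂ} {β' : ℂ → Mat n}
    (h : ∀ᶠ ε in 𝓝[>] (0 : ℝ), ∀ w ∈ K, RegAt (invSubst (spiral τ₀ ε) (B ε)) w)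
    (hlim : TendstoUniformlyOn (fun ε => evalAt (invSubst (spiral τ₀ ε) (B ε))) β' (𝓝[>] 0) K)
    {M : ℝ} (hM : ∀ w ∈ K, ‖β' w‖ ≤ M) (hβ' : ∀ w ∈ K, evalAt (diffMatrixInfty B') w = -β' w) :
    ConvUnifOn (bInf τ₀ B) (diffMatrixInfty B') K := by
  obtain ⟨h1, h2⟩ := tendstoUniformlyOn_neg_inverse_mul (tendsto_spiral_sub_one τ₀) hlim hM
  constructor
  · filter_upwards [h, h1, self_mem_nhdsWithin] with ε h h1 hε w hw
    exact (bInf_reg hτ₀ hε (h w hw) (h1 w hw)).2.1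
  · refine (h2.congr ?_).congr_right fun w hw => (hβ' w hw).symm
    filter_upwards [h, h1, self_mem_nhdsWithin] with ε h h1 hε w hw
    rw [(bInf_reg hτ₀ hε (h w hw) (h1 w hw)).2.2, Matrix.nonsing_inv_eq_ringInverse]

theorem diffMatrixInfty_reg {w : ℂ} (h : RegAt (atInfty B') w) :
    RegAt (diffMatrixInfty B') w ∧ evalAt (diffMatrixInfty B') w = -evalAt (atInfty B') w :=
  h.neg

theorem NonResonant.neg {M : Mat n} (h : NonResonant M) : NonResonant (-M) := by
  intro a ha b hb hab k hk
  rw [← spectrum.neg_eq, Set.mem_neg] at ha hb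
  refine h _ ha _ hb (fun h => hab (neg_injective h)) (-k) ?_
  push_cast
  linear_combination -hk

/-- The radius is halved because `q w` must remain in the original disc, and `|q| < 2` for small
`ε`. -/
theorem exists_disc_bInf (hτ₀ : 0 < τ₀.im)
    (hB : ∃ ρ > 0, (∀ w ∈ Metric.closedBall (0 : ℂ) ρ, RegAt (atInfty B') w) ∧
      ConvUnifOn (fun ε => atInfty (B ε)) (atInfty B') (Metric.closedBall 0 ρ)) :
    (∃ ρ > 0, (∀ z ∈ Metric.closedBall (0 : ℂ) ρ, RegAt (diffMatrixInfty B') z) ∧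
      ConvUnifOn (bInf τ₀ B) (diffMatrixInfty B') (Metric.closedBall 0 ρ)) ∧
    ∀ᶠ ε in 𝓝[>] (0 : ℝ),
      RegAt (qMatrixInfty (spiral τ₀ ε) (qMatrix (spiral τ₀ ε) (B ε))) 0 ∧
      IsUnit (1 + (spiral τ₀ ε - 1) • evalAt (atInfty (B ε)) 0) ∧
      evalAt (bInf τ₀ B ε) 0 = -((1 + (spiral τ₀ ε - 1) • evalAt (atInfty (B ε)) 0)⁻¹ *
        evalAt (atInfty (B ε)) 0) := by
  obtain ⟨ρ, hρ, hreg, hB1, hB2⟩ := hB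
  have hcont : ContinuousOn (evalAt (atInfty B')) (Metric.closedBall 0 ρ) := fun w hw =>
    (analyticAt_evalAt (hreg w hw)).continuousAt.continuousWithinAt
  have hKsub : Metric.closedBall (0 : ℂ) (ρ / 2) ⊆ Metric.closedBall 0 ρ :=
    Metric.closedBall_subset_closedBall (by linarith)
  have hmaps : ∀ᶠ ε in 𝓝[>] (0 : ℝ), ∀ w ∈ Metric.closedBall (0 : ℂ) (ρ / 2),
      spiral τ₀ ε * w ∈ Metric.closedBall (0 : ℂ) ρ := by
    filter_upwards [(tendsto_order.1 (tendsto_spiral_one τ₀).norm).2 2 (by simp)] with ε h w hw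
    rw [mem_closedBall_zero_iff] at hw ⊢
    rw [norm_mul]
    nlinarith [norm_nonneg w, norm_nonneg (spiral τ₀ ε)]
  have hφ : TendstoUniformlyOn (fun (ε : ℝ) (w : ℂ) => spiral τ₀ ε * w) (fun w => w) (𝓝[>] 0)
      (Metric.closedBall (0 : ℂ) (ρ / 2)) := by
    rw [Metric.tendstoUniformlyOn_iff]
    intro δ hδ
    have h1 : Tendsto (fun ε => ‖spiral τ₀ ε - 1‖ * (ρ / 2)) (𝓝[>] 0) (𝓝 0) := by
      simpa using (tendsto_spiral_sub_one τ₀).norm.mul_const (ρ / 2)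
    filter_upwards [(tendsto_order.1 h1).2 δ hδ] with ε h w hw
    rw [mem_closedBall_zero_iff] at hw
    rw [dist_comm, dist_eq_norm, ← sub_one_mul, norm_mul]
    exact lt_of_le_of_lt (mul_le_mul_of_nonneg_left hw (norm_nonneg _)) h
  have hlim := tendstoUniformlyOn_comp_of_isCompact (isCompact_closedBall (0 : ℂ) ρ) hB2 hcont hφ
    hmaps fun w hw => hKsub hw
  have hregq : ∀ᶠ ε in 𝓝[>] (0 : ℝ), ∀ w ∈ Metric.closedBall (0 : ℂ) (ρ / 2),
      RegAt (invSubst (spiral τ₀ ε) (B ε)) w ∧ evalAt (invSubst (spiral τ₀ ε) (B ε)) w =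
        evalAt (atInfty (B ε)) (spiral τ₀ ε * w) := by
    filter_upwards [hB1, hmaps] with ε h1 h2 w hw
    exact invSubst_reg_of_atInfty (spiral_ne_zero τ₀ ε) (h1 _ (h2 w hw))
  have hlim' : TendstoUniformlyOn (fun ε => evalAt (invSubst (spiral τ₀ ε) (B ε)))
      (evalAt (atInfty B')) (𝓝[>] 0) (Metric.closedBall 0 (ρ / 2)) := by
    refine hlim.congr ?_
    filter_upwards [hregq] with ε h w hw
    exact (h w hw).2.symm
  obtain ⟨M, hM⟩ := (isCompact_closedBall (0 : ℂ) (ρ / 2)).exists_bound_of_continuousOn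
    (hcont.mono hKsub)
  refine ⟨⟨ρ / 2, by positivity, fun z hz => (diffMatrixInfty_reg (hreg z (hKsub hz))).1,
    convUnifOn_bInf hτ₀ (hregq.mono fun ε h w hw => (h w hw).1) hlim' hM
      fun w hw => (diffMatrixInfty_reg (hreg w (hKsub hw))).2⟩, ?_⟩
  have h0 : (0 : ℂ) ∈ Metric.closedBall (0 : ℂ) (ρ / 2) :=
    Metric.mem_closedBall_self (by positivity)
  filter_upwards [hregq, (tendstoUniformlyOn_neg_inverse_mul (tendsto_spiral_sub_one τ₀) hlim'
    hM).1, self_mem_nhdsWithin] with ε h1 h2 hε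
  have h3 := bInf_reg hτ₀ hε (h1 0 h0).1 (h2 0 h0)
  have h4 := h2 0 h0
  rw [(h1 0 h0).2, mul_zero] at h3 h4
  exact ⟨h3.1, h4, h3.2.2⟩

/-! ### Points of the cut sphere -/

theorem goodPoint_zero {z : ℂ} (hz : z ∈ fullCut τ₀ B') (hB : ConvergesEnough τ₀ B B') :
    GoodPoint τ₀ B B' z := by
  obtain ⟨h0, hs, hp⟩ := hz
  refine ⟨h0, hs, fun p hp' t _ => hp p hp' t, fun T hT => ?_⟩
  have hconv := hB.2.2 z h0 (-T) 0 (by linarith) fun t _ => by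
    by_contra h
    refine hp _ h (-t) ?_
    rw [mul_assoc, ← spiral_add, add_neg_cancel, spiral_zero, mul_one]
  have hsub : ((fun t : ℝ => z * spiral τ₀ (-t)) '' Set.Icc 0 T) ⊆
      ((fun t : ℝ => z * spiral τ₀ t) '' Set.Icc (-T) 0) := by
    rintro _ ⟨t, ht, rfl⟩
    exact ⟨-t, ⟨by linarith [ht.2], by linarith [ht.1]⟩, rfl⟩
  exact ⟨hconv.1.mono fun ε h y hy => h y (hsub hy), hconv.2.mono hsub⟩

theorem goodPoint_infty (hτ₀ : 0 < τ₀.im) {z : ℂ}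
    (hz : z ∈ fullCut τ₀ B') (hB : ConvergesEnough τ₀ B B') :
    GoodPoint τ₀ (bInf τ₀ B) (diffMatrixInfty B') z⁻¹ := by
  obtain ⟨h0, hs, hp⟩ := hz
  have hreg : ∀ t : ℝ, RegAt B' (z * spiral τ₀ t) := fun t => by
    by_contra h
    refine hp _ h (-t) ?_
    rw [mul_assoc, ← spiral_add, add_neg_cancel, spiral_zero, mul_one]
  have hinv : ∀ t : ℝ, (z⁻¹ * spiral τ₀ (-t))⁻¹ = z * spiral τ₀ t := fun t => by
    rw [mul_inv, inv_inv, spiral_neg, inv_inv]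
  have hne : ∀ t : ℝ, z⁻¹ * spiral τ₀ (-t) ≠ 0 := fun t =>
    mul_ne_zero (inv_ne_zero h0) (spiral_ne_zero _ _)
  have hregD : ∀ t : ℝ, RegAt (atInfty B') (z⁻¹ * spiral τ₀ (-t)) ∧
      evalAt (atInfty B') (z⁻¹ * spiral τ₀ (-t)) = evalAt B' (z⁻¹ * spiral τ₀ (-t))⁻¹ := fun t =>
    atInfty_reg (hne t) (by rw [hinv]; exact hreg t)
  refine ⟨inv_ne_zero h0, fun t ht => hs (-t) ?_, ?_, fun T hT => ?_⟩
  · rw [spiral_neg, ← ht, inv_inv]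
  · rw [halfCut_eq]
    exact fun t _ => (diffMatrixInfty_reg (hregD t).1).1
  · set K := (fun t : ℝ => z * spiral τ₀ t) '' Set.Icc (-1) T with hKdef
    set K₀ := (fun t : ℝ => z⁻¹ * spiral τ₀ (-t)) '' Set.Icc 0 T with hK₀def
    have hK : IsCompact K := isCompact_Icc.image (continuous_const.mul (continuous_spiral τ₀))
    have hconv := hB.2.2 z h0 (-1) T (by linarith) fun t _ => hreg t
    have hcont : ContinuousOn (evalAt B') K := by
      rintro _ ⟨t, ht, rfl⟩
      exact (analyticAt_evalAt (hreg t)).continuousAt.continuousWithinAt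
    have hval : ∀ (ε t : ℝ), (spiral τ₀ ε * (z⁻¹ * spiral τ₀ (-t)))⁻¹ = z * spiral τ₀ (t - ε) := by
      intro ε t
      rw [mul_inv, hinv, sub_eq_add_neg, spiral_add, spiral_neg]; ring
    have hmaps : ∀ᶠ ε in 𝓝[>] (0 : ℝ), ∀ w ∈ K₀, (spiral τ₀ ε * w)⁻¹ ∈ K := by
      filter_upwards [self_mem_nhdsWithin,
        (eventually_lt_nhds one_pos).filter_mono nhdsWithin_le_nhds] with ε hε hε1
      rintro _ ⟨t, ht, rfl⟩
      have hε : 0 < ε := hε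
      exact ⟨t - ε, ⟨by linarith [ht.1], by linarith [ht.2]⟩, (hval ε t).symm⟩
    have hmaps' : ∀ w ∈ K₀, w⁻¹ ∈ K := by
      rintro _ ⟨t, ht, rfl⟩
      exact ⟨t, ⟨by linarith [ht.1], ht.2⟩, (hinv t).symm⟩
    obtain ⟨C, hC⟩ := hK.exists_bound_of_continuousOn continuousOn_id
    have hφ : TendstoUniformlyOn (fun (ε : ℝ) (w : ℂ) => (spiral τ₀ ε * w)⁻¹) (fun w => w⁻¹)
        (𝓝[>] 0) K₀ := by
      rw [Metric.tendstoUniformlyOn_iff]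
      intro δ hδ
      have h1 : Tendsto (fun ε => ‖(spiral τ₀ ε)⁻¹ - 1‖ * C) (𝓝[>] 0) (𝓝 0) := by
        have := (((tendsto_spiral_one τ₀).inv₀ one_ne_zero).sub_const 1).norm.mul_const C
        simpa using this
      filter_upwards [(tendsto_order.1 h1).2 δ hδ] with ε h w hw
      rw [dist_comm, dist_eq_norm, mul_inv, ← sub_one_mul, norm_mul]
      exact lt_of_le_of_lt (mul_le_mul_of_nonneg_left (hC _ (hmaps' w hw)) (norm_nonneg _)) h
    have hlim := tendstoUniformlyOn_comp_of_isCompact hK hconv.2 hcont hφ hmaps hmaps'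
    have hregq : ∀ᶠ ε in 𝓝[>] (0 : ℝ), ∀ w ∈ K₀,
        RegAt (invSubst (spiral τ₀ ε) (B ε)) w ∧ evalAt (invSubst (spiral τ₀ ε) (B ε)) w =
          evalAt (B ε) (spiral τ₀ ε * w)⁻¹ := by
      filter_upwards [hconv.1, hmaps] with ε h1 h2 w hw
      have hw0 : w ≠ 0 := by
        obtain ⟨t, -, rfl⟩ := hw
        exact hne t
      have := invSubst_reg (M := B ε) (spiral_ne_zero τ₀ ε) hw0
      rw [one_div] at this
      exact this (h1 _ (h2 w hw))
    have hlim' : TendstoUniformlyOn (fun ε => evalAt (invSubst (spiral τ₀ ε) (B ε)))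
        (fun w => evalAt B' w⁻¹) (𝓝[>] 0) K₀ := by
      refine hlim.congr ?_
      filter_upwards [hregq] with ε h w hw
      exact (h w hw).2.symm
    obtain ⟨M, hM⟩ := hK.exists_bound_of_continuousOn hcont
    refine convUnifOn_bInf hτ₀ (hregq.mono fun ε h w hw => (h w hw).1) hlim'
      (fun w hw => hM _ (hmaps' w hw)) ?_
    rintro _ ⟨t, ht, rfl⟩
    rw [(diffMatrixInfty_reg (hregD t).1).2, (hregD t).2]

end Infinity

/-! ### The Jordan structure at infinity -/

section JordanInfinity

/-- The matrix with columns `T ^ (m - 1 - a) e_{m - 1}`. -/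
def cyclicMatrix {m : ℕ} (T : Matrix (Fin m) (Fin m) ℂ) : Matrix (Fin m) (Fin m) ℂ :=
  Matrix.of fun b a => (T ^ (m - 1 - (a : ℕ))) b ⟨m - 1, by have := a.2; omega⟩

/-- The columns form a chain: `T` sends each to the preceding one and kills the first because `T ^ m
= 0`. Thus any such `T` near `-shift m` is reduced to `shift m` by a matrix depending continuously
on `T`, and invertible at `-shift m`. -/
theorem mul_cyclicMatrix {m : ℕ} {T : Matrix (Fin m) (Fin m) ℂ} (hT : T ^ m = 0) :
    T * cyclicMatrix T = cyclicMatrix T * shift m := by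
  ext b a
  have ha := a.2
  have h1 : (T * cyclicMatrix T) b a = (T ^ (m - 1 - (a : ℕ) + 1)) b ⟨m - 1, by omega⟩ := by
    rw [pow_succ', Matrix.mul_apply, Matrix.mul_apply]; rfl
  rw [h1, Matrix.mul_apply]
  simp only [shift_apply, mul_ite, mul_one, mul_zero]
  rcases Nat.eq_zero_or_pos (a : ℕ) with h0 | h0
  · have h2 : m - 1 - (a : ℕ) + 1 = m := by omega
    rw [h2, hT, Matrix.zero_apply]
    symm
    refine Finset.sum_eq_zero fun x _ => if_neg (by omega)
  · rw [Finset.sum_eq_single (⟨a - 1, by omega⟩ : Fin m)]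
    · rw [if_pos (by simp only; omega)]
      simp only [cyclicMatrix, Matrix.of_apply]
      have h2 : m - 1 - (a : ℕ) + 1 = m - 1 - (a - 1) := by omega
      rw [h2]
    · intro x _ hx
      refine if_neg fun h => hx (Fin.ext ?_)
      simp only; omega
    · simp

theorem cyclicMatrix_neg_shift (m : ℕ) : IsUnit (cyclicMatrix (-shift m)).det := by
  have : cyclicMatrix (-shift m) = Matrix.diagonal fun a : Fin m => (-1 : ℂ) ^ (m - 1 - (a : ℕ)) := by
    ext b a
    have ha := a.2
    have hb := b.2
    simp only [cyclicMatrix, Matrix.of_apply]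
    rw [neg_pow, ← map_one (algebraMap ℂ _), ← map_neg, ← map_pow, ← Algebra.smul_def,
      Matrix.smul_apply, shift_pow_apply, Matrix.diagonal_apply, smul_eq_mul, mul_ite, mul_one,
      mul_zero]
    simp only [Fin.ext_iff]
    by_cases h : (b : ℕ) = a
    · rw [if_pos (by omega), if_pos h, h]
    · rw [if_neg (by omega), if_neg h]
  rw [this, Matrix.det_diagonal]
  exact IsUnit.mk0 _ (Finset.prod_ne_zero_iff.2 fun a _ => pow_ne_zero _ (by norm_num))

theorem continuous_cyclicMatrix (m : ℕ) :
    Continuous (cyclicMatrix : Matrix (Fin m) (Fin m) ℂ → _) := by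
  refine continuous_matrix fun b a => ?_
  exact (continuous_id.pow _).matrix_elem _ _

/-- The nilpotent part of `-(1 + η J)⁻¹ J` for a Jordan block `J`. -/
def nilPart (m : ℕ) (η γ : ℂ) : Matrix (Fin m) (Fin m) ℂ :=
  -((1 + η * γ)⁻¹ • ((1 + η • (γ • 1 + shift m))⁻¹ * shift m))

/-- It splits `-(1 + η J)⁻¹ J`, for a Jordan block `J`, into the scalar `-γ / (1 + η γ)` and a
nilpotent matrix that commutes with it. -/
theorem one_add_smul_mul_nilPart {m : ℕ} {η γ : ℂ} (hc : 1 + η * γ ≠ 0)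
    (hu : IsUnit (1 + η • (γ • 1 + shift m)).det) :
    (1 + η • (γ • 1 + shift m)) * ((-(γ / (1 + η * γ))) • 1 + nilPart m η γ) =
      -(γ • 1 + shift m) := by
  rw [mul_add, nilPart, mul_neg, mul_smul_comm, mul_one, mul_smul_comm,
    Matrix.mul_nonsing_inv_cancel_left _ _ hu]
  ext a b
  simp only [Matrix.add_apply, Matrix.smul_apply, Matrix.neg_apply, smul_eq_mul]
  have h := inv_mul_cancel₀ hc
  rw [div_eq_mul_inv]
  linear_combination (-(γ * (1 : Matrix (Fin m) (Fin m) ℂ) a b + shift m a b)) * h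

theorem nilPart_pow {m : ℕ} {η γ : ℂ} (hu : IsUnit (1 + η • (γ • 1 + shift m)).det) :
    nilPart m η γ ^ m = 0 := by
  have hcom : Commute (1 + η • (γ • 1 + shift m)) (shift m) := by
    refine (Commute.one_left _).add_left (Commute.smul_left (Commute.add_left ?_ ?_) _)
    · exact (Commute.one_left _).smul_left _
    · exact Commute.refl _
  have hcom' : Commute (1 + η • (γ • 1 + shift m))⁻¹ (shift m) := by
    obtain ⟨u, hu⟩ := (Matrix.isUnit_iff_isUnit_det _).2 hu
    rw [← hu] at hcom ⊢
    rw [← Matrix.coe_units_inv]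
    exact hcom.units_inv_left
  rw [nilPart, neg_pow, smul_pow, hcom'.mul_pow, shift_pow_eq_zero le_rfl, mul_zero, smul_zero,
    mul_zero]

theorem tendsto_nilPart (m : ℕ) {η γ : ℝ → ℂ} {γ' : ℂ} (hη : Tendsto η (𝓝[>] 0) (𝓝 0))
    (hγ : Tendsto γ (𝓝[>] 0) (𝓝 γ')) :
    Tendsto (fun ε => nilPart m (η ε) (γ ε)) (𝓝[>] 0) (𝓝 (-shift m)) ∧
    ∀ᶠ ε in 𝓝[>] (0 : ℝ), IsUnit (1 + η ε • (γ ε • 1 + shift m)).det := by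
  have h1 : Tendsto (fun ε => 1 + η ε • (γ ε • (1 : Matrix (Fin m) (Fin m) ℂ) + shift m)) (𝓝[>] 0)
      (𝓝 1) := by
    have := (hη.smul ((hγ.smul_const (1 : Matrix (Fin m) (Fin m) ℂ)).add_const
      (shift m))).const_add (1 : Matrix (Fin m) (Fin m) ℂ)
    rwa [zero_smul, add_zero] at this
  have h2 : Tendsto (fun ε => (1 + η ε * γ ε)⁻¹) (𝓝[>] 0) (𝓝 1) := by
    simpa using (((hη.mul hγ).const_add 1).inv₀ (by simp))
  have h3 : Tendsto (fun ε => (1 + η ε • (γ ε • (1 : Matrix (Fin m) (Fin m) ℂ) + shift m))⁻¹)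
      (𝓝[>] 0) (𝓝 1) := by
    have := NormedRing.inverse_continuousAt (1 : (Matrix (Fin m) (Fin m) ℂ)ˣ)
    simp only [Matrix.nonsing_inv_eq_ringInverse]
    have h4 := this.tendsto.comp h1
    rwa [Units.val_one, Ring.inverse_one] at h4
  constructor
  · have h4 := (h2.smul (h3.mul_const (shift m))).neg
    rwa [one_smul, one_mul] at h4
  · have h4 : Tendsto (fun ε => (1 + η ε • (γ ε • (1 : Matrix (Fin m) (Fin m) ℂ) + shift m)).det)
        (𝓝[>] 0) (𝓝 1) := by
      have := (Continuous.matrix_det continuous_id).continuousAt.tendsto.comp h1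
      rwa [id, Matrix.det_one] at this
    exact (h4.eventually_ne one_ne_zero).mono fun ε h => IsUnit.mk0 _ h

variable {n k : ℕ} {m : Fin k → ℕ} (e : (Σ i : Fin k, Fin (m i)) ≃ Fin n)

theorem continuous_blocksHom : Continuous (blocksHom e) :=
  (blocksHom e).toLinearMap.continuous_of_finiteDimensional

theorem isUnit_det_blocksHom {P : ∀ i, Matrix (Fin (m i)) (Fin (m i)) ℂ}
    (h : ∀ i, IsUnit (P i).det) : IsUnit (blocksHom e P).det := by
  rw [← Matrix.isUnit_iff_isUnit_det]
  refine IsUnit.map (blocksHom e) (Pi.isUnit_iff.2 fun i => ?_)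
  exact (Matrix.isUnit_iff_isUnit_det _).2 (h i)

theorem reduce_of_mul_eq {R D J : Mat n} (hR : IsUnit R.det) (h : D * R = R * J) :
    R⁻¹ * D * R = J := by
  rw [Matrix.mul_assoc, h, Matrix.nonsing_inv_mul_cancel_left _ _ hR]

theorem conj_cyclic_eq {m : ℕ} {δ : ℂ} {T : Matrix (Fin m) (Fin m) ℂ} (hT : T ^ m = 0) :
    (δ • 1 + T) * cyclicMatrix T = cyclicMatrix T * (δ • 1 + shift m) := by
  rw [add_mul, mul_add, mul_cyclicMatrix hT]
  simp

/-- On each Jordan block the new matrix is a scalar plus a nilpotent matrix tending to `-shift`. The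
cyclic vector construction reduces it to a single block of the same size, by a matrix with an
invertible limit, so the block sizes are unchanged and the reducing matrices converge. -/
theorem IsJordanFamily.neg_inverse {η : ℝ → ℂ} (hη : Tendsto η (𝓝[>] 0) (𝓝 0))
    {M D : ℝ → Mat n} {M' : Mat n} {Q : ℝ → Mat n} {Q' : Mat n} {γ : ℝ → Fin k → ℂ}
    {γ' : Fin k → ℂ} (h : IsJordanFamily e M M' Q Q' γ γ')
    (hD : ∀ᶠ ε in 𝓝[>] (0 : ℝ), IsUnit (1 + η ε • M ε) ∧
      D ε = -((1 + η ε • M ε)⁻¹ * M ε)) :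
    IsJordanFamily e D (-M')
      (fun ε => Q ε * blocksHom e fun i => cyclicMatrix (nilPart (m i) (η ε) (γ ε i)))
      (Q' * blocksHom e fun i => cyclicMatrix (-shift (m i)))
      (fun ε i => -(γ ε i / (1 + η ε * γ ε i))) (fun i => -γ' i) := by
  have hP : Tendsto (fun ε => blocksHom e fun i => cyclicMatrix (nilPart (m i) (η ε) (γ ε i)))
      (𝓝[>] 0) (𝓝 (blocksHom e fun i => cyclicMatrix (-shift (m i)))) :=
    ((continuous_blocksHom e).tendsto _).comp (tendsto_pi_nhds.2 fun i =>
      ((continuous_cyclicMatrix (m i)).tendsto _).comp (tendsto_nilPart (m i) hη (h.tendsto_γ i)).1)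
  have hPu' := isUnit_det_blocksHom e fun i => cyclicMatrix_neg_shift (m i)
  have hPu : ∀ᶠ ε in 𝓝[>] (0 : ℝ), IsUnit
      (blocksHom e fun i => cyclicMatrix (nilPart (m i) (η ε) (γ ε i))).det :=
    (((Continuous.matrix_det continuous_id).continuousAt.tendsto.comp hP).eventually_ne
      hPu'.ne_zero).mono fun ε h => IsUnit.mk0 _ h
  have hu : ∀ᶠ ε in 𝓝[>] (0 : ℝ), ∀ i,
      IsUnit (1 + η ε • (γ ε i • 1 + shift (m i))).det :=
    eventually_all.2 fun i => (tendsto_nilPart (m i) hη (h.tendsto_γ i)).2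
  have hc : ∀ i, Tendsto (fun ε => 1 + η ε * γ ε i) (𝓝[>] 0) (𝓝 1) := fun i => by
    simpa using (hη.mul (h.tendsto_γ i)).const_add 1
  have hc0 : ∀ᶠ ε in 𝓝[>] (0 : ℝ), ∀ i, 1 + η ε * γ ε i ≠ 0 :=
    eventually_all.2 fun i => (hc i).eventually_ne one_ne_zero
  have hRu : ∀ᶠ ε in 𝓝[>] (0 : ℝ), IsUnit
      (Q ε * blocksHom e fun i => cyclicMatrix (nilPart (m i) (η ε) (γ ε i))).det := by
    filter_upwards [h.isUnit, hPu] with ε h1 h2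
    rw [Matrix.det_mul]
    exact h1.mul h2
  have hRu' : IsUnit (Q' * blocksHom e fun i => cyclicMatrix (-shift (m i))).det := by
    rw [Matrix.det_mul]
    exact h.isUnit'.mul hPu'
  refine ⟨hRu, hRu', ?_, ?_, h.tendsto_Q.mul hP, fun i => ?_⟩
  · filter_upwards [hRu, h.isUnit, h.reduce, hu, hc0, hD] with ε hRu hQ hred hu hc ⟨hMu, hD⟩
    refine reduce_of_mul_eq hRu ?_
    have hM := eq_conj_of_reduce hQ hred
    set J : ∀ i, Matrix (Fin (m i)) (Fin (m i)) ℂ := (fun i => γ ε i • 1) + fun i => shift (m i)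
    set H : ∀ i, Matrix (Fin (m i)) (Fin (m i)) ℂ := fun i =>
      (-(γ ε i / (1 + η ε * γ ε i))) • 1 + nilPart (m i) (η ε) (γ ε i) with hH
    have hDH : D ε = Q ε * blocksHom e H * (Q ε)⁻¹ := by
      have h1 : (1 + η ε • M ε) * (Q ε * blocksHom e H * (Q ε)⁻¹) = -M ε := by
        rw [hM, ← conjHom_apply _ hQ, ← conjHom_apply _ hQ, jordan_eq, ← map_smul, ← map_smul,
          ← map_one (conjHom (Q ε) hQ), ← map_one (blocksHom e), ← map_add, ← map_add, ← map_mul,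
          ← map_mul, ← map_neg, ← map_neg]
        congr 2
        funext i
        exact one_add_smul_mul_nilPart (hc i) (hu i)
      rw [hD, ← mul_neg, ← h1,
        Matrix.nonsing_inv_mul_cancel_left _ _ ((Matrix.isUnit_iff_isUnit_det _).1 hMu)]
    rw [hDH, jordan_eq, Matrix.mul_assoc, Matrix.nonsing_inv_mul_cancel_left _ _ hQ,
      Matrix.mul_assoc, Matrix.mul_assoc, ← map_mul, ← map_mul]
    congr 2
    funext i
    exact conj_cyclic_eq (nilPart_pow (hu i))
  · refine reduce_of_mul_eq hRu' ?_
    have hM := eq_conj_of_reduce h.isUnit' h.reduce'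
    have hneg : -M' = Q' * blocksHom e (fun i => (-γ' i) • 1 + -shift (m i)) * Q'⁻¹ := by
      rw [hM, jordan_eq, ← conjHom_apply _ h.isUnit', ← conjHom_apply _ h.isUnit', ← map_neg,
        ← map_neg]
      congr 2
      funext i
      simp only [Pi.neg_apply, Pi.add_apply, neg_smul]
      abel
    rw [hneg, jordan_eq, Matrix.mul_assoc, Matrix.nonsing_inv_mul_cancel_left _ _ h.isUnit',
      Matrix.mul_assoc, Matrix.mul_assoc, ← map_mul, ← map_mul]
    congr 2
    funext i
    refine conj_cyclic_eq ?_
    rw [neg_pow, shift_pow_eq_zero le_rfl, mul_zero]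
  · have := ((h.tendsto_γ i).div (hc i) one_ne_zero).neg
    rwa [div_one] at this

end JordanInfinity

end QDiff

end

noncomputable section

namespace QDiff

attribute [local instance] Matrix.linftyOpNormedRing Matrix.linftyOpNormedAlgebra

/-! ### The connection matrix: local constancy and ellipticity -/

section Connection

variable {n : ℕ} {τ₀ : ℂ} {B : ℝ → RMat n} {B' : RMat n}

theorem isOpen_fullCut (hτ₀ : 0 < τ₀.im) (B' : RMat n) (h0 : RegAt B' 0) :
    IsOpen (fullCut τ₀ B') := by
  have hS := isOpen_off_spiral hτ₀
  have hp : ∀ p, ¬ RegAt B' p → IsOpen {z : ℂ | z / p ≠ 0 ∧ ∀ t : ℝ, z / p ≠ spiral τ₀ t} :=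
    fun p _ => hS.preimage (continuous_id.div_const p)
  have : fullCut τ₀ B' = {z : ℂ | z ≠ 0 ∧ ∀ t : ℝ, z ≠ spiral τ₀ t} ∩
      ⋂ p ∈ {p | ¬ RegAt B' p}, {z : ℂ | z / p ≠ 0 ∧ ∀ t : ℝ, z / p ≠ spiral τ₀ t} := by
    ext z
    simp only [fullCut, Set.mem_ofPred_eq, Set.mem_inter_iff, Set.mem_iInter]
    constructor
    · rintro ⟨h1, h2, h3⟩
      refine ⟨⟨h1, h2⟩, fun p hp => ?_⟩
      have hp0 : p ≠ 0 := by rintro rfl; exact hp h0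
      refine ⟨div_ne_zero h1 hp0, fun t ht => h3 p hp t ?_⟩
      rw [← ht, mul_div_cancel₀ _ hp0]
    · rintro ⟨⟨h1, h2⟩, h3⟩
      refine ⟨h1, h2, ?_⟩
      rintro p hp t rfl
      have hp0 : p ≠ 0 := by rintro rfl; exact hp h0
      exact (h3 p hp).2 t (mul_div_cancel_left₀ _ hp0)
  rw [this]
  exact hS.inter ((finite_poles B').isOpen_biInter hp)

/-- Two solutions of the same linear system differ by a constant factor. -/
theorem hasDerivAt_inv_mul {X Y : ℂ → Mat n} {L : Mat n} {z : ℂ} (hX : HasDerivAt X (L * X z) z)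
    (hY : HasDerivAt Y (L * Y z) z) (hu : IsUnit (Y z)) :
    HasDerivAt (fun z => (Y z)⁻¹ * X z) 0 z := by
  obtain ⟨u, hu⟩ := hu
  have h1 := hasFDerivAt_ringInverse (𝕜 := ℂ) u
  rw [hu] at h1
  have h2 := h1.comp_hasDerivAt z hY
  have h3 : HasDerivAt (fun z => Ring.inverse (Y z) * X z) _ z := h2.mul hX
  simp only [Matrix.nonsing_inv_eq_ringInverse]
  refine h3.congr_deriv ?_
  have h4 : Y z = (u : Mat n) := hu.symm
  simp only [Function.comp, h4, Ring.inverse_unit, neg_apply,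
    ContinuousLinearMap.mulLeftRight_apply]
  simp only [mul_assoc, Units.mul_inv_cancel_left, neg_mul]
  simp

/-- Both solutions satisfy `δX = B' X` in the variable `z`, so the derivative of the quotient
vanishes on the open cut sphere. -/
theorem conn_locally_constant (hτ₀ : 0 < τ₀.im) (h0 : RegAt B' 0)
    (hres0 : NonResonant (evalAt B' 0)) (h0i : RegAt (diffMatrixInfty B') 0)
    (hresi : NonResonant (evalAt (diffMatrixInfty B') 0)) {X Y : ℂ → Mat n}
    (hX : IsDiffCanonical τ₀ B' X) (hY : IsDiffCanonical τ₀ (diffMatrixInfty B') Y)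
    (hgood : ∀ z ∈ fullCut τ₀ B', z⁻¹ ∈ halfCut τ₀ (diffMatrixInfty B')) {z : ℂ}
    (hz : z ∈ fullCut τ₀ B') :
    IsFundamentalAt X z ∧ IsFundamentalAt Y z⁻¹ ∧ ∀ᶠ y in 𝓝 z, conn X Y y = conn X Y z := by
  have hoff : ∀ z ∈ fullCut τ₀ B', ∀ t : ℝ, z⁻¹ ≠ spiral τ₀ t := by
    intro z hz t ht
    exact hz.2.1 (-t) (by rw [spiral_neg, ← ht, inv_inv])
  have hXf := fun z (hz : z ∈ fullCut τ₀ B') => hX.isFundamentalAt hτ₀ h0 hres0 hz.1 hz.2.1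
    fun p hp t _ => hz.2.2 p hp t
  have hYf := fun z (hz : z ∈ fullCut τ₀ B') => hY.isFundamentalAt hτ₀ h0i hresi (inv_ne_zero hz.1)
    (hoff z hz) (hgood z hz)
  refine ⟨(hXf z hz).1, (hYf z hz).1, ?_⟩
  have hderiv : ∀ y ∈ fullCut τ₀ B', HasDerivAt (conn X Y) 0 y := by
    intro y hy
    have hB : evalAt (diffMatrixInfty B') y⁻¹ = -evalAt B' y := by
      have hr : RegAt B' y⁻¹⁻¹ := by
        rw [inv_inv]
        by_contra h
        exact hy.2.2 y h 0 (by rw [spiral_zero, mul_one])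
      have h1 := atInfty_reg (inv_ne_zero hy.1) hr
      rw [(diffMatrixInfty_reg h1.1).2, h1.2, inv_inv]
    have h1 : HasDerivAt X ((y⁻¹ • evalAt B' y) * X y) y := by
      rw [smul_mul_assoc]; exact (hXf y hy).2
    have h2 : HasDerivAt (fun z => Y z⁻¹) ((y⁻¹ • evalAt B' y) * Y y⁻¹) y := by
      -- The sign produced by differentiating `z⁻¹` cancels the one in `D(w) = -B'(1/w)`.
      refine ((hYf y hy).2.scomp y (hasDerivAt_inv hy.1)).congr_deriv ?_
      have hy0 := hy.1
      rw [hB, inv_inv, smul_smul, neg_mul, neg_mul, smul_neg, neg_smul, neg_neg, smul_mul_assoc]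
      congr 1
      field_simp
    exact hasDerivAt_inv_mul h1 h2 ((Matrix.isUnit_iff_isUnit_det _).2 (hYf y hy).1.2)
  obtain ⟨r, hr, hball⟩ := Metric.isOpen_iff.1 (isOpen_fullCut hτ₀ B' h0) z hz
  filter_upwards [Metric.ball_mem_nhds z hr] with y hy
  exact (convex_ball z r).is_const_of_fderivWithin_eq_zero (𝕜 := ℂ)
    (fun w hw => (hderiv w (hball hw)).differentiableAt.differentiableWithinAt)
    (fun w hw => by
      rw [fderivWithin_of_isOpen Metric.isOpen_ball hw]
      exact (hderiv w (hball hw)).hasFDerivAt.fderiv.trans (by simp; rfl)) hy (Metric.mem_ball_self hr)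

theorem matrix_det_meromorphicAt {X : ℂ → Mat n} {z : ℂ}
    (hX : ∀ i j, MeromorphicAt (fun z => X z i j) z) : MeromorphicAt (fun z => (X z).det) z := by
  simp only [Matrix.det_apply']
  exact MeromorphicAt.fun_sum fun σ _ => (MeromorphicAt.const _ z).fun_mul
    (MeromorphicAt.fun_prod (F := fun i z => X z (σ i) i) fun i _ => hX (σ i) i)

theorem matrix_inv_meromorphicAt {X : ℂ → Mat n} {z : ℂ}
    (hX : ∀ i j, MeromorphicAt (fun z => X z i j) z) (i j : Fin n) :
    MeromorphicAt (fun z => (X z)⁻¹ i j) z := by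
  simp only [Matrix.inv_def, Ring.inverse_eq_inv', Matrix.smul_apply, smul_eq_mul,
    Matrix.adjugate_apply]
  refine (matrix_det_meromorphicAt hX).fun_inv.fun_mul (matrix_det_meromorphicAt fun a b => ?_)
  simp only [Matrix.updateRow_apply]
  split_ifs
  · exact MeromorphicAt.const _ z
  · exact hX a b

theorem tendsto_inv_mul_nhdsNE {q : ℂ} (hq : q ≠ 0) {z : ℂ} (hz : z ≠ 0) :
    Tendsto (fun y => (q * y)⁻¹) (𝓝[≠] z) (𝓝[≠] (q * z)⁻¹) := by
  refine tendsto_nhdsWithin_iff.2 ⟨?_, ?_⟩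
  · exact (((continuous_const_mul q).tendsto z).inv₀ (mul_ne_zero hq hz)).mono_left
      nhdsWithin_le_nhds
  · filter_upwards [self_mem_nhdsWithin] with y hy h
    exact hy (mul_left_cancel₀ hq (inv_injective h))

/-- Read at `w = (q y)⁻¹`, the equation at infinity says `Y(y⁻¹) = b(y)⁻¹ Y((q y)⁻¹)`. The factor
`b(y)` thus cancels between the two solutions. -/
theorem isElliptic_conn {q : ℂ} (hq : q ≠ 0) {b d : ℂ → Mat n} {X Y : ℂ → Mat n}
    (hX : ∀ z ≠ 0, (∀ i j, MeromorphicAt (fun z => X z i j) z) ∧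
      ∀ᶠ y in 𝓝[≠] z, X (q * y) = b y * X y)
    (hY : ∀ z ≠ 0, (∀ i j, MeromorphicAt (fun z => Y z i j) z) ∧
      ∀ᶠ y in 𝓝[≠] z, Y (q * y) = d y * Y y)
    (hbd : ∀ z ≠ 0, ∀ᶠ y in 𝓝[≠] z, IsUnit (b y).det ∧ d (q * y)⁻¹ = (b y)⁻¹) :
    IsElliptic q (conn X Y) := by
  constructor
  · intro i j z hz
    have hYi : ∀ i j, MeromorphicAt (fun z => Y z⁻¹ i j) z := fun i j =>
      MeromorphicAt.comp_analyticAt (g := fun z : ℂ => z⁻¹) ((hY z⁻¹ (inv_ne_zero hz)).1 i j)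
        (analyticAt_inv hz)
    exact matrix_mul_meromorphicAt (matrix_inv_meromorphicAt hYi) (hX z hz).1 i j
  · refine mem_codiscreteWithin_iff_forall_mem_nhdsNE.2 fun z hz => ?_
    filter_upwards [(hX z hz).2, hbd z hz, (tendsto_inv_mul_nhdsNE hq hz).eventually
      (hY _ (inv_ne_zero (mul_ne_zero hq hz))).2] with y h1 h2 h3
    left
    have h4 : q * (q * y)⁻¹ = y⁻¹ := by
      rw [mul_inv, mul_inv_cancel_left₀ hq]
    rw [h4, h2.2] at h3
    change (Y (q * y)⁻¹)⁻¹ * X (q * y) = (Y y⁻¹)⁻¹ * X y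
    -- The inverse of a product is reversed for singular matrices too, so only `b y` has to be
    -- invertible here.
    rw [h3, h1, Matrix.mul_inv_rev, Matrix.nonsing_inv_nonsing_inv _ h2.1, mul_assoc]

theorem eventually_regAt_nhdsNE (M : RMat n) (z : ℂ) : ∀ᶠ y in 𝓝[≠] z, RegAt M y := by
  have h : ({y | ¬ RegAt M y} \ {z}).Finite := (finite_poles M).subset Set.sdiff_subset
  have hmem : ({y | ¬ RegAt M y} \ {z})ᶜ ∈ 𝓝 z := h.isClosed.isOpen_compl.mem_nhds (by simp)
  filter_upwards [nhdsWithin_le_nhds hmem,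
    self_mem_nhdsWithin] with y hy hyz
  by_contra hne
  exact hy ⟨hne, hyz⟩

/-- Away from the finitely many poles of `M` and of `M⁻¹`, the identity `M⁻¹ M = 1` can be
evaluated. -/
theorem eventually_isUnit_det_nhdsNE {M : RMat n} (hM : IsUnit M.det) (z : ℂ) :
    ∀ᶠ y in 𝓝[≠] z, RegAt M y ∧ IsUnit (evalAt M y).det := by
  filter_upwards [eventually_regAt_nhdsNE M z, eventually_regAt_nhdsNE M⁻¹ z] with y h1 h2
  refine ⟨h1, ?_⟩
  have h3 := (h2.mul h1).2
  rw [Matrix.nonsing_inv_mul _ hM, regAt_one.2] at h3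
  exact Matrix.isUnit_det_of_left_inverse h3.symm

end Connection

/-! ### The confluence theorem for canonical solutions -/

section Canonical

variable {n : ℕ} {τ₀ : ℂ} {B : ℝ → RMat n} {B' : RMat n}

theorem ConvJordan.congr {M M₁ : ℝ → Mat n} {M' : Mat n} (h : ConvJordan M M')
    (heq : ∀ᶠ ε in 𝓝[>] (0 : ℝ), M ε = M₁ ε) : ConvJordan M₁ M' := by
  obtain ⟨k, m, e, Q, Q', γ, γ', h⟩ := h
  refine ⟨k, m, e, Q, Q', γ, γ', h.isUnit, h.isUnit', ?_, h.reduce', h.tendsto_Q, h.tendsto_γ⟩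
  filter_upwards [h.reduce, heq] with ε h1 h2
  rw [← h2, h1]

theorem deltaValue_eq {q : ℂ} {C : RMat n} (h : RegAt C 0) :
    deltaValue q C = evalAt (qDelta q C) 0 := (qDelta_reg q h).2.symm

theorem convJordan_bInf (hτ₀ : 0 < τ₀.im) (hregInf : RegAt (atInfty B') 0)
    (hB : ConvergesEnough τ₀ B B')
    (hC : ConvJordan (fun ε => evalAt (atInfty (B ε)) 0) (evalAt (atInfty B') 0)) :
    ConvJordan (fun ε => evalAt (bInf τ₀ B ε) 0) (evalAt (diffMatrixInfty B') 0) := by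
  obtain ⟨k, m, e, Q, Q', γ, γ', h⟩ := hC
  rw [(diffMatrixInfty_reg hregInf).2]
  exact ⟨k, m, e, _, _, _, _, h.neg_inverse e (tendsto_spiral_sub_one τ₀)
    ((exists_disc_bInf hτ₀ hB.2.1).2.mono fun ε h => h.2)⟩

theorem eventually_deltaValue_eq (hτ₀ : 0 < τ₀.im) (hB : ConvergesEnough τ₀ B B') :
    ∀ᶠ ε in 𝓝[>] (0 : ℝ), deltaValue (spiral τ₀ ε)
      (qMatrixInfty (spiral τ₀ ε) (qMatrix (spiral τ₀ ε) (B ε))) = evalAt (bInf τ₀ B ε) 0 :=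
  (exists_disc_bInf hτ₀ hB.2.1).2.mono fun _ h => deltaValue_eq h.1

theorem sideData_zero (hres0 : NonResonant (evalAt B' 0)) (hB : ConvergesEnough τ₀ B B')
    (hC0 : ConvJordan (fun ε => evalAt (B ε) 0) (evalAt B' 0)) : SideData B B' :=
  ⟨hres0, hB.1, hC0⟩

theorem sideData_infty (hτ₀ : 0 < τ₀.im) (hregInf : RegAt (atInfty B') 0)
    (hresInf : NonResonant (evalAt (atInfty B') 0)) (hB : ConvergesEnough τ₀ B B')
    (hCinf : ConvJordan (fun ε => evalAt (atInfty (B ε)) 0) (evalAt (atInfty B') 0)) :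
    SideData (bInf τ₀ B) (diffMatrixInfty B') := by
  refine ⟨?_, (exists_disc_bInf hτ₀ hB.2.1).1, convJordan_bInf hτ₀ hregInf hB hCinf⟩
  rw [(diffMatrixInfty_reg hregInf).2]
  exact hresInf.neg

/-- Generic relation between the coefficients of the systems at `0` and at `∞`. -/
theorem eventually_coeff_infty (hτ₀ : 0 < τ₀.im) {ε : ℝ} (hε : 0 < ε) (h0 : RegAt (B ε) 0)
    (hu : IsUnit (1 + (spiral τ₀ ε - 1) • evalAt (B ε) 0)) {z : ℂ} (hz : z ≠ 0) :
    ∀ᶠ y in 𝓝[≠] z, IsUnit (1 + (spiral τ₀ ε - 1) • evalAt (B ε) y).det ∧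
      1 + (spiral τ₀ ε - 1) • evalAt (bInf τ₀ B ε) (spiral τ₀ ε * y)⁻¹ =
        (1 + (spiral τ₀ ε - 1) • evalAt (B ε) y)⁻¹ := by
  set q := spiral τ₀ ε with hqdef
  have hq : q ≠ 0 := spiral_ne_zero τ₀ ε
  have hq1 : q - 1 ≠ 0 := spiral_sub_one_ne_zero hτ₀ hε
  have hA0 := qMatrix_reg q h0
  have hdet : IsUnit (qMatrix q (B ε)).det :=
    (hA0.1.inv (by rw [hA0.2]; exact (Matrix.isUnit_iff_isUnit_det _).1 hu)).2.2
  filter_upwards [eventually_isUnit_det_nhdsNE hdet z,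
    (eventually_ne_nhds hz).filter_mono nhdsWithin_le_nhds] with y ⟨h1, h2⟩ hy
  have hB := (qMatrix_reg_iff hq1).1 h1
  rw [(qMatrix_reg q hB).2] at h2
  refine ⟨h2, ?_⟩
  have hw : (q * y)⁻¹ ≠ 0 := inv_ne_zero (mul_ne_zero hq hy)
  have hwy : 1 / (q * (q * y)⁻¹) = y := by field_simp
  have h3 := invSubst_reg (M := B ε) hq hw (by rwa [hwy])
  rw [hwy] at h3
  have h4 := bInf_reg hτ₀ hε h3.1 (by rw [h3.2]; exact (Matrix.isUnit_iff_isUnit_det _).2 h2)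
  rw [h4.2.2, h3.2, ← hqdef, ← smul_inverse_sub_one hq1 h2, smul_smul, mul_inv_cancel₀ hq1,
    one_smul]
  abel

/-- The study at `0` is applied to `B ε` and, in the variable `w`, to `bInf τ₀ B ε`; the two meet
through `eventually_coeff_infty` for ellipticity and through continuity of the inverse for the
limit. -/
theorem connectionConfluence_canonical (hτ₀ : 0 < τ₀.im)
    (hB : ConvergesEnough τ₀ B B') (hS0 : SideData B B')
    (hSi : SideData (bInf τ₀ B) (diffMatrixInfty B')) :
    ConnectionConfluence τ₀ B B'
      (fun ε => IsQCanonical (spiral τ₀ ε) (qMatrix (spiral τ₀ ε) (B ε)))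
      (fun ε => IsQCanonical (spiral τ₀ ε)
        (qMatrixInfty (spiral τ₀ ε) (qMatrix (spiral τ₀ ε) (B ε))))
      (IsDiffCanonical τ₀ B')
      (IsDiffCanonical τ₀ (diffMatrixInfty B')) := by
  have h0 := hS0.reg0
  have h0i := hSi.reg0
  have hbinf : ∀ᶠ ε in 𝓝[>] (0 : ℝ), qMatrix (spiral τ₀ ε) (bInf τ₀ B ε) =
      qMatrixInfty (spiral τ₀ ε) (qMatrix (spiral τ₀ ε) (B ε)) := by
    filter_upwards [self_mem_nhdsWithin] with ε hε
    exact qMatrix_bInf hτ₀ B hε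
  refine ⟨existsUniqueOn_diffCanonical hτ₀ h0 hS0.nonres,
    existsUniqueOn_diffCanonical hτ₀ h0i hSi.nonres,
    eventually_existsUniqueOn_qCanonical hτ₀ hS0, ?_, ?_⟩
  · filter_upwards [eventually_existsUniqueOn_qCanonical hτ₀ hSi, hbinf] with ε h1 h2
    rwa [h2] at h1
  · intro X0' Xinf' hX0' hXinf' X0 Xinf hX
    have hX0 : ∀ᶠ ε in 𝓝[>] (0 : ℝ),
        IsQCanonical (spiral τ₀ ε) (qMatrix (spiral τ₀ ε) (B ε)) (X0 ε) := hX.mono fun _ h => h.1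
    have hXinf : ∀ᶠ ε in 𝓝[>] (0 : ℝ),
        IsQCanonical (spiral τ₀ ε) (qMatrix (spiral τ₀ ε) (bInf τ₀ B ε)) (Xinf ε) := by
      filter_upwards [hX, hbinf] with ε h1 h2
      rw [h2]; exact h1.2
    constructor
    · obtain ⟨k, m, e, Q, Q', γ, γ', hJ⟩ := hS0.jordan
      filter_upwards [hX0, hXinf, eventually_qCanonical_meromorphic hτ₀ hS0,
        eventually_qCanonical_meromorphic hτ₀ hSi, eventually_isQCanonical_iff hτ₀ hS0 e hJ,
        self_mem_nhdsWithin] with ε h1 h2 h3 h4 h5 hε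
      exact isElliptic_conn (spiral_ne_zero τ₀ ε) (h3 _ h1) (h4 _ h2)
        fun z hz => eventually_coeff_infty hτ₀ hε h5.1 h5.2.2.2.2.1 hz
    · intro z hz
      have hg0 := goodPoint_zero hz hB
      have hgi := goodPoint_infty hτ₀ hz hB
      obtain ⟨hf0, hfi, hconst⟩ := conn_locally_constant hτ₀ h0 hS0.nonres h0i hSi.nonres hX0' hXinf'
        (fun z hz => (goodPoint_infty hτ₀ hz hB).mem_halfCut) hz
      obtain ⟨hl0, he0⟩ := tendsto_qCanonical hτ₀ hS0 hg0 hX0' hX0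
      obtain ⟨hli, hei⟩ := tendsto_qCanonical hτ₀ hSi hgi hXinf' hXinf
      refine ⟨hf0, hfi, hconst, he0.and hei, ?_⟩
      refine Tendsto.mul ?_ hl0
      have := NormedRing.inverse_continuousAt
        ((Matrix.isUnit_iff_isUnit_det (Xinf' z⁻¹)).2 hfi.2).unit
      simp only [Matrix.nonsing_inv_eq_ringInverse]
      exact this.tendsto.comp hli

end Canonical

/-! ### Renormalised canonical solutions -/

section Renormalised

variable {n : ℕ} {τ₀ : ℂ} {B : ℝ → RMat n} {B' : RMat n}

theorem conj_inj {Q : Mat n} (hQ : IsUnit Q.det) {M N : Mat n} :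
    Q * M * Q⁻¹ = Q * N * Q⁻¹ ↔ M = N := by
  refine ⟨fun h => ?_, fun h => by rw [h]⟩
  have h1 := congrArg (fun Z => Q⁻¹ * Z * Q) h
  simp only [Matrix.mul_assoc, Matrix.nonsing_inv_mul _ hQ, mul_one,
    Matrix.nonsing_inv_mul_cancel_left _ _ hQ] at h1
  exact h1

theorem analyticAt_conj_iff {Q : Mat n} (hQ : IsUnit Q.det) {Y : ℂ → Mat n} {z : ℂ} :
    (∀ i j, AnalyticAt ℂ (fun z => Y z i j) z) ↔
      ∀ i j, AnalyticAt ℂ (fun z => (Q * Y z * Q⁻¹) i j) z := by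
  rw [← matrix_analyticAt_iff, ← matrix_analyticAt_iff (X := fun z => Q * Y z * Q⁻¹)]
  refine ⟨fun h => (analyticAt_const.fun_mul h).fun_mul analyticAt_const, fun h => ?_⟩
  have h1 := (analyticAt_const (v := Q⁻¹)).fun_mul h |>.fun_mul (analyticAt_const (v := Q))
  refine h1.congr (Eventually.of_forall fun z => ?_)
  simp only [Matrix.mul_assoc, Matrix.nonsing_inv_mul _ hQ, mul_one]
  exact Matrix.nonsing_inv_mul_cancel_left _ _ hQ

theorem isQGauge_conj_iff {q : ℂ} (hq : q ≠ 0) {A : RMat n} (h0 : RegAt A 0) {Q : Mat n}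
    (hQ : IsUnit Q.det) (Y : ℂ → Mat n) :
    IsQGauge q (const Q⁻¹ * A * const Q) Y ↔ IsQGauge q A fun z => Q * Y z * Q⁻¹ := by
  have hreg : qReg q (const Q⁻¹ * A * const Q) = qReg q A := by
    ext z
    simp only [qReg, Set.mem_ofPred_eq, regAt_conj_iff hQ]
  have hinv : (Q⁻¹ * evalAt A 0 * Q)⁻¹ = Q⁻¹ * (evalAt A 0)⁻¹ * Q := by
    rw [Matrix.mul_inv_rev, Matrix.mul_inv_rev, Matrix.nonsing_inv_nonsing_inv _ hQ, mul_assoc]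
  have heq : ∀ z, q * z ∈ qReg q A →
      (Y (q * z) = evalAt (const Q⁻¹ * A * const Q) z * Y z *
        (evalAt (const Q⁻¹ * A * const Q) 0)⁻¹ ↔
      Q * Y (q * z) * Q⁻¹ = evalAt A z * (Q * Y z * Q⁻¹) * (evalAt A 0)⁻¹) := by
    intro z hz
    have hz' : RegAt A z := by
      have := hz 1 le_rfl
      rwa [pow_one, mul_div_cancel_left₀ _ hq] at this
    rw [evalAt_conj hz', evalAt_conj h0, hinv, ← conj_inj hQ (M := Y (q * z))]
    have : Q * (Q⁻¹ * evalAt A z * Q * Y z * (Q⁻¹ * (evalAt A 0)⁻¹ * Q)) * Q⁻¹ =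
        evalAt A z * (Q * Y z * Q⁻¹) * (evalAt A 0)⁻¹ := by
      simp only [Matrix.mul_assoc, Matrix.mul_nonsing_inv _ hQ, mul_one,
        Matrix.mul_nonsing_inv_cancel_left _ _ hQ]
    rw [this]
  have hinit : Y 0 = 1 ↔ Q * Y 0 * Q⁻¹ = 1 := by
    rw [← conj_inj hQ, mul_one, Matrix.mul_nonsing_inv _ hQ]
  constructor
  · rintro ⟨h1, h2, h3⟩
    rw [hreg] at h1 h3
    exact ⟨fun i j z hz => (analyticAt_conj_iff hQ).1 (fun i j => h1 i j z hz) i j, hinit.1 h2,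
      fun z hz => (heq z hz).1 (h3 z hz)⟩
  · rintro ⟨h1, h2, h3⟩
    refine ⟨fun i j z hz => (analyticAt_conj_iff hQ).2 (fun i j => h1 i j z (hreg ▸ hz)) i j, hinit.2 h2,
      fun z hz => (heq z (hreg ▸ hz)).2 (h3 z (hreg ▸ hz))⟩

theorem isDiffGauge_conj_iff {A : RMat n} (h0 : RegAt A 0) {Q : Mat n}
    (hQ : IsUnit Q.det) (Y : ℂ → Mat n) :
    IsDiffGauge τ₀ (const Q⁻¹ * A * const Q) Y ↔ IsDiffGauge τ₀ A fun z => Q * Y z * Q⁻¹ := by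
  have hreg : halfCut τ₀ (const Q⁻¹ * A * const Q) = halfCut τ₀ A := by
    ext z
    simp only [halfCut, Set.mem_ofPred_eq, regAt_conj_iff hQ]
  have hinit : Y 0 = 1 ↔ Q * Y 0 * Q⁻¹ = 1 := by
    rw [← conj_inj hQ, mul_one, Matrix.mul_nonsing_inv _ hQ]
  have heq : ∀ z ∈ halfCut τ₀ A, (∀ i j, AnalyticAt ℂ (fun z => Y z i j) z) →
      ((∀ i j, z * deriv (fun y => Y y i j) z = (evalAt (const Q⁻¹ * A * const Q) z * Y z -
        Y z * evalAt (const Q⁻¹ * A * const Q) 0) i j) ↔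
      ∀ i j, z * deriv (fun y => (Q * Y y * Q⁻¹) i j) z =
        (evalAt A z * (Q * Y z * Q⁻¹) - Q * Y z * Q⁻¹ * evalAt A 0) i j) := by
    intro z hz hY
    have hz' : RegAt A z := by
      by_contra h
      exact hz z h 0 le_rfl (by rw [spiral_zero, mul_one])
    have hd : HasDerivAt Y (deriv Y z) z :=
      (matrix_analyticAt_iff.2 hY).differentiableAt.hasDerivAt
    have hd' : HasDerivAt (fun z => Q * Y z * Q⁻¹) (Q * deriv Y z * Q⁻¹) z :=
      (hd.const_mul Q).mul_const Q⁻¹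
    have e1 : ∀ (W : ℂ → Mat n) (W' R : Mat n), HasDerivAt W W' z →
        ((∀ i j, z * deriv (fun y => W y i j) z = R i j) ↔ z • W' = R) := by
      intro W W' R hW
      rw [← Matrix.ext_iff]
      refine forall_congr' fun i => forall_congr' fun j => ?_
      have h1 : deriv (fun y => W y i j) z = W' i j :=
        (matrix_deriv_apply hW.differentiableAt i j).symm.trans (congrFun (congrFun hW.deriv i) j)
      rw [h1, Matrix.smul_apply, smul_eq_mul]
    rw [e1 Y _ _ hd, e1 _ _ _ hd', evalAt_conj hz', evalAt_conj h0, ← conj_inj hQ]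
    have h1 : Q * (z • deriv Y z) * Q⁻¹ = z • (Q * deriv Y z * Q⁻¹) := by
      rw [mul_smul_comm, smul_mul_assoc]
    have h2 : Q * (Q⁻¹ * evalAt A z * Q * Y z - Y z * (Q⁻¹ * evalAt A 0 * Q)) * Q⁻¹ =
        evalAt A z * (Q * Y z * Q⁻¹) - Q * Y z * Q⁻¹ * evalAt A 0 := by
      rw [mul_sub, sub_mul]
      simp only [Matrix.mul_assoc, Matrix.mul_nonsing_inv _ hQ, mul_one,
        Matrix.mul_nonsing_inv_cancel_left _ _ hQ]
    rw [h1, h2]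
  constructor
  · rintro ⟨h1, h2, h3⟩
    rw [hreg] at h1 h3
    exact ⟨fun i j z hz => (analyticAt_conj_iff hQ).1 (fun i j => h1 i j z hz) i j, hinit.1 h2,
      fun z hz => (heq z hz fun i j => h1 i j z hz).1 (h3 z hz)⟩
  · rintro ⟨h1, h2, h3⟩
    have h1' : ∀ z ∈ halfCut τ₀ A, ∀ i j, AnalyticAt ℂ (fun z => Y z i j) z := fun z hz =>
      (analyticAt_conj_iff hQ).2 fun i j => h1 i j z hz
    refine ⟨fun i j z hz => h1' z (hreg ▸ hz) i j, hinit.2 h2,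
      fun z hz => (heq z (hreg ▸ hz) (h1' z (hreg ▸ hz))).2 (h3 z (hreg ▸ hz))⟩

/-- The dictionary between the two normalisations: `F = Q Y Q⁻¹` turns `X = Q Y L` into `X Q⁻¹ = F
(Q L Q⁻¹)`, and for the log-characters `Q L Q⁻¹` is the canonical factor. -/
theorem exists_conj_iff {Q : Mat n} (hQ : IsUnit Q.det) {G : (ℂ → Mat n) → Prop}
    {X L : ℂ → Mat n} :
    (∃ Y : ℂ → Mat n, G (fun z => Q * Y z * Q⁻¹) ∧ ∀ z, X z = Q * Y z * L z) ↔
      ∃ F : ℂ → Mat n, G F ∧ ∀ z, X z * Q⁻¹ = F z * (Q * L z * Q⁻¹) := by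
  constructor
  · rintro ⟨Y, hY, hX⟩
    refine ⟨_, hY, fun z => ?_⟩
    rw [hX]
    simp only [Matrix.mul_assoc, Matrix.nonsing_inv_mul_cancel_left _ _ hQ]
  · rintro ⟨F, hF, hX⟩
    have hF' : (fun z => Q * (Q⁻¹ * F z * Q) * Q⁻¹) = F := by
      funext z
      simp only [Matrix.mul_assoc, Matrix.mul_nonsing_inv _ hQ, mul_one,
        Matrix.mul_nonsing_inv_cancel_left _ _ hQ]
    refine ⟨fun z => Q⁻¹ * F z * Q, by rwa [hF'], fun z => ?_⟩
    have h1 := congrArg (fun Z => Z * Q) (hX z)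
    simp only [Matrix.nonsing_inv_mul_cancel_right _ _ hQ] at h1
    rw [h1]
    simp only [Matrix.mul_assoc, Matrix.nonsing_inv_mul _ hQ, mul_one,
      Matrix.mul_nonsing_inv_cancel_left _ _ hQ]

theorem isDiffJordanCanonical_iff {k : ℕ} {m : Fin k → ℕ} (e : (Σ i : Fin k, Fin (m i)) ≃ Fin n)
    {γ : Fin k → ℂ} {Q : Mat n} (h0 : RegAt B' 0) (hQ : IsUnit Q.det)
    (hred : Q⁻¹ * evalAt B' 0 * Q = QDiff.jordan e γ) (X : ℂ → Mat n) :
    IsDiffJordanCanonical e τ₀ γ Q B' X ↔ IsDiffCanonical τ₀ B' fun z => X z * Q⁻¹ := by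
  have hexp : ∀ z, NormedSpace.exp (logNeg τ₀ z • evalAt B' 0) =
      Q * diffLogCar e τ₀ γ z * Q⁻¹ := fun z => by
    rw [eq_conj_of_reduce hQ hred, ← exp_smul_jordan,
      ← Matrix.exp_conj _ _ ((Matrix.isUnit_iff_isUnit_det Q).2 hQ), mul_smul_comm,
      smul_mul_assoc]
  simp only [IsDiffJordanCanonical, IsDiffCanonical, isDiffGauge_conj_iff h0 hQ, hexp]
  exact exists_conj_iff hQ

theorem eventually_isQJordanCanonical_iff (hτ₀ : 0 < τ₀.im) (h : SideData B B') {k : ℕ}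
    {m : Fin k → ℕ} (e : (Σ i : Fin k, Fin (m i)) ≃ Fin n) {Q : ℝ → Mat n} {Q' : Mat n}
    {γ : ℝ → Fin k → ℂ} {γ' : Fin k → ℂ}
    (hJ : IsJordanFamily e (fun ε => evalAt (B ε) 0) (evalAt B' 0) Q Q' γ γ') :
    ∀ᶠ ε in 𝓝[>] (0 : ℝ), ∀ X, IsQJordanCanonical e (spiral τ₀ ε) (γ ε) (Q ε)
        (qMatrix (spiral τ₀ ε) (B ε)) X ↔
      IsQCanonical (spiral τ₀ ε) (qMatrix (spiral τ₀ ε) (B ε)) fun z => X z * (Q ε)⁻¹ := by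
  filter_upwards [eventually_isQCanonical_iff hτ₀ h e hJ, self_mem_nhdsWithin]
    with ε ⟨h0, hQ, hc, hred, hu, hiff⟩ hε X
  have hq := spiral_ne_zero τ₀ ε
  simp only [hiff, IsQJordanCanonical, isQGauge_conj_iff hq (qMatrix_reg _ h0).1 hQ,
    isQGauge_iff (spiral_sub_one_ne_zero hτ₀ hε) h0 hu hq]
  exact exists_conj_iff hQ

theorem ExistsUniqueOn.of_mul_inv {S S' : (ℂ → Mat n) → Prop} {U : Set ℂ} {Q : Mat n}
    (hQ : IsUnit Q.det) (hS : ∀ X, S' X ↔ S fun z => X z * Q⁻¹) (h : ExistsUniqueOn S U) :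
    ExistsUniqueOn S' U := by
  obtain ⟨⟨X, hX⟩, huniq⟩ := h
  refine ⟨⟨fun z => X z * Q, (hS _).2 ?_⟩, fun X Y hX hY z hz => ?_⟩
  · simpa only [Matrix.mul_nonsing_inv_cancel_right _ _ hQ] using hX
  · have h1 := huniq _ _ ((hS X).1 hX) ((hS Y).1 hY) hz
    have h2 := congrArg (fun Z => Z * Q) h1
    simpa only [Matrix.nonsing_inv_mul_cancel_right _ _ hQ] using h2

theorem IsFundamentalAt.of_mul_inv {X : ℂ → Mat n} {Q : Mat n} (hQ : IsUnit Q.det) {z : ℂ}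
    (h : IsFundamentalAt (fun z => X z * Q⁻¹) z) : IsFundamentalAt X z := by
  obtain ⟨h1, h2⟩ := h
  constructor
  · rw [← matrix_analyticAt_iff (X := fun z => X z * Q⁻¹)] at h1
    have h3 := h1.fun_mul (analyticAt_const (v := Q))
    simp only [Matrix.nonsing_inv_mul_cancel_right _ _ hQ] at h3
    exact matrix_analyticAt_iff.1 h3
  · rw [Matrix.det_mul] at h2
    exact isUnit_of_mul_isUnit_left h2

theorem conn_mul_inv {X Y : ℂ → Mat n} {Q R : Mat n} (hQ : IsUnit Q.det) (hR : IsUnit R.det)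
    (z : ℂ) :
    conn X Y z = R⁻¹ * conn (fun z => X z * Q⁻¹) (fun z => Y z * R⁻¹) z * Q := by
  simp only [conn]
  rw [Matrix.mul_inv_rev, Matrix.nonsing_inv_nonsing_inv _ hR]
  simp only [Matrix.mul_assoc, Matrix.nonsing_inv_mul_cancel_left _ _ hR,
    Matrix.nonsing_inv_mul _ hQ, mul_one]

theorem IsElliptic.const_mul_mul_const {q : ℂ} {P : ℂ → Mat n} (h : IsElliptic q P) (R Q : Mat n) :
    IsElliptic q fun z => R * P z * Q := by
  refine ⟨fun i j z hz => matrix_mul_meromorphicAt (matrix_mul_meromorphicAt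
    (fun i j => MeromorphicAt.const (R i j) z) (fun i j => h.1 i j z hz))
    (fun i j => MeromorphicAt.const (Q i j) z) i j, ?_⟩
  filter_upwards [h.2] with z hz
  rw [hz]

/-- Multiplying the solutions on the right by the constants `Q ε` and `R ε` changes the connection
matrix into `R⁻¹ P Q`. Every clause is stable under this, and the limit persists because `Q` and `R`
converge to invertible matrices. -/
theorem ConnectionConfluence.of_mul_inv {S0 Sinf S0J SinfJ : ℝ → (ℂ → Mat n) → Prop}
    {T0 Tinf T0J TinfJ : (ℂ → Mat n) → Prop} (h : ConnectionConfluence τ₀ B B' S0 Sinf T0 Tinf)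
    {Q R : ℝ → Mat n} {Q' R' : Mat n} (hQ : ∀ᶠ ε in 𝓝[>] (0 : ℝ), IsUnit (Q ε).det)
    (hR : ∀ᶠ ε in 𝓝[>] (0 : ℝ), IsUnit (R ε).det) (hQ' : IsUnit Q'.det) (hR' : IsUnit R'.det)
    (hQlim : Tendsto Q (𝓝[>] 0) (𝓝 Q')) (hRlim : Tendsto R (𝓝[>] 0) (𝓝 R'))
    (hS0 : ∀ᶠ ε in 𝓝[>] (0 : ℝ), ∀ X, S0J ε X ↔ S0 ε fun z => X z * (Q ε)⁻¹)
    (hSinf : ∀ᶠ ε in 𝓝[>] (0 : ℝ), ∀ X, SinfJ ε X ↔ Sinf ε fun z => X z * (R ε)⁻¹)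
    (hT0 : ∀ X, T0J X ↔ T0 fun z => X z * Q'⁻¹)
    (hTinf : ∀ X, TinfJ X ↔ Tinf fun z => X z * R'⁻¹) :
    ConnectionConfluence τ₀ B B' S0J SinfJ T0J TinfJ := by
  obtain ⟨h1, h2, h3, h4, h5⟩ := h
  refine ⟨h1.of_mul_inv hQ' hT0, h2.of_mul_inv hR' hTinf, ?_, ?_, ?_⟩
  · filter_upwards [h3, hQ, hS0] with ε h hQ hS
    exact h.of_mul_inv hQ hS
  · filter_upwards [h4, hR, hSinf] with ε h hR hS
    exact h.of_mul_inv hR hS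
  · intro X0' Xinf' hX0' hXinf' X0 Xinf hX
    obtain ⟨h6, h7⟩ := h5 _ _ ((hT0 _).1 hX0') ((hTinf _).1 hXinf')
      (fun ε z => X0 ε z * (Q ε)⁻¹) (fun ε z => Xinf ε z * (R ε)⁻¹) (by
        filter_upwards [hX, hS0, hSinf] with ε h1 h2 h3
        exact ⟨(h2 _).1 h1.1, (h3 _).1 h1.2⟩)
    constructor
    · filter_upwards [h6, hQ, hR] with ε h hQ hR
      have := h.const_mul_mul_const (R ε)⁻¹ (Q ε)
      have heq := funext (conn_mul_inv (X := X0 ε) (Y := Xinf ε) hQ hR)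
      rwa [heq]
    · intro z hz
      obtain ⟨g1, g2, g3, g4, g5⟩ := h7 z hz
      refine ⟨g1.of_mul_inv hQ', g2.of_mul_inv hR', ?_, ?_, ?_⟩
      · filter_upwards [g3] with y hy
        rw [conn_mul_inv hQ' hR', hy, ← conn_mul_inv hQ' hR']
      · filter_upwards [g4, hQ, hR] with ε h hQ hR
        exact ⟨h.1.of_mul_inv hQ, h.2.of_mul_inv hR⟩
      · rw [conn_mul_inv hQ' hR']
        have hRinv : Tendsto (fun ε => (R ε)⁻¹) (𝓝[>] 0) (𝓝 R'⁻¹) := by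
          have := NormedRing.inverse_continuousAt ((Matrix.isUnit_iff_isUnit_det R').2 hR').unit
          simp only [Matrix.nonsing_inv_eq_ringInverse]
          exact this.tendsto.comp hRlim
        refine ((hRinv.mul g5).mul hQlim).congr' ?_
        filter_upwards [hQ, hR] with ε hQ hR
        exact (conn_mul_inv hQ hR z).symm

end Renormalised

end QDiff

end

theorem mainTheorem2 {n : ℕ} (τ₀ : ℂ) (hτ₀ : 0 < τ₀.im)
    (B' : RMat n) (hreg0 : RegAt B' 0) (hregInf : RegAt (atInfty B') 0)
    (hres0 : NonResonant (evalAt B' 0)) (hresInf : NonResonant (evalAt (atInfty B') 0))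
    (B : ℝ → RMat n) (hA : PolesConverge B B') (hB : ConvergesEnough τ₀ B B')
    (hC0 : ConvJordan (fun ε => evalAt (B ε) 0) (evalAt B' 0))
    (hCinf : ConvJordan (fun ε => evalAt (atInfty (B ε)) 0) (evalAt (atInfty B') 0)) :
    ConnectionConfluence τ₀ B B'
      (fun ε => IsQCanonical (spiral τ₀ ε) (qMatrix (spiral τ₀ ε) (B ε)))
      (fun ε => IsQCanonical (spiral τ₀ ε)
        (qMatrixInfty (spiral τ₀ ε) (qMatrix (spiral τ₀ ε) (B ε))))
      (IsDiffCanonical τ₀ B')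
      (IsDiffCanonical τ₀ (diffMatrixInfty B')) ∧
    ConvJordan
      (fun ε => deltaValue (spiral τ₀ ε)
        (qMatrixInfty (spiral τ₀ ε) (qMatrix (spiral τ₀ ε) (B ε))))
      (evalAt (diffMatrixInfty B') 0) ∧
    ∀ {k l : ℕ} {m : Fin k → ℕ} {p : Fin l → ℕ}
      (e : (Σ i : Fin k, Fin (m i)) ≃ Fin n) (f : (Σ i : Fin l, Fin (p i)) ≃ Fin n)
      (Q R : ℝ → Mat n) (Q' R' : Mat n)
      (γ : ℝ → Fin k → ℂ) (γ' : Fin k → ℂ) (β : ℝ → Fin l → ℂ) (β' : Fin l → ℂ),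
      IsJordanFamily e (fun ε => evalAt (B ε) 0) (evalAt B' 0) Q Q' γ γ' →
      IsJordanFamily f
        (fun ε => deltaValue (spiral τ₀ ε)
          (qMatrixInfty (spiral τ₀ ε) (qMatrix (spiral τ₀ ε) (B ε))))
        (evalAt (diffMatrixInfty B') 0) R R' β β' →
      ConnectionConfluence τ₀ B B'
        (fun ε => IsQJordanCanonical e (spiral τ₀ ε) (γ ε) (Q ε)
          (qMatrix (spiral τ₀ ε) (B ε)))
        (fun ε => IsQJordanCanonical f (spiral τ₀ ε) (β ε) (R ε)
          (qMatrixInfty (spiral τ₀ ε) (qMatrix (spiral τ₀ ε) (B ε))))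
        (IsDiffJordanCanonical e τ₀ γ' Q' B')
        (IsDiffJordanCanonical f τ₀ β' R' (diffMatrixInfty B')) := by
  have hS0 := sideData_zero hres0 hB hC0
  have hSi := sideData_infty hτ₀ hregInf hresInf hB hCinf
  have hcanon := connectionConfluence_canonical hτ₀ hB hS0 hSi
  have hdelta := eventually_deltaValue_eq hτ₀ hB
  refine ⟨hcanon, hSi.jordan.congr (hdelta.mono fun ε h => h.symm), ?_⟩
  intro k l m p e f Q R Q' R' γ γ' β β' hJ0 hJi
  -- The family is given for `deltaValue`, whereas the study at infinity uses `bInf`; their values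
  -- at `0` agree for small `ε`.
  have hJi' : IsJordanFamily f (fun ε => evalAt (bInf τ₀ B ε) 0) (evalAt (diffMatrixInfty B') 0)
      R R' β β' := by
    refine ⟨hJi.isUnit, hJi.isUnit', ?_, hJi.reduce', hJi.tendsto_Q, hJi.tendsto_γ⟩
    filter_upwards [hJi.reduce, hdelta] with ε h1 h2
    rw [← h2, h1]
  refine hcanon.of_mul_inv hJ0.isUnit hJi.isUnit hJ0.isUnit' hJi.isUnit' hJ0.tendsto_Q
    hJi.tendsto_Q (eventually_isQJordanCanonical_iff hτ₀ hS0 e hJ0) ?_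
    (isDiffJordanCanonical_iff e hS0.reg0 hJ0.isUnit' hJ0.reduce')
    (isDiffJordanCanonical_iff f hSi.reg0 hJi.isUnit' hJi.reduce')
  filter_upwards [eventually_isQJordanCanonical_iff hτ₀ hSi f hJi', self_mem_nhdsWithin]
    with ε h1 hε
  rwa [qMatrix_bInf hτ₀ B hε] at h1
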